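/- **Notation and definitions.** $C_n(0,r)=\{v\in\mathbb R^n : |v_i|<r\}$. For $u:C_n(0,r)\to V$ ($V$ a finite-dimensional normed space) write $u\in\mathcal A(C_n(0,r))$, $\|u\|_r\le C$, if $u$ is the sum on $C_n(0,r)$ of its Taylor series at $0$ and $r^{|\alpha|}\,\|\partial^\alpha u(0)\|/\alpha!\le C$ for all multi-indices $\alpha$. For tensors on the cube, these norms are applied to the coordinate expressions. A real analytic Riemannian manifold $(N,k)$ of dimension $n$ is *of bounded analytic geometry* if it has a *bounded analytic atlas*: a family $(\mathcal U_x,\psi_x)_{x\in N}$ where $\mathcal U_x$ is an open neighbourhood of $x$, $\psi_x:\mathcal U_x\to C_n(0,1)$ is an analytic diffeomorphism with $\psi_x(x)=0$, the metrics $k_x=(\psi_x^{-1})^*k$ satisfy $\sup_x\|k_x\|_1<\infty$, and $c^{-1}\delta_{\rm flat}\le k_x\le c\,\delta_{\rm flat}$ on $C_n(0,1)$ for some $c>0$ and all $x$. A tensor field $T$ on $N$ is in $\mathcal AT^p_q(\mathcal U,k)$, for $\mathcal U\subset N$ open, if for some bounded analytic atlas and some $0<\varepsilon\le 1$ the coordinate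 expressions $T_x=(\psi_x^{-1})^*T$ satisfy $\sup\|T_x\|_\varepsilon<\infty$, the supremum being over the $x$ with $\mathcal U_x\cap\mathcal U\ne\emptyset$. A map $t\mapsto T_t$ is in $\mathcal A((-r,r);\mathcal AT^p_q(N,k))$ if, for some bounded analytic atlas and some $0<\varepsilon\le1$, with the norm $\|T\|=\sup_{x\in N}\|T_x\|_\varepsilon$, one has $T_t=\sum_{j\ge0}t^j a_j$ in this norm for $|t|<r$, with $\sup_j r^j\|a_j\|<\infty$. Let $(M,g)$ be a real analytic (Hausdorff, second countable), time-oriented Lorentzian manifold of dimension $d+1$ with signature $(-,+,\dots,+)$, and let $\Sigma\subset M$ be an analytic embedded spacelike hypersurface that is a Cauchy surface, i.e. $\Sigma$ is closed and every inextendible timelike curve meets it exactly once. Let $n$ be its future directed unit normal. $(M,g)$ is *of bounded analytic geometry near $\Sigma$* if there is an analytic Riemannian metric $\hat g$ on $M$ of bounded analytic geometry and an open neighbourhood $\mathcal U$ of $\Sigma$ such that - $g\in\mathcal AT^0_2(\mathcal U,\hat g)$ and $g^{-1}\in\mathcal AT^2_0(\mathcal U,\hat g)$; - for some bounded analytic atlas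 $(\mathcal U_x,\psi_x)_{x\in M}$ of $(M,\hat g)$ and some $C$, for each $x$ with $\mathcal U_x\cap\mathcal U\neq\emptyset$ there is $F_x\in\mathcal A(C_d(0,1))$ with $\|F_x\|_1\le C$ and $\psi_x(\Sigma\cap\mathcal U_x)=\{(v',v_{d+1})\in C_{d+1}(0,1): v_{d+1}=F_x(v')\}$; - $\sup_{y\in\Sigma}\hat g(y)(n(y),n(y))<\infty$. **Theorem.** Let $(M,g)$ be of bounded analytic geometry near the spacelike Cauchy surface $\Sigma$. Then: 1. There is $\delta>0$ such that the normal geodesic flow $\chi:(-\delta,\delta)\times\Sigma\to M$, $\chi(t,x)=\exp^g_x(t\,n(x))$, is well defined and is a smooth diffeomorphism onto its (open) image. 2. $\chi^*g=-dt^2+h_t$ on $(-\delta,\delta)\times\Sigma$, where $(h_t)$ is a smooth family of Riemannian metrics on $\Sigma$, and there is $0<\varepsilon_1\le\delta$ such that (i) $(\Sigma,h_0)$ is of bounded analytic geometry; (ii) $t\mapsto h_t\in\mathcal A((-\varepsilon_1,\varepsilon_1);\mathcal AT^0_2(\Sigma,h_0))$; (iii) $t\mapsto h_t^{-1}\in\mathcal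 A((-\varepsilon_1,\varepsilon_1);\mathcal AT^2_0(\Sigma,h_0))$. -/

import Mathlib

set_option maxSynthPendingDepth 3

open scoped Manifold ContDiff Topology

noncomputable section

namespace BAG

/-! ### Bounded analytic functions on cubes -/

/-- The model space `ℝⁿ` with its Euclidean norm. -/
abbrev Eu (n : ℕ) : Type := EuclideanSpace ℝ (Fin n)

/-- The open cube `C_n(0, r)` in `ℝⁿ`. -/
def cube (n : ℕ) (r : ℝ) : Set (Eu n) := {v | ∀ i, |v i| < r}

/-- `u` belongs to `𝒜(C_n(0, r))` with `‖u‖_r ≤ C`: on the cube, `u` is the sum of its Taylor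
series at `0`, whose coefficients `a α = (α!)⁻¹ ∂^α u(0)` satisfy `r^|α| ‖a α‖ ≤ C`.
Equivalently, `u` is real analytic on the cube and has such Taylor coefficients at `0`. -/
def AnalyticBound {n : ℕ} {V : Type*} [NormedAddCommGroup V] [NormedSpace ℝ V]
    (r C : ℝ) (u : Eu n → V) : Prop :=
  ∃ a : (Fin n → ℕ) → V,
    (∀ α, r ^ (∑ i, α i) * ‖a α‖ ≤ C) ∧
    ∀ v ∈ cube n r, HasSum (fun α : Fin n → ℕ => (∏ i, v i ^ α i) • a α) (u v)

/-! ### Tensor fields of order two -/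

/-- Fields of bilinear forms on the tangent spaces (covariant tensors of order two). -/
abbrev Cov2 (n : ℕ) (M : Type*) [TopologicalSpace M] [ChartedSpace (Eu n) M] : Type _ :=
  ∀ x : M, TangentSpace (𝓡 n) x →L[ℝ] TangentSpace (𝓡 n) x →L[ℝ] ℝ

/-- Fields of bilinear forms on the cotangent spaces (contravariant tensors of order two). -/
abbrev Contra2 (n : ℕ) (M : Type*) [TopologicalSpace M] [ChartedSpace (Eu n) M] : Type _ :=
  ∀ x : M, (TangentSpace (𝓡 n) x →L[ℝ] ℝ) →L[ℝ] (TangentSpace (𝓡 n) x →L[ℝ] ℝ) →L[ℝ] ℝ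

/-- The pullback `(v, w) ↦ T (L v) (L w)` of a bilinear form by a linear map. -/
def pullForm {A B : Type*} [AddCommGroup A] [Module ℝ A] [TopologicalSpace A]
    [AddCommGroup B] [Module ℝ B] [TopologicalSpace B]
    (T : A →L[ℝ] A →L[ℝ] ℝ) (L : B →L[ℝ] A) : B →L[ℝ] B →L[ℝ] ℝ :=
  (L.precomp ℝ) ∘L T ∘L L

section Manifold

variable {n : ℕ} {M : Type*} [TopologicalSpace M] [ChartedSpace (Eu n) M]

/-- The coordinate expression `(φ⁻¹)^* T` of a covariant tensor in the chart `φ`. -/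
def coordCov (φ : OpenPartialHomeomorph M (Eu n)) (T : Cov2 n M) :
    Eu n → (Eu n →L[ℝ] Eu n →L[ℝ] ℝ) :=
  fun v => pullForm (T (φ.symm v)) (mfderiv (𝓡 n) (𝓡 n) φ.symm v)

/-- The coordinate expression of a contravariant tensor in the chart `φ`:
covectors on `ℝⁿ` are pulled back by the differential of `φ`. -/
def coordContra (φ : OpenPartialHomeomorph M (Eu n)) (K : Contra2 n M) :
    Eu n → ((Eu n →L[ℝ] ℝ) →L[ℝ] (Eu n →L[ℝ] ℝ) →L[ℝ] ℝ) :=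
  fun v => pullForm (K (φ.symm v))
    ((mfderiv (𝓡 n) (𝓡 n) φ (φ.symm v)).precomp ℝ)

/-- The inverse metric `(α, β) ↦ α (g⁻¹ β)`, where `g` is viewed as a map `T_x M → T_x^* M`. -/
def inverseMetric (g : Cov2 n M) : Contra2 n M :=
  fun x => (ContinuousLinearMap.inverse (g x)).precomp ℝ

/-- `g` is a Riemannian metric of class `C^k` (`k = ω` for analytic). -/
def IsRiemannian [IsManifold (𝓡 n) ω M] (k : WithTop ℕ∞) (g : Cov2 n M) : Prop :=
  ∃ m : Bundle.ContMDiffRiemannianMetric (𝓡 n) k (Eu n) (fun x : M => TangentSpace (𝓡 n) x),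
    m.inner = g

/-- `g` is an analytic Lorentzian metric, of signature `(-, +, …, +)`. -/
structure IsLorentzian [IsManifold (𝓡 n) ω M] (g : Cov2 n M) : Prop where
  symm : ∀ x v w, g x v w = g x w v
  signature : ∀ x, ∃ v, g x v v < 0 ∧ ∀ w, g x v w = 0 → w ≠ 0 → 0 < g x w w
  analytic : ContMDiff (𝓡 n) ((𝓡 n).prod 𝓘(ℝ, Eu n →L[ℝ] Eu n →L[ℝ] ℝ)) ω
    (fun x : M => Bundle.TotalSpace.mk' (Eu n →L[ℝ] Eu n →L[ℝ] ℝ)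
      (E := fun x : M => TangentSpace (𝓡 n) x →L[ℝ] TangentSpace (𝓡 n) x →L[ℝ] ℝ) x (g x))

/-- A time orientation, given by a continuous timelike vector field. -/
def IsTimeOrientation [IsManifold (𝓡 n) ω M] (g : Cov2 n M) (τ : ∀ x : M, TangentSpace (𝓡 n) x) : Prop :=
  Continuous (fun x : M => (⟨x, τ x⟩ : TangentBundle (𝓡 n) M)) ∧ ∀ x, g x (τ x) (τ x) < 0

/-! ### Curves -/

/-- The velocity of a curve, as a point of the tangent bundle. -/
def velocity (γ : ℝ → M) (t : ℝ) : TangentBundle (𝓡 n) M :=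
  ⟨γ t, mfderiv 𝓘(ℝ, ℝ) (𝓡 n) γ t (1 : ℝ)⟩

/-- `Σ` is closed and meets every inextendible smooth timelike curve exactly once.
As timelike curves may be reparametrized, those that are defined on all of `ℝ` suffice;
inextendible means that there is no limit point at either end. -/
def IsCauchySurface (g : Cov2 n M) (Sig : Set M) : Prop :=
  IsClosed Sig ∧
  ∀ γ : ℝ → M, ContMDiff 𝓘(ℝ, ℝ) (𝓡 n) ∞ γ →
    (∀ t, g (γ t) (velocity (n := n) γ t).2 (velocity (n := n) γ t).2 < 0) →
    (¬ ∃ p, Filter.Tendsto γ Filter.atTop (𝓝 p)) →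
    (¬ ∃ p, Filter.Tendsto γ Filter.atBot (𝓝 p)) →
    ∃! t, γ t ∈ Sig

/-- The Christoffel symbols of the first kind, `Γ_{w, ab}`, of a metric `G` on an open subset
of `ℝⁿ`, at the point `v`. -/
def christoffel (G : Eu n → (Eu n →L[ℝ] Eu n →L[ℝ] ℝ)) (v a b w : Eu n) : ℝ :=
  (fderiv ℝ G v a b w + fderiv ℝ G v b a w - fderiv ℝ G v w a b) / 2

/-- `γ` is a geodesic of `g` on the open set `J` of times: in the chart at `γ t`, the geodesic
equation `c'' + Γ(c)(c', c') = 0` holds at `t`, written with its upper index lowered by `g`. -/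
def IsGeodesicOn (g : Cov2 n M) (γ : ℝ → M) (J : Set ℝ) : Prop :=
  ContMDiffOn 𝓘(ℝ, ℝ) (𝓡 n) ∞ γ J ∧
  ∀ t ∈ J, ∀ w : Eu n,
    coordCov (chartAt (Eu n) (γ t)) g (chartAt (Eu n) (γ t) (γ t))
        (iteratedDeriv 2 (fun s => chartAt (Eu n) (γ t) (γ s)) t) w
      + christoffel (coordCov (chartAt (Eu n) (γ t)) g) (chartAt (Eu n) (γ t) (γ t))
        (deriv (fun s => chartAt (Eu n) (γ t) (γ s)) t)
        (deriv (fun s => chartAt (Eu n) (γ t) (γ s)) t) w = 0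

/-! ### Bounded analytic geometry -/

/-- A bounded analytic atlas for `g`: for every point `x` an analytic diffeomorphism `ψ x` of a
neighbourhood of `x` onto the unit cube, with `ψ x x = 0`, such that the metrics
`g_x = ((ψ x)⁻¹)^* g` are bounded in `𝒜T⁰₂(C_n(0, 1))` and uniformly equivalent to the flat
metric. -/
structure IsBoundedAnalyticAtlas (g : Cov2 n M)
    (ψ : M → OpenPartialHomeomorph M (Eu n)) : Prop where
  analytic : ∀ x, ψ x ∈ IsManifold.maximalAtlas (𝓡 n) ω M
  mem_source : ∀ x, x ∈ (ψ x).source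
  target_eq : ∀ x, (ψ x).target = cube n 1
  center : ∀ x, ψ x x = 0
  bounded : ∃ C, ∀ x, AnalyticBound 1 C (coordCov (ψ x) g)
  equivalent : ∃ c > 0, ∀ x, ∀ v ∈ cube n 1, ∀ a,
    c⁻¹ * ‖a‖ ^ 2 ≤ coordCov (ψ x) g v a a ∧ coordCov (ψ x) g v a a ≤ c * ‖a‖ ^ 2

/-- `(M, g)` is an analytic Riemannian manifold of bounded analytic geometry. -/
def BoundedAnalyticGeometry [IsManifold (𝓡 n) ω M] (g : Cov2 n M) : Prop :=
  IsRiemannian ω g ∧ ∃ ψ, IsBoundedAnalyticAtlas g ψ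

/- In the next three definitions, `coord φ T` is the coordinate expression of the tensor `T` in
the chart `φ`; it is `coordCov` for covariant and `coordContra` for contravariant tensors. -/

/-- The norm of `T` in `𝒜T(U, g)`, computed with the atlas `ψ` on cubes of size `ε`, is at most
`C`. Only the charts whose domain meets `U` count. -/
def TensorBound {𝓣 V : Type*} [NormedAddCommGroup V] [NormedSpace ℝ V]
    (coord : OpenPartialHomeomorph M (Eu n) → 𝓣 → Eu n → V)
    (ψ : M → OpenPartialHomeomorph M (Eu n)) (U : Set M) (ε C : ℝ) (T : 𝓣) : Prop :=
  ∀ x, ((ψ x).source ∩ U).Nonempty → AnalyticBound ε C (coord (ψ x) T)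

/-- `T ∈ 𝒜T(U, g)`: the tensor `T` is bounded analytic over `U` for the Riemannian metric `g`. -/
def MemAT {𝓣 V : Type*} [NormedAddCommGroup V] [NormedSpace ℝ V]
    (coord : OpenPartialHomeomorph M (Eu n) → 𝓣 → Eu n → V)
    (g : Cov2 n M) (U : Set M) (T : 𝓣) : Prop :=
  ∃ ψ, IsBoundedAnalyticAtlas g ψ ∧
    ∃ ε, 0 < ε ∧ ε ≤ 1 ∧ ∃ C, TensorBound coord ψ U ε C T

/-- `t ↦ T t` belongs to `𝒜((-r, r); 𝒜T(M, g))`: with one bounded analytic atlas and one cube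
size `ε`, `T t = ∑ t^k a_k` in the norm of `𝒜T(M, g)` for `|t| < r`, where the Taylor
coefficients `a_k = (k!)⁻¹ ∂_t^k T(0)` satisfy `r^k ‖a_k‖ ≤ C`. -/
def MemAnalyticAT {𝓣 V : Type*} [AddCommGroup 𝓣] [Module ℝ 𝓣]
    [NormedAddCommGroup V] [NormedSpace ℝ V]
    (coord : OpenPartialHomeomorph M (Eu n) → 𝓣 → Eu n → V)
    (g : Cov2 n M) (r : ℝ) (T : ℝ → 𝓣) : Prop :=
  ∃ ψ, IsBoundedAnalyticAtlas g ψ ∧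
    ∃ ε, 0 < ε ∧ ε ≤ 1 ∧ ∃ (a : ℕ → 𝓣) (C : ℝ),
      (∀ k, TensorBound coord ψ Set.univ ε (C / r ^ k) (a k)) ∧
      ∀ t, |t| < r → ∀ η > 0, ∀ᶠ m in Filter.atTop,
        TensorBound coord ψ Set.univ ε η (T t - ∑ k ∈ Finset.range m, t ^ k • a k)

end Manifold

/-! ### Spacelike hypersurfaces -/

section Hypersurface

variable {d : ℕ} {M : Type*} [TopologicalSpace M] [ChartedSpace (Eu (d + 1)) M]
  {S : Type*} [TopologicalSpace S] [ChartedSpace (Eu d) S]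

/-- The hypersurface `ι : S → M` is spacelike: `ι^* g` is positive definite. -/
def IsSpacelike (g : Cov2 (d + 1) M) (ι : S → M) : Prop :=
  ∀ x v, v ≠ 0 → 0 < pullForm (g (ι x)) (mfderiv (𝓡 d) (𝓡 (d + 1)) ι x) v v

/-- `v` is the future directed unit normal to the hypersurface `ι : S → M` at `ι x`. -/
structure IsFutureUnitNormal (g : Cov2 (d + 1) M) (τ : ∀ p : M, TangentSpace (𝓡 (d + 1)) p)
    (ι : S → M) (x : S) (v : TangentSpace (𝓡 (d + 1)) (ι x)) : Prop where
  unit : g (ι x) v v = -1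
  normal : ∀ w, g (ι x) v (mfderiv (𝓡 d) (𝓡 (d + 1)) ι x w) = 0
  future : g (ι x) v (τ (ι x)) < 0

/-- The graph `{(v', v_n) ∈ C_n(0, 1) | v_n = F(v')}` over the first `n - 1` coordinates. -/
def graphInCube (F : Eu d → ℝ) : Set (Eu (d + 1)) :=
  {v | v ∈ cube (d + 1) 1 ∧ v (Fin.last d) = F (WithLp.toLp 2 fun i => v i.castSucc)}

/-- The spacetime `(M, g)`, time oriented by `τ`, is of bounded analytic geometry near the
hypersurface `ι : S → M`. -/
def BoundedAnalyticGeometryNear [IsManifold (𝓡 (d + 1)) ω M]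
    (g : Cov2 (d + 1) M) (τ : ∀ p : M, TangentSpace (𝓡 (d + 1)) p) (ι : S → M) : Prop :=
  ∃ gref : Cov2 (d + 1) M, BoundedAnalyticGeometry gref ∧
    (∃ U : Set M, IsOpen U ∧ Set.range ι ⊆ U ∧
      MemAT coordCov gref U g ∧
      MemAT coordContra gref U (inverseMetric g) ∧
      ∃ ψ, IsBoundedAnalyticAtlas gref ψ ∧ ∃ C, ∀ x, ((ψ x).source ∩ U).Nonempty →
        ∃ F : Eu d → ℝ, AnalyticBound 1 C F ∧
          ψ x '' (Set.range ι ∩ (ψ x).source) = graphInCube F) ∧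
    ∃ C, ∀ y v, IsFutureUnitNormal g τ ι y v → gref (ι y) v v ≤ C

/-- `χ` is the normal geodesic flow of the hypersurface up to time `δ`: the curve
`t ↦ χ (t, x) = exp_x (t n(x))` is the geodesic on `(-δ, δ)` that starts at `ι x` with the future
directed unit normal `n(x)` as its velocity. -/
def IsNormalGeodesicFlow (g : Cov2 (d + 1) M) (τ : ∀ p : M, TangentSpace (𝓡 (d + 1)) p)
    (ι : S → M) (δ : ℝ) (χ : ℝ × S → M) : Prop :=
  ∀ x, IsGeodesicOn g (fun t => χ (t, x)) (Set.Ioo (-δ) δ) ∧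
    ∃ v, IsFutureUnitNormal g τ ι x v ∧ velocity (fun t => χ (t, x)) 0 = ⟨ι x, v⟩

/-- `χ^* g = -dt² + h_t` on `(-δ, δ) × S`. -/
def PullbackSplits (g : Cov2 (d + 1) M) (δ : ℝ) (χ : ℝ × S → M) (h : ℝ → Cov2 d S) : Prop :=
  ∀ t ∈ Set.Ioo (-δ) δ, ∀ (x : S) (a b : ℝ) (v w : TangentSpace (𝓡 d) x),
    pullForm (g (χ (t, x))) (mfderiv (𝓘(ℝ, ℝ).prod (𝓡 d)) (𝓡 (d + 1)) χ (t, x)) (a, v) (b, w)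
      = -(a * b) + h t x v w

/-- `h_t`, `t ∈ (-δ, δ)`, is a smooth family of Riemannian metrics on `S`. -/
def IsSmoothFamily [IsManifold (𝓡 d) ω S] (δ : ℝ) (h : ℝ → Cov2 d S) : Prop :=
  (∀ t ∈ Set.Ioo (-δ) δ, IsRiemannian ∞ (h t)) ∧
  ContMDiffOn (𝓘(ℝ, ℝ).prod (𝓡 d)) ((𝓡 d).prod 𝓘(ℝ, Eu d →L[ℝ] Eu d →L[ℝ] ℝ)) ∞
    (fun p : ℝ × S => Bundle.TotalSpace.mk' (Eu d →L[ℝ] Eu d →L[ℝ] ℝ)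
      (E := fun x : S => TangentSpace (𝓡 d) x →L[ℝ] TangentSpace (𝓡 d) x →L[ℝ] ℝ)
      p.2 (h p.1 p.2))
    (Set.Ioo (-δ) δ ×ˢ Set.univ)

end Hypersurface

end BAG

end

set_option maxSynthPendingDepth 3
set_option linter.unusedSectionVars false

open scoped Manifold ContDiff Topology

noncomputable section
namespace BAG

open BoundedContinuousFunction Filter

/-! ### Superposition operators on spaces of bounded functions -/

section Superposition

variable {α : Type*} [TopologicalSpace α]
variable {E F : Type*} [NormedAddCommGroup E] [NormedSpace ℝ E]
  [NormedAddCommGroup F] [NormedSpace ℝ F]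

/-! Every local ingredient is classical: unit normals, the geodesic flow, the Gauss lemma, changes
of charts. The difficulty is uniformity, since one radius and one bound must serve all points of the
hypersurface. The device is to regard the points as a discrete index set `I` and to encode a family
of functions `u i` near `0` as one germ with values in the Banach space of bounded functions `I → V`
(`UA`). Analyticity of this single germ amounts to common Cauchy estimates on the Taylor
coefficients (`UA.of_analyticBound`, `UA.exists_analyticBound`). Ordinary analysis in Banach spaces
then yields uniform statements about composition, inversion, square roots, derivatives and flows
(`UA.comp`, `UA.inverse`, `UA.inv_sqrt`, `UA.fderiv`, `UA.flow`). Flows rest on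
`exists_analytic_flow`, which solves the Picard equation with the analytic inverse function theorem.

The hypotheses allow different atlases for the metric, for its inverse and for the graphs. The
transition between two bounded analytic charts with the same centre is an isometry of the reference
metric. An isometry `κ` satisfies `D²κ = Dκ ∘ Γ' - Γ(Dκ, Dκ)`, so along rays it solves a uniformly
analytic differential equation whose initial data are bounded; hence it is uniformly analytic
(`UAMetric.exists_ua_isometry`). This brings the Lorentzian metric, with uniform nondegeneracy, into
the atlas adapted to the hypersurface (`IsLorentzian.uaMetric`).

In that atlas the hypersurface is a uniformly analytic family of graphs, and the bound on the unit
normal for the reference metric keeps the normals in a bounded set. They extend analytically along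
the graphs (`exists_ua_normal`), and the geodesics that they start give maps `Ψ y (t, v)` on a
common ball, expanding distances by at least a fixed factor (`exists_gaussFlow`). The Gauss lemma
gives the form `-dt² + h_t`. Uniqueness of geodesics shows that the local flows are one map
(`IsGaussSetup.flowMap_eq`). For injectivity, if two short normal geodesics meet, then going back
along one of them stays in the chart centred at the foot of the other, where the flow is injective
(`IsGaussSetup.flowMap_injOn`).

Projecting the graphs to the first `d` coordinates gives charts of the hypersurface in which `h_t`
is a rescaled `leafForm`, uniformly analytic in `(t, v)`. A quantitative Cauchy–Schwarz argument on
the orthogonal complement of the normal (`IsLorentzForm.spacelike_lower`) makes `h_0` uniformly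
definite, so these charts form a bounded analytic atlas. The expansion in time is
`UA.time_expansion`; its coefficients in different charts fit together to tensors because power
series in `t` have unique coefficients (`exists_memAnalyticAT`).

The Cauchy property serves to show that the hypersurface is not empty unless the spacetime is:
bounded geometry supplies a complete timelike field, and its integral curves are inextendible
(`nonempty_of_isCauchySurface`). -/

/-- The pointwise action of a continuous multilinear map on bounded continuous functions. -/
def bcfMultilinear {k : ℕ} (m : ContinuousMultilinearMap ℝ (fun _ : Fin k => E) F) :
    ContinuousMultilinearMap ℝ (fun _ : Fin k => α →ᵇ E) (α →ᵇ F) :=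
  MultilinearMap.mkContinuous
    { toFun := fun ξ => BoundedContinuousFunction.ofNormedAddCommGroup
        (fun a => m fun j => ξ j a)
        (m.cont.comp (continuous_pi fun j => (ξ j).continuous)) (‖m‖ * ∏ j, ‖ξ j‖)
        (fun a => (m.le_opNorm _).trans (by
          gcongr with j
          exact (ξ j).norm_coe_le_norm a))
      map_update_add' := by
        intro _ ξ j x y
        ext a
        have h : ∀ z : α →ᵇ E, (fun i => (Function.update ξ j z) i a)
            = Function.update (fun i => ξ i a) j (z a) := by
          intro z; ext i
          by_cases hi : i = j
          · subst hi; simp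
          · simp [hi]
        simp [h]
      map_update_smul' := by
        intro _ ξ j c x
        ext a
        have h : ∀ z : α →ᵇ E, (fun i => (Function.update ξ j z) i a)
            = Function.update (fun i => ξ i a) j (z a) := by
          intro z; ext i
          by_cases hi : i = j
          · subst hi; simp
          · simp [hi]
        simp [h] }
    ‖m‖ (fun ξ => by
      refine (BoundedContinuousFunction.norm_le (by positivity)).2 fun a => ?_
      refine (m.le_opNorm _).trans ?_
      gcongr with j
      exact (ξ j).norm_coe_le_norm a)

@[simp]
lemma bcfMultilinear_apply {k : ℕ} (m : ContinuousMultilinearMap ℝ (fun _ : Fin k => E) F)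
    (ξ : Fin k → α →ᵇ E) (a : α) : bcfMultilinear m ξ a = m fun j => ξ j a := rfl

lemma norm_bcfMultilinear_le {k : ℕ} (m : ContinuousMultilinearMap ℝ (fun _ : Fin k => E) F) :
    ‖bcfMultilinear (α := α) m‖ ≤ ‖m‖ :=
  MultilinearMap.mkContinuous_norm_le _ (norm_nonneg _) _

/-- Superposition with an analytic function is analytic on bounded continuous functions. -/
lemma exists_analyticAt_superposition [CompleteSpace F] {f : E → F} (hf : AnalyticAt ℝ f 0) :
    ∃ N : (α →ᵇ E) → (α →ᵇ F), AnalyticAt ℝ N 0 ∧ ∀ᶠ ξ in 𝓝 0, ∀ a, N ξ a = f (ξ a) := by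
  obtain ⟨p, r, hp⟩ := hf
  let P : FormalMultilinearSeries ℝ (α →ᵇ E) (α →ᵇ F) := fun k => bcfMultilinear (p k)
  -- The coefficients act pointwise without increasing norms, so the series on bounded functions
  -- converges at least where `p` does. Evaluation at a point is continuous and linear, hence
  -- identifies its sum.
  have hrad : p.radius ≤ P.radius := by
    refine ENNReal.le_of_forall_nnreal_lt fun s hs => ?_
    obtain ⟨C, -, hC⟩ := p.norm_mul_pow_le_of_lt_radius hs
    refine P.le_radius_of_bound C fun k => le_trans ?_ (hC k)
    gcongr
    exact norm_bcfMultilinear_le _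
  have hpos : 0 < P.radius := (hp.r_pos.trans_le hp.r_le).trans_le hrad
  have hP := P.hasFPowerSeriesOnBall hpos
  refine ⟨P.sum, hP.analyticAt, ?_⟩
  have : ∀ᶠ ξ : α →ᵇ E in 𝓝 0, ξ ∈ Metric.eball (0 : α →ᵇ E) r := Metric.eball_mem_nhds _ hp.r_pos
  filter_upwards [this] with ξ hξ a
  have h1 : HasSum (fun k => P k fun _ => ξ) (P.sum ξ) := by
    refine P.hasSum ?_
    exact Metric.eball_subset_eball (hp.r_le.trans hrad) hξ
  have h2 := (BoundedContinuousFunction.evalCLM ℝ a).hasSum h1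
  have h3 : ξ a ∈ Metric.eball (0 : E) r := by
    simp only [Metric.mem_eball, edist_zero_right] at hξ ⊢
    refine lt_of_le_of_lt ?_ hξ
    rw [enorm_le_iff_norm_le]
    exact ξ.norm_coe_le_norm a
  have h4 := hp.hasSum h3
  rw [zero_add] at h4
  exact h2.unique h4

end Superposition

/-! ### The analytic flow of a vector field on a Banach space -/

section Flow

variable {E : Type*} [NormedAddCommGroup E] [NormedSpace ℝ E] [CompleteSpace E]

/-- The interval `[-1, 1]`. -/
abbrev UnitSeg : Type := Set.Icc (-1 : ℝ) 1

/-- Extension of a function on `[-1, 1]` to the line. -/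
def segExtend (u : UnitSeg →ᵇ E) : ℝ → E := Set.IccExtend (by norm_num : (-1 : ℝ) ≤ 1) u

lemma continuous_segExtend (u : UnitSeg →ᵇ E) : Continuous (segExtend u) :=
  u.continuous.Icc_extend'

lemma norm_segExtend_le (u : UnitSeg →ᵇ E) (t : ℝ) : ‖segExtend u t‖ ≤ ‖u‖ :=
  u.norm_coe_le_norm _

lemma segExtend_coe (u : UnitSeg →ᵇ E) (t : UnitSeg) : segExtend u t = u t :=
  Set.IccExtend_val _ _ _

lemma norm_integral_segExtend_le (u : UnitSeg →ᵇ E) (τ : UnitSeg) :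
    ‖∫ s in (0 : ℝ)..τ, segExtend u s‖ ≤ ‖u‖ := by
  refine (intervalIntegral.norm_integral_le_of_norm_le_const
    (fun s _ => norm_segExtend_le u s)).trans ?_
  have : |(τ : ℝ) - 0| ≤ 1 := by simpa using abs_le.2 τ.2
  nlinarith [norm_nonneg u]

/-- The operator `u ↦ ∫₀^τ u` on `C([-1, 1], E)`. -/
def segIntegral : (UnitSeg →ᵇ E) →L[ℝ] (UnitSeg →ᵇ E) :=
  LinearMap.mkContinuous
    { toFun := fun u => BoundedContinuousFunction.ofNormedAddCommGroup
        (fun τ : UnitSeg => ∫ s in (0 : ℝ)..τ, segExtend u s)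
        ((intervalIntegral.continuous_primitive
          (fun a b => (continuous_segExtend u).intervalIntegrable a b) 0).comp
          continuous_subtype_val) ‖u‖
        (norm_integral_segExtend_le u)
      map_add' := by
        intro u v
        ext τ
        simp only [BoundedContinuousFunction.coe_ofNormedAddCommGroup,
          BoundedContinuousFunction.coe_add, Pi.add_apply]
        rw [← intervalIntegral.integral_add ((continuous_segExtend u).intervalIntegrable _ _)
          ((continuous_segExtend v).intervalIntegrable _ _)]
        rfl
      map_smul' := by
        intro c u
        ext τ
        simp only [BoundedContinuousFunction.coe_ofNormedAddCommGroup,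
          BoundedContinuousFunction.coe_smul, RingHom.id_apply]
        rw [← intervalIntegral.integral_smul]
        rfl }
    1 (fun u => by
      rw [one_mul]
      exact (BoundedContinuousFunction.norm_le (norm_nonneg _)).2 (norm_integral_segExtend_le u))

lemma segIntegral_apply (u : UnitSeg →ᵇ E) (τ : UnitSeg) :
    segIntegral u τ = ∫ s in (0 : ℝ)..τ, segExtend u s := rfl

/-- The inclusion of `E` in the bounded functions as constants. -/
def constCLM (α : Type*) [TopologicalSpace α] (E : Type*) [NormedAddCommGroup E]
    [NormedSpace ℝ E] : E →L[ℝ] (α →ᵇ E) :=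
  LinearMap.mkContinuous
    { toFun := fun x => BoundedContinuousFunction.const α x
      map_add' := fun _ _ => rfl
      map_smul' := fun _ _ => rfl } 1
    (fun x => by rw [one_mul]; exact BoundedContinuousFunction.norm_const_le x)

@[simp]
lemma constCLM_apply (α : Type*) [TopologicalSpace α] (x : E) (a : α) :
    constCLM α E x a = x := rfl

/-- Scaling of `[-1, 1]` by `τ ∈ [-1, 1]`. -/
def segScale (τ : UnitSeg) : C(UnitSeg, UnitSeg) where
  toFun σ := ⟨τ * σ, by
    have h1 := abs_le.2 τ.2
    have h2 := abs_le.2 σ.2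
    exact abs_le.1 (by rw [abs_mul]; exact mul_le_one₀ h1 (abs_nonneg _) h2)⟩
  continuous_toFun := by fun_prop

/-- The linear part at `0` of the integral equation. -/
def shearEquiv (c : UnitSeg →ᵇ E) :
    (ℝ × E × (UnitSeg →ᵇ E)) ≃L[ℝ] (ℝ × E × (UnitSeg →ᵇ E)) :=
  ContinuousLinearEquiv.equivOfInverse
    ((ContinuousLinearMap.fst ℝ ℝ _).prod
      (((ContinuousLinearMap.fst ℝ E _).comp (ContinuousLinearMap.snd ℝ ℝ _)).prod
        ((ContinuousLinearMap.snd ℝ E (UnitSeg →ᵇ E)).comp (ContinuousLinearMap.snd ℝ ℝ _)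
          - (constCLM UnitSeg E).comp
            ((ContinuousLinearMap.fst ℝ E _).comp (ContinuousLinearMap.snd ℝ ℝ _))
          - (ContinuousLinearMap.fst ℝ ℝ _).smulRight c)))
    ((ContinuousLinearMap.fst ℝ ℝ _).prod
      (((ContinuousLinearMap.fst ℝ E _).comp (ContinuousLinearMap.snd ℝ ℝ _)).prod
        ((ContinuousLinearMap.snd ℝ E (UnitSeg →ᵇ E)).comp (ContinuousLinearMap.snd ℝ ℝ _)
          + (constCLM UnitSeg E).comp
            ((ContinuousLinearMap.fst ℝ E _).comp (ContinuousLinearMap.snd ℝ ℝ _))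
          + (ContinuousLinearMap.fst ℝ ℝ _).smulRight c)))
    (fun z => by ext <;> simp <;> abel) (fun z => by ext <;> simp <;> abel)

lemma shearEquiv_apply (c : UnitSeg →ᵇ E) (z : ℝ × E × (UnitSeg →ᵇ E)) :
    shearEquiv c z = (z.1, z.2.1, z.2.2 - constCLM UnitSeg E z.2.1 - z.1 • c) := rfl

/-- The flow of an analytic vector field on a Banach space is analytic. -/
theorem exists_analytic_flow {X : E → E} (hX : AnalyticAt ℝ X 0) :
    ∃ Φ : ℝ × E → E, AnalyticAt ℝ Φ 0 ∧ Φ 0 = 0 ∧ ∀ᶠ p in 𝓝 (0 : ℝ × E),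
      Φ (0, p.2) = p.2 ∧ HasDerivAt (fun s => Φ (s, p.2)) (X (Φ p)) p.1 := by
  obtain ⟨N, hN, hNX⟩ := exists_analyticAt_superposition (α := UnitSeg) hX
  -- Time is rescaled to `[-1, 1]`: the last component vanishes exactly when `y τ = x + s ∫₀^τ
  -- X(y)`, so `τ ↦ y τ` is the solution at times `s τ`. Carrying `s` and `x` along turns the
  -- implicit function theorem into an inversion of `T`.
  let T : ℝ × E × (UnitSeg →ᵇ E) → ℝ × E × (UnitSeg →ᵇ E) := fun z =>
    (z.1, z.2.1, z.2.2 - constCLM UnitSeg E z.2.1 - z.1 • segIntegral (N z.2.2))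
  have hN' : AnalyticAt ℝ (fun z : ℝ × E × (UnitSeg →ᵇ E) => N z.2.2) 0 :=
    AnalyticAt.fun_comp (g := N) (f := fun z : ℝ × E × (UnitSeg →ᵇ E) => z.2.2) hN
      (analyticAt_snd.fun_comp analyticAt_snd)
  have hT : AnalyticAt ℝ T 0 := by
    refine analyticAt_fst.prod ((analyticAt_fst.fun_comp analyticAt_snd).prod ?_)
    refine ((analyticAt_snd.fun_comp analyticAt_snd).sub ?_).sub ?_
    · exact ((constCLM UnitSeg E).analyticAt _).fun_comp (analyticAt_fst.fun_comp analyticAt_snd)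
    · exact analyticAt_fst.smul ((segIntegral.analyticAt _).fun_comp hN')
  -- The term `s • ∫ N y` is a product whose first factor vanishes at the origin, so it contributes
  -- only `s • ∫ N 0` and the derivative is a shear, whatever `N` is.
  have hTd : HasFDerivAt T
      (shearEquiv (segIntegral (N 0)) : (ℝ × E × (UnitSeg →ᵇ E)) →L[ℝ] _) 0 := by
    have h1 : HasFDerivAt (fun z : ℝ × E × (UnitSeg →ᵇ E) => z.1 • segIntegral (N z.2.2))
        ((ContinuousLinearMap.fst ℝ ℝ _).smulRight (segIntegral (N 0))) 0 := by
      have h2 := ((segIntegral.analyticAt _).fun_comp hN').differentiableAt.hasFDerivAt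
      have h3 := (hasFDerivAt_fst (𝕜 := ℝ) (p := (0 : ℝ × E × (UnitSeg →ᵇ E)))).smul h2
      refine h3.congr_fderiv ?_
      ext z <;> simp
    refine HasFDerivAt.prodMk hasFDerivAt_fst
      (HasFDerivAt.prodMk (hasFDerivAt_fst.comp _ hasFDerivAt_snd) ?_)
    refine HasFDerivAt.sub (HasFDerivAt.sub ?_ ?_) h1
    · exact hasFDerivAt_snd.comp _ hasFDerivAt_snd
    · exact (constCLM UnitSeg E).hasFDerivAt.comp (0 : ℝ × E × (UnitSeg →ᵇ E))
        (hasFDerivAt_fst.comp _ hasFDerivAt_snd)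
  have hTc : ContDiffAt ℝ ω T 0 := hT.contDiffAt
  let e := hTc.toOpenPartialHomeomorph T hTd (by simp)
  have hecoe : (e : _ → _) = T := hTc.toOpenPartialHomeomorph_coe hTd (by simp)
  have he0 : (0 : ℝ × E × (UnitSeg →ᵇ E)) ∈ e.source :=
    hTc.mem_toOpenPartialHomeomorph_source hTd (by simp)
  have hT0 : T 0 = 0 := by ext <;> simp [T]
  have hesymm0 : e.symm 0 = 0 := by
    have := e.left_inv he0
    rwa [hecoe, hT0] at this
  have het0 : (0 : ℝ × E × (UnitSeg →ᵇ E)) ∈ e.target := by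
    have := e.map_source he0
    rwa [hecoe, hT0] at this
  have hsymm : AnalyticAt ℝ e.symm 0 := by
    have : ContDiffAt ℝ ω e.symm 0 := by
      refine e.contDiffAt_symm het0 (f₀' := shearEquiv (segIntegral (N 0))) ?_ ?_
      · rw [hesymm0, hecoe]; exact hTd
      · rw [hesymm0, hecoe]; exact hTc
    exact this.analyticAt
  let j : ℝ × E → ℝ × E × (UnitSeg →ᵇ E) := fun p => (p.1, p.2, 0)
  have hj : AnalyticAt ℝ j 0 :=
    analyticAt_fst.prod (analyticAt_snd.prod analyticAt_const)
  let Y : ℝ × E → (UnitSeg →ᵇ E) := fun p => (e.symm (j p)).2.2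
  have hj0 : j 0 = 0 := rfl
  have hY : AnalyticAt ℝ Y 0 := by
    have : AnalyticAt ℝ (fun p => e.symm (j p)) 0 := by
      refine AnalyticAt.fun_comp (g := e.symm) (f := j) ?_ hj
      rw [hj0]; exact hsymm
    exact analyticAt_snd.fun_comp (analyticAt_snd.fun_comp this)
  have hY0 : Y 0 = 0 := by simp [Y, hj0, hesymm0]
  -- The rescaled solution at `τ = 1` is the solution at time `s`.
  let one : UnitSeg := ⟨1, by norm_num⟩
  let Φ : ℝ × E → E := fun p => Y p one
  have hΦ : AnalyticAt ℝ Φ 0 :=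
    ((BoundedContinuousFunction.evalCLM ℝ one).analyticAt _).fun_comp hY
  -- the equation for `Y` and its uniqueness
  have heq : ∀ᶠ p in 𝓝 (0 : ℝ × E), Y p = constCLM UnitSeg E p.2 + p.1 • segIntegral (N (Y p)) := by
    have : ∀ᶠ p in 𝓝 (0 : ℝ × E), j p ∈ e.target :=
      hj.continuousAt.eventually_mem (by rw [hj0]; exact e.open_target.mem_nhds het0)
    filter_upwards [this] with p hp
    have h1 := e.right_inv hp
    rw [hecoe] at h1
    have h2 : (e.symm (j p)).1 = p.1 := congrArg (fun z => z.1) h1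
    have h3 : (e.symm (j p)).2.1 = p.2 := congrArg (fun z => z.2.1) h1
    have h4 : Y p - constCLM UnitSeg E (e.symm (j p)).2.1
        - (e.symm (j p)).1 • segIntegral (N (Y p)) = 0 := congrArg (fun z => z.2.2) h1
    rw [h2, h3, sub_sub, sub_eq_zero] at h4
    exact h4
  obtain ⟨r, hr, hrs⟩ := Metric.isOpen_iff.1 e.open_source 0 he0
  -- Injectivity of the local inverse makes small solutions of the integral equation unique.
  have huniq : ∀ s x y, |s| < r → ‖x‖ < r → ‖y‖ < r →
      y = constCLM UnitSeg E x + s • segIntegral (N y) → y = Y (s, x) := by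
    intro s x y hs hx hy hyeq
    have hmem : (s, x, y) ∈ e.source := hrs (by
      simp [Prod.norm_def, hs, hx, hy])
    have h1 := e.left_inv hmem
    have h2 : e (s, x, y) = j (s, x) := by
      rw [hecoe]
      refine Prod.ext rfl (Prod.ext rfl ?_)
      change y - constCLM UnitSeg E x - s • segIntegral (N y) = 0
      rw [sub_sub, sub_eq_zero]; exact hyeq
    rw [h2] at h1
    change _ = (e.symm (j (s, x))).2.2
    rw [h1]
  obtain ⟨r1, hr1, hball⟩ := Metric.eventually_nhds_iff_ball.1 hNX
  have hYsmall : ∀ᶠ p in 𝓝 (0 : ℝ × E), ‖Y p‖ < min r r1 := by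
    have := hY.continuousAt.norm
    refine this.eventually_lt_const ?_
    simp only [hY0, norm_zero]; positivity
  obtain ⟨ρ, hρ, hρb⟩ := Metric.eventually_nhds_iff_ball.1 (heq.and hYsmall)
  -- The curve `σ ↦ Y (s, x) (τ σ)` solves the equation with `s τ` in place of `s`, so uniqueness
  -- identifies it with `Y (s τ, x)`. Thus the single curve `Y (s, x)` contains `Φ` at all times
  -- between `-s` and `s`.
  have hscale : ∀ s x, |s| < min r ρ → ‖x‖ < min r ρ → ∀ τ : UnitSeg,
      Φ (s * τ, x) = Y (s, x) τ := by
    intro s x hs hx τ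
    have hsr := (lt_min_iff.1 hs)
    have hxr := (lt_min_iff.1 hx)
    obtain ⟨h1, h2⟩ := hρb (s, x) (by simp [Prod.norm_def, hsr.2, hxr.2])
    have hτ : |(τ : ℝ)| ≤ 1 := abs_le.2 τ.2
    have key : (Y (s, x)).compContinuous (segScale τ) = Y (s * τ, x) := by
      have hnorm : ‖(Y (s, x)).compContinuous (segScale τ)‖ ≤ ‖Y (s, x)‖ :=
        BoundedContinuousFunction.norm_compContinuous_le _ _
      refine huniq _ _ _ ?_ hxr.1 (hnorm.trans_lt (lt_min_iff.1 h2).1) ?_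
      · rw [abs_mul]
        calc |s| * |(τ : ℝ)| ≤ |s| * 1 := by gcongr
          _ < r := by simpa using hsr.1
      · ext σ
        have hN1 := hball _ (by simpa using (lt_min_iff.1 h2).2 : Y (s, x) ∈ _)
        have hN2 := hball _ (by
          simpa using hnorm.trans_lt (lt_min_iff.1 h2).2 :
            (Y (s, x)).compContinuous (segScale τ) ∈ _)
        have hL : ((Y (s, x)).compContinuous (segScale τ)) σ = Y (s, x) (segScale τ σ) := rfl
        have hR : (constCLM UnitSeg E x + (s * τ) • segIntegral
            (N ((Y (s, x)).compContinuous (segScale τ)))) σ = x + (s * τ) •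
              ∫ u in (0 : ℝ)..σ, segExtend (N ((Y (s, x)).compContinuous (segScale τ))) u := rfl
        rw [hL, hR]
        conv_lhs => rw [h1]
        simp only [BoundedContinuousFunction.coe_add, BoundedContinuousFunction.coe_smul,
          Pi.add_apply, constCLM_apply, segIntegral_apply, add_right_inj]
        rw [mul_smul]
        congr 1
        have hcov := intervalIntegral.smul_integral_comp_mul_left (a := 0) (b := σ)
          (fun u => segExtend (N (Y (s, x))) u) (τ : ℝ)
        have hts : ((segScale τ σ : UnitSeg) : ℝ) = τ * σ := rfl
        rw [hts]
        rw [mul_zero] at hcov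
        rw [← hcov]
        congr 1
        refine intervalIntegral.integral_congr fun u hu => ?_
        have huI : u ∈ Set.Icc (-1 : ℝ) 1 := by
          have h0 : (0 : ℝ) ∈ Set.Icc (-1 : ℝ) 1 := by norm_num
          exact Set.uIcc_subset_Icc h0 σ.2 hu
        have e1 : segExtend (N (Y (s, x))) (τ * u) = N (Y (s, x)) (segScale τ ⟨u, huI⟩) :=
          segExtend_coe _ (segScale τ ⟨u, huI⟩)
        have e2 : segExtend (N ((Y (s, x)).compContinuous (segScale τ))) u
            = N ((Y (s, x)).compContinuous (segScale τ)) ⟨u, huI⟩ := segExtend_coe _ ⟨u, huI⟩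
        simp only [e1, e2, hN1, hN2, BoundedContinuousFunction.compContinuous_apply]
    change Y (s * τ, x) one = _
    rw [← key]
    change Y (s, x) (segScale τ one) = _
    congr 1
    exact Subtype.ext (mul_one _)
  refine ⟨Φ, hΦ, by simp [Φ, hY0], ?_⟩
  set δ := min r ρ with hδdef
  have hδ : 0 < δ := lt_min hr hρ
  refine Metric.eventually_nhds_iff_ball.2 ⟨δ / 2, by positivity, ?_⟩
  rintro ⟨t, x⟩ hp
  obtain ⟨ht, hx⟩ : |t| < δ / 2 ∧ ‖x‖ < δ / 2 := by simpa [Prod.norm_def] using hp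
  have hs : |δ / 2| < δ := by rw [abs_of_pos (by positivity)]; linarith
  have hx' : ‖x‖ < δ := by linarith
  have hsc := hscale (δ / 2) x hs hx'
  obtain ⟨h1, h2⟩ := hρb (δ / 2, x) (by
    have : δ ≤ ρ := min_le_right _ _
    simp only [mem_ball_zero_iff, Prod.norm_def, Real.norm_eq_abs, sup_lt_iff]
    exact ⟨hs.trans_le this, hx'.trans_le this⟩)
  have hN1 := hball _ (by simpa using (lt_min_iff.1 h2).2 : Y (δ / 2, x) ∈ _)
  -- With this `s` fixed, `Φ (σ, x)` for `|σ| < s` is an integral with upper limit `σ / s`, and the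
  -- fundamental theorem of calculus gives the derivative.
  set s := δ / 2 with hsdef
  have hs0 : 0 < s := by positivity
  have hint : ∀ τ : UnitSeg, Φ (s * τ, x)
      = x + s • ∫ u in (0 : ℝ)..τ, segExtend (N (Y (s, x))) u := by
    intro τ
    rw [hsc τ]
    conv_lhs => rw [h1]
    simp [segIntegral_apply]
  constructor
  · have := hint ⟨0, by norm_num⟩
    simpa using this
  · have hloc : (fun σ => Φ (σ, x)) =ᶠ[𝓝 t]
        fun σ => x + s • ∫ u in (0 : ℝ)..(σ / s), segExtend (N (Y (s, x))) u := by
      have : ∀ᶠ σ in 𝓝 t, |σ| < s := continuous_abs.continuousAt.eventually_lt_const ht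
      filter_upwards [this] with σ hσ
      have hmem : σ / s ∈ Set.Icc (-1 : ℝ) 1 := by
        refine abs_le.1 ?_
        rw [abs_div, abs_of_pos hs0, div_le_one hs0]; exact hσ.le
      have := hint ⟨σ / s, hmem⟩
      simp only at this
      rwa [mul_div_cancel₀ _ hs0.ne'] at this
    refine HasDerivAt.congr_of_eventuallyEq ?_ hloc
    have hmem : t / s ∈ Set.Icc (-1 : ℝ) 1 := by
      refine abs_le.1 ?_
      rw [abs_div, abs_of_pos hs0, div_le_one hs0]; exact ht.le
    have hd : HasDerivAt (fun τ => ∫ u in (0 : ℝ)..τ, segExtend (N (Y (s, x))) u)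
        (segExtend (N (Y (s, x))) (t / s)) (t / s) :=
      intervalIntegral.integral_hasDerivAt_right
        ((continuous_segExtend _).intervalIntegrable _ _)
        ((continuous_segExtend _).stronglyMeasurableAtFilter _ _)
        (continuous_segExtend _).continuousAt
    have hd2 := (hd.scomp t ((hasDerivAt_id t).div_const s)).const_smul s
    have hd3 := hd2.const_add x
    have hval : s • ((1 / s) • segExtend (N (Y (s, x))) (t / s)) = X (Φ (t, x)) := by
      rw [smul_smul, mul_one_div_cancel hs0.ne', one_smul]
      have e1 : segExtend (N (Y (s, x))) (t / s) = N (Y (s, x)) ⟨t / s, hmem⟩ :=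
        segExtend_coe _ ⟨t / s, hmem⟩
      rw [e1, hN1, ← hsc ⟨t / s, hmem⟩]
      simp only [mul_div_cancel₀ _ hs0.ne']
    rw [← hval]
    exact hd3

end Flow
end BAG

end

noncomputable section
namespace BAG

open BoundedContinuousFunction Filter

/-! ### Calculus of uniformly analytic families -/

section UniformlyAnalytic

variable {I : Type*} [TopologicalSpace I] [DiscreteTopology I]
variable {D E V W Z : Type*} [NormedAddCommGroup D] [NormedSpace ℝ D]
  [NormedAddCommGroup E] [NormedSpace ℝ E]
  [NormedAddCommGroup V] [NormedSpace ℝ V] [NormedAddCommGroup W] [NormedSpace ℝ W]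
  [NormedAddCommGroup Z] [NormedSpace ℝ Z]

/-- The bounded function on a discrete space with given values; zero if they are unbounded. -/
def bddFun (c : I → V) (C : ℝ) (hc : ∀ i, ‖c i‖ ≤ C) : I →ᵇ V :=
  BoundedContinuousFunction.ofNormedAddCommGroupDiscrete c C hc

@[simp]
lemma bddFun_apply (c : I → V) (C : ℝ) (hc : ∀ i, ‖c i‖ ≤ C) (i : I) : bddFun c C hc i = c i := rfl

lemma norm_bddFun_le (c : I → V) (C : ℝ) (hC : 0 ≤ C) (hc : ∀ i, ‖c i‖ ≤ C) :
    ‖bddFun c C hc‖ ≤ C := (BoundedContinuousFunction.norm_le hC).2 hc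

/-- The family `u` of functions is analytic at `0`, uniformly in the index. -/
def UA (u : I → E → V) : Prop :=
  ∃ F : E → (I →ᵇ V), AnalyticAt ℝ F 0 ∧ ∀ᶠ v in 𝓝 0, ∀ i, F v i = u i v

namespace UA

lemma congr {u w : I → E → V} (hu : UA u) (h : ∀ᶠ v in 𝓝 0, ∀ i, u i v = w i v) : UA w := by
  obtain ⟨F, hF, hFu⟩ := hu
  refine ⟨F, hF, ?_⟩
  filter_upwards [hFu, h] with v h1 h2 i
  rw [h1, h2]

lemma const {c : I → V} {C : ℝ} (hc : ∀ i, ‖c i‖ ≤ C) : UA (fun i (_ : E) => c i) :=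
  ⟨fun _ => bddFun c C hc, analyticAt_const, Eventually.of_forall fun _ _ => rfl⟩

lemma of_analyticAt {f : E → V} (hf : AnalyticAt ℝ f 0) : UA (fun (_ : I) => f) :=
  ⟨fun v => constCLM I V (f v), ((constCLM I V).analyticAt _).fun_comp hf,
    Eventually.of_forall fun _ _ => rfl⟩

lemma clm {u : I → E → V} (hu : UA u) (L : V →L[ℝ] W) : UA (fun i v => L (u i v)) := by
  obtain ⟨F, hF, hFu⟩ := hu
  refine ⟨fun v => L.compLeftContinuousBounded I (F v),
    ((L.compLeftContinuousBounded I).analyticAt _).fun_comp hF, ?_⟩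
  filter_upwards [hFu] with v hv i
  simp [hv i]

lemma add {u w : I → E → V} (hu : UA u) (hw : UA w) : UA (fun i v => u i v + w i v) := by
  obtain ⟨F, hF, hFu⟩ := hu
  obtain ⟨G, hG, hGw⟩ := hw
  refine ⟨fun v => F v + G v, hF.fun_add hG, ?_⟩
  filter_upwards [hFu, hGw] with v h1 h2 i
  simp [h1 i, h2 i]

lemma neg {u : I → E → V} (hu : UA u) : UA (fun i v => - u i v) := by
  simpa using hu.clm (-(ContinuousLinearMap.id ℝ V))

lemma sub {u w : I → E → V} (hu : UA u) (hw : UA w) : UA (fun i v => u i v - w i v) := by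
  simpa [sub_eq_add_neg] using hu.add hw.neg

lemma prodMk {u : I → E → V} {w : I → E → W} (hu : UA u) (hw : UA w) :
    UA (fun i v => (u i v, w i v)) := by
  simpa using (hu.clm (ContinuousLinearMap.inl ℝ V W)).add (hw.clm (ContinuousLinearMap.inr ℝ V W))

end UA

/-- The pointwise action of a bilinear map on bounded functions. -/
def bcfBilin (B : V →L[ℝ] W →L[ℝ] Z) : (I →ᵇ V) →L[ℝ] (I →ᵇ W) →L[ℝ] (I →ᵇ Z) :=
  LinearMap.mkContinuous₂
    (LinearMap.mk₂ ℝ (fun f g => bddFun (fun i => B (f i) (g i)) (‖B‖ * ‖f‖ * ‖g‖)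
        (fun i => (B.le_opNorm₂ _ _).trans (by
          gcongr
          · exact f.norm_coe_le_norm i
          · exact g.norm_coe_le_norm i)))
      (fun f f' g => by ext i; simp) (fun c f g => by ext i; simp)
      (fun f g g' => by ext i; simp) (fun c f g => by ext i; simp))
    ‖B‖ (fun f g => (BoundedContinuousFunction.norm_le (by positivity)).2 fun i =>
      (B.le_opNorm₂ _ _).trans (by
        gcongr
        · exact f.norm_coe_le_norm i
        · exact g.norm_coe_le_norm i))

@[simp]
lemma bcfBilin_apply (B : V →L[ℝ] W →L[ℝ] Z) (f : I →ᵇ V) (g : I →ᵇ W) (i : I) :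
    bcfBilin B f g i = B (f i) (g i) := rfl

/-- A map with values in bounded functions, read as a bounded family of maps. -/
def bcfCurry : (E →L[ℝ] (I →ᵇ V)) →L[ℝ] (I →ᵇ (E →L[ℝ] V)) :=
  LinearMap.mkContinuous
    { toFun := fun T => bddFun (fun i => (BoundedContinuousFunction.evalCLM ℝ i).comp T) ‖T‖
        (fun i => ContinuousLinearMap.opNorm_le_bound _ (norm_nonneg _) fun v =>
          ((T v).norm_coe_le_norm i).trans (T.le_opNorm v))
      map_add' := fun S T => by ext i v; simp
      map_smul' := fun c T => by ext i v; simp }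
    1 (fun T => by
      rw [one_mul]
      exact (BoundedContinuousFunction.norm_le (norm_nonneg _)).2 fun i =>
        ContinuousLinearMap.opNorm_le_bound _ (norm_nonneg _) fun v =>
          ((T v).norm_coe_le_norm i).trans (T.le_opNorm v))

@[simp]
lemma bcfCurry_apply (T : E →L[ℝ] (I →ᵇ V)) (i : I) (v : E) : bcfCurry T i v = T v i := rfl

/-- Restriction to the diagonal. -/
def bcfDiag : (I →ᵇ (I →ᵇ V)) →L[ℝ] (I →ᵇ V) :=
  LinearMap.mkContinuous
    { toFun := fun T => bddFun (fun i => T i i) ‖T‖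
        (fun i => ((T i).norm_coe_le_norm i).trans (T.norm_coe_le_norm i))
      map_add' := fun S T => by ext i; simp
      map_smul' := fun c T => by ext i; simp }
    1 (fun T => by
      rw [one_mul]
      exact (BoundedContinuousFunction.norm_le (norm_nonneg _)).2 fun i =>
        ((T i).norm_coe_le_norm i).trans (T.norm_coe_le_norm i))

@[simp]
lemma bcfDiag_apply (T : I →ᵇ (I →ᵇ V)) (i : I) : bcfDiag T i = T i i := rfl

/-- Here the nonlinearity depends on the index. Superposition with the germ `F` of the family
produces all values `F (ξ i) j`; the diagonal `j = i` is extracted by a continuous linear map. -/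
lemma exists_diagonal_superposition [CompleteSpace V] {u : I → E → V} (hu : UA u) :
    ∃ N : (I →ᵇ E) → (I →ᵇ V), AnalyticAt ℝ N 0 ∧ ∀ᶠ ξ in 𝓝 0, ∀ i, N ξ i = u i (ξ i) := by
  obtain ⟨F, hF, hFu⟩ := hu
  obtain ⟨N, hN, hNF⟩ := exists_analyticAt_superposition (α := I) hF
  refine ⟨fun ξ => bcfDiag (N ξ), (bcfDiag.analyticAt _).fun_comp hN, ?_⟩
  obtain ⟨r, hr, hrb⟩ := Metric.eventually_nhds_iff_ball.1 hFu
  filter_upwards [hNF, Metric.ball_mem_nhds 0 hr] with ξ h1 h2 i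
  rw [bcfDiag_apply, h1 i]
  refine hrb _ ?_ i
  simp only [mem_ball_zero_iff] at h2 ⊢
  exact (ξ.norm_coe_le_norm i).trans_lt h2

namespace UA

lemma bilin (B : V →L[ℝ] W →L[ℝ] Z) {u : I → E → V} {w : I → E → W} (hu : UA u) (hw : UA w) :
    UA (fun i v => B (u i v) (w i v)) := by
  obtain ⟨F, hF, hFu⟩ := hu
  obtain ⟨G, hG, hGw⟩ := hw
  refine ⟨fun v => bcfBilin B (F v) (G v), ?_, ?_⟩
  · exact ((bcfBilin B).analyticAt_bilinear (F 0, G 0)).comp₂ hF hG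
  · filter_upwards [hFu, hGw] with v h1 h2 i
    simp [h1 i, h2 i]

lemma clm_apply {u : I → E → (V →L[ℝ] W)} {w : I → E → V} (hu : UA u) (hw : UA w) :
    UA (fun i v => u i v (w i v)) :=
  hu.bilin (ContinuousLinearMap.id ℝ (V →L[ℝ] W)) hw

lemma clm_comp {u : I → E → (W →L[ℝ] Z)} {w : I → E → (V →L[ℝ] W)} (hu : UA u) (hw : UA w) :
    UA (fun i v => (u i v).comp (w i v)) :=
  hu.bilin (ContinuousLinearMap.compL ℝ V W Z) hw

lemma smul {u : I → E → ℝ} {w : I → E → V} (hu : UA u) (hw : UA w) :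
    UA (fun i v => u i v • w i v) :=
  hu.bilin (ContinuousLinearMap.lsmul ℝ ℝ) hw

lemma fderiv [CompleteSpace V] {u : I → E → V} (hu : UA u) : UA (fun i v => fderiv ℝ (u i) v) := by
  obtain ⟨F, hF, hFu⟩ := hu
  refine ⟨fun v => bcfCurry (_root_.fderiv ℝ F v), (bcfCurry.analyticAt _).fun_comp hF.fderiv, ?_⟩
  filter_upwards [hFu.eventually_nhds, hF.eventually_analyticAt] with v h1 h2 i
  have h3 : (fun w => F w i) =ᶠ[𝓝 v] u i := by
    filter_upwards [h1] with w hw using hw i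
  have h4 := ((BoundedContinuousFunction.evalCLM ℝ i).hasFDerivAt.comp v
    h2.differentiableAt.hasFDerivAt).congr_of_eventuallyEq h3.symm
  rw [h4.fderiv]
  rfl

/-- Since every `w i` fixes the origin, the germ of `w` has value `0` in the space of bounded
functions, which is where the diagonal superposition with `u` is analytic. -/
lemma comp [CompleteSpace V] {u : I → E → V} {w : I → D → E} (hu : UA u) (hw : UA w)
    (h0 : ∀ i, w i 0 = 0) : UA (fun i v => u i (w i v)) := by
  obtain ⟨N, hN, hNu⟩ := exists_diagonal_superposition hu
  obtain ⟨G, hG, hGw⟩ := hw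
  have hG0 : G 0 = 0 := by
    ext i; rw [hGw.self_of_nhds i, h0]; rfl
  refine ⟨fun v => N (G v), AnalyticAt.fun_comp (by rwa [hG0]) hG, ?_⟩
  have h := hG.continuousAt.tendsto
  rw [hG0] at h
  filter_upwards [hGw, h.eventually hNu] with v h1 h2 i
  rw [h2 i, h1 i]

lemma eventually_analyticAt [CompleteSpace V] {u : I → E → V} (hu : UA u) :
    ∀ᶠ v in 𝓝 0, ∀ i, AnalyticAt ℝ (u i) v := by
  obtain ⟨F, hF, hFu⟩ := hu
  filter_upwards [hFu.eventually_nhds, hF.eventually_analyticAt] with v h1 h2 i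
  refine (((BoundedContinuousFunction.evalCLM ℝ i).analyticAt _).fun_comp h2).congr ?_
  filter_upwards [h1] with w hw using hw i

lemma bounded {u : I → E → V} (hu : UA u) : ∃ C, ∀ᶠ v in 𝓝 0, ∀ i, ‖u i v‖ ≤ C := by
  obtain ⟨F, hF, hFu⟩ := hu
  refine ⟨‖F 0‖ + 1, ?_⟩
  filter_upwards [hFu, hF.continuousAt.norm.eventually_lt_const (lt_add_one _)] with v h1 h2 i
  rw [← h1 i]
  exact ((F v).norm_coe_le_norm i).trans h2.le

lemma bounded_zero {u : I → E → V} (hu : UA u) : ∃ C, ∀ i, ‖u i 0‖ ≤ C :=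
  hu.bounded.imp fun _ h => h.self_of_nhds

lemma eventually_dist_lt {u : I → E → V} (hu : UA u) {ε : ℝ} (hε : 0 < ε) :
    ∀ᶠ v in 𝓝 0, ∀ i, ‖u i v - u i 0‖ < ε := by
  obtain ⟨F, hF, hFu⟩ := hu
  have h := (hF.continuousAt.sub (continuousAt_const (y := F 0))).norm
  have h' := h.eventually_lt_const (u := ε) (by simpa using hε)
  filter_upwards [hFu, h'] with v h1 h2 i
  rw [← h1 i, ← hFu.self_of_nhds i]
  exact ((F v - F 0).norm_coe_le_norm i).trans_lt h2

lemma eventually_lt {u : I → E → V} (hu : UA u) (h0 : ∀ i, u i 0 = 0) {ε : ℝ} (hε : 0 < ε) :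
    ∀ᶠ v in 𝓝 0, ∀ i, ‖u i v‖ < ε := by
  simpa [h0] using hu.eventually_dist_lt hε

/-- Strict differentiability of the one germ at `0` provides a radius that does not depend on the
index. -/
lemma strict [CompleteSpace V] {u : I → E → V} (hu : UA u) {ε : ℝ} (hε : 0 < ε) :
    ∃ r > 0, ∀ i, ∀ p ∈ Metric.ball (0 : E) r, ∀ q ∈ Metric.ball (0 : E) r,
      ‖u i p - u i q - _root_.fderiv ℝ (u i) 0 (p - q)‖ ≤ ε * ‖p - q‖ := by
  obtain ⟨F, hF, hFu⟩ := hu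
  have h := hF.hasStrictFDerivAt.isLittleO.def hε
  rw [show ((0 : E), (0 : E)) = 0 from rfl] at h
  obtain ⟨r, hr, hrb⟩ := Metric.eventually_nhds_iff_ball.1 h
  obtain ⟨r', hr', hrb'⟩ := Metric.eventually_nhds_iff_ball.1 hFu
  refine ⟨min r r', lt_min hr hr', fun i p hp q hq => ?_⟩
  have hp' := Metric.ball_subset_ball (min_le_right r r') hp
  have hq' := Metric.ball_subset_ball (min_le_right r r') hq
  have hpq := hrb (p, q) (by
    simp only [mem_ball_zero_iff, lt_min_iff] at hp hq
    simp [Prod.norm_def, hp.1, hq.1])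
  have h3 : (fun w => F w i) =ᶠ[𝓝 0] u i := by
    filter_upwards [hFu] with w hw using hw i
  have h4 := ((BoundedContinuousFunction.evalCLM ℝ i).hasFDerivAt.comp (0 : E)
    hF.differentiableAt.hasFDerivAt).congr_of_eventuallyEq h3.symm
  rw [h4.fderiv, ← hrb' p hp' i, ← hrb' q hq' i]
  exact ((F p - F q - _root_.fderiv ℝ F 0 (p - q)).norm_coe_le_norm i).trans hpq

lemma lipschitz [CompleteSpace V] {u : I → E → V} (hu : UA u) :
    ∃ K : NNReal, ∃ r > 0, ∀ i, LipschitzOnWith K (u i) (Metric.ball (0 : E) r) := by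
  obtain ⟨F, hF, hFu⟩ := hu
  obtain ⟨K, t, ht, hK⟩ := (hF.contDiffAt (n := 1)).exists_lipschitzOnWith
  obtain ⟨r, hr, hrb⟩ := Metric.eventually_nhds_iff_ball.1 (hFu.and ht)
  refine ⟨K, r, hr, fun i => LipschitzOnWith.of_dist_le_mul fun p hp q hq => ?_⟩
  rw [← (hrb p hp).1 i, ← (hrb q hq).1 i]
  exact (BoundedContinuousFunction.dist_coe_le_dist i).trans
    (hK.dist_le_mul p (hrb p hp).2 q (hrb q hq).2)

/-- The neighbourhoods on which `w i` and `u i` agree may shrink with `i`. The identity theorem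
enlarges them to one ball on which both families are analytic. -/
lemma of_germ [CompleteSpace V] {u w : I → E → V} (hw : UA w) (h : ∀ i, w i =ᶠ[𝓝 0] u i)
    {r : ℝ} (hr : 0 < r) (hu : ∀ i, AnalyticOnNhd ℝ (u i) (Metric.ball 0 r)) : UA u := by
  refine hw.congr ?_
  obtain ⟨r', hr', hrb⟩ := Metric.eventually_nhds_iff_ball.1 hw.eventually_analyticAt
  refine Metric.eventually_nhds_iff_ball.2 ⟨min r r', lt_min hr hr', fun v hv i => ?_⟩
  refine AnalyticOnNhd.eqOn_of_preconnected_of_eventuallyEq (U := Metric.ball 0 (min r r'))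
    (z₀ := 0) (fun z hz => hrb z (Metric.ball_subset_ball (min_le_right _ _) hz) i)
    (fun z hz => hu i z (Metric.ball_subset_ball (min_le_left _ _) hz))
    (convex_ball _ _).isPreconnected (Metric.mem_ball_self (lt_min hr hr')) (h i) hv

/-- Multiplication by the bounded inverses `A i` at the origin reduces the claim to inversion near
the identity, which is a fixed analytic function: `(u i v)⁻¹ = (A i ∘ u i v)⁻¹ ∘ A i`. -/
lemma inverse [CompleteSpace V] [CompleteSpace W] {u : I → E → (V →L[ℝ] W)} (hu : UA u)
    {A : I → (W →L[ℝ] V)} {C : ℝ} (hC : ∀ i, ‖A i‖ ≤ C)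
    (h1 : ∀ i, (A i).comp (u i 0) = ContinuousLinearMap.id ℝ V)
    (h2 : ∀ i, (u i 0).comp (A i) = ContinuousLinearMap.id ℝ W) :
    UA (fun i v => (u i v).inverse) ∧ ∀ᶠ v in 𝓝 0, ∀ i, (u i v).IsInvertible := by
  have hA : UA (fun i (_ : E) => A i) := UA.const hC
  have hz : UA (fun i v => (A i).comp (u i v) - ContinuousLinearMap.id ℝ V) :=
    (hA.clm_comp hu).sub (UA.of_analyticAt analyticAt_const)
  have hz0 : ∀ i, (A i).comp (u i 0) - ContinuousLinearMap.id ℝ V = 0 := fun i => by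
    rw [h1, sub_self]
  have hAinv : ∀ i, (A i).IsInvertible := fun i =>
    ContinuousLinearMap.IsInvertible.of_inverse (h1 i) (h2 i)
  have hf : AnalyticAt ℝ (fun z : V →L[ℝ] V => Ring.inverse (1 + z)) 0 := by
    refine AnalyticAt.fun_comp (g := Ring.inverse) ?_ (analyticAt_const.fun_add analyticAt_id)
    simpa using analyticAt_inverse (𝕜 := ℝ) (1 : (V →L[ℝ] V)ˣ)
  have hR := (UA.of_analyticAt (I := I) hf).comp hz hz0
  have hunit : ∀ᶠ v in 𝓝 0, ∀ i, (u i v).IsInvertible := by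
    filter_upwards [hz.eventually_lt hz0 one_pos] with v hv i
    have hsm : ‖-((A i).comp (u i v) - ContinuousLinearMap.id ℝ V)‖ < 1 := by
      rw [norm_neg]; exact hv i
    have hU := isUnit_one_sub_of_norm_lt_one hsm
    have hinv : ((A i).comp (u i v)).IsInvertible := by
      have he : (1 : V →L[ℝ] V) - -((A i).comp (u i v) - ContinuousLinearMap.id ℝ V)
          = (A i).comp (u i v) := by
        ext x; simp
      rw [he] at hU
      obtain ⟨e, he⟩ := hU
      exact ⟨ContinuousLinearEquiv.unitsEquiv ℝ V e, by rw [← he]; rfl⟩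
    obtain ⟨e, he⟩ := hAinv i
    rw [← he] at hinv
    exact ContinuousLinearMap.isInvertible_equiv_comp.1 hinv
  refine ⟨(hR.clm_comp hA).congr ?_, hunit⟩
  filter_upwards [hunit] with v hv i
  have he : (1 : V →L[ℝ] V) + ((A i).comp (u i v) - ContinuousLinearMap.id ℝ V)
      = (A i).comp (u i v) := by
    ext x; simp
  rw [he, ContinuousLinearMap.ringInverse_eq_inverse, (hAinv i).inverse_comp_of_left,
    ContinuousLinearMap.comp_assoc, (hAinv i).inverse_comp_self, ContinuousLinearMap.comp_id]

/-- Division by `u i 0` leaves the fixed function `(1 + z)^(-1/2)` at `z = 0`. The lower bound `c`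
keeps the normalizing factors bounded. -/
lemma inv_sqrt {u : I → E → ℝ} (hu : UA u) {c : ℝ} (hc : 0 < c) (h : ∀ i, c ≤ u i 0) :
    UA (fun i v => (Real.sqrt (u i v))⁻¹) ∧ ∀ᶠ v in 𝓝 0, ∀ i, 0 < u i v := by
  have hpos : ∀ i, 0 < u i 0 := fun i => hc.trans_le (h i)
  have hb : ∀ i, ‖(u i 0)⁻¹‖ ≤ c⁻¹ := fun i => by
    rw [Real.norm_of_nonneg (inv_nonneg.2 (hpos i).le)]
    exact inv_anti₀ hc (h i)
  have hb2 : ∀ i, ‖(Real.sqrt (u i 0))⁻¹‖ ≤ (Real.sqrt c)⁻¹ := fun i => by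
    rw [Real.norm_of_nonneg (inv_nonneg.2 (Real.sqrt_nonneg _))]
    exact inv_anti₀ (Real.sqrt_pos.2 hc) (Real.sqrt_le_sqrt (h i))
  have hz : UA (fun i v => (u i 0)⁻¹ • u i v - 1) :=
    ((UA.const hb).smul hu).sub (UA.of_analyticAt analyticAt_const)
  have hz0 : ∀ i, (u i 0)⁻¹ • u i 0 - 1 = 0 := fun i => by
    rw [smul_eq_mul, inv_mul_cancel₀ (hpos i).ne', sub_self]
  have hf : AnalyticAt ℝ (fun z : ℝ => (Real.sqrt (1 + z))⁻¹) 0 := by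
    have h1 : AnalyticAt ℝ Real.sqrt (1 + 0) :=
      (Real.contDiffAt_sqrt (n := ω) (by norm_num)).analyticAt
    refine AnalyticAt.fun_inv (AnalyticAt.fun_comp (g := Real.sqrt) h1
      (analyticAt_const.fun_add analyticAt_id)) (by norm_num)
  have hev : ∀ᶠ v in 𝓝 0, ∀ i, 0 < u i v := by
    filter_upwards [hu.eventually_dist_lt hc] with v hv i
    have := (abs_lt.1 (by simpa using hv i)).1
    linarith [h i]
  refine ⟨((UA.const hb2).smul ((UA.of_analyticAt (I := I) hf).comp hz hz0)).congr ?_, hev⟩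
  filter_upwards [hev] with v hv i
  have he : 1 + ((u i 0)⁻¹ • u i v - 1) = (u i 0)⁻¹ * u i v := by simp
  rw [he, Real.sqrt_mul (inv_nonneg.2 (hpos i).le), Real.sqrt_inv, mul_inv, inv_inv, smul_eq_mul,
    ← mul_assoc, inv_mul_cancel₀ (Real.sqrt_pos.2 (hpos i)).ne', one_mul]

/-- The flows of a uniformly analytic family of vector fields. -/
theorem flow [CompleteSpace E] {X : I → E → E} (hX : UA X) :
    ∃ Φ : I → ℝ × E → E, UA Φ ∧ (∀ i, Φ i 0 = 0) ∧ ∃ ρ > 0,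
      (∀ i t x, |t| < ρ → ‖x‖ < ρ → Φ i (0, x) = x ∧
        HasDerivAt (fun s => Φ i (s, x)) (X i (Φ i (t, x))) t) ∧
      ∀ i (t₀ : ℝ) (c : ℝ → E), 0 ≤ t₀ → t₀ < ρ →
        (∀ t ∈ Set.Icc 0 t₀, HasDerivAt c (X i (c t)) t ∧ ‖c t‖ < ρ) →
        c t₀ = Φ i (t₀, c 0) := by
  -- All the differential equations together are one equation in the Banach space of bounded
  -- functions. Its flow, started at constant functions, has the individual flows as its components.
  obtain ⟨N, hN, hNX⟩ := exists_diagonal_superposition hX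
  obtain ⟨Φ, hΦ, hΦ0, hflow⟩ := exists_analytic_flow hN
  let J : ℝ × E → ℝ × (I →ᵇ E) := fun p => (p.1, constCLM I E p.2)
  have hJ : AnalyticAt ℝ J 0 :=
    analyticAt_fst.prod (((constCLM I E).analyticAt _).fun_comp analyticAt_snd)
  have hJ0 : J 0 = 0 := by
    refine Prod.ext rfl ?_
    change constCLM I E 0 = 0
    simp
  have hΦJ : AnalyticAt ℝ (fun p => Φ (J p)) 0 :=
    AnalyticAt.fun_comp (by rwa [hJ0]) hJ
  have hΦJ0 : Φ (J 0) = 0 := by rw [hJ0, hΦ0]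
  have hUA : UA (fun i p => Φ (J p) i) := ⟨fun p => Φ (J p), hΦJ, Eventually.of_forall fun _ _ => rfl⟩
  refine ⟨fun i p => Φ (J p) i, hUA, fun i => by simp only [hΦJ0]; rfl, ?_⟩
  obtain ⟨K, r, hr, hK⟩ := hX.lipschitz
  have hsmall : ∀ᶠ p in 𝓝 (0 : ℝ × E), ∀ i, ‖Φ (J p) i‖ < r :=
    hUA.eventually_lt (fun i => by rw [hΦJ0]; rfl) hr
  have hder : ∀ᶠ p in 𝓝 (0 : ℝ × E), ∀ i, Φ (J (0, p.2)) i = p.2 ∧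
      HasDerivAt (fun s => Φ (J (s, p.2)) i) (X i (Φ (J p) i)) p.1 := by
    have h1 := hJ.continuousAt.tendsto
    have h2 := hΦJ.continuousAt.tendsto
    rw [hJ0] at h1
    rw [hΦJ0] at h2
    filter_upwards [h1.eventually hflow, h2.eventually hNX] with p h3 h4 i
    refine ⟨?_, ?_⟩
    · change Φ (0, constCLM I E p.2) i = p.2
      rw [h3.1]; rfl
    · have := (BoundedContinuousFunction.evalCLM ℝ i).hasFDerivAt.comp_hasDerivAt p.1 h3.2
      rw [← h4 i]
      exact this
  obtain ⟨ρ, hρ, hρb⟩ := Metric.eventually_nhds_iff_ball.1 (hsmall.and hder)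
  have hmem : ∀ t x, |t| < ρ → ‖x‖ < ρ → ((t, x) : ℝ × E) ∈ Metric.ball (0 : ℝ × E) ρ := by
    intro t x ht hx
    simp [Prod.norm_def, ht, hx]
  refine ⟨min ρ r, lt_min hρ hr, ?_, ?_⟩
  · intro i t x ht hx
    have := (hρb (t, x) (hmem t x (ht.trans_le (min_le_left _ _)) (hx.trans_le (min_le_left _ _)))).2 i
    exact this
  · intro i t₀ c h0 ht₀ hc
    have ht₀' := ht₀.trans_le (min_le_left _ _)
    have hc0 := (hc 0 ⟨le_rfl, h0⟩).2.trans_le (min_le_left _ _)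
    have hΦt : ∀ t ∈ Set.Icc 0 t₀, _ := fun t ht => hρb (t, c 0) (hmem t (c 0)
      (by rw [abs_of_nonneg ht.1]; exact ht.2.trans_lt ht₀') hc0)
    -- Both curves stay in the ball of radius `r`, where the fields have a common Lipschitz
    -- constant.
    refine ODE_solution_unique_of_mem_Icc_right (v := fun _ => X i)
      (s := fun _ => Metric.ball 0 r) (K := K) (a := 0) (b := t₀) (fun _ _ => hK i)
      (fun t ht => (hc t ht).1.continuousAt.continuousWithinAt)
      (fun t ht => (hc t (Set.Ico_subset_Icc_self ht)).1.hasDerivWithinAt)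
      (fun t ht => ?_)
      (g := fun t => Φ (J (t, c 0)) i)
      (fun t ht => ((hΦt t ht).2 i).2.continuousAt.continuousWithinAt)
      (fun t ht => ((hΦt t (Set.Ico_subset_Icc_self ht)).2 i).2.hasDerivWithinAt)
      (fun t ht => ?_) ?_ ⟨h0, le_rfl⟩
    · simpa using (hc t (Set.Ico_subset_Icc_self ht)).2.trans_le (min_le_right _ _)
    · simpa using (hΦt t (Set.Ico_subset_Icc_self ht)).1 i
    · exact ((hΦt 0 ⟨le_rfl, h0⟩).2 i).1.symm

end UA

end UniformlyAnalytic
end BAG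

end

noncomputable section
namespace BAG

open BoundedContinuousFunction Filter

/-! ### Uniform analyticity and common bounds on Taylor coefficients -/

section MultiIndex

variable {n : ℕ} {V : Type*} [NormedAddCommGroup V] [NormedSpace ℝ V]

/-- The multi-index of a word in the coordinates. -/
def wordIndex (z : Σ k, Fin k → Fin n) : Fin n → ℕ := fun i => (List.ofFn z.2).count i

lemma prod_word (v : Fin n → ℝ) (z : Σ k, Fin k → Fin n) :
    ∏ j, v (z.2 j) = ∏ i, v i ^ wordIndex z i := by
  have h1 : ∏ j, v (z.2 j) = ((List.ofFn z.2).map v).prod := by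
    rw [List.map_ofFn, List.prod_ofFn]; rfl
  rw [h1, Finset.prod_list_map_count]
  refine Finset.prod_subset (Finset.subset_univ _) fun i _ hi => ?_
  rw [List.mem_toFinset] at hi
  rw [List.count_eq_zero_of_not_mem hi, pow_zero]

lemma sum_wordIndex (z : Σ k, Fin k → Fin n) : ∑ i, wordIndex z i = z.1 := by
  have h := Multiset.sum_count_eq_card (s := Finset.univ) (m := (↑(List.ofFn z.2) : Multiset (Fin n)))
    (fun _ _ => Finset.mem_univ _)
  simpa [wordIndex] using h

lemma exists_wordIndex_eq (α : Fin n → ℕ) : ∃ z : Σ k, Fin k → Fin n, wordIndex z = α := by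
  set m : Multiset (Fin n) := ∑ i, Multiset.replicate (α i) i with hm
  set l := m.toList with hldef
  have hl : (l : Multiset (Fin n)) = m := Multiset.coe_toList m
  refine ⟨⟨l.length, l.get⟩, ?_⟩
  funext i
  have h : l.count i = Multiset.count i m := by
    rw [← hl]; exact (Multiset.coe_count i l).symm
  have h2 : wordIndex (⟨l.length, l.get⟩ : Σ k, Fin k → Fin n) i = l.count i := by
    simp only [wordIndex, List.ofFn_get]
  rw [h2, h, hm, Multiset.count_sum']
  simp [Multiset.count_replicate]

/-- A word with the given multi-index. -/
def indexWord (α : Fin n → ℕ) : Σ k, Fin k → Fin n := (exists_wordIndex_eq α).choose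

@[simp]
lemma wordIndex_indexWord (α : Fin n → ℕ) : wordIndex (indexWord α) = α :=
  (exists_wordIndex_eq α).choose_spec

/-- The multilinear map `(v₁, …, v_k) ↦ ∏ j, (v_j)_{s j} • a`. -/
def wordMonomial {k : ℕ} (s : Fin k → Fin n) (a : V) :
    ContinuousMultilinearMap ℝ (fun _ : Fin k => Eu n) V :=
  ((ContinuousMultilinearMap.mkPiAlgebra ℝ (Fin k) ℝ).compContinuousLinearMap
    (fun j => EuclideanSpace.proj (s j))).smulRight a

lemma wordMonomial_apply {k : ℕ} (s : Fin k → Fin n) (a : V) (v : Fin k → Eu n) :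
    wordMonomial s a v = (∏ j, v j (s j)) • a := by
  simp [wordMonomial]

lemma norm_wordMonomial_le {k : ℕ} (s : Fin k → Fin n) (a : V) : ‖wordMonomial s a‖ ≤ ‖a‖ := by
  refine ContinuousMultilinearMap.opNorm_le_bound (norm_nonneg _) fun v => ?_
  rw [wordMonomial_apply, norm_smul, mul_comm, norm_prod]
  gcongr with j
  exact PiLp.norm_apply_le _ _

/-- There are `n ^ k` words of length `k`. Sums over words mediate between homogeneous multilinear
terms, graded by length, and monomials, graded by multi-index. -/
lemma summable_words {f : ℕ → ℝ} (hf0 : ∀ k, 0 ≤ f k) (hf : Summable fun k => (n : ℝ) ^ k * f k) :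
    Summable fun z : Σ k, Fin k → Fin n => f z.1 := by
  refine (summable_sigma_of_nonneg fun z => hf0 z.1).2 ⟨fun k => Summable.of_finite, ?_⟩
  refine hf.congr fun k => ?_
  rw [tsum_fintype]
  simp

/-- An analytic function is the sum of a power series in the coordinates. -/
lemma exists_multiIndex_of_analyticAt [CompleteSpace V] {F : Eu n → V} (hF : AnalyticAt ℝ F 0) :
    ∃ r > 0, ∃ C, AnalyticBound r C F := by
  obtain ⟨p, R, hp⟩ := hF
  obtain ⟨ρ', hρ'0, hρ'R⟩ := ENNReal.lt_iff_exists_nnreal_btwn.1 hp.r_pos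
  have hρ'pos : 0 < (ρ' : ℝ) := by exact_mod_cast hρ'0
  -- The `n ^ k` words of length `k` cost a factor `n` in the radius; `n + 1` also covers `n = 0`.
  set ρ : ℝ := ρ' / (n + 1) with hρ
  have hn : (0 : ℝ) < n + 1 := by positivity
  have hρpos : 0 < ρ := by positivity
  have hnρ : (n : ℝ) * ρ ≤ ρ' := by
    rw [hρ, ← mul_div_assoc, div_le_iff₀ hn]; nlinarith
  let e : Fin n → Eu n := fun i => EuclideanSpace.single i 1
  have he : ∀ i, ‖e i‖ = 1 := fun i => by simp [e]
  let m : (Σ k, Fin k → Fin n) → V := fun z => p z.1 (fun j => e (z.2 j))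
  have hm : ∀ z, ‖m z‖ ≤ ‖p z.1‖ := fun z => by
    refine ((p z.1).le_opNorm _).trans ?_
    simp [he]
  have hsumk : Summable fun k => (n : ℝ) ^ k * (ρ ^ k * ‖p k‖) := by
    have h := p.summable_norm_mul_pow (hρ'R.trans_le hp.r_le)
    refine Summable.of_nonneg_of_le (fun k => by positivity) (fun k => ?_) h
    rw [← mul_assoc, ← mul_pow, mul_comm]
    gcongr
  have hS : Summable fun z : Σ k, Fin k → Fin n => ρ ^ z.1 * ‖p z.1‖ :=
    summable_words (f := fun k => ρ ^ k * ‖p k‖) (fun k => by positivity) hsumk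
  have hS' : Summable fun z : Σ k, Fin k → Fin n => ρ ^ z.1 * ‖m z‖ :=
    Summable.of_nonneg_of_le (fun z => by positivity)
      (fun z => by gcongr; exact hm z) hS
  have hmsum : ∀ α, Summable fun z : wordIndex ⁻¹' {α} => ‖m z.1‖ := by
    intro α
    have h1 := hS'.subtype (wordIndex ⁻¹' {α})
    have h2 := h1.mul_left ((ρ ^ (∑ i, α i))⁻¹)
    refine h2.congr fun z => ?_
    have hz : wordIndex z.1 = α := z.2
    have : ∑ i, α i = z.1.1 := (congrArg (fun β => ∑ i, β i) hz).symm.trans (sum_wordIndex _)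
    rw [this]
    simp only [Function.comp_apply]
    rw [← mul_assoc, inv_mul_cancel₀ (by positivity), one_mul]
  -- The coefficient of a multi-index collects all words that spell it, and the sum over all words
  -- bounds every coefficient at once.
  refine ⟨ρ, hρpos, ∑' z, ρ ^ z.1 * ‖m z‖, fun α => ∑' z : wordIndex ⁻¹' {α}, m z.1, ?_, ?_⟩
  · intro α
    calc ρ ^ (∑ i, α i) * ‖∑' z : wordIndex ⁻¹' {α}, m z.1‖
        ≤ ρ ^ (∑ i, α i) * ∑' z : wordIndex ⁻¹' {α}, ‖m z.1‖ := by
          gcongr; exact norm_tsum_le_tsum_norm (hmsum α)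
      _ = ∑' z : wordIndex ⁻¹' {α}, ρ ^ z.1.1 * ‖m z.1‖ := by
          rw [← tsum_mul_left]
          refine tsum_congr fun z => ?_
          have hz : wordIndex z.1 = α := z.2
          have : ∑ i, α i = z.1.1 :=
            (congrArg (fun β => ∑ i, β i) hz).symm.trans (sum_wordIndex _)
          rw [this]
      _ ≤ ∑' z, ρ ^ z.1 * ‖m z‖ :=
          hS'.tsum_subtype_le _ _ (fun z => by positivity)
  · intro v hv
    have hvρ : ∀ i, |v i| ≤ ρ := fun i => (hv i).le
    have hvnorm : ‖v‖ ≤ n * ρ := by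
      calc ‖v‖ = ‖∑ i, v i • e i‖ := by
            congr 1
            ext i
            simp [e, Finset.sum_apply, Pi.single_apply]
        _ ≤ ∑ i, ‖v i • e i‖ := norm_sum_le _ _
        _ ≤ ∑ _i : Fin n, ρ := by
            gcongr with i
            rw [norm_smul, he, mul_one]; exact hvρ i
        _ = n * ρ := by simp
    have hvdec : v = ∑ i, v i • e i := by
      ext i
      simp [e, Finset.sum_apply, Pi.single_apply]
    have hball : v ∈ Metric.eball (0 : Eu n) R := by
      rw [Metric.mem_eball, edist_zero_right]
      refine lt_of_le_of_lt ?_ hρ'R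
      rw [enorm_eq_nnnorm, ENNReal.coe_le_coe]
      exact_mod_cast hvnorm.trans hnρ
    have hsum := hp.hasSum hball
    rw [zero_add] at hsum
    let f : (Σ k, Fin k → Fin n) → V := fun z => (∏ j, v (z.2 j)) • m z
    have hf : Summable f := by
      refine Summable.of_norm_bounded hS' fun z => ?_
      rw [norm_smul, norm_prod]
      gcongr
      calc ∏ j, ‖v (z.2 j)‖ ≤ ∏ _j : Fin z.1, ρ :=
            Finset.prod_le_prod (fun _ _ => norm_nonneg _) (fun j _ => hvρ _)
        _ = ρ ^ z.1 := by simp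
    have hfk : ∀ k, HasSum (fun s : Fin k → Fin n => f ⟨k, s⟩) (p k fun _ => v) := by
      intro k
      have : (p k fun _ => v) = ∑ s : Fin k → Fin n, f ⟨k, s⟩ := by
        conv_lhs => rw [hvdec]
        rw [ContinuousMultilinearMap.map_sum]
        refine Finset.sum_congr rfl fun s _ => ?_
        rw [ContinuousMultilinearMap.map_smul_univ]
      rw [this]
      exact hasSum_fintype _
    have hF : HasSum f (F v) := HasSum.sigma_of_hasSum hsum hfk hf
    have := hF.tsum_fiberwise wordIndex
    refine this.congr_fun ?_
    intro α
    have hmα : Summable fun z : wordIndex ⁻¹' {α} => m z.1 := (hmsum α).of_norm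
    rw [← hmα.tsum_const_smul]
    refine tsum_congr fun z => ?_
    have hz : wordIndex z.1 = α := z.2
    change _ = (∏ j, v (z.1.2 j)) • m z.1
    rw [prod_word (fun i => v i), hz]

variable {I : Type*} [TopologicalSpace I] [DiscreteTopology I]

/-- The Taylor coefficients of the germ are bounded functions of the index, so evaluating them at
`i` gives those of `u i`, with the same bound. -/
lemma UA.exists_analyticBound [CompleteSpace V] {u : I → Eu n → V} (hu : UA u) :
    ∃ r > 0, ∃ C, ∀ i, AnalyticBound r C (u i) := by
  obtain ⟨F, hF, hFu⟩ := hu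
  obtain ⟨r, hr, C, a, ha, hsum⟩ := exists_multiIndex_of_analyticAt hF
  obtain ⟨s, hs, hsb⟩ := Metric.eventually_nhds_iff_ball.1 hFu
  -- A cube of half-width `s / (n + 1)` lies in the Euclidean ball of radius `s`, on which the germ
  -- represents the family.
  set ρ := min r (s / (n + 1)) with hρ
  have hn : (0 : ℝ) < n + 1 := by positivity
  have hρ0 : 0 < ρ := lt_min hr (by positivity)
  refine ⟨ρ, hρ0, C, fun i => ⟨fun α => a α i, fun α => ?_, fun v hv => ?_⟩⟩
  · refine le_trans ?_ (ha α)
    gcongr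
    · exact min_le_left _ _
    · exact (a α).norm_coe_le_norm i
  · have hv1 : v ∈ cube n r := fun j => (hv j).trans_le (min_le_left _ _)
    have hv2 : v ∈ Metric.ball (0 : Eu n) s := by
      rw [mem_ball_zero_iff]
      have h1 : ‖v‖ ≤ ∑ j, ‖v j‖ := by
        have : v = ∑ j, v j • (EuclideanSpace.single j (1 : ℝ) : Eu n) := by
          ext j; simp [Finset.sum_apply, Pi.single_apply]
        conv_lhs => rw [this]
        refine (norm_sum_le _ _).trans (le_of_eq ?_)
        simp [norm_smul]
      have h2 : ∑ j, ‖v j‖ ≤ n * (s / (n + 1)) := by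
        calc ∑ j, ‖v j‖ ≤ ∑ _j : Fin n, (s / (n + 1)) := by
              gcongr with j; exact (hv j).le.trans (min_le_right _ _)
          _ = _ := by simp
      have h3 : (n : ℝ) * (s / (n + 1)) < s := by
        rw [← mul_div_assoc, div_lt_iff₀ hn]; nlinarith
      linarith
    have h := (BoundedContinuousFunction.evalCLM ℝ i).hasSum (hsum v hv1)
    rw [← hsb v hv2 i]
    exact h

/-- The common bound makes each coefficient a bounded function of the index. To obtain multilinear
terms, each coefficient is attached to one chosen word with its multi-index and every other word
gets zero; symmetry of the terms is not needed. -/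
lemma UA.of_analyticBound [CompleteSpace V] {u : I → Eu n → V} {r C : ℝ} (hr : 0 < r)
    (hu : ∀ i, AnalyticBound r C (u i)) : UA u := by
  choose a ha hsum using hu
  rcases isEmpty_or_nonempty I with hI | ⟨⟨i₀⟩⟩
  · exact ⟨fun _ => 0, analyticAt_const, Eventually.of_forall fun _ i => hI.elim i⟩
  have hC : 0 ≤ C := le_trans (by positivity) (ha i₀ 0)
  have hab : ∀ α i, ‖a i α‖ ≤ C / r ^ (∑ j, α j) := fun α i => by
    rw [le_div_iff₀ (by positivity), mul_comm]; exact ha i α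
  let A : (Fin n → ℕ) → (I →ᵇ V) := fun α => bddFun (fun i => a i α) _ (hab α)
  have hA : ∀ α, ‖A α‖ ≤ C / r ^ (∑ j, α j) := fun α => norm_bddFun_le _ _ (by positivity) _
  classical
  let w : (Σ k, Fin k → Fin n) → (I →ᵇ V) := fun z =>
    if z = indexWord (wordIndex z) then A (wordIndex z) else 0
  have hw : ∀ z, ‖w z‖ ≤ C / r ^ z.1 := fun z => by
    simp only [w]
    split_ifs
    · rw [← sum_wordIndex z]; exact hA _
    · rw [norm_zero]; positivity
  let p : FormalMultilinearSeries ℝ (Eu n) (I →ᵇ V) := fun k =>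
    ∑ s : Fin k → Fin n, wordMonomial s (w ⟨k, s⟩)
  have hp : ∀ k, ‖p k‖ ≤ n ^ k * (C / r ^ k) := fun k => by
    refine (norm_sum_le _ _).trans ?_
    calc ∑ s : Fin k → Fin n, ‖wordMonomial s (w ⟨k, s⟩)‖ ≤ ∑ _s : Fin k → Fin n, C / r ^ k := by
          gcongr with s; exact (norm_wordMonomial_le _ _).trans (hw ⟨k, s⟩)
      _ = _ := by simp
  -- Chosen so that `n ρ / r ≤ 1 / 2`, which lets a geometric series dominate the sum over all
  -- words.
  set ρ : NNReal := ⟨r / (2 * (n + 1)), by positivity⟩ with hρ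
  have hρv : (ρ : ℝ) = r / (2 * (n + 1)) := rfl
  have hρpos : 0 < (ρ : ℝ) := by rw [hρv]; positivity
  have hgeo : ∀ k : ℕ, (n : ℝ) ^ k * (C / r ^ k * (ρ : ℝ) ^ k) ≤ C * (1 / 2) ^ k := fun k => by
    have h1 : (n : ℝ) ^ k * (C / r ^ k * (ρ : ℝ) ^ k) = C * (n * ρ / r) ^ k := by
      rw [div_pow, mul_pow]; field_simp
    rw [h1]
    refine mul_le_mul_of_nonneg_left (pow_le_pow_left₀ (by positivity) ?_ k) hC
    rw [hρv, div_le_div_iff₀ hr two_pos]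
    field_simp
    linarith
  have hrad : (ρ : ENNReal) ≤ p.radius := by
    refine p.le_radius_of_bound C fun k => ?_
    calc ‖p k‖ * (ρ : ℝ) ^ k ≤ n ^ k * (C / r ^ k) * (ρ : ℝ) ^ k := by gcongr; exact hp k
      _ = n ^ k * (C / r ^ k * (ρ : ℝ) ^ k) := by ring
      _ ≤ C * (1 / 2) ^ k := hgeo k
      _ ≤ C := by
        refine mul_le_of_le_one_right hC (pow_le_one₀ (by norm_num) (by norm_num))
  have hpos : 0 < p.radius := lt_of_lt_of_le (by exact_mod_cast hρpos) hrad
  refine ⟨p.sum, (p.hasFPowerSeriesOnBall hpos).analyticAt, ?_⟩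
  refine Metric.eventually_nhds_iff_ball.2 ⟨ρ, hρpos, fun v hv i => ?_⟩
  have hvρ : ∀ j, ‖v j‖ ≤ ρ := fun j =>
    (PiLp.norm_apply_le v j).trans (mem_ball_zero_iff.1 hv).le
  have hρr : (ρ : ℝ) < r := by
    rw [hρv, div_lt_iff₀ (by positivity)]
    have : (0 : ℝ) ≤ n := Nat.cast_nonneg n
    nlinarith
  have hvr : v ∈ cube n r := fun j => (hvρ j).trans_lt hρr
  have hvb : v ∈ Metric.eball (0 : Eu n) p.radius := by
    rw [Metric.mem_eball, edist_zero_right]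
    refine lt_of_lt_of_le ?_ hrad
    rw [enorm_eq_nnnorm, ENNReal.coe_lt_coe]
    exact_mod_cast mem_ball_zero_iff.1 hv
  have h1 := (BoundedContinuousFunction.evalCLM ℝ i).hasSum (p.hasSum hvb)
  let f : (Σ k, Fin k → Fin n) → V := fun z => (∏ j, v (z.2 j)) • w z i
  have hf : Summable f := by
    have hS : Summable fun z : Σ k, Fin k → Fin n => C / r ^ z.1 * (ρ : ℝ) ^ z.1 := by
      refine summable_words (f := fun k => C / r ^ k * (ρ : ℝ) ^ k) (fun k => by positivity) ?_
      exact Summable.of_nonneg_of_le (fun k => by positivity) hgeo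
        (summable_geometric_two.mul_left C)
    refine Summable.of_norm_bounded hS fun z => ?_
    rw [norm_smul, norm_prod, mul_comm]
    gcongr
    · exact ((w z).norm_coe_le_norm i).trans (hw z)
    · calc ∏ j, ‖v (z.2 j)‖ ≤ ∏ _j : Fin z.1, (ρ : ℝ) :=
            Finset.prod_le_prod (fun _ _ => norm_nonneg _) (fun j _ => hvρ _)
        _ = (ρ : ℝ) ^ z.1 := by simp
  have hfk : ∀ k, HasSum (fun s : Fin k → Fin n => f ⟨k, s⟩)
      (BoundedContinuousFunction.evalCLM ℝ i (p k fun _ => v)) := by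
    intro k
    have : BoundedContinuousFunction.evalCLM ℝ i (p k fun _ => v)
        = ∑ s : Fin k → Fin n, f ⟨k, s⟩ := by
      simp only [p, _root_.sum_apply, map_sum, wordMonomial_apply]
      rfl
    rw [this]
    exact hasSum_fintype _
  have h2 : HasSum f (p.sum v i) := HasSum.sigma_of_hasSum h1 hfk hf
  have h3 := h2.tsum_fiberwise wordIndex
  refine h3.unique ?_
  convert hsum i v hvr using 2 with α
  have hmem : indexWord α ∈ wordIndex ⁻¹' {α} := wordIndex_indexWord α
  rw [tsum_eq_single (⟨indexWord α, hmem⟩ : wordIndex ⁻¹' {α})]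
  · simp only [f, w, wordIndex_indexWord, if_true]
    rw [prod_word (fun i => v i), wordIndex_indexWord]
    rfl
  · intro z hz
    have hz' : wordIndex z.1 = α := z.2
    have hne : z.1 ≠ indexWord (wordIndex z.1) := fun h => hz (Subtype.ext (by rw [h, hz']))
    simp only [f, w, if_neg hne]
    simp

end MultiIndex
end BAG

end

noncomputable section
namespace BAG

open BoundedContinuousFunction Filter

/-! ### Expansion in powers of time -/

section TimeExpansion

variable {d : ℕ} {V : Type*} [NormedAddCommGroup V] [NormedSpace ℝ V]

/-- This serves as uniqueness of the coefficients of a power series in one variable. -/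
lemma iteratedDeriv_of_hasSum [CompleteSpace V] {f : ℝ → V} {b : ℕ → V}
    (h : ∀ᶠ t in 𝓝 (0 : ℝ), HasSum (fun k => t ^ k • b k) (f t)) (k : ℕ) :
    iteratedDeriv k f 0 = (k.factorial : ℝ) • b k := by
  let p : FormalMultilinearSeries ℝ ℝ V := fun k => ContinuousMultilinearMap.mkPiRing ℝ (Fin k) (b k)
  have hp : HasFPowerSeriesAt f p 0 := by
    rw [hasFPowerSeriesAt_iff]
    filter_upwards [h] with t ht
    have : ∀ k, p.coeff k = b k := fun k => by
      simp [p, FormalMultilinearSeries.coeff]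
    simpa [this] using ht
  obtain ⟨r, hr⟩ := hp
  have := hr.factorial_smul 1 k
  rw [iteratedDeriv_eq_iteratedFDeriv, ← this]
  simp [p, Nat.cast_smul_eq_nsmul]

/-- The first coordinate and the remaining ones. -/
def headTail (d : ℕ) : Eu (d + 1) →L[ℝ] ℝ × Eu d :=
  LinearMap.toContinuousLinearMap
    { toFun := fun w => (w 0, WithLp.toLp 2 fun i => w i.succ)
      map_add' := fun _ _ => rfl
      map_smul' := fun _ _ => rfl }

lemma headTail_apply (w : Eu (d + 1)) :
    headTail d w = (w 0, WithLp.toLp 2 fun i => w i.succ) := rfl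

variable {I : Type*} [TopologicalSpace I] [DiscreteTopology I]

/-- Expansion in powers of the first variable of a uniformly analytic family. -/
lemma UA.time_expansion [CompleteSpace V] {u : I → ℝ × Eu d → V} (hu : UA u) :
    ∃ r > 0, ∃ C, ∃ b : I → ℕ → Eu d → V,
      (∀ i k, AnalyticBound r (C / r ^ k) (b i k)) ∧
      (∀ i t, |t| < r → ∀ v ∈ cube d r, HasSum (fun k => t ^ k • b i k v) (u i (t, v))) ∧
      ∀ t, |t| < r → ∀ η > 0, ∀ᶠ m in atTop, ∀ i,
        AnalyticBound r η (fun v => u i (t, v) - ∑ k ∈ Finset.range m, t ^ k • b i k v) := by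
  have hL : UA (fun (_ : I) => headTail d) := UA.of_analyticAt ((headTail d).analyticAt _)
  obtain ⟨r, hr, C, hb⟩ := (hu.comp hL (fun _ => map_zero _)).exists_analyticBound
  choose a ha hsum using hb
  -- Time is the first of `d + 1` coordinates, so the multi-indices with first entry `k` make up the
  -- coefficient of `t ^ k`.
  let c : I → ℕ → (Fin d → ℕ) → V := fun i k α => a i (Fin.cons k α)
  have hc : ∀ i k α, r ^ k * (r ^ (∑ j, α j) * ‖c i k α‖) ≤ C := by
    intro i k α
    have := ha i (Fin.cons k α)
    rwa [Fin.sum_cons, pow_add, mul_assoc] at this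
  have hc' : ∀ i k α, r ^ (∑ j, α j) * ‖c i k α‖ ≤ C / r ^ k := fun i k α => by
    rw [le_div_iff₀ (by positivity), mul_comm]; exact hc i k α
  have htot : ∀ i t, |t| < r → ∀ v ∈ cube d r, HasSum
      (fun q : ℕ × (Fin d → ℕ) => t ^ q.1 • (∏ j, v j ^ q.2 j) • c i q.1 q.2) (u i (t, v)) := by
    intro i t ht v hv
    let w : Eu (d + 1) := WithLp.toLp 2 (Fin.cons t v)
    have hw : w ∈ cube (d + 1) r := by
      intro j
      refine Fin.cases ?_ (fun j => ?_) j
      · simpa [w] using ht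
      · simpa [w] using hv j
    have h1 := hsum i w hw
    have h2 : headTail d w = (t, v) := by
      rw [headTail_apply]
      refine Prod.ext (by simp [w]) ?_
      ext j; simp [w]
    simp only [h2] at h1
    rw [← (Fin.consEquiv (fun _ => ℕ)).hasSum_iff] at h1
    refine h1.congr_fun fun q => ?_
    simp only [Function.comp_apply, Fin.consEquiv_apply, Fin.prod_univ_succ, w, Fin.cons_zero,
      Fin.cons_succ, mul_smul]
    rfl
  have hα : ∀ i k, ∀ v ∈ cube d r, HasSum (fun α : Fin d → ℕ => (∏ j, v j ^ α j) • c i k α)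
      (∑' α : Fin d → ℕ, (∏ j, v j ^ α j) • c i k α) := by
    intro i k v hv
    refine Summable.hasSum ?_
    -- Any nonzero time below `r` would do: the slice of the joint sum at a fixed power of time is
    -- summable, and that power is divided out.
    have h := (htot i (r / 2) (by rw [abs_of_pos (by positivity)]; linarith) v hv).summable
    have h' := (h.prod_factor k).const_smul (((r / 2) ^ k)⁻¹)
    refine h'.congr fun α => ?_
    simp only
    rw [smul_smul, inv_mul_cancel₀ (by positivity), one_smul]
  refine ⟨r, hr, C, fun i k v => ∑' α : Fin d → ℕ, (∏ j, v j ^ α j) • c i k α, ?_, ?_, ?_⟩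
  · intro i k
    exact ⟨c i k, fun α => hc' i k α, hα i k⟩
  · intro i t ht v hv
    refine (htot i t ht v hv).prod_fiberwise fun k => ?_
    exact (hα i k v hv).const_smul (t ^ k)
  · intro t ht η hη
    rcases isEmpty_or_nonempty I with hI | ⟨⟨i₀⟩⟩
    · exact Eventually.of_forall fun _ i => hI.elim i
    -- The tail of the series in `t` is geometric with ratio `q` in every coefficient. The bound `C
    -- q ^ m / (1 - q)` depends on neither the index nor the multi-index.
    set q := |t| / r with hq
    have hq1 : q < 1 := (div_lt_one hr).2 ht
    have hq0 : 0 ≤ q := by positivity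
    have hC : 0 ≤ C := le_trans (by positivity) (ha i₀ 0)
    have hlim : Tendsto (fun m : ℕ => C * q ^ m / (1 - q)) atTop (𝓝 0) := by
      have := ((tendsto_pow_atTop_nhds_zero_of_lt_one hq0 hq1).const_mul C).div_const (1 - q)
      simpa using this
    filter_upwards [hlim.eventually_lt_const hη] with m hm i
    have hterm : ∀ α k, ‖t ^ k • c i k α‖ ≤ (C / r ^ (∑ j, α j)) * q ^ k := fun α k => by
      rw [norm_smul, norm_pow, Real.norm_eq_abs, hq, div_pow, div_mul_div_comm,
        le_div_iff₀ (by positivity)]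
      calc |t| ^ k * ‖c i k α‖ * (r ^ (∑ j, α j) * r ^ k)
          = |t| ^ k * (r ^ k * (r ^ (∑ j, α j) * ‖c i k α‖)) := by ring
        _ ≤ |t| ^ k * C := by gcongr; exact hc i k α
        _ = C * |t| ^ k := by ring
    have hsm : ∀ α, HasSum (fun k => t ^ k • c i k α) (∑' k, t ^ k • c i k α) := fun α =>
      (Summable.of_norm_bounded ((summable_geometric_of_lt_one hq0 hq1).mul_left _)
        (hterm α)).hasSum
    refine ⟨fun α => (∑' k, t ^ k • c i k α) - ∑ k ∈ Finset.range m, t ^ k • c i k α, ?_, ?_⟩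
    · intro α
      have h1 := norm_sub_le_of_geometric_bound_of_hasSum hq1 (hterm α) (hsm α) m
      rw [norm_sub_rev] at h1
      calc r ^ (∑ j, α j) * ‖(∑' k, t ^ k • c i k α) - ∑ k ∈ Finset.range m, t ^ k • c i k α‖
          ≤ r ^ (∑ j, α j) * (C / r ^ (∑ j, α j) * q ^ m / (1 - q)) := by gcongr
        _ = C * q ^ m / (1 - q) := by field_simp
        _ ≤ η := hm.le
    · intro v hv
      have h1 : HasSum (fun α : Fin d → ℕ => (∏ j, v j ^ α j) • ∑' k, t ^ k • c i k α)
          (u i (t, v)) := by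
        have h2 := (Equiv.prodComm _ _).hasSum_iff.2 (htot i t ht v hv)
        refine h2.prod_fiberwise fun α => ?_
        have h3 := (hsm α).const_smul (∏ j, v j ^ α j)
        refine h3.congr_fun fun k => ?_
        simp only [Function.comp_apply, Equiv.prodComm_apply, Prod.swap]
        rw [smul_comm]
      have h2 : HasSum (fun α : Fin d → ℕ =>
          ∑ k ∈ Finset.range m, (∏ j, v j ^ α j) • t ^ k • c i k α)
          (∑ k ∈ Finset.range m, t ^ k • ∑' α : Fin d → ℕ, (∏ j, v j ^ α j) • c i k α) := by
        refine hasSum_sum fun k _ => ?_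
        refine ((hα i k v hv).const_smul (t ^ k)).congr_fun fun α => ?_
        rw [smul_comm]
      refine (h1.sub h2).congr_fun fun α => ?_
      rw [smul_sub, Finset.smul_sum]

end TimeExpansion
end BAG

end

noncomputable section
namespace BAG

open Filter
open scoped BoundedContinuousFunction

/-! ### Pullbacks of bilinear forms -/

section PullForm

variable {A B : Type*} [NormedAddCommGroup A] [NormedSpace ℝ A] [NormedAddCommGroup B]
  [NormedSpace ℝ B]

lemma pullForm_apply {A B : Type*} [AddCommGroup A] [Module ℝ A] [TopologicalSpace A]
    [AddCommGroup B] [Module ℝ B] [TopologicalSpace B]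
    (T : A →L[ℝ] A →L[ℝ] ℝ) (L : B →L[ℝ] A) (v w : B) :
    pullForm T L v w = T (L v) (L w) := rfl

lemma pullForm_eq (T : A →L[ℝ] A →L[ℝ] ℝ) (L : B →L[ℝ] A) :
    pullForm T L = ((ContinuousLinearMap.compL ℝ B A ℝ).flip L).comp (T.comp L) := rfl

lemma pullForm_pullForm {A B C : Type*} [AddCommGroup A] [Module ℝ A] [TopologicalSpace A]
    [AddCommGroup B] [Module ℝ B] [TopologicalSpace B]
    [AddCommGroup C] [Module ℝ C] [TopologicalSpace C]
    (T : A →L[ℝ] A →L[ℝ] ℝ) (L : B →L[ℝ] A) (K : C →L[ℝ] B) :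
    pullForm (pullForm T L) K = pullForm T (L.comp K) := rfl

lemma _root_.AnalyticAt.pullForm {D : Type*} [NormedAddCommGroup D] [NormedSpace ℝ D]
    {T : D → A →L[ℝ] A →L[ℝ] ℝ} {L : D → B →L[ℝ] A} {x : D} (hT : AnalyticAt ℝ T x)
    (hL : AnalyticAt ℝ L x) : AnalyticAt ℝ (fun y => BAG.pullForm (T y) (L y)) x := by
  simp only [pullForm_eq]
  have h1 : AnalyticAt ℝ (fun y => (T y).comp (L y)) x :=
    ((ContinuousLinearMap.compL ℝ B A (A →L[ℝ] ℝ)).analyticAt_bilinear _).comp₂ hT hL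
  exact ((ContinuousLinearMap.compL ℝ B (A →L[ℝ] ℝ) (B →L[ℝ] ℝ)).analyticAt_bilinear _).comp₂
    (((ContinuousLinearMap.compL ℝ B A ℝ).flip.analyticAt _).fun_comp hL) h1

lemma UA.pullForm {I : Type*} [TopologicalSpace I] [DiscreteTopology I] {D : Type*}
    [NormedAddCommGroup D] [NormedSpace ℝ D] {T : I → D → A →L[ℝ] A →L[ℝ] ℝ}
    {L : I → D → B →L[ℝ] A} (hT : UA T) (hL : UA L) :
    UA (fun i y => BAG.pullForm (T i y) (L i y)) :=
  (hL.clm (ContinuousLinearMap.compL ℝ B A ℝ).flip).clm_comp (hT.clm_comp hL)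

lemma hasFDerivAt_form_apply {D : Type*} [NormedAddCommGroup D] [NormedSpace ℝ D]
    {T : D → A →L[ℝ] A →L[ℝ] ℝ} {T' : D →L[ℝ] A →L[ℝ] A →L[ℝ] ℝ}
    {a b : D → A} {a' b' : D →L[ℝ] A} {x : D} (hT : HasFDerivAt T T' x)
    (ha : HasFDerivAt a a' x) (hb : HasFDerivAt b b' x) (c : D) :
    fderiv ℝ (fun y => T y (a y) (b y)) x c
      = T' c (a x) (b x) + T x (a' c) (b x) + T x (a x) (b' c) := by
  rw [((hT.clm_apply ha).clm_apply hb).fderiv]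
  simp
  ring

end PullForm

/-! ### Christoffel symbols and isometries -/

section Christoffel

variable {n : ℕ}

/-- Bilinear forms on `ℝⁿ`. -/
abbrev Form (n : ℕ) : Type := Eu n →L[ℝ] Eu n →L[ℝ] ℝ

/-- Differentiating `G (κ x) (Dκ e) (Dκ f)` produces two terms with `D²κ` for each of the three
derivatives. By the symmetry of `G` and of `D²κ` they cancel in the Christoffel combination, except
for twice the term pairing `D²κ(a, b)` with `Dκ w`. -/
lemma christoffel_pullForm {G G' : Eu n → Form n} {κ : Eu n → Eu n} {v : Eu n}
    (hκ : ContDiffAt ℝ 2 κ v) (hG : DifferentiableAt ℝ G (κ v))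
    (hsymm : ∀ a b, G (κ v) a b = G (κ v) b a)
    (hG' : G' =ᶠ[𝓝 v] fun x => pullForm (G (κ x)) (fderiv ℝ κ x)) (a b w : Eu n) :
    christoffel G' v a b w = G (κ v) (fderiv ℝ (fderiv ℝ κ) v a b) (fderiv ℝ κ v w)
      + christoffel G (κ v) (fderiv ℝ κ v a) (fderiv ℝ κ v b) (fderiv ℝ κ v w) := by
  have hκ1 : HasFDerivAt κ (fderiv ℝ κ v) v :=
    (hκ.differentiableAt (by norm_num)).hasFDerivAt
  have hκ2 : HasFDerivAt (fderiv ℝ κ) (fderiv ℝ (fderiv ℝ κ) v) v :=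
    ((hκ.fderiv_right (m := 1) (by norm_num)).differentiableAt (by norm_num)).hasFDerivAt
  have hsnd : ∀ a b, fderiv ℝ (fderiv ℝ κ) v a b = fderiv ℝ (fderiv ℝ κ) v b a := fun a b =>
    (hκ.isSymmSndFDerivAt (by simp)).eq a b
  have hGκ : HasFDerivAt (fun x => G (κ x)) ((fderiv ℝ G (κ v)).comp (fderiv ℝ κ v)) v :=
    hG.hasFDerivAt.comp v hκ1
  have hap : ∀ e, HasFDerivAt (fun x => fderiv ℝ κ x e) ((fderiv ℝ (fderiv ℝ κ) v).flip e) v :=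
    fun e => by
      have := hκ2.clm_apply (hasFDerivAt_const e v)
      refine this.congr_fderiv ?_
      ext; simp
  have hdiff : DifferentiableAt ℝ G' v := by
    refine DifferentiableAt.congr_of_eventuallyEq ?_ hG'
    simp only [pullForm_eq]
    have h1 := hGκ.differentiableAt.clm_comp hκ2.differentiableAt
    have h2 : DifferentiableAt ℝ
        (fun x => (ContinuousLinearMap.compL ℝ (Eu n) (Eu n) ℝ).flip (fderiv ℝ κ x)) v :=
      (ContinuousLinearMap.differentiableAt _).comp v hκ2.differentiableAt
    exact h2.clm_comp h1
  have key : ∀ c e f, fderiv ℝ G' v c e f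
      = fderiv ℝ G (κ v) (fderiv ℝ κ v c) (fderiv ℝ κ v e) (fderiv ℝ κ v f)
        + G (κ v) (fderiv ℝ (fderiv ℝ κ) v c e) (fderiv ℝ κ v f)
        + G (κ v) (fderiv ℝ κ v e) (fderiv ℝ (fderiv ℝ κ) v c f) := by
    intro c e f
    have h1 : fderiv ℝ G' v c e f = fderiv ℝ (fun x => G' x e f) v c := by
      have := (hasFDerivAt_form_apply hdiff.hasFDerivAt (hasFDerivAt_const e v)
        (hasFDerivAt_const f v) c)
      simpa using this.symm
    have h2 : (fun x => G' x e f) =ᶠ[𝓝 v]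
        fun x => G (κ x) (fderiv ℝ κ x e) (fderiv ℝ κ x f) := by
      filter_upwards [hG'] with x hx
      rw [hx, pullForm_apply]
    rw [h1, h2.fderiv_eq, hasFDerivAt_form_apply hGκ (hap e) (hap f)]
    rfl
  simp only [christoffel, key]
  rw [hsnd b a, hsnd w a, hsnd w b,
    hsymm (fderiv ℝ κ v b) (fderiv ℝ (fderiv ℝ κ) v a w)]
  ring

/-- The operator from the derivative of a metric to its Christoffel symbols of the first kind. -/
def christoffelMap (n : ℕ) : (Eu n →L[ℝ] Form n) →L[ℝ] (Eu n →L[ℝ] Form n) :=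
  LinearMap.toContinuousLinearMap
    { toFun := fun T => (1 / 2 : ℝ) • (T + T.flip -
        ((ContinuousLinearMap.flipₗᵢ ℝ (Eu n) (Eu n) ℝ).toContinuousLinearEquiv :
          Form n →L[ℝ] Form n).comp T.flip)
      map_add' := fun S T => by
        ext a b w; simp; ring
      map_smul' := fun c T => by
        ext a b w; simp; ring }

lemma christoffelMap_apply (G : Eu n → Form n) (v a b w : Eu n) :
    christoffelMap n (fderiv ℝ G v) a b w = christoffel G v a b w := by
  change (1 / 2 : ℝ) * (fderiv ℝ G v a b w + fderiv ℝ G v b a w - fderiv ℝ G v w a b) = _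
  rw [christoffel]; ring

/-- The Christoffel symbols of the second kind. -/
def gammaSharp (G : Eu n → Form n) (v : Eu n) : Eu n →L[ℝ] Eu n →L[ℝ] Eu n :=
  (ContinuousLinearMap.compL ℝ (Eu n) (Eu n →L[ℝ] ℝ) (Eu n) (G v).inverse).comp
    (christoffelMap n (fderiv ℝ G v))

lemma gammaSharp_apply (G : Eu n → Form n) (v a b : Eu n) :
    gammaSharp G v a b = (G v).inverse (christoffelMap n (fderiv ℝ G v) a b) := rfl

lemma form_gammaSharp {G : Eu n → Form n} {v : Eu n} (hG : (G v).IsInvertible) (a b w : Eu n) :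
    G v (gammaSharp G v a b) w = christoffel G v a b w := by
  rw [gammaSharp_apply, hG.self_apply_inverse, christoffelMap_apply]

lemma analyticAt_gammaSharp {G : Eu n → Form n} {v : Eu n} (hG : AnalyticAt ℝ G v)
    (hinv : (G v).IsInvertible) : AnalyticAt ℝ (gammaSharp G) v := by
  obtain ⟨e, he⟩ := hinv
  have h1 : AnalyticAt ℝ (fun x => (G x).inverse) v := by
    refine AnalyticAt.fun_comp (g := ContinuousLinearMap.inverse) ?_ hG
    rw [← he]
    exact (contDiffAt_map_inverse (n := ω) e).analyticAt
  have h2 : AnalyticAt ℝ (fun x => christoffelMap n (fderiv ℝ G x)) v :=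
    ((christoffelMap n).analyticAt _).fun_comp hG.fderiv
  exact ((ContinuousLinearMap.compL ℝ (Eu n) (Eu n →L[ℝ] Eu n →L[ℝ] ℝ)
    (Eu n →L[ℝ] Eu n)).analyticAt_bilinear _).comp₂
    (((ContinuousLinearMap.compL ℝ (Eu n) (Eu n →L[ℝ] ℝ) (Eu n)).analyticAt _).fun_comp h1) h2

variable {I : Type*} [TopologicalSpace I] [DiscreteTopology I]

/-- A uniformly analytic family of nondegenerate forms, with uniformly bounded inverses at `0`. -/
structure UAMetric (G : I → Eu n → Form n) : Prop where
  ua : UA G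
  nondeg : ∃ C, ∃ A : I → ((Eu n →L[ℝ] ℝ) →L[ℝ] Eu n), (∀ i, ‖A i‖ ≤ C) ∧
    (∀ i, (A i).comp (G i 0) = ContinuousLinearMap.id ℝ _) ∧
    ∀ i, (G i 0).comp (A i) = ContinuousLinearMap.id ℝ _

lemma UAMetric.inverse {G : I → Eu n → Form n} (hG : UAMetric G) :
    UA (fun i v => (G i v).inverse) ∧ ∀ᶠ v in 𝓝 0, ∀ i, (G i v).IsInvertible := by
  obtain ⟨C, A, hA, h1, h2⟩ := hG.nondeg
  exact hG.ua.inverse hA h1 h2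

lemma UAMetric.gammaSharp {G : I → Eu n → Form n} (hG : UAMetric G) :
    UA (fun i v => gammaSharp (G i) v) :=
  (hG.inverse.1.clm (ContinuousLinearMap.compL ℝ (Eu n) (Eu n →L[ℝ] ℝ) (Eu n))).clm_comp
    (hG.ua.fderiv.clm (christoffelMap n))

lemma hasDerivAt_along_ray {E F : Type*} [NormedAddCommGroup E] [NormedSpace ℝ E]
    [NormedAddCommGroup F] [NormedSpace ℝ F] {f : E → F} {w : E} {t : ℝ}
    (hf : DifferentiableAt ℝ f (t • w)) :
    HasDerivAt (fun t : ℝ => f (t • w)) (fderiv ℝ f (t • w) w) t := by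
  have hline : HasDerivAt (fun t : ℝ => t • w) w t := by
    simpa using (hasDerivAt_id t).smul_const w
  exact hf.hasFDerivAt.comp_hasDerivAt t hline

/-- The second derivative of an isometry is determined by its first derivative. -/
lemma fderiv_fderiv_isometry {G G' : Eu n → Form n} {κ : Eu n → Eu n} {v : Eu n}
    (hκ : ContDiffAt ℝ 2 κ v) (hG : DifferentiableAt ℝ G (κ v))
    (hsymm : ∀ a b, G (κ v) a b = G (κ v) b a)
    (hG' : G' =ᶠ[𝓝 v] fun x => pullForm (G (κ x)) (fderiv ℝ κ x))
    (hi : (G (κ v)).IsInvertible) (hi' : (G' v).IsInvertible) (a : Eu n) :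
    fderiv ℝ (fderiv ℝ κ) v a = (fderiv ℝ κ v).comp (gammaSharp G' v a)
      - (gammaSharp G (κ v) (fderiv ℝ κ v a)).comp (fderiv ℝ κ v) := by
  ext1 b
  have hv := hG'.self_of_nhds
  -- A kernel vector of `Dκ` would lie in the radical of the pulled back form, which is
  -- nondegenerate. Surjectivity then allows testing the identity on vectors `Dκ w`.
  have hinj : Function.Injective (fderiv ℝ κ v) := by
    rw [injective_iff_map_eq_zero]
    intro x hx
    refine hi'.injective ?_
    rw [hv, map_zero]
    ext w
    simp [pullForm_apply, hx]
  have hsurj : Function.Surjective (fderiv ℝ κ v) :=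
    (LinearMap.injective_iff_surjective (f := (fderiv ℝ κ v : Eu n →ₗ[ℝ] Eu n))).1 hinj
  refine hi.injective ?_
  ext w'
  obtain ⟨w, rfl⟩ := hsurj w'
  have h1 := christoffel_pullForm hκ hG hsymm hG' a b w
  have h2 := form_gammaSharp hi' a b w
  rw [hv, pullForm_apply] at h2
  have h3 := form_gammaSharp hi (fderiv ℝ κ v a) (fderiv ℝ κ v b) (fderiv ℝ κ v w)
  simp only [_root_.sub_apply, ContinuousLinearMap.comp_apply, map_sub]
  rw [h2, h3, h1]
  ring

set_option maxHeartbeats 1000000 in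
/-- Isometries between uniformly analytic metrics are uniformly analytic. -/
theorem UAMetric.exists_ua_isometry {G G' : I → Eu n → Form n} (hG : UAMetric G)
    (hG' : UAMetric G') (hsymm : ∀ i, ∀ᶠ v in 𝓝 0, ∀ a b, G i v a b = G i v b a)
    {κ : I → Eu n → Eu n} (hκ : ∀ i, AnalyticAt ℝ (κ i) 0) (hκ0 : ∀ i, κ i 0 = 0)
    {C : ℝ} (hC : ∀ i, ‖fderiv ℝ (κ i) 0‖ ≤ C)
    (hpull : ∀ i, G' i =ᶠ[𝓝 0] fun x => pullForm (G i (κ i x)) (fderiv ℝ (κ i) x)) :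
    ∃ φ : I → Eu n → Eu n, UA φ ∧ ∀ i, φ i =ᶠ[𝓝 0] κ i := by
  -- The state along a ray consists of `κ`, `Dκ - Dκ(0)`, the point of the ray and its direction.
  -- Subtracting `Dκ(0)` places the initial state near the origin, where `UA` gives control; the
  -- bounded family `Dκ(0)` becomes a parameter of the field.
  let P := Eu n × (Eu n →L[ℝ] Eu n) × Eu n × Eu n
  have u1 : UA (fun (_ : I) (z : P) => z.1) := UA.of_analyticAt analyticAt_fst
  have u2 : UA (fun (_ : I) (z : P) => z.2.1) :=
    UA.of_analyticAt (analyticAt_fst.fun_comp analyticAt_snd)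
  have u3 : UA (fun (_ : I) (z : P) => z.2.2.1) :=
    UA.of_analyticAt (analyticAt_fst.fun_comp (analyticAt_snd.fun_comp analyticAt_snd))
  have u4 : UA (fun (_ : I) (z : P) => z.2.2.2) :=
    UA.of_analyticAt (analyticAt_snd.fun_comp (analyticAt_snd.fun_comp analyticAt_snd))
  let A : I → P → (Eu n →L[ℝ] Eu n) := fun i z => fderiv ℝ (κ i) 0 + z.2.1
  have uA : UA A := (UA.const hC).add u2
  let X : I → P → P := fun i z => (A i z z.2.2.2,
    (A i z).comp (BAG.gammaSharp (G' i) z.2.2.1 z.2.2.2)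
      - (BAG.gammaSharp (G i) z.1 (A i z z.2.2.2)).comp (A i z), z.2.2.2, 0)
  have hX : UA X := by
    have hAv := uA.clm_apply u4
    refine hAv.prodMk (UA.prodMk ?_ (u4.prodMk (UA.of_analyticAt analyticAt_const)))
    refine (uA.clm_comp ((hG'.gammaSharp.comp u3 fun _ => rfl).clm_apply u4)).sub ?_
    exact ((hG.gammaSharp.comp u1 fun _ => rfl).clm_apply hAv).clm_comp uA
  obtain ⟨Φ, hΦ, -, ρ, hρ, -, huniq⟩ := hX.flow
  obtain ⟨F, hF, hFΦ⟩ := hΦ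
  obtain ⟨δ, hδ, hδb⟩ := Metric.eventually_nhds_iff_ball.1
    (hF.eventually_analyticAt.and hFΦ.eventually_nhds)
  set t₀ := min ρ δ / 2 with ht₀
  have hmin : 0 < min ρ δ := lt_min hρ hδ
  have ht₀pos : 0 < t₀ := by positivity
  have ht₀ρ : t₀ < ρ := (half_lt_self hmin).trans_le (min_le_left _ _)
  have ht₀δ : t₀ < δ := (half_lt_self hmin).trans_le (min_le_right _ _)
  -- The flow exists only for short times, so `v` is reached at the fixed time `t₀` with velocity
  -- `t₀⁻¹ • v`.
  let L : Eu n → ℝ × P := fun v => (t₀, 0, 0, 0, t₀⁻¹ • v)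
  have hL : AnalyticAt ℝ L 0 := by
    refine analyticAt_const.prod (analyticAt_const.prod (analyticAt_const.prod
      (analyticAt_const.prod ?_)))
    exact (t₀⁻¹ • ContinuousLinearMap.id ℝ (Eu n)).analyticAt 0
  have hL0 : L 0 ∈ Metric.ball (0 : ℝ × P) δ := by
    have : L 0 = (t₀, (0 : P)) := by simp only [L, smul_zero]; rfl
    rw [this, mem_ball_zero_iff, Prod.norm_def, norm_zero, Real.norm_of_nonneg ht₀pos.le]
    exact max_lt ht₀δ hδ
  refine ⟨fun i v => (Φ i (L v)).1, ?_, ?_⟩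
  · have h1 : UA (fun i v => Φ i (L v)) := by
      refine ⟨fun v => F (L v), AnalyticAt.fun_comp (hδb _ hL0).1 hL, ?_⟩
      exact hL.continuousAt.tendsto.eventually (hδb _ hL0).2
    exact h1.clm (ContinuousLinearMap.fst ℝ _ _)
  · intro i
    have hi := hG.inverse.2
    have hi' := hG'.inverse.2
    have hκc : Tendsto (κ i) (𝓝 0) (𝓝 0) := by
      have := (hκ i).continuousAt.tendsto
      rwa [hκ0 i] at this
    -- a neighbourhood on which everything is controlled
    have hgood : ∀ᶠ v in 𝓝 (0 : Eu n), AnalyticAt ℝ (κ i) v ∧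
        (∀ a, fderiv ℝ (fderiv ℝ (κ i)) v a = (fderiv ℝ (κ i) v).comp (BAG.gammaSharp (G' i) v a)
          - (BAG.gammaSharp (G i) (κ i v) (fderiv ℝ (κ i) v a)).comp (fderiv ℝ (κ i) v)) ∧
        ‖κ i v‖ < ρ ∧ ‖fderiv ℝ (κ i) v - fderiv ℝ (κ i) 0‖ < ρ ∧ ‖v‖ < ρ ∧ ‖t₀⁻¹ • v‖ < ρ := by
      have e1 := (hκ i).eventually_analyticAt
      have e2 := hκc.eventually hG.ua.eventually_analyticAt
      have e3 := hκc.eventually (hsymm i)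
      have e4 := (hpull i).eventually_nhds
      have e5 := hκc.eventually hi
      have e6 := (hκ i).continuousAt.norm.eventually_lt_const (u := ρ) (by simpa [hκ0 i] using hρ)
      have e7 := ((hκ i).fderiv.continuousAt.sub
        (continuousAt_const (y := fderiv ℝ (κ i) 0))).norm.eventually_lt_const (u := ρ)
        (by simpa using hρ)
      have e8 : ∀ᶠ v in 𝓝 (0 : Eu n), ‖v‖ < ρ :=
        continuous_norm.continuousAt.eventually_lt_const (by simpa using hρ)
      have e9 : ∀ᶠ v in 𝓝 (0 : Eu n), ‖t₀⁻¹ • v‖ < ρ :=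
        (continuous_const_smul t₀⁻¹).norm.continuousAt.eventually_lt_const (by simpa using hρ)
      filter_upwards [e1, e2, e3, e4, e5, hi', e6, e7, e8, e9] with v f1 f2 f3 f4 f5 f6 f7 f8 f9 f10
      exact ⟨f1, fun a => fderiv_fderiv_isometry f1.contDiffAt (f2 i).differentiableAt f3 f4
        (f5 i) (f6 i) a, f7, f8, f9, f10⟩
    -- This radius depends on `i`, which is harmless: only equality of germs is claimed for each
    -- index.
    obtain ⟨s, hs, hsb⟩ := Metric.eventually_nhds_iff_ball.1 hgood
    filter_upwards [Metric.ball_mem_nhds 0 hs] with v hv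
    set w := t₀⁻¹ • v with hw
    have hseg : ∀ t ∈ Set.Icc 0 t₀, t • w ∈ Metric.ball (0 : Eu n) s := by
      intro t ht
      rw [mem_ball_zero_iff] at hv ⊢
      refine lt_of_le_of_lt ?_ hv
      rw [hw, smul_smul, norm_smul]
      refine mul_le_of_le_one_left (norm_nonneg _) ?_
      rw [Real.norm_of_nonneg (mul_nonneg ht.1 (inv_nonneg.2 ht₀pos.le)), ← div_eq_mul_inv]
      exact div_le_one_of_le₀ ht.2 ht₀pos.le
    let c : ℝ → P := fun t => (κ i (t • w), fderiv ℝ (κ i) (t • w) - fderiv ℝ (κ i) 0, t • w, w)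
    have hc : ∀ t ∈ Set.Icc 0 t₀, HasDerivAt c (X i (c t)) t ∧ ‖c t‖ < ρ := by
      intro t ht
      obtain ⟨g1, g2, g3, g4, g5, -⟩ := hsb _ (hseg t ht)
      have hw' : ‖w‖ < ρ := (hsb v hv).2.2.2.2.2
      have hline : HasDerivAt (fun t : ℝ => t • w) w t := by
        simpa using (hasDerivAt_id t).smul_const w
      have hd1 : HasDerivAt (fun t : ℝ => κ i (t • w)) (fderiv ℝ (κ i) (t • w) w) t :=
        hasDerivAt_along_ray g1.differentiableAt
      have hd2 : HasDerivAt (fun t : ℝ => fderiv ℝ (κ i) (t • w) - fderiv ℝ (κ i) 0)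
          (fderiv ℝ (fderiv ℝ (κ i)) (t • w) w) t :=
        (hasDerivAt_along_ray (f := fderiv ℝ (κ i)) g1.fderiv.differentiableAt).sub_const _
      constructor
      · have hd := hd1.prodMk (hd2.prodMk (hline.prodMk (hasDerivAt_const t w)))
        refine hd.congr_deriv ?_
        have hA : A i (c t) = fderiv ℝ (κ i) (t • w) := add_sub_cancel _ _
        refine Prod.ext ?_ (Prod.ext ?_ rfl)
        · change _ = A i (c t) w
          rw [hA]
        · change _ = (A i (c t)).comp (BAG.gammaSharp (G' i) (t • w) w)
            - (BAG.gammaSharp (G i) (κ i (t • w)) (A i (c t) w)).comp (A i (c t))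
          rw [hA, g2 w]
      · exact max_lt g3 (max_lt g4 (max_lt g5 hw'))
    -- The isometry, followed along the ray, solves the equation and hence agrees with the uniformly
    -- analytic flow.
    have hfin := huniq i t₀ c ht₀pos.le ht₀ρ hc
    have hc0 : c 0 = (0, 0, 0, t₀⁻¹ • v) := by
      simp [c, hκ0 i, hw]
    rw [hc0] at hfin
    have hv' : t₀ • w = v := by rw [hw, smul_smul, mul_inv_cancel₀ ht₀pos.ne', one_smul]
    change (Φ i (t₀, 0, 0, 0, t₀⁻¹ • v)).1 = κ i v
    rw [← hfin]
    simp only [c, hv']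

end Christoffel
end BAG

end

noncomputable section
namespace BAG

open Filter
open scoped BoundedContinuousFunction

/-! ### Unit normals to graphs -/

section Graph

variable {d : ℕ}

/-- The projection to the first `d` coordinates. -/
def initL (d : ℕ) : Eu (d + 1) →L[ℝ] Eu d :=
  LinearMap.toContinuousLinearMap
    { toFun := fun w => WithLp.toLp 2 fun i => w i.castSucc
      map_add' := fun _ _ => rfl
      map_smul' := fun _ _ => rfl }

/-- The last coordinate. -/
def lastL (d : ℕ) : Eu (d + 1) →L[ℝ] ℝ := EuclideanSpace.proj (Fin.last d)

/-- The point with given first `d` coordinates and given last coordinate. -/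
def snocL (d : ℕ) : Eu d × ℝ →L[ℝ] Eu (d + 1) :=
  LinearMap.toContinuousLinearMap
    { toFun := fun p => WithLp.toLp 2 (Fin.snoc (α := fun _ => ℝ) p.1 p.2)
      map_add' := fun p q => by
        ext i
        refine Fin.lastCases ?_ (fun i => ?_) i <;> simp
      map_smul' := fun c p => by
        ext i
        refine Fin.lastCases ?_ (fun i => ?_) i <;> simp }

lemma initL_apply (w : Eu (d + 1)) : initL d w = WithLp.toLp 2 fun i => w i.castSucc := rfl

@[simp]
lemma snocL_castSucc (p : Eu d × ℝ) (i : Fin d) : snocL d p i.castSucc = p.1 i := by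
  change (Fin.snoc (α := fun _ => ℝ) p.1 p.2 : Fin (d + 1) → ℝ) i.castSucc = _
  simp

@[simp]
lemma snocL_last (p : Eu d × ℝ) : snocL d p (Fin.last d) = p.2 := by
  change (Fin.snoc (α := fun _ => ℝ) p.1 p.2 : Fin (d + 1) → ℝ) (Fin.last d) = _
  simp

@[simp]
lemma initL_snocL (p : Eu d × ℝ) : initL d (snocL d p) = p.1 := by
  ext i; simp [initL_apply]

@[simp]
lemma lastL_snocL (p : Eu d × ℝ) : lastL d (snocL d p) = p.2 := snocL_last p

lemma lastL_apply (w : Eu (d + 1)) : lastL d w = w (Fin.last d) := rfl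

lemma snocL_initL_lastL (w : Eu (d + 1)) : snocL d (initL d w, lastL d w) = w := by
  ext i
  refine Fin.lastCases ?_ (fun i => ?_) i <;> simp [initL_apply, lastL_apply]

/-- The parametrization of the graph of `F`. -/
def graphMap (F : Eu d → ℝ) (v : Eu d) : Eu (d + 1) := snocL d (v, F v)

lemma initL_graphMap (F : Eu d → ℝ) (v : Eu d) : initL d (graphMap F v) = v := initL_snocL _

lemma mem_graphInCube_iff {F : Eu d → ℝ} {w : Eu (d + 1)} :
    w ∈ graphInCube F ↔ w ∈ cube (d + 1) 1 ∧ w = graphMap F (initL d w) := by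
  constructor
  · rintro ⟨h1, h2⟩
    refine ⟨h1, ?_⟩
    conv_lhs => rw [← snocL_initL_lastL w]
    rw [graphMap, lastL_apply, h2]
    rfl
  · rintro ⟨h1, h2⟩
    refine ⟨h1, ?_⟩
    have : lastL d w = F (initL d w) := by
      conv_lhs => rw [h2]
      exact lastL_snocL _
    exact this

lemma fderiv_graphMap {F : Eu d → ℝ} {v : Eu d} (hF : DifferentiableAt ℝ F v) :
    fderiv ℝ (graphMap F) v = (snocL d).comp ((ContinuousLinearMap.id ℝ _).prod (fderiv ℝ F v)) :=
  ((snocL d).hasFDerivAt.comp v ((hasFDerivAt_id v).prodMk hF.hasFDerivAt)).fderiv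

lemma analyticAt_graphMap {F : Eu d → ℝ} {v : Eu d} (hF : AnalyticAt ℝ F v) :
    AnalyticAt ℝ (graphMap F) v :=
  ((snocL d).analyticAt _).fun_comp (analyticAt_id.prod hF)

/-- The conormal `dv_{d+1} - dF` of the graph of `F`. -/
def conormal (F : Eu d → ℝ) (v : Eu d) : Eu (d + 1) →L[ℝ] ℝ :=
  lastL d - (fderiv ℝ F v).comp (initL d)

lemma conormal_graph {F : Eu d → ℝ} {v : Eu d} (hF : DifferentiableAt ℝ F v) (w : Eu d) :
    conormal F v (fderiv ℝ (graphMap F) v w) = 0 := by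
  rw [fderiv_graphMap hF]
  simp [conormal]

/-- A covector that vanishes on the tangent space of the graph is a multiple of the conormal. -/
lemma eq_smul_conormal {F : Eu d → ℝ} {v : Eu d} (hF : DifferentiableAt ℝ F v)
    {α : Eu (d + 1) →L[ℝ] ℝ} (h : ∀ w, α (fderiv ℝ (graphMap F) v w) = 0) :
    α = α (snocL d (0, 1)) • conormal F v := by
  ext x
  have hx : x = fderiv ℝ (graphMap F) v (initL d x) + conormal F v x • snocL d (0, 1) := by
    rw [fderiv_graphMap hF]
    conv_lhs => rw [← snocL_initL_lastL x]
    rw [← map_smul, ContinuousLinearMap.comp_apply, ← map_add]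
    congr 1
    simp [conormal]
  conv_lhs => rw [hx]
  rw [map_add, h, zero_add, map_smul, smul_eq_mul]
  simp [mul_comm]

variable {I : Type*} [TopologicalSpace I] [DiscreteTopology I]

lemma UA.graphMap {F : I → Eu d → ℝ} (hF : UA F) : UA (fun i v => BAG.graphMap (F i) v) :=
  ((UA.of_analyticAt analyticAt_id).prodMk hF).clm (snocL d)

lemma UA.conormal {F : I → Eu d → ℝ} (hF : UA F) : UA (fun i v => BAG.conormal (F i) v) :=
  (UA.of_analyticAt analyticAt_const).sub
    (hF.fderiv.clm ((ContinuousLinearMap.compL ℝ (Eu (d + 1)) (Eu d) ℝ).flip (initL d)))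

/-- The data of a unit normal to the graph of `F` at `graphMap F v`. -/
structure IsUnitNormalAt (G : Eu (d + 1) → Form (d + 1)) (F : Eu d → ℝ) (v : Eu d)
    (ν : Eu (d + 1)) : Prop where
  unit : G (graphMap F v) ν ν = -1
  normal : ∀ w, G (graphMap F v) ν (fderiv ℝ (graphMap F) v w) = 0

/-- A unit normal and the conormal. -/
lemma IsUnitNormalAt.exists_smul {G : Eu (d + 1) → Form (d + 1)} {F : Eu d → ℝ} {v : Eu d}
    {ν : Eu (d + 1)} (h : IsUnitNormalAt G F v ν) (hF : DifferentiableAt ℝ F v) :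
    ∃ l : ℝ, |l| ≤ ‖G (graphMap F v)‖ * ‖ν‖ ∧ l ≠ 0 ∧ G (graphMap F v) ν = l • conormal F v ∧
      l * conormal F v ν = -1 := by
  have h1 := eq_smul_conormal hF h.normal
  set l := G (graphMap F v) ν (snocL d (0, 1)) with hl
  have h2 : l * conormal F v ν = -1 := by
    rw [← h.unit]
    conv_rhs => rw [h1]
    simp
  refine ⟨l, ?_, ?_, h1, h2⟩
  · have hn : ‖snocL d ((0 : Eu d), (1 : ℝ))‖ = 1 := by
      have : snocL d ((0 : Eu d), (1 : ℝ)) = EuclideanSpace.single (Fin.last d) 1 := by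
        ext i
        refine Fin.lastCases ?_ (fun i => ?_) i
        · simp
        · simp [(Fin.castSucc_lt_last i).ne]
      rw [this]; simp
    have := (G (graphMap F v)).le_opNorm₂ ν (snocL d (0, 1))
    rwa [hn, mul_one] at this
  · rintro h0
    rw [h0, zero_mul] at h2
    norm_num at h2

/-- Uniformly analytic extension of unit normals. -/
lemma exists_ua_normal {G : I → Eu (d + 1) → Form (d + 1)} (hG : UAMetric G)
    {F : I → Eu d → ℝ} (hF : UA F) (hF0 : ∀ i, F i 0 = 0) {ν : I → Eu (d + 1)} {C : ℝ}
    (hC : ∀ i, ‖ν i‖ ≤ C) (hν : ∀ i, IsUnitNormalAt (G i) (F i) 0 (ν i)) :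
    ∃ N : I → Eu d → Eu (d + 1), UA N ∧ (∀ i, N i 0 = ν i) ∧
      ∀ᶠ v in 𝓝 0, ∀ i, IsUnitNormalAt (G i) (F i) v (N i v) := by
  have hg0 : ∀ i, graphMap (F i) 0 = 0 := fun i => by
    rw [graphMap, hF0]; exact map_zero _
  have hFd : ∀ i, DifferentiableAt ℝ (F i) 0 := fun i =>
    (hF.eventually_analyticAt.self_of_nhds i).differentiableAt
  choose l hl hl0 hGl hlc using fun i => (hν i).exists_smul (hFd i)
  obtain ⟨B, hB⟩ := hG.ua.bounded_zero
  have hinv0 : ∀ i, (G i 0).IsInvertible := fun i => hG.inverse.2.self_of_nhds i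
  -- Raising the index of the conormal gives an analytic normal field. It remains to normalize it
  -- and to choose the side on which `ν i` lies.
  let N₀ : I → Eu d → Eu (d + 1) := fun i v => (G i (graphMap (F i) v)).inverse (conormal (F i) v)
  have uN₀ : UA N₀ := (hG.inverse.1.comp hF.graphMap hg0).clm_apply hF.conormal
  have hN₀ : ∀ i, N₀ i 0 = (l i)⁻¹ • ν i := fun i => by
    simp only [N₀]
    rw [(hg0 i ▸ hinv0 i : (G i (graphMap (F i) 0)).IsInvertible).inverse_apply_eq, map_smul,
      hGl i, smul_smul, inv_mul_cancel₀ (hl0 i), one_smul]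
  let s : I → Eu d → ℝ := fun i v => -(conormal (F i) v (N₀ i v))
  have us : UA s := (hF.conormal.clm_apply uN₀).neg
  -- `s` is minus the square of `N₀`. At the origin it is bounded below, because the factor `l`
  -- between the lowered `ν` and the conormal is bounded by the norms of the metric and of `ν`.
  have hs0 : ∀ i, s i 0 = (l i ^ 2)⁻¹ := fun i => by
    simp only [s, hN₀ i, map_smul, smul_eq_mul]
    have h1 : conormal (F i) 0 (ν i) = -(l i)⁻¹ := by
      have h2 := hlc i
      have h3 := hl0 i
      field_simp
      linarith
    rw [h1]
    have h3 := hl0 i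
    field_simp
  have hlB : ∀ i, |l i| ≤ |B| * |C| + 1 := fun i => by
    refine (hl i).trans ?_
    rw [hg0 i]
    calc ‖G i 0‖ * ‖ν i‖ ≤ |B| * |C| := by
          gcongr
          · exact (hB i).trans (le_abs_self _)
          · exact (hC i).trans (le_abs_self _)
      _ ≤ _ := by linarith
  set K := |B| * |C| + 1
  have hK : 0 < K := by positivity
  have hsK : ∀ i, (K ^ 2)⁻¹ ≤ s i 0 := fun i => by
    rw [hs0]
    refine inv_anti₀ (by have := hl0 i; positivity) ?_
    rw [← sq_abs]
    exact pow_le_pow_left₀ (abs_nonneg _) (hlB i) 2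
  obtain ⟨uq, hpos⟩ := us.inv_sqrt (c := (K ^ 2)⁻¹) (by positivity) hsK
  -- The square root loses the sign of `l i`, which distinguishes `ν i` from its negative. A sign
  -- depending only on the index is a bounded constant family.
  let σ : I → ℝ := fun i => SignType.sign (l i)
  have hσ : ∀ i, σ i * σ i = 1 := fun i => by
    rcases lt_or_gt_of_ne (hl0 i) with h | h <;> simp [σ, h]
  have uσ : UA (fun i (_ : Eu d) => σ i) := UA.const (C := 1) fun i => by
    rcases lt_or_gt_of_ne (hl0 i) with h | h <;> simp [σ, h]
  refine ⟨fun i v => σ i • (Real.sqrt (s i v))⁻¹ • N₀ i v, uσ.smul (uq.smul uN₀), fun i => ?_, ?_⟩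
  · simp only [hs0 i, hN₀ i, Real.sqrt_inv, Real.sqrt_sq_eq_abs, inv_inv, smul_smul]
    have : σ i * (|l i| * (l i)⁻¹) = 1 := by
      rcases lt_or_gt_of_ne (hl0 i) with h | h
      · simp only [σ, sign_neg h, abs_of_neg h]
        have := hl0 i
        field_simp
        simp
      · simp only [σ, sign_pos h, abs_of_pos h]
        have := hl0 i
        field_simp
        simp
    rw [this, one_smul]
  · obtain ⟨r, hr, hrb⟩ := Metric.eventually_nhds_iff_ball.1 hG.inverse.2
    filter_upwards [hpos, hF.graphMap.eventually_lt hg0 hr, hF.eventually_analyticAt] with v h1 h2 h3 i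
    have hinv := hrb (graphMap (F i) v) (mem_ball_zero_iff.2 (h2 i)) i
    have hGN : G i (graphMap (F i) v) (N₀ i v) = conormal (F i) v := hinv.self_apply_inverse _
    have hsq : (Real.sqrt (s i v))⁻¹ * (Real.sqrt (s i v))⁻¹ * s i v = 1 := by
      have := Real.sq_sqrt (h1 i).le
      have h4 := (Real.sqrt_pos.2 (h1 i)).ne'
      field_simp
      linarith
    constructor
    · simp only [map_smul, smul_apply, hGN, smul_eq_mul]
      have : conormal (F i) v (N₀ i v) = - s i v := by simp [s]
      rw [this]
      linear_combination (-1 : ℝ) * hsq * (σ i * σ i) - hσ i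
    · intro w
      simp only [map_smul, smul_apply, hGN, conormal_graph (h3 i).differentiableAt w, smul_zero]

end Graph
end BAG

end

noncomputable section
namespace BAG

open Filter
open scoped BoundedContinuousFunction

/-! ### The normal geodesic flow in coordinates -/

section GaussFlow

variable {d : ℕ}

lemma hasDerivAt_slice {E V : Type*} [NormedAddCommGroup E] [NormedSpace ℝ E]
    [NormedAddCommGroup V] [NormedSpace ℝ V] {f : ℝ × E → V} {t : ℝ} {v : E}
    (hf : DifferentiableAt ℝ f (t, v)) :
    HasDerivAt (fun s => f (s, v)) (fderiv ℝ f (t, v) (1, 0)) t :=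
  hf.hasFDerivAt.comp_hasDerivAt t ((hasDerivAt_id t).prodMk (hasDerivAt_const t v))

/-- The normal geodesic flow `Ψ` from the graph of `F`, for `|t|, ‖v‖ < r`, in coordinates. -/
structure IsGaussFlow (G : Eu (d + 1) → Form (d + 1)) (F : Eu d → ℝ) (r c C : ℝ)
    (Ψ : ℝ × Eu d → Eu (d + 1)) : Prop where
  analytic : ∀ p ∈ Metric.ball (0 : ℝ × Eu d) r, AnalyticAt ℝ Ψ p
  analytic_graph : ∀ v ∈ Metric.ball (0 : Eu d) r, AnalyticAt ℝ F v
  initial : ∀ v ∈ Metric.ball (0 : Eu d) r, Ψ (0, v) = graphMap F v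
  geodesic : ∀ p ∈ Metric.ball (0 : ℝ × Eu d) r, ∀ w,
    G (Ψ p) (fderiv ℝ (fun q => fderiv ℝ Ψ q (1, 0)) p (1, 0)) w
      + christoffel G (Ψ p) (fderiv ℝ Ψ p (1, 0)) (fderiv ℝ Ψ p (1, 0)) w = 0
  unit : ∀ p ∈ Metric.ball (0 : ℝ × Eu d) r,
    G (Ψ p) (fderiv ℝ Ψ p (1, 0)) (fderiv ℝ Ψ p (1, 0)) = -1
  orth : ∀ p ∈ Metric.ball (0 : ℝ × Eu d) r, ∀ w,
    G (Ψ p) (fderiv ℝ Ψ p (1, 0)) (fderiv ℝ Ψ p (0, w)) = 0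
  expand : ∀ p ∈ Metric.ball (0 : ℝ × Eu d) r, ∀ q ∈ Metric.ball (0 : ℝ × Eu d) r,
    c * ‖p - q‖ ≤ ‖Ψ p - Ψ q‖
  small : ∀ p ∈ Metric.ball (0 : ℝ × Eu d) r, ‖Ψ p‖ < 1 / 2
  speed : ∀ p ∈ Metric.ball (0 : ℝ × Eu d) r, ‖fderiv ℝ Ψ p (1, 0)‖ ≤ C

lemma mem_ball_prod {r t : ℝ} {E : Type*} [NormedAddCommGroup E] {v : E} :
    (t, v) ∈ Metric.ball (0 : ℝ × E) r ↔ |t| < r ∧ ‖v‖ < r := by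
  simp [Prod.norm_def]

/-- A function of time with vanishing derivative on an interval around `0` is constant. -/
lemma eq_of_hasDerivAt_zero {f : ℝ → ℝ} {r : ℝ} (h : ∀ s, |s| < r → HasDerivAt f 0 s) {t : ℝ}
    (ht : |t| < r) : f t = f 0 := by
  have hr : 0 < r := (abs_nonneg t).trans_lt ht
  have hpre : IsPreconnected (Set.Ioo (-r) r) := isPreconnected_Ioo
  refine isOpen_Ioo.is_const_of_deriv_eq_zero (𝕜 := ℝ) hpre
    (fun s hs => (h s (abs_lt.2 hs)).differentiableAt.differentiableWithinAt)
    (fun s hs => (h s (abs_lt.2 hs)).deriv) (abs_lt.1 ht) ⟨by linarith, hr⟩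

/-- The Gauss lemma in coordinates. -/
lemma gauss_lemma {G : Eu (d + 1) → Form (d + 1)} {Ψ : ℝ × Eu d → Eu (d + 1)} {r : ℝ}
    (hsymm : ∀ v a b, G v a b = G v b a)
    (hΨ : ∀ p ∈ Metric.ball (0 : ℝ × Eu d) r, AnalyticAt ℝ Ψ p)
    (hG : ∀ p ∈ Metric.ball (0 : ℝ × Eu d) r, AnalyticAt ℝ G (Ψ p))
    (hgeo : ∀ p ∈ Metric.ball (0 : ℝ × Eu d) r, ∀ w,
      G (Ψ p) (fderiv ℝ (fun q => fderiv ℝ Ψ q (1, 0)) p (1, 0)) w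
        + christoffel G (Ψ p) (fderiv ℝ Ψ p (1, 0)) (fderiv ℝ Ψ p (1, 0)) w = 0)
    (hunit : ∀ v ∈ Metric.ball (0 : Eu d) r,
      G (Ψ (0, v)) (fderiv ℝ Ψ (0, v) (1, 0)) (fderiv ℝ Ψ (0, v) (1, 0)) = -1)
    (horth : ∀ v ∈ Metric.ball (0 : Eu d) r, ∀ w,
      G (Ψ (0, v)) (fderiv ℝ Ψ (0, v) (1, 0)) (fderiv ℝ Ψ (0, v) (0, w)) = 0) :
    ∀ p ∈ Metric.ball (0 : ℝ × Eu d) r,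
      G (Ψ p) (fderiv ℝ Ψ p (1, 0)) (fderiv ℝ Ψ p (1, 0)) = -1 ∧
      ∀ w, G (Ψ p) (fderiv ℝ Ψ p (1, 0)) (fderiv ℝ Ψ p (0, w)) = 0 := by
  let U : ℝ × Eu d → Eu (d + 1) := fun q => fderiv ℝ Ψ q (1, 0)
  have hap : ∀ (e : ℝ × Eu d), ∀ p ∈ Metric.ball (0 : ℝ × Eu d) r,
      HasFDerivAt (fun q => fderiv ℝ Ψ q e) ((fderiv ℝ (fderiv ℝ Ψ) p).flip e) p := by
    intro e p hp
    have := (hΨ p hp).fderiv.differentiableAt.hasFDerivAt.clm_apply (hasFDerivAt_const e p)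
    refine this.congr_fderiv ?_
    rw [ContinuousLinearMap.comp_zero, zero_add]
  have hU : ∀ p ∈ Metric.ball (0 : ℝ × Eu d) r, ∀ x,
      fderiv ℝ U p x = fderiv ℝ (fderiv ℝ Ψ) p x (1, 0) := fun p hp x => by
    rw [(hap (1, 0) p hp).fderiv]; rfl
  have hGΨ : ∀ p ∈ Metric.ball (0 : ℝ × Eu d) r,
      HasFDerivAt (fun q => G (Ψ q)) ((fderiv ℝ G (Ψ p)).comp (fderiv ℝ Ψ p)) p := fun p hp =>
    (hG p hp).differentiableAt.hasFDerivAt.comp p (hΨ p hp).differentiableAt.hasFDerivAt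
  have hdiff : ∀ p ∈ Metric.ball (0 : ℝ × Eu d) r, ∀ e e' : ℝ × Eu d,
      DifferentiableAt ℝ (fun q => G (Ψ q) (fderiv ℝ Ψ q e) (fderiv ℝ Ψ q e')) p :=
    fun p hp e e' => (((hGΨ p hp).clm_apply (hap e p hp)).clm_apply (hap e' p hp)).differentiableAt
  have hder : ∀ p ∈ Metric.ball (0 : ℝ × Eu d) r, ∀ e e' x : ℝ × Eu d,
      fderiv ℝ (fun q => G (Ψ q) (fderiv ℝ Ψ q e) (fderiv ℝ Ψ q e')) p x
        = fderiv ℝ G (Ψ p) (fderiv ℝ Ψ p x) (fderiv ℝ Ψ p e) (fderiv ℝ Ψ p e')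
          + G (Ψ p) (fderiv ℝ (fderiv ℝ Ψ) p x e) (fderiv ℝ Ψ p e')
          + G (Ψ p) (fderiv ℝ Ψ p e) (fderiv ℝ (fderiv ℝ Ψ) p x e') := fun p hp e e' x =>
    hasFDerivAt_form_apply (hGΨ p hp) (hap e p hp) (hap e' p hp) x
  have h1 : ∀ p ∈ Metric.ball (0 : ℝ × Eu d) r,
      G (Ψ p) (fderiv ℝ Ψ p (1, 0)) (fderiv ℝ Ψ p (1, 0)) = -1 := by
    rintro ⟨t, v⟩ hp
    obtain ⟨ht, hv⟩ := mem_ball_prod.1 hp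
    rw [← hunit v (mem_ball_zero_iff.2 hv)]
    refine eq_of_hasDerivAt_zero (f := fun s => G (Ψ (s, v)) (fderiv ℝ Ψ (s, v) (1, 0))
      (fderiv ℝ Ψ (s, v) (1, 0))) (fun s hs => ?_) ht
    have hs' : (s, v) ∈ Metric.ball (0 : ℝ × Eu d) r := mem_ball_prod.2 ⟨hs, hv⟩
    have h2 := hasDerivAt_slice (hdiff _ hs' (1, 0) (1, 0))
    refine h2.congr_deriv ?_
    -- Tested on the velocity itself, the Christoffel term is half the derivative of the metric, so
    -- the geodesic equation says that the square of the velocity is conserved.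
    have h3 := hgeo _ hs' (fderiv ℝ Ψ (s, v) (1, 0))
    rw [hder _ hs', ← hU _ hs', hsymm _ (fderiv ℝ Ψ (s, v) (1, 0)) (fderiv ℝ U (s, v) (1, 0))]
    rw [christoffel] at h3
    linarith
  refine fun p hp => ⟨h1 p hp, fun w => ?_⟩
  obtain ⟨t, v⟩ := p
  obtain ⟨ht, hv⟩ := mem_ball_prod.1 hp
  refine (eq_of_hasDerivAt_zero (f := fun s => G (Ψ (s, v)) (fderiv ℝ Ψ (s, v) (1, 0))
    (fderiv ℝ Ψ (s, v) (0, w))) (fun s hs => ?_) ht).trans (horth v (mem_ball_zero_iff.2 hv) w)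
  have hs' : (s, v) ∈ Metric.ball (0 : ℝ × Eu d) r := mem_ball_prod.2 ⟨hs, hv⟩
  have h2 := hasDerivAt_slice (hdiff _ hs' (1, 0) (0, w))
  refine h2.congr_deriv ?_
  have h3 := hgeo _ hs' (fderiv ℝ Ψ (s, v) (0, w))
  -- The square of the velocity is constant also across the geodesics. This replaces the product of
  -- the velocity with its transverse derivative, which equals the time derivative of the transverse
  -- field by symmetry of `D²Ψ`.
  have h4 : fderiv ℝ (fun q => G (Ψ q) (fderiv ℝ Ψ q (1, 0)) (fderiv ℝ Ψ q (1, 0))) (s, v) (0, w)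
      = 0 := by
    have : (fun q => G (Ψ q) (fderiv ℝ Ψ q (1, 0)) (fderiv ℝ Ψ q (1, 0))) =ᶠ[𝓝 (s, v)]
        fun _ => (-1 : ℝ) := by
      filter_upwards [Metric.isOpen_ball.mem_nhds hs'] with q hq using h1 q hq
    rw [this.fderiv_eq]; simp
  have hsnd : fderiv ℝ (fderiv ℝ Ψ) (s, v) (1, 0) (0, w)
      = fderiv ℝ (fderiv ℝ Ψ) (s, v) (0, w) (1, 0) :=
    (((hΨ _ hs').contDiffAt (n := 2)).isSymmSndFDerivAt (by simp)).eq _ _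
  rw [hder _ hs', hsymm _ (fderiv ℝ (fderiv ℝ Ψ) (s, v) (0, w) (1, 0))] at h4
  rw [hder _ hs', ← hU _ hs', hsnd]
  rw [christoffel] at h3
  linarith

variable {I : Type*} [TopologicalSpace I] [DiscreteTopology I]

/-- The normal geodesic flow of a uniformly analytic family of graphs. -/
theorem exists_gaussFlow {G : I → Eu (d + 1) → Form (d + 1)} (hG : UAMetric G)
    (hsymm : ∀ i v a b, G i v a b = G i v b a)
    {F : I → Eu d → ℝ} (hF : UA F) (hF0 : ∀ i, F i 0 = 0) {ν : I → Eu (d + 1)} {C : ℝ}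
    (hC : ∀ i, ‖ν i‖ ≤ C) (hν : ∀ i, IsUnitNormalAt (G i) (F i) 0 (ν i)) :
    ∃ Ψ : I → ℝ × Eu d → Eu (d + 1), UA Ψ ∧ (∀ i, fderiv ℝ (Ψ i) 0 (1, 0) = ν i) ∧
      ∃ r > 0, ∃ c > 0, ∃ C', ∀ i, IsGaussFlow (G i) (F i) r c C' (Ψ i) := by
  have hg0 : ∀ i, graphMap (F i) 0 = 0 := fun i => by
    rw [graphMap, hF0]; exact map_zero _
  obtain ⟨N, uN, hN0, hN⟩ := exists_ua_normal hG hF hF0 hC hν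
  let P := Eu (d + 1) × Eu (d + 1)
  have u1 : UA (fun (_ : I) (z : P) => z.1) := UA.of_analyticAt analyticAt_fst
  have u2 : UA (fun (_ : I) (z : P) => z.2) := UA.of_analyticAt analyticAt_snd
  have uν : UA (fun i (z : P) => ν i + z.2) := (UA.const hC).add u2
  -- The second component is the velocity minus `ν i`. With this shift the central initial state is
  -- the origin for every index.
  let X : I → P → P := fun i z =>
    (ν i + z.2, -(gammaSharp (G i) z.1 (ν i + z.2) (ν i + z.2)))
  have hX : UA X :=
    uν.prodMk (((hG.gammaSharp.comp u1 fun _ => rfl).clm_apply uν).clm_apply uν).neg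
  obtain ⟨Φ, hΦ, hΦ0, ρ, hρ, hflow, -⟩ := hX.flow
  let init : I → Eu d → P := fun i v => (graphMap (F i) v, N i v - ν i)
  have uinit : UA init := hF.graphMap.prodMk (uN.sub (UA.const hC))
  have hinit0 : ∀ i, init i 0 = 0 := fun i => by
    simp only [init, hg0, hN0, sub_self]; rfl
  let jj : I → ℝ × Eu d → ℝ × P := fun i p => (p.1, init i p.2)
  have ujj : UA jj := (UA.of_analyticAt analyticAt_fst).prodMk
    (uinit.comp (UA.of_analyticAt analyticAt_snd) fun _ => rfl)
  have hjj0 : ∀ i, jj i 0 = 0 := fun i => Prod.ext rfl (hinit0 i)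
  have uΦj : UA (fun i p => Φ i (jj i p)) := hΦ.comp ujj hjj0
  have uΨ : UA (fun i p => (Φ i (jj i p)).1) := uΦj.clm (ContinuousLinearMap.fst ℝ _ _)
  set Ψ : I → ℝ × Eu d → Eu (d + 1) := fun i p => (Φ i (jj i p)).1 with hΨdef
  have hΨ0 : ∀ i, Ψ i 0 = 0 := fun i => by
    simp only [Ψ, hjj0 i, hΦ0 i]; rfl
  -- a common neighbourhood
  have hinv := hG.inverse.2
  obtain ⟨ρG, hρG, hGb⟩ := Metric.eventually_nhds_iff_ball.1 (hinv.and hG.ua.eventually_analyticAt)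
  obtain ⟨B, hB⟩ := uΨ.fderiv.bounded
  have e1 : ∀ᶠ p in 𝓝 (0 : ℝ × Eu d), ∀ i, AnalyticAt ℝ (Ψ i) p := uΨ.eventually_analyticAt
  have e2 : ∀ᶠ p in 𝓝 (0 : ℝ × Eu d), ∀ i, AnalyticAt ℝ (fun p => Φ i (jj i p)) p :=
    uΦj.eventually_analyticAt
  have e3 : ∀ᶠ p in 𝓝 (0 : ℝ × Eu d), ∀ i, ‖Ψ i p‖ < min ρG (1 / 2) :=
    uΨ.eventually_lt hΨ0 (lt_min hρG (by norm_num))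
  obtain ⟨r₁, hr₁, hr₁b⟩ := Metric.eventually_nhds_iff_ball.1 (e1.and (e2.and (e3.and hB)))
  obtain ⟨r₂, hr₂, hr₂b⟩ := Metric.eventually_nhds_iff_ball.1
    (hN.and (hF.eventually_analyticAt.and (uinit.eventually_lt hinit0 hρ)))
  -- the linear estimate
  have hder0 : ∀ i t v, |t| < min ρ (min r₁ r₂) → ‖v‖ < min ρ (min r₁ r₂) →
      Φ i (jj i (0, v)) = init i v ∧
      HasDerivAt (fun s => Φ i (jj i (s, v))) (X i (Φ i (jj i (t, v)))) t := by
    intro i t v ht hv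
    refine hflow i t (init i v) (ht.trans_le (min_le_left _ _)) ?_
    exact (hr₂b v (mem_ball_zero_iff.2 (hv.trans_le ((min_le_right _ _).trans (min_le_right _ _))))).2.2 i
  set r₃ := min ρ (min r₁ r₂) with hr₃
  have hr₃pos : 0 < r₃ := lt_min hρ (lt_min hr₁ hr₂)
  have hr₃1 : r₃ ≤ r₁ := (min_le_right _ _).trans (min_le_left _ _)
  have hr₃2 : r₃ ≤ r₂ := (min_le_right _ _).trans (min_le_right _ _)
  have hU : ∀ i, ∀ p ∈ Metric.ball (0 : ℝ × Eu d) r₃,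
      fderiv ℝ (Ψ i) p (1, 0) = ν i + (Φ i (jj i p)).2 := by
    rintro i ⟨t, v⟩ hp
    obtain ⟨ht, hv⟩ := mem_ball_prod.1 hp
    have h1 := hasDerivAt_slice ((hr₁b _ (Metric.ball_subset_ball hr₃1 hp)).1 i).differentiableAt
    exact h1.unique (hder0 i t v ht hv).2.fst
  have hUU : ∀ i, ∀ p ∈ Metric.ball (0 : ℝ × Eu d) r₃,
      fderiv ℝ (fun q => fderiv ℝ (Ψ i) q (1, 0)) p (1, 0)
        = -(gammaSharp (G i) (Ψ i p) (fderiv ℝ (Ψ i) p (1, 0)) (fderiv ℝ (Ψ i) p (1, 0))) := by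
    rintro i ⟨t, v⟩ hp
    obtain ⟨ht, hv⟩ := mem_ball_prod.1 hp
    have hΨa := (hr₁b _ (Metric.ball_subset_ball hr₃1 hp)).1 i
    have hdiff : DifferentiableAt ℝ (fun q => fderiv ℝ (Ψ i) q (1, 0)) (t, v) :=
      hΨa.fderiv.differentiableAt.clm_apply (differentiableAt_const _)
    have h1 := hasDerivAt_slice hdiff
    have h2 : (fun s => fderiv ℝ (Ψ i) (s, v) (1, 0)) =ᶠ[𝓝 t]
        fun s => ν i + (Φ i (jj i (s, v))).2 := by
      have : ∀ᶠ s in 𝓝 t, |s| < r₃ := continuous_abs.continuousAt.eventually_lt_const ht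
      filter_upwards [this] with s hs using hU i _ (mem_ball_prod.2 ⟨hs, hv⟩)
    have h3 : HasDerivAt (fun s => ν i + (Φ i (jj i (s, v))).2)
        (X i (Φ i (jj i (t, v)))).2 t := HasDerivAt.const_add (ν i) (hder0 i t v ht hv).2.snd
    rw [h1.unique (HasDerivAt.congr_of_eventuallyEq h3 h2), hU i _ hp]
  have hinitΨ : ∀ i, ∀ v ∈ Metric.ball (0 : Eu d) r₃, Ψ i (0, v) = graphMap (F i) v := by
    intro i v hv
    have := (hder0 i 0 v (by simpa using hr₃pos) (mem_ball_zero_iff.1 hv)).1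
    simp only [Ψ, this]
    rfl
  have hinitU : ∀ i, ∀ v ∈ Metric.ball (0 : Eu d) r₃, fderiv ℝ (Ψ i) (0, v) (1, 0) = N i v := by
    intro i v hv
    have h0 : ((0 : ℝ), v) ∈ Metric.ball (0 : ℝ × Eu d) r₃ :=
      mem_ball_prod.2 ⟨by simpa using hr₃pos, mem_ball_zero_iff.1 hv⟩
    rw [hU i _ h0, (hder0 i 0 v (by simpa using hr₃pos) (mem_ball_zero_iff.1 hv)).1]
    simp [init]
  have hinitV : ∀ i, ∀ v ∈ Metric.ball (0 : Eu d) r₃, ∀ w,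
      fderiv ℝ (Ψ i) (0, v) (0, w) = fderiv ℝ (graphMap (F i)) v w := by
    intro i v hv w
    have h0 : ((0 : ℝ), v) ∈ Metric.ball (0 : ℝ × Eu d) r₃ :=
      mem_ball_prod.2 ⟨by simpa using hr₃pos, mem_ball_zero_iff.1 hv⟩
    have hΨa := ((hr₁b _ (Metric.ball_subset_ball hr₃1 h0)).1 i).differentiableAt.hasFDerivAt
    have h1 : HasFDerivAt (fun x : Eu d => Ψ i (0, x))
        ((fderiv ℝ (Ψ i) (0, v)).comp (ContinuousLinearMap.inr ℝ ℝ (Eu d))) v :=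
      hΨa.comp v (hasFDerivAt_prodMk_right 0 v)
    have h2 : (fun x : Eu d => Ψ i (0, x)) =ᶠ[𝓝 v] graphMap (F i) := by
      filter_upwards [Metric.isOpen_ball.mem_nhds hv] with x hx using hinitΨ i x hx
    rw [← h2.fderiv_eq, h1.fderiv]
    rfl
  have hgauss : ∀ i, _ := fun i => gauss_lemma (G := G i) (Ψ := Ψ i) (r := r₃) (hsymm i)
    (fun p hp => (hr₁b p (Metric.ball_subset_ball hr₃1 hp)).1 i)
    (fun p hp => (hGb (Ψ i p) (mem_ball_zero_iff.2 (((hr₁b p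
      (Metric.ball_subset_ball hr₃1 hp)).2.2.1 i).trans_le (min_le_left _ _)))).2 i)
    (fun p hp w => by
      have hi := (hGb (Ψ i p) (mem_ball_zero_iff.2 (((hr₁b p
        (Metric.ball_subset_ball hr₃1 hp)).2.2.1 i).trans_le (min_le_left _ _)))).1 i
      rw [hUU i p hp, map_neg, neg_apply, form_gammaSharp hi, neg_add_cancel])
    (fun v hv => by
      rw [hinitΨ i v hv, hinitU i v hv]
      exact ((hr₂b v (Metric.ball_subset_ball hr₃2 hv)).1 i).unit)
    (fun v hv w => by
      rw [hinitΨ i v hv, hinitU i v hv, hinitV i v hv]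
      exact ((hr₂b v (Metric.ball_subset_ball hr₃2 hv)).1 i).normal w)
  -- expansion
  have h00 : (0 : Eu d) ∈ Metric.ball (0 : Eu d) r₃ := Metric.mem_ball_self hr₃pos
  have hFd : ∀ i, DifferentiableAt ℝ (F i) 0 := fun i =>
    (hF.eventually_analyticAt.self_of_nhds i).differentiableAt
  obtain ⟨K₁, hK₁⟩ := hF.conormal.bounded_zero
  obtain ⟨K₂, hK₂⟩ := hG.ua.bounded_zero
  -- The image of `(t, w)` is `t ν` plus a vector tangent to the graph. The conormal annihilates the
  -- latter and has product `-1 / l` with `ν`, so it recovers `t`; the first `d` coordinates then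
  -- recover `w`.
  have hlow : ∃ K > 0, ∀ i, ∀ p : ℝ × Eu d, ‖p‖ ≤ K * ‖fderiv ℝ (Ψ i) 0 p‖ := by
    set A := |K₂| * |C| * |K₁| with hA
    have hA0 : 0 ≤ A := by positivity
    refine ⟨A + (‖initL d‖ + A * (‖initL d‖ * |C|)) + 1, by positivity, ?_⟩
    rintro i ⟨t, w⟩
    set y := fderiv ℝ (Ψ i) 0 (t, w) with hy
    have hydec : y = t • ν i + fderiv ℝ (graphMap (F i)) 0 w := by
      have h1 : ((t, w) : ℝ × Eu d) = t • (1, 0) + (0, w) := by simp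
      rw [hy, h1, map_add, map_smul]
      have := hinitU i 0 h00
      have h2 := hinitV i 0 h00 w
      rw [hN0] at this
      rw [show ((0 : ℝ), (0 : Eu d)) = 0 from rfl] at this h2
      rw [this, h2]
    obtain ⟨l, hl, hl0, -, hlc⟩ := (hν i).exists_smul (hFd i)
    have hl' : |l| ≤ |K₂| * |C| := by
      refine hl.trans ?_
      rw [hg0]
      gcongr
      · exact (hK₂ i).trans (le_abs_self _)
      · exact (hC i).trans (le_abs_self _)
    have ht : |t| ≤ A * ‖y‖ := by
      have h1 : conormal (F i) 0 y = t * conormal (F i) 0 (ν i) := by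
        rw [hydec, map_add, map_smul, conormal_graph (hFd i), add_zero, smul_eq_mul]
      have h2 : t = -(l * conormal (F i) 0 y) := by
        rw [h1]; linear_combination t * hlc
      rw [h2, abs_neg, abs_mul]
      calc |l| * |conormal (F i) 0 y| ≤ |K₂| * |C| * (|K₁| * ‖y‖) := by
            gcongr
            refine ((conormal (F i) 0).le_opNorm y).trans ?_
            gcongr
            exact (hK₁ i).trans (le_abs_self _)
        _ = A * ‖y‖ := by rw [hA]; ring
    have hw : ‖w‖ ≤ (‖initL d‖ + A * (‖initL d‖ * |C|)) * ‖y‖ := by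
      have h1 : w = initL d y - t • initL d (ν i) := by
        rw [hydec, map_add, map_smul, fderiv_graphMap (hFd i)]
        simp
      calc ‖w‖ = ‖initL d y - t • initL d (ν i)‖ := by rw [← h1]
        _ ≤ ‖initL d‖ * ‖y‖ + |t| * (‖initL d‖ * |C|) := by
            refine (norm_sub_le _ _).trans ?_
            rw [norm_smul, Real.norm_eq_abs]
            gcongr
            · exact (initL d).le_opNorm y
            · refine ((initL d).le_opNorm _).trans ?_
              gcongr
              exact (hC i).trans (le_abs_self _)
        _ ≤ ‖initL d‖ * ‖y‖ + (A * ‖y‖) * (‖initL d‖ * |C|) := by gcongr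
        _ = _ := by ring
    have hB0 : 0 ≤ ‖initL d‖ + A * (‖initL d‖ * |C|) := by positivity
    have hy0 := norm_nonneg y
    rw [Prod.norm_def]
    refine max_le ?_ ?_
    · simp only [Real.norm_eq_abs]; nlinarith
    · simp only; nlinarith
  obtain ⟨K, hK, hKlow⟩ := hlow
  -- The linearization expands by `K⁻¹`. An error of half that size leaves the factor `(2 K)⁻¹`.
  obtain ⟨r₄, hr₄, hstrict⟩ := uΨ.strict (ε := (2 * K)⁻¹) (by positivity)
  refine ⟨Ψ, uΨ, fun i => ?_, min r₃ r₄, lt_min hr₃pos hr₄, (2 * K)⁻¹, by positivity,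
    |B| * 1, fun i => ?_⟩
  · have := hinitU i 0 h00
    rw [hN0] at this
    exact this
  · have hb3 : Metric.ball (0 : ℝ × Eu d) (min r₃ r₄) ⊆ Metric.ball 0 r₃ :=
      Metric.ball_subset_ball (min_le_left _ _)
    have hb1 : Metric.ball (0 : ℝ × Eu d) (min r₃ r₄) ⊆ Metric.ball 0 r₁ :=
      hb3.trans (Metric.ball_subset_ball hr₃1)
    have hv3 : Metric.ball (0 : Eu d) (min r₃ r₄) ⊆ Metric.ball 0 r₃ :=
      Metric.ball_subset_ball (min_le_left _ _)
    refine
      { analytic := fun p hp => (hr₁b p (hb1 hp)).1 i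
        analytic_graph := fun v hv =>
          (hr₂b v (Metric.ball_subset_ball hr₃2 (hv3 hv))).2.1 i
        initial := fun v hv => hinitΨ i v (hv3 hv)
        geodesic := fun p hp w => ?_
        unit := fun p hp => (hgauss i p (hb3 hp)).1
        orth := fun p hp w => (hgauss i p (hb3 hp)).2 w
        expand := fun p hp q hq => ?_
        small := fun p hp => ((hr₁b p (hb1 hp)).2.2.1 i).trans_le (min_le_right _ _)
        speed := fun p hp => ?_ }
    · have hi := (hGb (Ψ i p) (mem_ball_zero_iff.2 (((hr₁b p (hb1 hp)).2.2.1 i).trans_le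
        (min_le_left _ _)))).1 i
      rw [hUU i p (hb3 hp), map_neg, neg_apply, form_gammaSharp hi, neg_add_cancel]
    · have h1 := hstrict i p (Metric.ball_subset_ball (min_le_right _ _) hp) q
        (Metric.ball_subset_ball (min_le_right _ _) hq)
      have h2 := hKlow i (p - q)
      have h3 : ‖fderiv ℝ (Ψ i) 0 (p - q)‖
          ≤ ‖Ψ i p - Ψ i q‖ + ‖Ψ i p - Ψ i q - fderiv ℝ (Ψ i) 0 (p - q)‖ := by
        have := norm_sub_le (Ψ i p - Ψ i q) (Ψ i p - Ψ i q - fderiv ℝ (Ψ i) 0 (p - q))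
        simpa using this
      have h4 : K⁻¹ * ‖p - q‖ ≤ ‖fderiv ℝ (Ψ i) 0 (p - q)‖ := by
        rw [inv_mul_le_iff₀ hK]; exact h2
      have h5 : K⁻¹ = (2 * K)⁻¹ + (2 * K)⁻¹ := by field_simp; norm_num
      rw [h5] at h4
      linarith
    · refine ((fderiv ℝ (Ψ i) p).le_opNorm _).trans ?_
      gcongr
      · exact ((hr₁b p (hb1 hp)).2.2.2 i).trans (le_abs_self _)
      · simp [Prod.norm_def]

end GaussFlow
end BAG

end

noncomputable section
namespace BAG

open Filter
open scoped BoundedContinuousFunction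

/-! ### Tensors and their coordinate expressions -/

section Charts

variable {n : ℕ} {M : Type*} [TopologicalSpace M] [ChartedSpace (Eu n) M]

/-- The value of a covariant tensor, as a form on the model space. -/
def formAt (g : Cov2 n M) (x : M) : Form n := g x

/-- The differential of a chart, as an endomorphism of the model space. -/
def dchart (φ : OpenPartialHomeomorph M (Eu n)) (x : M) : Eu n →L[ℝ] Eu n :=
  mfderiv (𝓡 n) (𝓡 n) φ x

/-- The differential of the inverse of a chart, as an endomorphism of the model space. -/
def dsymm (φ : OpenPartialHomeomorph M (Eu n)) (v : Eu n) : Eu n →L[ℝ] Eu n :=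
  mfderiv (𝓡 n) (𝓡 n) φ.symm v

lemma coordCov_eq (φ : OpenPartialHomeomorph M (Eu n)) (g : Cov2 n M) (v : Eu n) :
    coordCov φ g v = pullForm (formAt g (φ.symm v)) (dsymm φ v) := rfl

variable [IsManifold (𝓡 n) ω M] {φ φ' : OpenPartialHomeomorph M (Eu n)}

lemma contMDiffAt_chart (hφ : φ ∈ IsManifold.maximalAtlas (𝓡 n) ω M) {x : M}
    (hx : x ∈ φ.source) : ContMDiffAt (𝓡 n) (𝓡 n) ω φ x :=
  contMDiffAt_of_mem_maximalAtlas hφ hx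

lemma contMDiffAt_chart_symm (hφ : φ ∈ IsManifold.maximalAtlas (𝓡 n) ω M) {v : Eu n}
    (hv : v ∈ φ.target) : ContMDiffAt (𝓡 n) (𝓡 n) ω φ.symm v :=
  contMDiffAt_symm_of_mem_maximalAtlas hφ hv

lemma mdifferentiable_chart_of_mem (hφ : φ ∈ IsManifold.maximalAtlas (𝓡 n) ω M) :
    φ.MDifferentiable (𝓡 n) (𝓡 n) :=
  ⟨fun x hx => ((contMDiffAt_chart hφ hx).mdifferentiableAt (by simp)).mdifferentiableWithinAt,
   fun v hv => ((contMDiffAt_chart_symm hφ hv).mdifferentiableAt (by simp)).mdifferentiableWithinAt⟩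

lemma dchart_comp_dsymm (hφ : φ ∈ IsManifold.maximalAtlas (𝓡 n) ω M) {v : Eu n}
    (hv : v ∈ φ.target) : dchart φ (φ.symm v) ∘L dsymm φ v = ContinuousLinearMap.id ℝ (Eu n) :=
  (mdifferentiable_chart_of_mem hφ).comp_symm_deriv hv

lemma dsymm_comp_dchart (hφ : φ ∈ IsManifold.maximalAtlas (𝓡 n) ω M) {x : M}
    (hx : x ∈ φ.source) : dsymm φ (φ x) ∘L dchart φ x = ContinuousLinearMap.id ℝ (Eu n) :=
  (mdifferentiable_chart_of_mem hφ).symm_comp_deriv hx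

lemma analyticAt_transition (hφ : φ ∈ IsManifold.maximalAtlas (𝓡 n) ω M)
    (hφ' : φ' ∈ IsManifold.maximalAtlas (𝓡 n) ω M) {v : Eu n} (hv : v ∈ φ.target)
    (hv' : φ.symm v ∈ φ'.source) : AnalyticAt ℝ (fun u => φ' (φ.symm u)) v := by
  have h := (contMDiffAt_chart hφ' hv').comp v (contMDiffAt_chart_symm hφ hv)
  exact (contMDiffAt_iff_contDiffAt.1 h).analyticAt

lemma dsymm_transition (hφ : φ ∈ IsManifold.maximalAtlas (𝓡 n) ω M)
    (hφ' : φ' ∈ IsManifold.maximalAtlas (𝓡 n) ω M) {v : Eu n} (hv : v ∈ φ.target)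
    (hv' : φ.symm v ∈ φ'.source) :
    dsymm φ v = dsymm φ' (φ' (φ.symm v)) ∘L fderiv ℝ (fun u => φ' (φ.symm u)) v := by
  have hκ := (analyticAt_transition hφ hφ' hv hv').differentiableAt
  have h1 : φ.symm =ᶠ[𝓝 v] φ'.symm ∘ fun u => φ' (φ.symm u) := by
    filter_upwards [(φ.continuousAt_symm hv).preimage_mem_nhds (φ'.open_source.mem_nhds hv')]
      with u hu
    exact (φ'.left_inv hu).symm
  have h2 : mfderiv (𝓡 n) (𝓡 n) φ.symm v
      = mfderiv (𝓡 n) (𝓡 n) (φ'.symm ∘ fun u => φ' (φ.symm u)) v := h1.mfderiv_eq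
  have h3 := mfderiv_comp v (I' := 𝓡 n) (I'' := 𝓡 n)
    ((contMDiffAt_chart_symm hφ' (φ'.map_source hv')).mdifferentiableAt (by simp))
    (mdifferentiableAt_iff_differentiableAt.2 hκ)
  rw [mfderiv_eq_fderiv] at h3
  exact h2.trans h3

lemma fderiv_transition (hφ : φ ∈ IsManifold.maximalAtlas (𝓡 n) ω M)
    (hφ' : φ' ∈ IsManifold.maximalAtlas (𝓡 n) ω M) {v : Eu n} (hv : v ∈ φ.target)
    (hv' : φ.symm v ∈ φ'.source) :
    fderiv ℝ (fun u => φ' (φ.symm u)) v = dchart φ' (φ.symm v) ∘L dsymm φ v := by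
  have h := dchart_comp_dsymm hφ' (φ'.map_source hv')
  rw [φ'.left_inv hv'] at h
  rw [dsymm_transition hφ hφ' hv hv', ← ContinuousLinearMap.comp_assoc, h,
    ContinuousLinearMap.id_comp]

lemma coordCov_transition (hφ : φ ∈ IsManifold.maximalAtlas (𝓡 n) ω M)
    (hφ' : φ' ∈ IsManifold.maximalAtlas (𝓡 n) ω M) (g : Cov2 n M) {v : Eu n} (hv : v ∈ φ.target)
    (hv' : φ.symm v ∈ φ'.source) :
    coordCov φ g v = pullForm (coordCov φ' g (φ' (φ.symm v)))
      (fderiv ℝ (fun u => φ' (φ.symm u)) v) := by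
  rw [coordCov_eq, coordCov_eq, pullForm_pullForm, ← dsymm_transition hφ hφ' hv hv',
    φ'.left_inv hv']

lemma formAt_eq (hφ : φ ∈ IsManifold.maximalAtlas (𝓡 n) ω M) (g : Cov2 n M) {x : M}
    (hx : x ∈ φ.source) : formAt g x = pullForm (coordCov φ g (φ x)) (dchart φ x) := by
  rw [coordCov_eq, pullForm_pullForm, dsymm_comp_dchart hφ hx, φ.left_inv hx]
  rfl

/-- The tangent bundle is trivialized at `x₀` by the differential of the preferred chart, so the
inverse trivialization is that of the inverse chart. This makes smoothness of sections checkable on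
coordinate expressions. -/
lemma inCoordinates_form {x₀ x : M} (hx : x ∈ (chartAt (Eu n) x₀).source)
    (A : TangentSpace (𝓡 n) x →L[ℝ] TangentSpace (𝓡 n) x →L[ℝ] ℝ) :
    ContinuousLinearMap.inCoordinates (Eu n) (TangentSpace (𝓡 n)) (Eu n →L[ℝ] ℝ)
      (fun x : M => TangentSpace (𝓡 n) x →L[ℝ] ℝ) x₀ x x₀ x A
      = pullForm (show Form n from A) (dsymm (chartAt (Eu n) x₀) (chartAt (Eu n) x₀ x)) := by
  have hb : x ∈ (trivializationAt (Eu n) (TangentSpace (𝓡 n)) x₀).baseSet := by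
    simpa using hx
  have hs : ∀ v, (trivializationAt (Eu n) (TangentSpace (𝓡 n)) x₀).symm x v
      = dsymm (chartAt (Eu n) x₀) (chartAt (Eu n) x₀ x) v := by
    intro v
    have h := DFunLike.congr_fun
      (TangentBundle.symmL_trivializationAt (I := 𝓡 n) (𝕜 := ℝ) hx) v
    rw [show Set.range (𝓡 n) = Set.univ from Set.range_id, mfderivWithin_univ] at h
    have h1 : (trivializationAt (Eu n) (TangentSpace (𝓡 n)) x₀).symmL ℝ x v
        = (trivializationAt (Eu n) (TangentSpace (𝓡 n)) x₀).symm x v :=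
      Bundle.Trivialization.symmL_apply _ hb v
    exact h1.symm.trans h
  ext v w
  refine (inCoordinates_apply_eq₂ (E₃ := fun _ : M => ℝ) (F₃ := ℝ) hb hb (Set.mem_univ _)).trans ?_
  rw [hs, hs, pullForm_apply]
  exact DFunLike.congr_fun (Bundle.Trivial.linearMapAt_trivialization ℝ M ℝ x) _

/-- Smoothness of a covariant tensor along a map, in coordinates. -/
lemma contMDiffAt_form_iff {E H N : Type*} [NormedAddCommGroup E] [NormedSpace ℝ E]
    [TopologicalSpace H] {J : ModelWithCorners ℝ E H} [TopologicalSpace N] [ChartedSpace H N]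
    {k : WithTop ℕ∞} {f : N → M} {p₀ : N} (A : ∀ p, TangentSpace (𝓡 n) (f p) →L[ℝ] TangentSpace (𝓡 n) (f p) →L[ℝ] ℝ)
    (hf : ContMDiffAt J (𝓡 n) k f p₀) :
    ContMDiffAt J ((𝓡 n).prod 𝓘(ℝ, Eu n →L[ℝ] Eu n →L[ℝ] ℝ)) k
      (fun p => Bundle.TotalSpace.mk' (Eu n →L[ℝ] Eu n →L[ℝ] ℝ)
        (E := fun x : M => TangentSpace (𝓡 n) x →L[ℝ] TangentSpace (𝓡 n) x →L[ℝ] ℝ) (f p) (A p)) p₀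
    ↔ ContMDiffAt J 𝓘(ℝ, Form n) k (fun p => pullForm (show Form n from A p)
        (dsymm (chartAt (Eu n) (f p₀)) (chartAt (Eu n) (f p₀) (f p)))) p₀ := by
  rw [contMDiffAt_hom_bundle]
  have h : (fun p => ContinuousLinearMap.inCoordinates (Eu n) (TangentSpace (𝓡 n)) (Eu n →L[ℝ] ℝ)
      (fun x : M => TangentSpace (𝓡 n) x →L[ℝ] ℝ) (f p₀) (f p) (f p₀) (f p) (A p)) =ᶠ[𝓝 p₀]
      fun p => pullForm (show Form n from A p)
        (dsymm (chartAt (Eu n) (f p₀)) (chartAt (Eu n) (f p₀) (f p))) := by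
    filter_upwards [hf.continuousAt.preimage_mem_nhds (chart_source_mem_nhds (Eu n) (f p₀))]
      with p hp using inCoordinates_form hp (A p)
  exact ⟨fun h' => h'.2.congr_of_eventuallyEq h.symm, fun h' => ⟨hf, h'.congr_of_eventuallyEq h⟩⟩

/-- The coordinate expressions of an analytic tensor are analytic. -/
lemma analyticAt_coordCov {g : Cov2 n M}
    (hg : ContMDiff (𝓡 n) ((𝓡 n).prod 𝓘(ℝ, Eu n →L[ℝ] Eu n →L[ℝ] ℝ)) ω
      (fun x : M => Bundle.TotalSpace.mk' (Eu n →L[ℝ] Eu n →L[ℝ] ℝ)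
        (E := fun x : M => TangentSpace (𝓡 n) x →L[ℝ] TangentSpace (𝓡 n) x →L[ℝ] ℝ) x (g x)))
    (hφ : φ ∈ IsManifold.maximalAtlas (𝓡 n) ω M) {v : Eu n} (hv : v ∈ φ.target) :
    AnalyticAt ℝ (coordCov φ g) v := by
  set x₀ := φ.symm v with hx₀
  set θ := chartAt (Eu n) x₀ with hθdef
  have hθ : θ ∈ IsManifold.maximalAtlas (𝓡 n) ω M := IsManifold.chart_mem_maximalAtlas x₀
  have hx₀θ : x₀ ∈ θ.source := mem_chart_source _ _
  have h1 := (contMDiffAt_form_iff g contMDiffAt_id).1 (hg x₀)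
  have h2 : ContMDiffAt (𝓡 n) 𝓘(ℝ, Form n) ω (fun v => pullForm (formAt g (θ.symm v))
      (dsymm θ (θ (θ.symm v)))) (θ x₀) := by
    refine ContMDiffAt.comp (θ x₀) (I' := 𝓡 n) (g := fun p => pullForm (formAt g p)
      (dsymm θ (θ p))) ?_ (contMDiffAt_chart_symm hθ (θ.map_source hx₀θ))
    rw [θ.left_inv hx₀θ]
    exact h1
  have h3 : AnalyticAt ℝ (coordCov θ g) (θ x₀) := by
    refine (contMDiffAt_iff_contDiffAt.1 (h2.congr_of_eventuallyEq ?_)).analyticAt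
    filter_upwards [θ.open_target.mem_nhds (θ.map_source hx₀θ)] with u hu
    rw [θ.right_inv hu]
    rfl
  have hκ := analyticAt_transition hφ hθ hv hx₀θ
  refine (AnalyticAt.pullForm (AnalyticAt.comp (f := fun u => θ (φ.symm u)) h3 hκ) hκ.fderiv).congr ?_
  filter_upwards [φ.open_target.mem_nhds hv,
    (φ.continuousAt_symm hv).preimage_mem_nhds (θ.open_source.mem_nhds hx₀θ)] with u hu hu'
  exact (coordCov_transition hφ hθ g hu hu').symm

end Charts
end BAG

end

noncomputable section
namespace BAG

open Filter
open scoped BoundedContinuousFunction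

/-! ### Linear algebra of Lorentzian forms -/

section Forms

variable {n d : ℕ}

lemma finrank_dual_eu : Module.finrank ℝ (Eu n →L[ℝ] ℝ) = n := by
  rw [← (LinearMap.toContinuousLinearMap (𝕜 := ℝ) (E := Eu n) (F' := ℝ)).finrank_eq]
  rw [Subspace.dual_finrank_eq, finrank_euclideanSpace_fin]

lemma isInvertible_of_injective {E F : Type*} [NormedAddCommGroup E] [NormedSpace ℝ E]
    [FiniteDimensional ℝ E] [NormedAddCommGroup F] [NormedSpace ℝ F] [FiniteDimensional ℝ F]
    (hEF : Module.finrank ℝ E = Module.finrank ℝ F) {L : E →L[ℝ] F}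
    (hL : Function.Injective L) : L.IsInvertible :=
  ⟨(LinearEquiv.ofInjectiveOfFinrankEq (L : E →ₗ[ℝ] F) hL hEF).toContinuousLinearEquiv, rfl⟩

lemma isInvertible_form {B : Form n} (hB : ∀ u, B u = 0 → u = 0) : B.IsInvertible :=
  isInvertible_of_injective (by rw [finrank_dual_eu, finrank_euclideanSpace_fin])
    ((injective_iff_map_eq_zero B).2 hB)

lemma exists_bounded_inverse {B : Form n} {C : ℝ} (hC : 0 ≤ C) (hB : ∀ a, ‖a‖ ≤ C * ‖B a‖) :
    ∃ A : (Eu n →L[ℝ] ℝ) →L[ℝ] Eu n, ‖A‖ ≤ C ∧ A.comp B = ContinuousLinearMap.id ℝ _ ∧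
      B.comp A = ContinuousLinearMap.id ℝ _ := by
  have hi : B.IsInvertible := isInvertible_form fun u hu => by
    have := hB u
    rw [hu, norm_zero, mul_zero] at this
    exact norm_le_zero_iff.1 this
  refine ⟨B.inverse, ContinuousLinearMap.opNorm_le_bound _ hC fun β => ?_,
    hi.inverse_comp_self, hi.self_comp_inverse⟩
  have := hB (B.inverse β)
  rwa [hi.self_apply_inverse] at this

lemma norm_le_of_form_lower {B : Form n} {c : ℝ} (hc : 0 < c) (h : ∀ a, c⁻¹ * ‖a‖ ^ 2 ≤ B a a)
    (a : Eu n) : ‖a‖ ≤ c * ‖B a‖ := by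
  have h1 := h a
  have h2 : B a a ≤ ‖B a‖ * ‖a‖ := (le_abs_self _).trans ((B a).le_opNorm a)
  rcases (norm_nonneg a).eq_or_lt with h0 | h0
  · rw [← h0]; positivity
  · have h3 : c⁻¹ * ‖a‖ ^ 2 ≤ ‖B a‖ * ‖a‖ := h1.trans h2
    rw [inv_mul_le_iff₀ hc] at h3
    nlinarith

/-- The signature of a form is `(-, +, …, +)`. -/
structure IsLorentzForm (B : Form n) : Prop where
  symm : ∀ v w, B v w = B w v
  signature : ∃ v, B v v < 0 ∧ ∀ w, B v w = 0 → w ≠ 0 → 0 < B w w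

variable {B : Form n}

/-- The signature is known through one timelike vector `v` only. If `w` were not spacelike, a
combination of `u` and `w` orthogonal to `v` would be nonzero with nonpositive square. -/
lemma IsLorentzForm.pos_of_orthogonal (hB : IsLorentzForm B) {u w : Eu n} (hu : B u u < 0)
    (huw : B u w = 0) (hw : w ≠ 0) : 0 < B w w := by
  obtain ⟨v, hv, hpos⟩ := hB.signature
  by_contra! hneg
  have hu0 : u ≠ 0 := by rintro rfl; simp at hu
  have hvu : B v u ≠ 0 := fun h => absurd (hpos u h hu0) (by linarith)
  set z := B v w • u - B v u • w with hz
  have h1 : B v z = 0 := by simp [hz]; ring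
  have h2 : B z z = B v w ^ 2 * B u u + B v u ^ 2 * B w w := by
    simp [hz, huw, hB.symm w u]; ring
  have h3 : z ≠ 0 := by
    intro h0
    have h4 : B u z = 0 := by rw [h0, map_zero]
    have h5 : B v w * B u u = 0 := by simpa [hz, huw] using h4
    have h6 : B v w = 0 := (mul_eq_zero.1 h5).resolve_right hu.ne
    rw [hz, h6, zero_smul, zero_sub, neg_eq_zero, smul_eq_zero] at h0
    exact h0.elim hvu hw
  have h7 := hpos z h1 h3
  rw [h2] at h7
  nlinarith [sq_nonneg (B v w), sq_nonneg (B v u)]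

lemma IsLorentzForm.ne_zero_of_timelike (hB : IsLorentzForm B) {u v : Eu n} (hu : B u u < 0)
    (hv : B v v < 0) : B u v ≠ 0 := fun h =>
  absurd (hB.pos_of_orthogonal hu h (by rintro rfl; simp at hv)) (by linarith)

lemma IsLorentzForm.isInvertible (hB : IsLorentzForm B) : B.IsInvertible := by
  refine isInvertible_form fun u hu => ?_
  obtain ⟨v, hv, hpos⟩ := hB.signature
  by_contra h0
  have := hpos u (by rw [hB.symm, hu]; rfl) h0
  rw [hu] at this
  simp at this

lemma IsLorentzForm.pull (hB : IsLorentzForm B) {L L' : Eu n →L[ℝ] Eu n}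
    (h : L ∘L L' = ContinuousLinearMap.id ℝ (Eu n)) : IsLorentzForm (pullForm B L) := by
  have hLL : ∀ v, L (L' v) = v := fun v => DFunLike.congr_fun h v
  have hinj : Function.Injective L := by
    have : Function.Surjective (L : Eu n →ₗ[ℝ] Eu n) := fun v => ⟨L' v, hLL v⟩
    exact LinearMap.injective_iff_surjective.2 this
  refine ⟨fun v w => by simp only [pullForm_apply]; exact hB.symm _ _, ?_⟩
  obtain ⟨v, hv, hpos⟩ := hB.signature
  refine ⟨L' v, by simpa only [pullForm_apply, hLL] using hv, fun w h1 h2 => ?_⟩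
  rw [pullForm_apply, hLL] at h1
  exact hpos _ h1 fun h0 => h2 (hinj (h0.trans (map_zero L).symm))

variable {B : Form (d + 1)} {D : Eu d →L[ℝ] Eu (d + 1)}

/-- A vector orthogonal to a spacelike hyperplane splits off the hyperplane. -/
lemma exists_decomposition (hpos : ∀ w, w ≠ 0 → 0 < B (D w) (D w)) {ν : Eu (d + 1)} (hν : ν ≠ 0)
    (hort : ∀ w, B ν (D w) = 0) (v : Eu (d + 1)) : ∃ (w : Eu d) (c : ℝ), v = D w + c • ν := by
  let L : Eu d × ℝ →ₗ[ℝ] Eu (d + 1) :=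
    (D : Eu d →ₗ[ℝ] Eu (d + 1)).coprod (LinearMap.toSpanSingleton ℝ _ ν)
  have hL : ∀ w c, L (w, c) = D w + c • ν := fun w c => rfl
  have hinj : Function.Injective L := by
    refine (injective_iff_map_eq_zero L).2 ?_
    rintro ⟨w, c⟩ h
    rw [hL] at h
    have hw : w = 0 := by
      by_contra hw
      have h1 : B (D w + c • ν) (D w) = 0 := by rw [h]; simp
      rw [map_add, map_smul, add_apply, smul_apply, hort, smul_zero,
        add_zero] at h1
      exact (hpos w hw).ne' h1
    rw [hw, map_zero, zero_add, smul_eq_zero] at h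
    rw [hw, h.resolve_right hν]; rfl
  have hsurj : Function.Surjective L :=
    (LinearMap.injective_iff_surjective_of_finrank_eq_finrank (by simp)).1 hinj
  obtain ⟨⟨w, c⟩, h⟩ := hsurj v
  exact ⟨w, c, h.symm⟩

/-- A nonzero normal exists since `d + 1` exceeds `d`. It is timelike, for otherwise the form would
be nonnegative on the span of the hyperplane and the normal, which is everything. The sign is fixed
by `τ`, as two timelike vectors are never orthogonal. -/
lemma exists_unit_normal (hB : IsLorentzForm B) (hpos : ∀ w, w ≠ 0 → 0 < B (D w) (D w))
    {τ : Eu (d + 1)} (hτ : B τ τ < 0) :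
    ∃ ν, B ν ν = -1 ∧ (∀ w, B ν (D w) = 0) ∧ B ν τ < 0 := by
  let L : Eu (d + 1) →ₗ[ℝ] (Eu d →L[ℝ] ℝ) := (D.precomp ℝ ∘L B : Eu (d + 1) →L[ℝ] (Eu d →L[ℝ] ℝ))
  have hker : ∃ ν, L ν = 0 ∧ ν ≠ 0 := by
    have : ¬ Function.Injective L := fun h => by
      have := LinearMap.finrank_le_finrank_of_injective h
      rw [finrank_dual_eu, finrank_euclideanSpace_fin] at this
      omega
    rw [injective_iff_map_eq_zero] at this
    push Not at this
    exact this
  obtain ⟨ν, h0, hν⟩ := hker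
  have hort : ∀ w, B ν (D w) = 0 := fun w => DFunLike.congr_fun h0 w
  have hneg : B ν ν < 0 := by
    by_contra! h
    obtain ⟨v, hv, -⟩ := hB.signature
    obtain ⟨w, c, rfl⟩ := exists_decomposition hpos hν hort v
    have h1 : B (D w + c • ν) (D w + c • ν) = B (D w) (D w) + c ^ 2 * B ν ν := by
      simp [hort, hB.symm (D w) ν]; ring
    have h2 : 0 ≤ B (D w) (D w) := by
      rcases eq_or_ne w 0 with rfl | hw
      · simp
      · exact (hpos w hw).le
    rw [h1] at hv
    nlinarith [sq_nonneg c]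
  have key : ∀ s : ℝ, s ^ 2 * B ν ν = -1 → s * B ν τ < 0 →
      ∃ ν, B ν ν = -1 ∧ (∀ w, B ν (D w) = 0) ∧ B ν τ < 0 := by
    intro s h1 h2
    refine ⟨s • ν, ?_, fun w => by simp [hort], by simpa using h2⟩
    rw [← h1]; simp; ring
  have hs : 0 < √(-B ν ν) := Real.sqrt_pos.2 (by linarith)
  have hs2 : √(-B ν ν) ^ 2 = -B ν ν := Real.sq_sqrt (by linarith)
  rcases lt_or_gt_of_ne (hB.ne_zero_of_timelike hneg hτ) with h | h
  · refine key (√(-B ν ν))⁻¹ ?_ (mul_neg_of_pos_of_neg (inv_pos.2 hs) h)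
    rw [inv_pow, hs2, inv_neg, neg_mul, inv_mul_cancel₀ hneg.ne]
  · refine key (-(√(-B ν ν))⁻¹) ?_ ?_
    · rw [neg_sq, inv_pow, hs2, inv_neg, neg_mul, inv_mul_cancel₀ hneg.ne]
    · rw [neg_mul]; exact neg_neg_of_pos (mul_pos (inv_pos.2 hs) h)

lemma unit_normal_unique (hpos : ∀ w, w ≠ 0 → 0 < B (D w) (D w)) {ν ν' τ : Eu (d + 1)}
    (h : B ν ν = -1) (h' : B ν' ν' = -1) (hD : ∀ w, B ν (D w) = 0) (hD' : ∀ w, B ν' (D w) = 0)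
    (hf : B ν τ < 0) (hf' : B ν' τ < 0) : ν = ν' := by
  have hν : ν ≠ 0 := by rintro rfl; simp at h
  obtain ⟨w, c, rfl⟩ := exists_decomposition hpos hν hD ν'
  have hw : w = 0 := by
    by_contra hw
    have h1 := hD' w
    rw [map_add, map_smul, add_apply, smul_apply, hD, smul_zero, add_zero] at h1
    exact (hpos w hw).ne' h1
  subst hw
  simp only [map_zero, zero_add, map_smul, smul_apply, smul_eq_mul] at h' hf' ⊢
  rw [h] at h'
  have hc : 0 < c := by nlinarith
  have : c = 1 := by nlinarith
  rw [this, one_smul]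

/-- A Lorentzian form with bounded inverse is uniformly positive on the orthogonal complement of
a bounded unit timelike vector. -/
lemma IsLorentzForm.spacelike_lower {B : Form n} (hB : IsLorentzForm B) {C K N : ℝ}
    {A : (Eu n →L[ℝ] ℝ) →L[ℝ] Eu n} (hA : ‖A‖ ≤ C) (hBA : B.comp A = ContinuousLinearMap.id ℝ _)
    (hK : ‖B‖ ≤ K) {ν : Eu n} (hν : B ν ν = -1) (hN : ‖ν‖ ≤ N) {a : Eu n} (ha : B ν a = 0) :
    ‖a‖ ^ 2 ≤ K * (C * (1 + K * N ^ 2)) ^ 2 * B a a := by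
  have hC0 : 0 ≤ C := (norm_nonneg _).trans hA
  have hK0 : 0 ≤ K := (norm_nonneg _).trans hK
  have hN0 : 0 ≤ N := (norm_nonneg _).trans hN
  rcases eq_or_ne a 0 with rfl | ha0
  · simp
  have hz : 0 < B a a := hB.pos_of_orthogonal (by rw [hν]; norm_num) ha ha0
  have hna : 0 < ‖a‖ := norm_pos_iff.2 ha0
  -- The vector dual to `a`, so that `B b x` is the Euclidean product of `a` and `x`; its size is
  -- controlled by the bounded inverse of the form.
  set b := A (innerSL ℝ a) with hb
  have hBb : ∀ x, B b x = inner ℝ a x := fun x => by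
    rw [hb, ← ContinuousLinearMap.comp_apply B A, hBA]; rfl
  have hbn : ‖b‖ ≤ C * ‖a‖ := by
    refine (A.le_opNorm _).trans ?_
    rw [innerSL_apply_norm]
    gcongr
  -- The projection of `b` to the complement of `ν`. It does not change the product with `a`, which
  -- is itself orthogonal to `ν`.
  set b' := b + B b ν • ν with hb'
  have hb'ν : B ν b' = 0 := by simp [hb', hν, hB.symm ν b]
  have hb'a : B b' a = ‖a‖ ^ 2 := by
    rw [hb', map_add, map_smul, add_apply, smul_apply, ha, smul_zero, add_zero, hBb,
      real_inner_self_eq_norm_sq]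
  have hform : ∀ x y, |B x y| ≤ K * ‖x‖ * ‖y‖ := fun x y =>
    (B.le_opNorm₂ x y).trans (by gcongr)
  have hb'n : ‖b'‖ ≤ C * (1 + K * N ^ 2) * ‖a‖ := by
    calc ‖b'‖ ≤ ‖b‖ + |B b ν| * ‖ν‖ := by
          rw [hb', ← Real.norm_eq_abs, ← norm_smul]; exact norm_add_le _ _
      _ ≤ C * ‖a‖ + (K * (C * ‖a‖) * N) * N := by
          gcongr
          refine (hform b ν).trans ?_
          gcongr
      _ = _ := by ring
  have hb'b' : B b' b' ≤ K * (C * (1 + K * N ^ 2)) ^ 2 * ‖a‖ ^ 2 := by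
    refine (le_abs_self _).trans ((hform b' b').trans ?_)
    calc K * ‖b'‖ * ‖b'‖ ≤ K * (C * (1 + K * N ^ 2) * ‖a‖) * (C * (1 + K * N ^ 2) * ‖a‖) := by
          gcongr
      _ = _ := by ring
  -- The Cauchy–Schwarz inequality on the complement of `ν`, where the form is positive definite.
  have hcs : (‖a‖ ^ 2) ^ 2 ≤ B b' b' * B a a := by
    set x := B a a • b' - (‖a‖ ^ 2) • a with hx
    have h1 : 0 ≤ B x x := by
      rcases eq_or_ne x 0 with h0 | h0
      · rw [h0]; simp
      · refine (hB.pos_of_orthogonal (u := ν) (by rw [hν]; norm_num) ?_ h0).le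
        rw [hx, map_sub, map_smul, map_smul, hb'ν, ha, smul_zero, smul_zero, sub_zero]
    have h2 : B x x = B a a * (B b' b' * B a a - (‖a‖ ^ 2) ^ 2) := by
      simp only [hx, map_sub, map_smul, sub_apply, smul_apply, smul_eq_mul,
        hB.symm a b', hb'a]
      ring
    rw [h2] at h1
    have := (mul_nonneg_iff_of_pos_left hz).1 h1
    linarith
  have h3 : (‖a‖ ^ 2) ^ 2 ≤ K * (C * (1 + K * N ^ 2)) ^ 2 * ‖a‖ ^ 2 * B a a :=
    hcs.trans (by gcongr)
  have h4 : 0 < ‖a‖ ^ 2 := by positivity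
  nlinarith

end Forms

/-! ### Metrics in bounded analytic atlases -/

section UniformMetric

variable {n : ℕ} {M : Type*} [TopologicalSpace M] [ChartedSpace (Eu n) M]
  [IsManifold (𝓡 n) ω M]

lemma IsLorentzian.form {g : Cov2 n M} (hg : IsLorentzian g) (x : M) : IsLorentzForm (formAt g x) :=
  ⟨hg.symm x, hg.signature x⟩

lemma IsLorentzian.coord {g : Cov2 n M} (hg : IsLorentzian g) {φ : OpenPartialHomeomorph M (Eu n)}
    (hφ : φ ∈ IsManifold.maximalAtlas (𝓡 n) ω M) {v : Eu n} (hv : v ∈ φ.target) :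
    IsLorentzForm (coordCov φ g v) := by
  have h := dsymm_comp_dchart hφ (φ.map_target hv)
  rw [φ.right_inv hv] at h
  exact (hg.form _).pull h

lemma coordCov_symm {g : Cov2 n M} (hg : ∀ x v w, g x v w = g x w v)
    (φ : OpenPartialHomeomorph M (Eu n)) (v a b : Eu n) :
    coordCov φ g v a b = coordCov φ g v b a := hg _ _ _

variable {gref : Cov2 n M} {ψ ψ' : M → OpenPartialHomeomorph M (Eu n)}

lemma zero_mem_cube (n : ℕ) : (0 : Eu n) ∈ cube n 1 := fun i => by simp

lemma IsBoundedAnalyticAtlas.zero_mem_target (hψ : IsBoundedAnalyticAtlas gref ψ) (x : M) :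
    0 ∈ (ψ x).target := by rw [hψ.target_eq]; exact zero_mem_cube n

lemma IsBoundedAnalyticAtlas.symm_zero (hψ : IsBoundedAnalyticAtlas gref ψ) (x : M) :
    (ψ x).symm 0 = x := by
  rw [← hψ.center x]; exact (ψ x).left_inv (hψ.mem_source x)

lemma ball_subset_cube (n : ℕ) (r : ℝ) : Metric.ball (0 : Eu n) r ⊆ cube n r := fun v hv i =>
  (PiLp.norm_apply_le v i).trans_lt (mem_ball_zero_iff.1 hv)

/-- The transition between two bounded analytic atlases has a bounded differential. -/
lemma exists_transition_bound (hψ : IsBoundedAnalyticAtlas gref ψ)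
    (hψ' : IsBoundedAnalyticAtlas gref ψ') :
    ∃ C, 0 ≤ C ∧ ∀ x, ‖fderiv ℝ (fun u => ψ' x ((ψ x).symm u)) 0‖ ≤ C := by
  obtain ⟨c, hc, h⟩ := hψ.equivalent
  obtain ⟨c', hc', h'⟩ := hψ'.equivalent
  refine ⟨√(c' * c), Real.sqrt_nonneg _, fun x => ContinuousLinearMap.opNorm_le_bound _
    (Real.sqrt_nonneg _) fun a => ?_⟩
  have hx : (ψ x).symm 0 ∈ (ψ' x).source := by rw [hψ.symm_zero]; exact hψ'.mem_source x
  have h1 := coordCov_transition (hψ.analytic x) (hψ'.analytic x) gref (hψ.zero_mem_target x) hx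
  have h2 := (h x 0 (zero_mem_cube n) a).2
  rw [h1, pullForm_apply, hψ.symm_zero, hψ'.center] at h2
  have h3 := ((h' x 0 (zero_mem_cube n) _).1).trans h2
  rw [inv_mul_le_iff₀ hc'] at h3
  refine (Real.le_sqrt_of_sq_le h3).trans_eq ?_
  rw [← mul_assoc, Real.sqrt_mul (by positivity), Real.sqrt_sq (norm_nonneg _)]

variable {I : Type*} [TopologicalSpace I] [DiscreteTopology I]

lemma IsBoundedAnalyticAtlas.uaMetric (hψ : IsBoundedAnalyticAtlas gref ψ) (p : I → M) :
    UAMetric (fun i => coordCov (ψ (p i)) gref) := by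
  obtain ⟨C, hC⟩ := hψ.bounded
  obtain ⟨c, hc, h⟩ := hψ.equivalent
  refine ⟨UA.of_analyticBound one_pos fun i => hC (p i), ?_⟩
  choose A h1 h2 h3 using fun i => exists_bounded_inverse hc.le
    (norm_le_of_form_lower hc fun a => (h (p i) 0 (zero_mem_cube n) a).1)
  exact ⟨c, A, h1, h2, h3⟩

/-- Inverting a metric commutes with passing to coordinates; contravariant statements thus reduce to
inverses of covariant coordinate expressions. -/
lemma coordContra_inverseMetric {g : Cov2 n M} {φ : OpenPartialHomeomorph M (Eu n)}
    (hφ : φ ∈ IsManifold.maximalAtlas (𝓡 n) ω M) {v : Eu n} (hv : v ∈ φ.target)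
    (hg : (coordCov φ g v).IsInvertible) :
    coordContra φ (inverseMetric g) v = (coordCov φ g v).inverse.precomp ℝ := by
  set L := dsymm φ v with hL
  set D := dchart φ (φ.symm v) with hD
  have hDL : D ∘L L = ContinuousLinearMap.id ℝ (Eu n) := dchart_comp_dsymm hφ hv
  have hLD : L ∘L D = ContinuousLinearMap.id ℝ (Eu n) := by
    have := dsymm_comp_dchart hφ (φ.map_target hv)
    rwa [φ.right_inv hv] at this
  have hDL' : ∀ a, D (L a) = a := fun a => DFunLike.congr_fun hDL a
  have hLD' : ∀ a, L (D a) = a := fun a => DFunLike.congr_fun hLD a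
  set H := coordCov φ g v with hH
  have hHap : ∀ a b, H a b = formAt g (φ.symm v) (L a) (L b) := fun a b => rfl
  have hinv : (formAt g (φ.symm v)).inverse = L ∘L H.inverse ∘L (L.precomp ℝ) := by
    refine ContinuousLinearMap.inverse_eq ?_ ?_
    · ext β a
      have h1 := DFunLike.congr_fun (hg.self_apply_inverse (β ∘L L)) (D a)
      rw [hHap, hLD'] at h1
      refine h1.trans ?_
      simp [hLD']
    · ext1 a
      have h1 : (L.precomp ℝ) (formAt g (φ.symm v) a) = H (D a) := by
        ext b
        rw [hHap, hLD']; rfl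
      change L (H.inverse ((L.precomp ℝ) (formAt g (φ.symm v) a))) = a
      rw [h1, hg.inverse_apply_self, hLD']
  ext α β
  change (α ∘L D) ((formAt g (φ.symm v)).inverse (β ∘L D)) = α (H.inverse β)
  rw [hinv]
  change α (D (L (H.inverse ((β ∘L D) ∘L L)))) = _
  rw [hDL', ContinuousLinearMap.comp_assoc, hDL, ContinuousLinearMap.comp_id]

/-- A Lorentzian metric that is bounded analytic together with its inverse is uniformly analytic
and nondegenerate in every bounded analytic atlas. -/
theorem IsLorentzian.uaMetric {g : Cov2 n M} (hg : IsLorentzian g)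
    (hsymm : ∀ x v w, gref x v w = gref x w v)
    {ψ₁ ψ₂ : M → OpenPartialHomeomorph M (Eu n)}
    (hψ : IsBoundedAnalyticAtlas gref ψ) (hψ₁ : IsBoundedAnalyticAtlas gref ψ₁)
    (hψ₂ : IsBoundedAnalyticAtlas gref ψ₂) (p : I → M) {ε₁ ε₂ C₁ C₂ : ℝ} (hε₁ : 0 < ε₁)
    (hε₂ : 0 < ε₂) (h₁ : ∀ i, AnalyticBound ε₁ C₁ (coordCov (ψ₁ (p i)) g))
    (h₂ : ∀ i, AnalyticBound ε₂ C₂ (coordContra (ψ₂ (p i)) (inverseMetric g))) :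
    UAMetric (fun i => coordCov (ψ (p i)) g) := by
  constructor
  · obtain ⟨C, -, hC⟩ := exists_transition_bound hψ hψ₁
    have hsrc : ∀ i, (ψ (p i)).symm 0 ∈ (ψ₁ (p i)).source := fun i => by
      rw [hψ.symm_zero]; exact hψ₁.mem_source _
    have hev : ∀ i, ∀ᶠ u in 𝓝 (0 : Eu n), u ∈ (ψ (p i)).target ∧
        (ψ (p i)).symm u ∈ (ψ₁ (p i)).source := fun i =>
      Eventually.and ((ψ (p i)).open_target.mem_nhds (hψ.zero_mem_target _))
        (((ψ (p i)).continuousAt_symm (hψ.zero_mem_target _)).preimage_mem_nhds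
          ((ψ₁ (p i)).open_source.mem_nhds (hsrc i)))
    -- The transition maps are isometries between coordinate expressions of the reference metric,
    -- hence uniformly analytic. Pulling back along them carries the bound on `g` from `ψ₁` to `ψ`.
    obtain ⟨κ, uκ, hκ⟩ := (hψ₁.uaMetric p).exists_ua_isometry (hψ.uaMetric p)
      (fun i => Eventually.of_forall fun v a b => coordCov_symm hsymm _ v a b)
      (κ := fun i u => ψ₁ (p i) ((ψ (p i)).symm u))
      (fun i => analyticAt_transition (hψ.analytic _) (hψ₁.analytic _) (hψ.zero_mem_target _)
        (hsrc i))
      (fun i => by simp only [hψ.symm_zero, hψ₁.center]) (fun i => hC (p i))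
      (fun i => by
        filter_upwards [hev i] with u hu
        exact coordCov_transition (hψ.analytic _) (hψ₁.analytic _) gref hu.1 hu.2)
    have hκ0 : ∀ i, κ i 0 = 0 := fun i => by
      rw [(hκ i).self_of_nhds]; simp only [hψ.symm_zero, hψ₁.center]
    have u1 : UA (fun i => coordCov (ψ₁ (p i)) g) := UA.of_analyticBound hε₁ h₁
    -- The chart domains of the two atlases overlap in neighbourhoods of no uniform size, so only
    -- germs are compared. The coordinate expressions in `ψ` are analytic on the whole unit ball,
    -- which restores uniformity.
    refine UA.of_germ ((u1.comp uκ hκ0).pullForm uκ.fderiv) (fun i => ?_) one_pos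
      (fun i v hv => analyticAt_coordCov hg.analytic (hψ.analytic _) ?_)
    · filter_upwards [hev i, (hκ i).eventuallyEq_nhds] with u hu hu'
      rw [hu'.fderiv_eq, hu'.self_of_nhds]
      exact (coordCov_transition (hψ.analytic _) (hψ₁.analytic _) g hu.1 hu.2).symm
    · rw [hψ.target_eq]; exact ball_subset_cube n 1 hv
  · obtain ⟨C, hC0, hC⟩ := exists_transition_bound hψ₂ hψ
    obtain ⟨K, hK⟩ := (UA.of_analyticBound hε₂ h₂).bounded_zero
    -- The bound on the inverse metric is available in `ψ₂` and is moved to `ψ` by the differentials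
    -- of the transitions. In each direction these are bounded because both atlases are uniformly
    -- equivalent to the flat metric.
    have key : ∀ i a, ‖a‖ ≤ C * (|K| * C) * ‖coordCov (ψ (p i)) g 0 a‖ := by
      intro i a
      have hsrc : (ψ (p i)).symm 0 ∈ (ψ₂ (p i)).source := by
        rw [hψ.symm_zero]; exact hψ₂.mem_source _
      have hsrc' : (ψ₂ (p i)).symm 0 ∈ (ψ (p i)).source := by
        rw [hψ₂.symm_zero]; exact hψ.mem_source _
      set L := fderiv ℝ (fun u => ψ₂ (p i) ((ψ (p i)).symm u)) 0 with hL
      set L' := fderiv ℝ (fun u => ψ (p i) ((ψ₂ (p i)).symm u)) 0 with hL'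
      set H := coordCov (ψ₂ (p i)) g 0 with hH
      have hHi : H.IsInvertible :=
        (hg.coord (hψ₂.analytic (p i)) (hψ₂.zero_mem_target _)).isInvertible
      have hpull : H = pullForm (coordCov (ψ (p i)) g 0) L' := by
        rw [hH, coordCov_transition (hψ₂.analytic _) (hψ.analytic _) g (hψ₂.zero_mem_target _)
          hsrc', hψ₂.symm_zero, hψ.center]
      have hLL : L' (L a) = a := by
        have e1 := fderiv_transition (hψ.analytic _) (hψ₂.analytic _) (hψ.zero_mem_target _) hsrc
        have e2 := fderiv_transition (hψ₂.analytic _) (hψ.analytic _) (hψ₂.zero_mem_target _) hsrc'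
        have e3 := dsymm_comp_dchart (hψ₂.analytic _) (hψ₂.mem_source (p i))
        have e4 := dsymm_comp_dchart (hψ.analytic _) (hψ.mem_source (p i))
        have e5 := dchart_comp_dsymm (hψ.analytic _) (hψ.zero_mem_target (p i))
        rw [hψ₂.center] at e3
        rw [hψ.symm_zero] at e1 e5
        rw [hψ₂.symm_zero] at e2
        rw [hL, hL', e1, e2]
        have e6 : ∀ x, dsymm (ψ₂ (p i)) 0 (dchart (ψ₂ (p i)) (p i) x) = x := fun x =>
          DFunLike.congr_fun e3 x
        simp only [ContinuousLinearMap.comp_apply, e6]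
        exact DFunLike.congr_fun e5 a
      have h1 : ‖L a‖ ≤ |K| * ‖H (L a)‖ := by
        have e1 := hK i
        rw [coordContra_inverseMetric (hψ₂.analytic _) (hψ₂.zero_mem_target _) hHi] at e1
        have e2 : H.inverse.precomp ℝ (innerSL ℝ (L a)) (H (L a)) = ‖L a‖ ^ 2 := by
          change innerSL ℝ (L a) (H.inverse (H (L a))) = _
          rw [hHi.inverse_apply_self]
          exact real_inner_self_eq_norm_sq (L a)
        have e3 := (H.inverse.precomp ℝ).le_opNorm₂ (innerSL ℝ (L a)) (H (L a))
        rw [e2, innerSL_apply_norm, Real.norm_eq_abs, abs_of_nonneg (by positivity)] at e3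
        have e4 : ‖L a‖ ^ 2 ≤ |K| * ‖L a‖ * ‖H (L a)‖ :=
          e3.trans (by gcongr; exact e1.trans (le_abs_self _))
        rcases (norm_nonneg (L a)).eq_or_lt with h0 | h0
        · rw [← h0]; positivity
        · nlinarith
      have h2 : ‖H (L a)‖ ≤ C * ‖coordCov (ψ (p i)) g 0 a‖ := by
        refine ContinuousLinearMap.opNorm_le_bound _ (by positivity) fun x => ?_
        rw [hpull, pullForm_apply, hLL]
        calc _ ≤ ‖coordCov (ψ (p i)) g 0 a‖ * ‖L' x‖ := ContinuousLinearMap.le_opNorm _ _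
          _ ≤ ‖coordCov (ψ (p i)) g 0 a‖ * (C * ‖x‖) := by
              gcongr
              exact (L'.le_opNorm x).trans (by gcongr; exact hC (p i))
          _ = _ := by ring
      calc ‖a‖ = ‖L' (L a)‖ := by rw [hLL]
        _ ≤ C * ‖L a‖ := (L'.le_opNorm _).trans (by gcongr; exact hC (p i))
        _ ≤ C * (|K| * (C * ‖coordCov (ψ (p i)) g 0 a‖)) := by gcongr; exact h1.trans (by gcongr)
        _ = _ := by ring
    choose A a1 a2 a3 using fun i => exists_bounded_inverse (by positivity) (key i)
    exact ⟨_, A, a1, a2, a3⟩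

end UniformMetric
end BAG

end

noncomputable section
namespace BAG

open Filter
open scoped BoundedContinuousFunction

/-! ### The geodesic equation and uniqueness of geodesics -/

section Geodesics

variable {n : ℕ}

/-- The geodesic equation at time `t` for a curve in an open subset of `ℝⁿ`. -/
def GeodEq (G : Eu n → Form n) (u : ℝ → Eu n) (t : ℝ) : Prop :=
  ∀ w, G (u t) (iteratedDeriv 2 u t) w + christoffel G (u t) (deriv u t) (deriv u t) w = 0

lemma iteratedDeriv_two_eq {V : Type*} [NormedAddCommGroup V] [NormedSpace ℝ V] (u : ℝ → V) :
    iteratedDeriv 2 u = deriv (deriv u) := by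
  rw [iteratedDeriv_succ, iteratedDeriv_one]

lemma _root_.ContDiffAt.hasDerivAt_deriv {V : Type*} [NormedAddCommGroup V] [NormedSpace ℝ V]
    {u : ℝ → V} {t : ℝ} (hu : ContDiffAt ℝ 2 u t) :
    HasDerivAt (deriv u) (iteratedDeriv 2 u t) t := by
  rw [iteratedDeriv_two_eq]
  have h : ContDiffAt ℝ 1 (fderiv ℝ u) t := hu.fderiv_right (by norm_num)
  have h2 : DifferentiableAt ℝ (fun s => fderiv ℝ u s 1) t :=
    (h.differentiableAt (by norm_num)).clm_apply (differentiableAt_const _)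
  exact DifferentiableAt.hasDerivAt h2

/-- The geodesic equation does not depend on the chart. -/
lemma GeodEq.transition {G G' : Eu n → Form n} {κ : Eu n → Eu n} {u : ℝ → Eu n} {t : ℝ}
    (h : GeodEq G' u t) (hu : ContDiffAt ℝ 2 u t) (hκ : ContDiffAt ℝ 2 κ (u t))
    (hG : DifferentiableAt ℝ G (κ (u t))) (hsymm : ∀ a b, G (κ (u t)) a b = G (κ (u t)) b a)
    (hG' : G' =ᶠ[𝓝 (u t)] fun x => pullForm (G (κ x)) (fderiv ℝ κ x))
    (hsurj : Function.Surjective (fderiv ℝ κ (u t))) : GeodEq G (fun s => κ (u s)) t := by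
  have hu1 : HasDerivAt u (deriv u t) t := (hu.differentiableAt (by norm_num)).hasDerivAt
  have hκ2 : HasFDerivAt (fderiv ℝ κ) (fderiv ℝ (fderiv ℝ κ) (u t)) (u t) :=
    ((hκ.fderiv_right (m := 1) (by norm_num)).differentiableAt (by norm_num)).hasFDerivAt
  have hd : deriv (fun s => κ (u s)) =ᶠ[𝓝 t] fun s => fderiv ℝ κ (u s) (deriv u s) := by
    filter_upwards [hu.eventually (by simp), hu.continuousAt.eventually (hκ.eventually (by simp))]
      with s hs hs'
    exact ((hs'.differentiableAt (by norm_num)).hasFDerivAt.comp_hasDerivAt s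
      (hs.differentiableAt (by norm_num)).hasDerivAt).deriv
  have hdd : iteratedDeriv 2 (fun s => κ (u s)) t
      = fderiv ℝ (fderiv ℝ κ) (u t) (deriv u t) (deriv u t)
        + fderiv ℝ κ (u t) (iteratedDeriv 2 u t) := by
    rw [iteratedDeriv_two_eq, hd.deriv_eq]
    exact ((hκ2.comp_hasDerivAt t hu1).clm_apply hu.hasDerivAt_deriv).deriv
  intro w'
  obtain ⟨w, rfl⟩ := hsurj w'
  have h1 := christoffel_pullForm hκ hG hsymm hG' (deriv u t) (deriv u t) w
  have h2 := h w
  rw [hG'.self_of_nhds, pullForm_apply] at h2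
  rw [hdd, hd.self_of_nhds, map_add, add_apply]
  linarith

/-- Local uniqueness of geodesics. -/
lemma GeodEq.eventuallyEq {G : Eu n → Form n} {u u' : ℝ → Eu n} {t : ℝ}
    (hu : ∀ᶠ s in 𝓝 t, ContDiffAt ℝ 2 u s ∧ GeodEq G u s)
    (hu' : ∀ᶠ s in 𝓝 t, ContDiffAt ℝ 2 u' s ∧ GeodEq G u' s)
    (hG : AnalyticAt ℝ G (u t)) (hi : ∀ᶠ v in 𝓝 (u t), (G v).IsInvertible)
    (h0 : u t = u' t) (h1 : deriv u t = deriv u' t) : u =ᶠ[𝓝 t] u' := by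
  let X : Eu n × Eu n → Eu n × Eu n := fun z => (z.2, -(gammaSharp G z.1 z.2 z.2))
  have hX : ContDiffAt ℝ 1 X (u t, deriv u t) := by
    have e1 : AnalyticAt ℝ (fun z : Eu n × Eu n => gammaSharp G z.1) (u t, deriv u t) :=
      AnalyticAt.comp (g := gammaSharp G) (f := Prod.fst) (analyticAt_gammaSharp hG hi.self_of_nhds)
        analyticAt_fst
    exact contDiffAt_snd.prodMk
      ((e1.contDiffAt.clm_apply contDiffAt_snd).clm_apply contDiffAt_snd).neg
  obtain ⟨K, s, hs, hK⟩ := hX.exists_lipschitzOnWith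
  have key : ∀ w : ℝ → Eu n, w t = u t → deriv w t = deriv u t →
      (∀ᶠ s in 𝓝 t, ContDiffAt ℝ 2 w s ∧ GeodEq G w s) →
      ∀ᶠ τ in 𝓝 t, HasDerivAt (fun s => (w s, deriv w s)) (X (w τ, deriv w τ)) τ ∧
        (w τ, deriv w τ) ∈ s := by
    intro w hw0 hw1 hw
    have hc : ContDiffAt ℝ 2 w t := hw.self_of_nhds.1
    have hcont : ContinuousAt (fun s => (w s, deriv w s)) t :=
      hc.continuousAt.prodMk hc.hasDerivAt_deriv.continuousAt
    have hs' : s ∈ 𝓝 (w t, deriv w t) := by rw [hw0, hw1]; exact hs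
    have hi' : ∀ᶠ v in 𝓝 (w t), (G v).IsInvertible := by rw [hw0]; exact hi
    filter_upwards [hw, hcont.preimage_mem_nhds hs', hc.continuousAt.eventually hi']
      with τ hτ hτs hτi
    refine ⟨?_, hτs⟩
    have e1 : HasDerivAt w (deriv w τ) τ := (hτ.1.differentiableAt (by norm_num)).hasDerivAt
    have e2 : iteratedDeriv 2 w τ = -(gammaSharp G (w τ) (deriv w τ) (deriv w τ)) := by
      rw [← add_eq_zero_iff_eq_neg]
      refine hτi.injective ?_
      ext x
      rw [map_add, add_apply, form_gammaSharp hτi, hτ.2 x]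
      simp
    have e3 := hτ.1.hasDerivAt_deriv
    rw [e2] at e3
    exact e1.prodMk e3
  have h := ODE_solution_unique_of_eventually (v := fun _ => X) (s := fun _ => s)
    (Eventually.of_forall fun _ => hK) (key u rfl rfl hu) (key u' h0.symm h1.symm hu')
    (by simp only [h0, h1])
  filter_upwards [h] with τ hτ using congrArg Prod.fst hτ

variable {M : Type*} [TopologicalSpace M] [ChartedSpace (Eu n) M] [IsManifold (𝓡 n) ω M]
  {g : Cov2 n M} {φ φ' : OpenPartialHomeomorph M (Eu n)}

/-- `u` is a geodesic in the chart `φ`, for `|t| < r`. -/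
structure IsChartGeodesic (g : Cov2 n M) (φ : OpenPartialHomeomorph M (Eu n)) (r : ℝ)
    (u : ℝ → Eu n) : Prop where
  mem_target : ∀ t ∈ Set.Ioo (-r) r, u t ∈ φ.target
  contDiffAt : ∀ t ∈ Set.Ioo (-r) r, ContDiffAt ℝ ω u t
  geodEq : ∀ t ∈ Set.Ioo (-r) r, GeodEq (coordCov φ g) u t

lemma surjective_fderiv_transition (hφ : φ ∈ IsManifold.maximalAtlas (𝓡 n) ω M)
    (hφ' : φ' ∈ IsManifold.maximalAtlas (𝓡 n) ω M) {v : Eu n} (hv : v ∈ φ.target)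
    (hv' : φ.symm v ∈ φ'.source) :
    Function.Surjective (fderiv ℝ (fun u => φ' (φ.symm u)) v) := by
  intro w
  have h1 := dchart_comp_dsymm hφ' (φ'.map_source hv')
  have h2 := dsymm_comp_dchart hφ (φ.map_target hv)
  rw [φ'.left_inv hv'] at h1
  rw [φ.right_inv hv] at h2
  refine ⟨dchart φ (φ.symm v) (dsymm φ' (φ' (φ.symm v)) w), ?_⟩
  rw [fderiv_transition hφ hφ' hv hv']
  have h3 := DFunLike.congr_fun h2 (dsymm φ' (φ' (φ.symm v)) w)
  rw [ContinuousLinearMap.comp_apply] at h3 ⊢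
  rw [h3]
  exact DFunLike.congr_fun h1 w

lemma IsLorentzian.geodEq_transition (hg : IsLorentzian g)
    (hφ : φ ∈ IsManifold.maximalAtlas (𝓡 n) ω M) (hφ' : φ' ∈ IsManifold.maximalAtlas (𝓡 n) ω M)
    {u : ℝ → Eu n} {t : ℝ} (hu : ContDiffAt ℝ ω u t) (ht : u t ∈ φ.target)
    (ht' : φ.symm (u t) ∈ φ'.source) (h : GeodEq (coordCov φ g) u t) :
    GeodEq (coordCov φ' g) (fun s => φ' (φ.symm (u s))) t := by
  refine GeodEq.transition (κ := fun v => φ' (φ.symm v)) h (hu.of_le (by simp))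
    (analyticAt_transition hφ hφ' ht ht').contDiffAt
    (analyticAt_coordCov hg.analytic hφ' (φ'.map_source ht')).differentiableAt
    (coordCov_symm hg.symm φ' _) ?_ (surjective_fderiv_transition hφ hφ' ht ht')
  filter_upwards [φ.open_target.mem_nhds ht,
    (φ.continuousAt_symm ht).preimage_mem_nhds (φ'.open_source.mem_nhds ht')] with v hv hv'
  exact coordCov_transition hφ hφ' g hv hv'

lemma IsChartGeodesic.isGeodesicOn (hg : IsLorentzian g)
    (hφ : φ ∈ IsManifold.maximalAtlas (𝓡 n) ω M) {r : ℝ} {u : ℝ → Eu n}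
    (hu : IsChartGeodesic g φ r u) : IsGeodesicOn g (fun t => φ.symm (u t)) (Set.Ioo (-r) r) := by
  refine ⟨fun t ht => ?_, fun t ht w => ?_⟩
  · have h1 := (contMDiffAt_chart_symm hφ (hu.mem_target t ht)).comp t
      (contMDiffAt_iff_contDiffAt.2 (hu.contDiffAt t ht))
    exact (h1.of_le (by simp)).contMDiffWithinAt
  · exact hg.geodEq_transition hφ (IsManifold.chart_mem_maximalAtlas _) (hu.contDiffAt t ht)
      (hu.mem_target t ht) (mem_chart_source _ _) (hu.geodEq t ht) w

/-- Uniqueness of geodesics. -/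
theorem IsChartGeodesic.unique [T2Space M] (hg : IsLorentzian g)
    (hφ : φ ∈ IsManifold.maximalAtlas (𝓡 n) ω M) (hφ' : φ' ∈ IsManifold.maximalAtlas (𝓡 n) ω M)
    {r : ℝ} {u u' : ℝ → Eu n} (hu : IsChartGeodesic g φ r u) (hu' : IsChartGeodesic g φ' r u')
    (h0 : φ.symm (u 0) = φ'.symm (u' 0))
    (h1 : dsymm φ (u 0) (deriv u 0) = dsymm φ' (u' 0) (deriv u' 0)) :
    ∀ t ∈ Set.Ioo (-r) r, φ.symm (u t) = φ'.symm (u' t) := by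
  intro t₁ ht₁
  have hr : 0 < r := by linarith [ht₁.1, ht₁.2]
  set w : ℝ → Eu n := fun s => φ' (φ.symm (u s)) with hw
  have hcont : ∀ t ∈ Set.Ioo (-r) r, ContinuousAt (fun s => φ.symm (u s)) t := fun t ht =>
    (φ.continuousAt_symm (hu.mem_target t ht)).comp (f := u) (hu.contDiffAt t ht).continuousAt
  have hcont' : ∀ t ∈ Set.Ioo (-r) r, ContinuousAt (fun s => φ'.symm (u' s)) t := fun t ht =>
    (φ'.continuousAt_symm (hu'.mem_target t ht)).comp (f := u') (hu'.contDiffAt t ht).continuousAt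
  have hIoo : ∀ t ∈ Set.Ioo (-r) r, ∀ᶠ s in 𝓝 t, s ∈ Set.Ioo (-r) r := fun t ht =>
    isOpen_Ioo.mem_nhds ht
  have hsrc : ∀ t ∈ Set.Ioo (-r) r, φ.symm (u t) = φ'.symm (u' t) →
      φ.symm (u t) ∈ φ'.source := fun t ht h => by
    rw [h]; exact φ'.map_target (hu'.mem_target t ht)
  have hevsrc : ∀ t ∈ Set.Ioo (-r) r, φ.symm (u t) = φ'.symm (u' t) →
      ∀ᶠ s in 𝓝 t, φ.symm (u s) ∈ φ'.source := fun t ht h =>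
    (hcont t ht).preimage_mem_nhds (φ'.open_source.mem_nhds (hsrc t ht h))
  have hwC : ∀ s ∈ Set.Ioo (-r) r, φ.symm (u s) ∈ φ'.source → ContDiffAt ℝ ω w s := fun s hs h =>
    ((analyticAt_transition hφ hφ' (hu.mem_target s hs) h).contDiffAt (n := ω)).comp s
      (hu.contDiffAt s hs)
  -- local uniqueness
  have hloc : ∀ t ∈ Set.Ioo (-r) r, φ.symm (u t) = φ'.symm (u' t) → deriv w t = deriv u' t →
      ∀ᶠ s in 𝓝 t, φ.symm (u s) = φ'.symm (u' s) := by
    intro t ht h0 h1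
    have hwu : w t = u' t := by
      simp only [w]; rw [h0, φ'.right_inv (hu'.mem_target t ht)]
    have hwt : w t ∈ φ'.target := by rw [hwu]; exact hu'.mem_target t ht
    have h2 : w =ᶠ[𝓝 t] u' := by
      refine GeodEq.eventuallyEq (G := coordCov φ' g) ?_ ?_
        (analyticAt_coordCov hg.analytic hφ' hwt) ?_ hwu h1
      · filter_upwards [hIoo t ht, hevsrc t ht h0] with s hs hs'
        exact ⟨(hwC s hs hs').of_le (by simp), hg.geodEq_transition hφ hφ' (hu.contDiffAt s hs)
          (hu.mem_target s hs) hs' (hu.geodEq s hs)⟩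
      · filter_upwards [hIoo t ht] with s hs
        exact ⟨(hu'.contDiffAt s hs).of_le (by simp), hu'.geodEq s hs⟩
      · filter_upwards [φ'.open_target.mem_nhds hwt] with v hv
        exact (hg.coord hφ' hv).isInvertible
    filter_upwards [h2, hevsrc t ht h0] with s hs hs'
    rw [← hs, φ'.left_inv hs']
  -- Times near which the curves coincide, an open set by definition. At a limit time in the
  -- interval both the points and the velocities agree, and local uniqueness applies again.
  let U : Set ℝ := {t | ∀ᶠ s in 𝓝 t, φ.symm (u s) = φ'.symm (u' s)}
  have hU : IsOpen U := isOpen_iff_mem_nhds.2 fun t ht => by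
    filter_upwards [eventually_eventually_nhds.2 ht] with s hs using hs
  have h00 : (0 : ℝ) ∈ Set.Ioo (-r) r := ⟨by linarith, hr⟩
  have hsub : Set.Ioo (-r) r ⊆ U := by
    refine isPreconnected_Ioo.subset_of_closure_inter_subset hU ⟨0, h00, ?_⟩ ?_
    · refine hloc 0 h00 h0 ?_
      have e1 : HasDerivAt w (fderiv ℝ (fun v => φ' (φ.symm v)) (u 0) (deriv u 0)) 0 :=
        (analyticAt_transition hφ hφ' (hu.mem_target 0 h00)
          (hsrc 0 h00 h0)).differentiableAt.hasFDerivAt.comp_hasDerivAt 0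
          ((hu.contDiffAt 0 h00).differentiableAt (by simp)).hasDerivAt
      rw [e1.deriv, fderiv_transition hφ hφ' (hu.mem_target 0 h00) (hsrc 0 h00 h0),
        ContinuousLinearMap.comp_apply, h1, h0]
      exact DFunLike.congr_fun (dchart_comp_dsymm hφ' (hu'.mem_target 0 h00)) _
    · rintro t ⟨htU, ht⟩
      have hfr : ∃ᶠ s in 𝓝 t, s ∈ U := mem_closure_iff_frequently.1 htU
      -- Only here is the Hausdorff property needed, to pass equality of the points to the limit.
      have e0 : φ.symm (u t) = φ'.symm (u' t) := by
        by_contra hne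
        obtain ⟨A, B, hA, hB, hxA, hxB, hAB⟩ := t2_separation hne
        have e := (hfr.and_eventually
          ((hcont t ht).preimage_mem_nhds (hA.mem_nhds hxA))).and_eventually
          ((hcont' t ht).preimage_mem_nhds (hB.mem_nhds hxB))
        obtain ⟨s, ⟨hsU, hsA⟩, hsB⟩ := e.exists
        have := hsU.self_of_nhds
        exact Set.disjoint_left.1 hAB hsA (by simp only [this]; exact hsB)
      refine hloc t ht e0 ?_
      have hwt := (hwC t ht (hsrc t ht e0)).of_le (m := 2) (by simp)
      have hut := (hu'.contDiffAt t ht).of_le (m := 2) (by simp)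
      by_contra hne
      have hev : ∀ᶠ s in 𝓝 t, deriv w s ≠ deriv u' s :=
        (hwt.hasDerivAt_deriv.continuousAt.ne_iff_eventually_ne
          hut.hasDerivAt_deriv.continuousAt).1 hne
      obtain ⟨s, hsU, hs, hsI⟩ := (hfr.and_eventually (hev.and (hIoo t ht))).exists
      refine hs (EventuallyEq.deriv_eq ?_)
      filter_upwards [hsU, hIoo s hsI] with σ hσ hσI
      simp only [w]
      rw [hσ, φ'.right_inv (hu'.mem_target σ hσI)]
  exact (hsub ht₁).self_of_nhds

end Geodesics
end BAG

end

noncomputable section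
namespace BAG

open Filter
open scoped BoundedContinuousFunction

/-! ### Vector fields in coordinates -/

section Continuity

variable {n : ℕ} {M : Type*} [TopologicalSpace M] [ChartedSpace (Eu n) M]
  [IsManifold (𝓡 n) ω M] {φ : OpenPartialHomeomorph M (Eu n)}

/-- A continuous vector field is continuous in coordinates. -/
lemma continuousAt_coord_vectorField (hφ : φ ∈ IsManifold.maximalAtlas (𝓡 n) ω M)
    {τ : ∀ x : M, TangentSpace (𝓡 n) x}
    (hτ : Continuous (fun x : M => (⟨x, τ x⟩ : TangentBundle (𝓡 n) M))) {x : M}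
    (hx : x ∈ φ.source) : ContinuousAt (fun y => dchart φ y (τ y)) x := by
  have h1 : ContMDiffOn (𝓡 n) (𝓡 n) 1 φ φ.source := fun y hy =>
    ((contMDiffAt_chart hφ hy).of_le (by simp)).contMDiffWithinAt
  have h2 := h1.continuousOn_tangentMapWithin le_rfl φ.open_source.uniqueMDiffOn
  have h3 : ContinuousAt (fun y : M => tangentMapWithin (𝓡 n) (𝓡 n) φ φ.source ⟨y, τ y⟩) x := by
    refine ContinuousAt.comp (f := fun y : M => (⟨y, τ y⟩ : TangentBundle (𝓡 n) M))
      (g := tangentMapWithin (𝓡 n) (𝓡 n) φ φ.source)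
      (h2.continuousAt ?_) hτ.continuousAt
    exact (φ.open_source.preimage (FiberBundle.continuous_proj _ _)).mem_nhds hx
  have h4 : Continuous (fun z : TangentBundle (𝓡 n) (Eu n) => (show Eu n from z.2)) := by
    have := (tangentBundleModelSpaceHomeomorph (𝓡 n)).continuous.snd
    refine this.congr fun z => ?_
    rfl
  have h5 := h4.continuousAt.comp (f := fun y : M =>
    tangentMapWithin (𝓡 n) (𝓡 n) φ φ.source ⟨y, τ y⟩) h3
  refine h5.congr ?_
  filter_upwards [φ.open_source.mem_nhds hx] with y hy
  have h6 := mfderivWithin_of_isOpen (I := 𝓡 n) (I' := 𝓡 n) (f := φ) φ.open_source hy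
  exact DFunLike.congr_fun h6 (τ y)

end Continuity

/-! ### The hypersurface in graph charts -/

section Hypersurface

variable {d : ℕ} {M : Type*} [TopologicalSpace M] [ChartedSpace (Eu (d + 1)) M]
  [IsManifold (𝓡 (d + 1)) ω M]
  {S : Type*} [TopologicalSpace S] [ChartedSpace (Eu d) S] [IsManifold (𝓡 d) ω S]
  {g : Cov2 (d + 1) M} {τ : ∀ p : M, TangentSpace (𝓡 (d + 1)) p} {ι : S → M}
  {φ : OpenPartialHomeomorph M (Eu (d + 1))} {F : Eu d → ℝ}

/-- The differential of a map from a manifold of dimension `d` to one of dimension `d + 1`. -/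
def dmap (ι : S → M) (x : S) : Eu d →L[ℝ] Eu (d + 1) := mfderiv (𝓡 d) (𝓡 (d + 1)) ι x

/-- The analytic chart `φ`, onto the unit cube, represents the hypersurface `ι` as a graph. -/
structure IsGraphChart (ι : S → M) (φ : OpenPartialHomeomorph M (Eu (d + 1)))
    (F : Eu d → ℝ) : Prop where
  analytic : φ ∈ IsManifold.maximalAtlas (𝓡 (d + 1)) ω M
  target_eq : φ.target = cube (d + 1) 1
  image : φ '' (Set.range ι ∩ φ.source) = graphInCube F

lemma IsGraphChart.eq_graphMap (h : IsGraphChart ι φ F) {x : S} (hx : ι x ∈ φ.source) :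
    φ (ι x) = graphMap F (initL d (φ (ι x))) := by
  have : φ (ι x) ∈ graphInCube F := by
    rw [← h.image]; exact ⟨ι x, ⟨⟨x, rfl⟩, hx⟩, rfl⟩
  exact (mem_graphInCube_iff.1 this).2

lemma IsGraphChart.exists_eq (h : IsGraphChart ι φ F) {v : Eu d}
    (hv : graphMap F v ∈ cube (d + 1) 1) : ∃ x, ι x ∈ φ.source ∧ φ (ι x) = graphMap F v := by
  have : graphMap F v ∈ φ '' (Set.range ι ∩ φ.source) := by
    rw [h.image, mem_graphInCube_iff, initL_graphMap]; exact ⟨hv, rfl⟩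
  obtain ⟨_, ⟨⟨x, rfl⟩, hx⟩, hx'⟩ := this
  exact ⟨x, hx, hx'⟩

/-- The differentiated form of `φ ∘ ι = graphMap F ∘ initL d ∘ φ ∘ ι`, which holds near `x`. -/
lemma IsGraphChart.dchart_dmap (h : IsGraphChart ι φ F) (hι : ContMDiff (𝓡 d) (𝓡 (d + 1)) ω ι)
    {x : S} (hx : ι x ∈ φ.source) (hF : DifferentiableAt ℝ F (initL d (φ (ι x)))) :
    dchart φ (ι x) ∘L dmap ι x = fderiv ℝ (graphMap F) (initL d (φ (ι x))) ∘L
      (initL d ∘L dchart φ (ι x) ∘L dmap ι x) := by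
  have h1 : MDifferentiableAt (𝓡 d) (𝓡 (d + 1)) ι x := (hι x).mdifferentiableAt (by simp)
  have h2 : MDifferentiableAt (𝓡 (d + 1)) (𝓡 (d + 1)) φ (ι x) :=
    (contMDiffAt_chart h.analytic hx).mdifferentiableAt (by simp)
  have h3 : HasMFDerivAt (𝓡 d) (𝓡 (d + 1)) (φ ∘ ι) x (dchart φ (ι x) ∘L dmap ι x) :=
    h2.hasMFDerivAt.comp x h1.hasMFDerivAt
  have h4 : HasFDerivAt (fun w => graphMap F (initL d w))
      (fderiv ℝ (graphMap F) (initL d (φ (ι x))) ∘L initL d) (φ (ι x)) := by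
    have hg : DifferentiableAt ℝ (graphMap F) (initL d (φ (ι x))) :=
      (snocL d).differentiableAt.comp (f := fun v => (v, F v)) _ (differentiableAt_id.prodMk hF)
    exact hg.hasFDerivAt.comp _ (initL d).hasFDerivAt
  have h5 : HasMFDerivAt (𝓡 d) (𝓡 (d + 1)) ((fun w => graphMap F (initL d w)) ∘ (φ ∘ ι)) x
      ((fderiv ℝ (graphMap F) (initL d (φ (ι x))) ∘L initL d) ∘L (dchart φ (ι x) ∘L dmap ι x)) :=
    HasMFDerivAt.comp x (hasMFDerivAt_iff_hasFDerivAt.2 h4) h3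
  have h6 : (fun w => graphMap F (initL d w)) ∘ (φ ∘ ι) =ᶠ[𝓝 x] φ ∘ ι := by
    filter_upwards [(hι x).continuousAt.preimage_mem_nhds (φ.open_source.mem_nhds hx)] with y hy
    exact (h.eq_graphMap hy).symm
  exact hasMFDerivAt_unique h3 (h5.congr_of_eventuallyEq h6.symm)

lemma spacelike_pos (hs : IsSpacelike g ι) (x : S) {w : Eu d} (hw : w ≠ 0) :
    0 < formAt g (ι x) (dmap ι x w) (dmap ι x w) := hs x w hw

lemma formAt_coord (hφ : φ ∈ IsManifold.maximalAtlas (𝓡 (d + 1)) ω M) (g : Cov2 (d + 1) M) {x : M}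
    (hx : x ∈ φ.source) (a b : Eu (d + 1)) :
    formAt g x a b = coordCov φ g (φ x) (dchart φ x a) (dchart φ x b) := by
  rw [formAt_eq hφ g hx, pullForm_apply]

lemma dchart_injective (hφ : φ ∈ IsManifold.maximalAtlas (𝓡 (d + 1)) ω M) {x : M}
    (hx : x ∈ φ.source) : Function.Injective (dchart φ x) :=
  Function.LeftInverse.injective (g := dsymm φ (φ x)) fun a =>
    DFunLike.congr_fun (dsymm_comp_dchart hφ hx) a

lemma dchart_dsymm_apply (hφ : φ ∈ IsManifold.maximalAtlas (𝓡 (d + 1)) ω M) {x : M}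
    (hx : x ∈ φ.source) (a : Eu (d + 1)) : dchart φ x (dsymm φ (φ x) a) = a := by
  have h := dchart_comp_dsymm hφ (φ.map_source hx)
  rw [φ.left_inv hx] at h
  exact DFunLike.congr_fun h a

/-- The tangent space of the hypersurface is that of the graph. -/
lemma IsGraphChart.surjective (h : IsGraphChart ι φ F) (hι : ContMDiff (𝓡 d) (𝓡 (d + 1)) ω ι)
    (hs : IsSpacelike g ι) {x : S} (hx : ι x ∈ φ.source)
    (hF : DifferentiableAt ℝ F (initL d (φ (ι x)))) :
    Function.Bijective (initL d ∘L dchart φ (ι x) ∘L dmap ι x) := by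
  have h1 := h.dchart_dmap hι hx hF
  have hinj : Function.Injective (initL d ∘L dchart φ (ι x) ∘L dmap ι x) := by
    refine (injective_iff_map_eq_zero _).2 fun w hw => ?_
    by_contra hw0
    have h2 := DFunLike.congr_fun h1 w
    rw [ContinuousLinearMap.comp_apply (fderiv ℝ (graphMap F) _), hw, map_zero] at h2
    have h3 := spacelike_pos hs x hw0
    have h4 : dmap ι x w = 0 := dchart_injective h.analytic hx (h2.trans (map_zero _).symm)
    rw [h4] at h3
    simp at h3
  exact ⟨hinj, (LinearMap.injective_iff_surjective (f :=
    ((initL d ∘L dchart φ (ι x) ∘L dmap ι x : Eu d →L[ℝ] Eu d) : Eu d →ₗ[ℝ] Eu d))).1 hinj⟩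

lemma IsGraphChart.isUnitNormalAt (h : IsGraphChart ι φ F)
    (hι : ContMDiff (𝓡 d) (𝓡 (d + 1)) ω ι) (hs : IsSpacelike g ι) {x : S} (hx : ι x ∈ φ.source)
    (hF : DifferentiableAt ℝ F (initL d (φ (ι x)))) {ν : Eu (d + 1)}
    (hν : IsFutureUnitNormal g τ ι x ν) :
    IsUnitNormalAt (coordCov φ g) F (initL d (φ (ι x))) (dchart φ (ι x) ν) := by
  have hgm := h.eq_graphMap hx
  refine ⟨?_, fun w' => ?_⟩
  · rw [← hgm, ← formAt_coord h.analytic g hx]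
    exact hν.unit
  · obtain ⟨w, rfl⟩ := (h.surjective hι hs hx hF).2 w'
    have h1 := DFunLike.congr_fun (h.dchart_dmap hι hx hF) w
    rw [ContinuousLinearMap.comp_apply (fderiv ℝ (graphMap F) _)] at h1
    rw [← h1, ← hgm, ContinuousLinearMap.comp_apply, ← formAt_coord h.analytic g hx]
    exact hν.normal w

lemma exists_futureUnitNormal (hg : IsLorentzian g) (hτ : IsTimeOrientation g τ)
    (hs : IsSpacelike g ι) (x : S) : ∃ ν : Eu (d + 1), IsFutureUnitNormal g τ ι x ν := by
  obtain ⟨ν, h1, h2, h3⟩ := exists_unit_normal (hg.form (ι x)) (D := dmap ι x)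
    (fun w hw => spacelike_pos hs x hw) (τ := τ (ι x)) (hτ.2 (ι x))
  exact ⟨ν, h1, h2, h3⟩

/-- Normal geodesic flows, of uniform size, in charts around all points of the hypersurface. -/
structure IsGaussSetup (g : Cov2 (d + 1) M) (τ : ∀ p : M, TangentSpace (𝓡 (d + 1)) p) (ι : S → M)
    (φ : S → OpenPartialHomeomorph M (Eu (d + 1))) (F : S → Eu d → ℝ) (ν : S → Eu (d + 1))
    (Ψ : S → ℝ × Eu d → Eu (d + 1)) (r c C : ℝ) : Prop where
  chart : ∀ y, IsGraphChart ι (φ y) (F y)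
  mem_source : ∀ y, ι y ∈ (φ y).source
  center : ∀ y, φ y (ι y) = 0
  future : ∀ y, IsFutureUnitNormal g τ ι y (ν y)
  flow : ∀ y, IsGaussFlow (coordCov (φ y) g) (F y) r c C (Ψ y)
  initial : ∀ y, fderiv ℝ (Ψ y) 0 (1, 0) = dchart (φ y) (ι y) (ν y)

/-- A type of points, with the discrete topology. -/
def Pts (S : Type*) : Type _ := S

instance (S : Type*) : TopologicalSpace (Pts S) := ⊥

instance (S : Type*) : DiscreteTopology (Pts S) := ⟨rfl⟩

/-- The atlas in which the hypersurface is a graph is kept. The bounds on `g` and its inverse, given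
in other atlases, are moved to it by `IsLorentzian.uaMetric`; charts at points of the hypersurface
meet `U`, so all bounds apply. -/
theorem exists_gaussSetup (hg : IsLorentzian g) (hτ : IsTimeOrientation g τ)
    (hι : ContMDiff (𝓡 d) (𝓡 (d + 1)) ω ι) (hs : IsSpacelike g ι)
    (hbag : BoundedAnalyticGeometryNear g τ ι) :
    ∃ (gref : Cov2 (d + 1) M) (ψ : M → OpenPartialHomeomorph M (Eu (d + 1))),
      IsBoundedAnalyticAtlas gref ψ ∧
      UAMetric (fun y : Pts S => coordCov (ψ (ι y)) g) ∧
      ∃ (F : Pts S → Eu d → ℝ) (ν : Pts S → Eu (d + 1)) (Ψ : Pts S → ℝ × Eu d → Eu (d + 1)),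
        UA Ψ ∧ (∃ N, ∀ y, ‖dchart (ψ (ι y)) (ι y) (ν y)‖ ≤ N) ∧
        ∃ r > 0, ∃ c > 0, ∃ C, IsGaussSetup g τ ι (fun y => ψ (ι y)) F ν Ψ r c C := by
  obtain ⟨gref, ⟨⟨m, rfl⟩, -⟩, ⟨U, hU, hιU, ⟨ψ₁, hψ₁, ε₁, hε₁, -, C₁, h₁⟩,
    ⟨ψ₂, hψ₂, ε₂, hε₂, -, C₂, h₂⟩, ψ, hψ, CF, hF⟩, Cn, hCn⟩ := hbag
  have hmeet : ∀ {ψ' : M → OpenPartialHomeomorph M (Eu (d + 1))},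
      IsBoundedAnalyticAtlas m.inner ψ' → ∀ y : S, ((ψ' (ι y)).source ∩ U).Nonempty :=
    fun h y => ⟨ι y, h.mem_source _, hιU ⟨y, rfl⟩⟩
  have hG : UAMetric (fun y : Pts S => coordCov (ψ (ι y)) g) :=
    hg.uaMetric (fun x v w => m.symm x v w) hψ hψ₁ hψ₂ (fun y : Pts S => ι y) hε₁ hε₂
      (fun y => h₁ _ (hmeet hψ₁ y)) (fun y => h₂ _ (hmeet hψ₂ y))
  choose F hFb hFi using fun y : Pts S => hF (ι y) (hmeet hψ y)
  have hchart : ∀ y : Pts S, IsGraphChart ι (ψ (ι y)) (F y) := fun y =>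
    ⟨hψ.analytic _, hψ.target_eq _, hFi y⟩
  have uF : UA F := UA.of_analyticBound one_pos hFb
  have hF0 : ∀ y, F y 0 = 0 := by
    intro y
    have h1 := (hchart y).eq_graphMap (hψ.mem_source (ι y))
    rw [hψ.center, map_zero] at h1
    have h2 := congrArg (lastL d) h1
    rw [map_zero, graphMap, lastL_snocL] at h2
    exact h2.symm
  choose ν hν using fun y : Pts S => exists_futureUnitNormal hg hτ hs y
  obtain ⟨c₀, hc₀, heq⟩ := hψ.equivalent
  -- The bound on the normal for the reference metric becomes a Euclidean one by uniform equivalence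
  -- with the flat metric. It makes the initial velocities a bounded family.
  have hN : ∀ y : Pts S, ‖dchart (ψ (ι y)) (ι y) (ν y)‖ ≤ √(c₀ * Cn) := by
    intro y
    refine Real.le_sqrt_of_sq_le ?_
    have h1 := (heq (ι y) 0 (zero_mem_cube _) (dchart (ψ (ι y)) (ι y) (ν y))).1
    have h2 := formAt_coord (hψ.analytic (ι y)) m.inner (hψ.mem_source (ι y)) (ν y) (ν y)
    rw [hψ.center] at h2
    rw [← h2, inv_mul_le_iff₀ hc₀] at h1
    exact h1.trans (mul_le_mul_of_nonneg_left (hCn y (ν y) (hν y)) hc₀.le)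
  have hunit : ∀ y : Pts S, IsUnitNormalAt (coordCov (ψ (ι y)) g) (F y) 0
      (dchart (ψ (ι y)) (ι y) (ν y)) := by
    intro y
    have hz : initL d (ψ (ι y) (ι y)) = 0 := by rw [hψ.center, map_zero]
    have h1 := (hchart y).isUnitNormalAt hι hs (hψ.mem_source (ι y)) (by
      rw [hz]; exact (uF.eventually_analyticAt.self_of_nhds y).differentiableAt) (hν y)
    rwa [hz] at h1
  obtain ⟨Ψ, uΨ, hΨ0, r, hr, c, hc, C, hflow⟩ := exists_gaussFlow hG
    (fun y => coordCov_symm hg.symm _) uF hF0 hN hunit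
  exact ⟨m.inner, ψ, hψ, hG, F, ν, Ψ, uΨ, ⟨_, hN⟩, r, hr, c, hc, C, hchart,
    fun y => hψ.mem_source _, fun y => hψ.center _, hν, hflow, hΨ0⟩

namespace IsGaussSetup

variable {φ : S → OpenPartialHomeomorph M (Eu (d + 1))} {F : S → Eu d → ℝ}
  {ν : S → Eu (d + 1)} {Ψ : S → ℝ × Eu d → Eu (d + 1)} {r c C : ℝ}

lemma mem_target (h : IsGaussSetup g τ ι φ F ν Ψ r c C) (y : S) {p : ℝ × Eu d}
    (hp : p ∈ Metric.ball (0 : ℝ × Eu d) r) : Ψ y p ∈ (φ y).target := by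
  rw [(h.chart y).target_eq]
  exact ball_subset_cube _ _ (mem_ball_zero_iff.2 (((h.flow y).small p hp).trans (by norm_num)))

lemma differentiableAt_graph (h : IsGaussSetup g τ ι φ F ν Ψ r c C) (y : S) {v : Eu d}
    (hv : ‖v‖ < r) : DifferentiableAt ℝ (F y) v :=
  ((h.flow y).analytic_graph v (mem_ball_zero_iff.2 hv)).differentiableAt

lemma eq_initial (h : IsGaussSetup g τ ι φ F ν Ψ r c C) {y x : S} (hx : ι x ∈ (φ y).source)
    (hv : ‖initL d (φ y (ι x))‖ < r) : Ψ y (0, initL d (φ y (ι x))) = φ y (ι x) := by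
  rw [(h.flow y).initial _ (mem_ball_zero_iff.2 hv)]
  exact ((h.chart y).eq_graphMap hx).symm

lemma exists_point (h : IsGaussSetup g τ ι φ F ν Ψ r c C) (y : S) {v : Eu d} (hv : ‖v‖ < r) :
    ∃ x, ι x ∈ (φ y).source ∧ φ y (ι x) = graphMap (F y) v := by
  refine (h.chart y).exists_eq ?_
  rw [← (h.flow y).initial v (mem_ball_zero_iff.2 hv), ← (h.chart y).target_eq]
  exact h.mem_target y (mem_ball_prod.2 ⟨by simpa using (norm_nonneg v).trans_lt hv, hv⟩)

lemma isChartGeodesic (h : IsGaussSetup g τ ι φ F ν Ψ r c C) (y : S) {v : Eu d} (hv : ‖v‖ < r) :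
    IsChartGeodesic g (φ y) r (fun t => Ψ y (t, v)) := by
  have hmem : ∀ t ∈ Set.Ioo (-r) r, (t, v) ∈ Metric.ball (0 : ℝ × Eu d) r := fun t ht =>
    mem_ball_prod.2 ⟨abs_lt.2 ht, hv⟩
  have hd : ∀ t ∈ Set.Ioo (-r) r, deriv (fun s => Ψ y (s, v)) t = fderiv ℝ (Ψ y) (t, v) (1, 0) :=
    fun t ht => (hasDerivAt_slice ((h.flow y).analytic _ (hmem t ht)).differentiableAt).deriv
  refine ⟨fun t ht => h.mem_target y (hmem t ht), fun t ht => ?_, fun t ht w => ?_⟩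
  · exact ((h.flow y).analytic _ (hmem t ht)).contDiffAt.comp t
      (contDiffAt_id.prodMk contDiffAt_const)
  · have h2 : iteratedDeriv 2 (fun s => Ψ y (s, v)) t
        = fderiv ℝ (fun q => fderiv ℝ (Ψ y) q (1, 0)) (t, v) (1, 0) := by
      rw [iteratedDeriv_two_eq]
      have e : deriv (fun s => Ψ y (s, v)) =ᶠ[𝓝 t] fun s => fderiv ℝ (Ψ y) (s, v) (1, 0) := by
        filter_upwards [isOpen_Ioo.mem_nhds ht] with s hs using hd s hs
      rw [e.deriv_eq]
      exact (hasDerivAt_slice (f := fun q => fderiv ℝ (Ψ y) q (1, 0))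
        (((h.flow y).analytic _ (hmem t ht)).fderiv.differentiableAt.clm_apply
          (differentiableAt_const _))).deriv
    rw [h2, hd t ht]
    exact (h.flow y).geodesic _ (hmem t ht) w

/-- The flow in every chart starts with the future directed unit normal. -/
lemma dsymm_initial (h : IsGaussSetup g τ ι φ F ν Ψ r c C) (hg : IsLorentzian g)
    (hτ : IsTimeOrientation g τ) (hι : ContMDiff (𝓡 d) (𝓡 (d + 1)) ω ι) (hs : IsSpacelike g ι)
    {y x : S} (hx : ι x ∈ (φ y).source) (hv : ‖initL d (φ y (ι x))‖ < r) :
    dsymm (φ y) (φ y (ι x)) (fderiv ℝ (Ψ y) (0, initL d (φ y (ι x))) (1, 0)) = ν x := by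
  set v := initL d (φ y (ι x)) with hvdef
  have hr : 0 < r := (norm_nonneg v).trans_lt hv
  have hφ := (h.chart y).analytic
  have hmem : ∀ s ∈ Set.Icc (0 : ℝ) 1, ((0 : ℝ), s • v) ∈ Metric.ball (0 : ℝ × Eu d) r := by
    intro s hs
    refine mem_ball_prod.2 ⟨by simpa using hr, ?_⟩
    rw [norm_smul, Real.norm_eq_abs, abs_of_nonneg hs.1]
    nlinarith [norm_nonneg v, hs.2]
  -- the time orientation in coordinates
  let τ' : M → Eu (d + 1) := fun p => τ p
  let T : Eu (d + 1) → Eu (d + 1) := fun w => dchart (φ y) ((φ y).symm w) (τ' ((φ y).symm w))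
  have hT : ∀ w ∈ (φ y).target, ContinuousAt T w := fun w hw =>
    ContinuousAt.comp (f := (φ y).symm) (g := fun p => dchart (φ y) p (τ' p))
      (continuousAt_coord_vectorField hφ hτ.1 ((φ y).map_target hw)) ((φ y).continuousAt_symm hw)
  have hTneg : ∀ w ∈ (φ y).target, coordCov (φ y) g w (T w) (T w) < 0 := by
    intro w hw
    have e := formAt_coord hφ g ((φ y).map_target hw) (τ' ((φ y).symm w)) (τ' ((φ y).symm w))
    rw [(φ y).right_inv hw] at e
    exact e ▸ hτ.2 ((φ y).symm w)
  let q : ℝ → Eu (d + 1) := fun s => Ψ y (0, s • v)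
  let N : ℝ → Eu (d + 1) := fun s => fderiv ℝ (Ψ y) (0, s • v) (1, 0)
  let f : ℝ → ℝ := fun s => coordCov (φ y) g (q s) (N s) (T (q s))
  have hf : ContinuousOn f (Set.Icc 0 1) := by
    intro s hs
    have hm := hmem s hs
    have a1 : ContinuousAt (fun s : ℝ => ((0 : ℝ), s • v)) s := by fun_prop
    have a2 : ContinuousAt q s :=
      ContinuousAt.comp (g := Ψ y) ((h.flow y).analytic _ hm).continuousAt a1
    have a3 : ContinuousAt N s :=
      (ContinuousAt.comp (f := fun s : ℝ => ((0 : ℝ), s • v)) (g := fderiv ℝ (Ψ y)) ((h.flow y).analytic _ hm).fderiv.continuousAt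
        a1).clm_apply continuousAt_const
    have a4 : ContinuousAt (fun s => coordCov (φ y) g (q s)) s :=
      ContinuousAt.comp (g := coordCov (φ y) g)
        (analyticAt_coordCov hg.analytic hφ (h.mem_target y hm)).continuousAt a2
    have a5 : ContinuousAt (fun s => T (q s)) s :=
      ContinuousAt.comp (g := T) (hT _ (h.mem_target y hm)) a2
    exact ((a4.clm_apply a3).clm_apply a5).continuousWithinAt
  -- The initial velocity and the time orientation are both timelike, so their product cannot
  -- vanish. Its sign is therefore constant along the segment from the centre, where the normal is
  -- future directed by construction.
  have hf0 : ∀ s ∈ Set.Icc (0 : ℝ) 1, f s ≠ 0 := by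
    intro s hs
    have hm := hmem s hs
    refine (hg.coord hφ (h.mem_target y hm)).ne_zero_of_timelike ?_ (hTneg _ (h.mem_target y hm))
    rw [(h.flow y).unit _ hm]; norm_num
  have hfs : f 0 < 0 := by
    have e0 : q 0 = φ y (ι y) := by
      simp only [q, zero_smul]
      rw [(h.flow y).initial 0 (Metric.mem_ball_self hr), h.center]
      have := (h.chart y).eq_graphMap (h.mem_source y)
      rw [h.center, map_zero] at this
      exact this.symm
    have e1 : N 0 = dchart (φ y) (ι y) (ν y) := by
      simp only [N, zero_smul]; exact h.initial y
    have e2 : T (q 0) = dchart (φ y) (ι y) (τ' (ι y)) := by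
      simp only [T, e0]; rw [(φ y).left_inv (h.mem_source y)]
    simp only [f]
    rw [e2, e1, e0, ← formAt_coord hφ g (h.mem_source y)]
    exact (h.future y).future
  have hf1 : f 1 < 0 := by
    by_contra! hge
    obtain ⟨s, hs, hs0⟩ := intermediate_value_Icc (zero_le_one' ℝ) hf ⟨hfs.le, hge⟩
    exact hf0 s hs hs0
  have hm := hmem 1 ⟨zero_le_one, le_rfl⟩
  have e0 : q 1 = φ y (ι x) := by
    simp only [q, one_smul]; exact h.eq_initial hx hv
  rw [one_smul] at hm
  have hbij := (h.chart y).surjective hι hs hx (h.differentiableAt_graph y hv)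
  set X := fderiv ℝ (Ψ y) (0, v) (1, 0) with hX
  have hDX : dchart (φ y) (ι x) (dsymm (φ y) (φ y (ι x)) X) = X := dchart_dsymm_apply hφ hx X
  refine unit_normal_unique (B := formAt g (ι x)) (D := dmap ι x) (τ := τ' (ι x))
    (fun w hw => spacelike_pos hs x hw) ?_ (h.future x).unit ?_ (h.future x).normal ?_
    (h.future x).future
  · rw [formAt_coord hφ g hx, hDX]
    have := (h.flow y).unit _ hm
    rwa [h.eq_initial hx hv] at this
  · intro w
    rw [formAt_coord hφ g hx, hDX]
    have h1 := DFunLike.congr_fun ((h.chart y).dchart_dmap hι hx (h.differentiableAt_graph y hv)) w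
    have h2 := (h.flow y).orth _ hm ((initL d ∘L dchart (φ y) (ι x) ∘L dmap ι x) w)
    rw [h.eq_initial hx hv] at h2
    refine Eq.trans ?_ h2
    congr 1
    refine h1.trans ?_
    have h3 : HasFDerivAt (fun z : Eu d => Ψ y (0, z))
        ((fderiv ℝ (Ψ y) (0, v)).comp (ContinuousLinearMap.inr ℝ ℝ (Eu d))) v :=
      ((h.flow y).analytic _ hm).differentiableAt.hasFDerivAt.comp v (hasFDerivAt_prodMk_right 0 v)
    have h4 : (fun z : Eu d => Ψ y (0, z)) =ᶠ[𝓝 v] graphMap (F y) := by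
      filter_upwards [Metric.isOpen_ball.mem_nhds (mem_ball_zero_iff.2 hv)] with z hz
        using (h.flow y).initial z hz
    rw [ContinuousLinearMap.comp_apply, ← h4.fderiv_eq, h3.fderiv]
    rfl
  · rw [formAt_coord hφ g hx, hDX]
    have e2 : T (q 1) = dchart (φ y) (ι x) (τ' (ι x)) := by
      simp only [T, e0]; rw [(φ y).left_inv hx]
    simp only [f] at hf1
    rw [e2, e0] at hf1
    simpa only [N, one_smul] using hf1

/-- The normal geodesic flow. -/
def flowMap (φ : S → OpenPartialHomeomorph M (Eu (d + 1))) (Ψ : S → ℝ × Eu d → Eu (d + 1))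
    (p : ℝ × S) : M := (φ p.2).symm (Ψ p.2 (p.1, 0))

/-- The normal geodesic flow, in every chart. -/
theorem flowMap_eq [T2Space M] (h : IsGaussSetup g τ ι φ F ν Ψ r c C) (hg : IsLorentzian g)
    (hτ : IsTimeOrientation g τ) (hι : ContMDiff (𝓡 d) (𝓡 (d + 1)) ω ι) (hs : IsSpacelike g ι)
    {y x : S} (hx : ι x ∈ (φ y).source) (hv : ‖initL d (φ y (ι x))‖ < r) {t : ℝ} (ht : |t| < r) :
    flowMap φ Ψ (t, x) = (φ y).symm (Ψ y (t, initL d (φ y (ι x)))) := by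
  have hr : 0 < r := (abs_nonneg t).trans_lt ht
  have h00 : (0 : ℝ) ∈ Set.Ioo (-r) r := ⟨by linarith, hr⟩
  have hz : initL d (φ x (ι x)) = 0 := by rw [h.center, map_zero]
  have hz' : ‖initL d (φ x (ι x))‖ < r := by rw [hz, norm_zero]; exact hr
  have hd : ∀ (y : S) (v : Eu d), ‖v‖ < r →
      deriv (fun s => Ψ y (s, v)) 0 = fderiv ℝ (Ψ y) (0, v) (1, 0) := fun y v hv =>
    (hasDerivAt_slice ((h.flow y).analytic _
      (mem_ball_prod.2 ⟨by simpa using hr, hv⟩)).differentiableAt).deriv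
  have e1 := h.eq_initial (h.mem_source x) hz'
  have e2 := h.dsymm_initial hg hτ hι hs (h.mem_source x) hz'
  rw [hz] at e1 e2
  -- Both sides are geodesics from `ι x`, in different charts, and start with the future directed
  -- unit normal `ν x`.
  refine (h.isChartGeodesic x (v := 0) (by simpa using hr)).unique hg (h.chart x).analytic
    (h.chart y).analytic (h.isChartGeodesic y hv) ?_ ?_ t (abs_lt.1 ht)
  · rw [e1, h.eq_initial hx hv, (φ x).left_inv (h.mem_source x), (φ y).left_inv hx]
  · rw [hd x 0 (by simpa using hr), hd y _ hv, e1, e2, h.eq_initial hx hv,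
      h.dsymm_initial hg hτ hι hs hx hv]

end IsGaussSetup

end Hypersurface
end BAG

end

noncomputable section
namespace BAG

open Filter
open scoped BoundedContinuousFunction

/-! ### Curves of bounded speed stay in a chart -/

section Paths

variable {n : ℕ} {M : Type*} [TopologicalSpace M] [ChartedSpace (Eu n) M]
  [IsManifold (𝓡 n) ω M]

lemma isOpen_cube (n : ℕ) (r : ℝ) : IsOpen (cube n r) := by
  have : cube n r = ⋂ i, {v : Eu n | |v i| < r} := by ext v; simp [cube]
  rw [this]
  exact isOpen_iInter_of_finite fun i => isOpen_lt (by fun_prop) continuous_const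

/-- Transitions between the charts of a bounded analytic atlas are uniformly Lipschitz. -/
lemma norm_fderiv_transition_le {gref : Cov2 n M} {φ φ' : OpenPartialHomeomorph M (Eu n)}
    (hφ : φ ∈ IsManifold.maximalAtlas (𝓡 n) ω M) (hφ' : φ' ∈ IsManifold.maximalAtlas (𝓡 n) ω M)
    {c : ℝ} (hc : 0 < c) {v : Eu n} (hv : v ∈ φ.target) (hv' : φ.symm v ∈ φ'.source)
    (h : ∀ a, coordCov φ gref v a a ≤ c * ‖a‖ ^ 2)
    (h' : ∀ a, c⁻¹ * ‖a‖ ^ 2 ≤ coordCov φ' gref (φ' (φ.symm v)) a a) (a : Eu n) :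
    ‖fderiv ℝ (fun u => φ' (φ.symm u)) v a‖ ≤ c * ‖a‖ := by
  have h1 := h a
  rw [coordCov_transition hφ hφ' gref hv hv', pullForm_apply] at h1
  have h2 := (h' _).trans h1
  rw [inv_mul_le_iff₀ hc] at h2
  refine le_of_sq_le_sq ?_ (by positivity)
  linarith [mul_pow c ‖a‖ 2, h2, show c * (c * ‖a‖ ^ 2) = c ^ 2 * ‖a‖ ^ 2 by ring]

/-- A curve of bounded speed that starts near the centre of a chart stays in the chart. -/
lemma stays_in_chart [T2Space M] {φ : OpenPartialHomeomorph M (Eu n)}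
    (hcube : φ.target = cube n 1) {α : ℝ → M} {K ρ : ℝ} (hK : 0 ≤ K) (hρ : ρ + K < 1)
    (hα : ∀ s ∈ Set.Icc (0 : ℝ) 1, ContinuousAt α s)
    (hd : ∀ s ∈ Set.Icc (0 : ℝ) 1, α s ∈ φ.source →
      ∃ w, HasDerivAt (fun s => φ (α s)) w s ∧ ‖w‖ ≤ K)
    (h0 : α 0 ∈ φ.source) (h0' : ‖φ (α 0)‖ ≤ ρ) : α 1 ∈ φ.source ∧ ‖φ (α 1)‖ ≤ ρ + K := by
  let Z : Set ℝ := {s | α s ∈ φ.source ∧ ‖φ (α s)‖ ≤ ρ + K * s}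
  have hBt : Metric.closedBall (0 : Eu n) (ρ + K) ⊆ φ.target := by
    rw [hcube]
    exact (Metric.closedBall_subset_ball hρ).trans (ball_subset_cube n 1)
  -- A compact subset of a Hausdorff space. It prevents the curve from leaving the chart domain at a
  -- limit time while its coordinates stay in a ball inside the cube.
  have hQ : IsClosed (φ.symm '' Metric.closedBall (0 : Eu n) (ρ + K)) :=
    ((isCompact_closedBall _ _).image_of_continuousOn
      (φ.continuousOn_symm.mono hBt)).isClosed
  have hcl : IsClosed (Z ∩ Set.Icc 0 1) := by
    refine isClosed_of_closure_subset fun s hs => ?_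
    have hs1 : s ∈ Set.Icc (0 : ℝ) 1 :=
      closure_minimal Set.inter_subset_right isClosed_Icc hs
    have hfr := mem_closure_iff_frequently.1 hs
    have hsQ : α s ∈ φ.symm '' Metric.closedBall (0 : Eu n) (ρ + K) := by
      by_contra hno
      have hev := (hα s hs1).preimage_mem_nhds (hQ.isOpen_compl.mem_nhds hno)
      obtain ⟨σ, ⟨⟨hσ1, hσ2⟩, hσ3⟩, hσ4⟩ := (hfr.and_eventually hev).exists
      refine hσ4 ⟨φ (α σ), ?_, φ.left_inv hσ1⟩
      rw [mem_closedBall_zero_iff]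
      nlinarith [hσ3.2]
    obtain ⟨w, hw, hws⟩ := hsQ
    have hsrc : α s ∈ φ.source := by rw [← hws]; exact φ.map_target (hBt hw)
    refine ⟨⟨hsrc, ?_⟩, hs1⟩
    have hc : ContinuousAt (fun s => ‖φ (α s)‖ - (ρ + K * s)) s := by
      have : ContinuousAt (fun s => φ (α s)) s := (φ.continuousAt hsrc).comp (hα s hs1)
      exact this.norm.sub (by fun_prop)
    by_contra! hlt
    have hev : ∀ᶠ σ in 𝓝 s, 0 < ‖φ (α σ)‖ - (ρ + K * σ) :=
      hc.eventually_const_lt (by linarith)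
    obtain ⟨σ, ⟨⟨-, hσ2⟩, -⟩, hσ4⟩ := (hfr.and_eventually hev).exists
    linarith
  have hsub : Set.Icc (0 : ℝ) 1 ⊆ Z := by
    refine hcl.Icc_subset_of_forall_exists_gt ⟨h0, by simpa using h0'⟩ ?_
    rintro s ⟨⟨hs1, hs2⟩, hs3⟩ y hy
    have hev := (hα s ⟨hs3.1, hs3.2.le⟩).preimage_mem_nhds (φ.open_source.mem_nhds hs1)
    obtain ⟨η, hη, hηb⟩ := Metric.mem_nhds_iff.1 hev
    -- A slightly later time up to which the curve remains in the chart domain, so that the mean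
    -- value inequality propagates the bound `ρ + K s`.
    set b := min (min y 1) (s + η / 2) with hb
    have hsb : s < b := lt_min (lt_min hy hs3.2) (by linarith)
    have hb1 : b ≤ 1 := (min_le_left _ _).trans (min_le_right _ _)
    have hseg : ∀ σ ∈ Set.Icc s b, α σ ∈ φ.source ∧ σ ∈ Set.Icc (0 : ℝ) 1 := by
      intro σ hσ
      refine ⟨hηb ?_, hs3.1.trans hσ.1, hσ.2.trans hb1⟩
      rw [Metric.mem_ball, Real.dist_eq, abs_lt]
      have := hσ.2.trans (min_le_right (min y 1) (s + η / 2))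
      constructor <;> linarith [hσ.1]
    choose! w hw hwK using hd
    have hmv := (convex_Icc s b).norm_image_sub_le_of_norm_hasDerivWithin_le
      (f := fun s => φ (α s)) (f' := w) (C := K)
      (fun σ hσ => (hw σ (hseg σ hσ).2 (hseg σ hσ).1).hasDerivWithinAt)
      (fun σ hσ => hwK σ (hseg σ hσ).2 (hseg σ hσ).1) (Set.left_mem_Icc.2 hsb.le)
      (Set.right_mem_Icc.2 hsb.le)
    rw [Real.norm_eq_abs, abs_of_pos (by linarith)] at hmv
    refine ⟨b, ⟨(hseg b (Set.right_mem_Icc.2 hsb.le)).1, ?_⟩, hsb,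
      (min_le_left _ _).trans (min_le_left _ _)⟩
    have := norm_sub_norm_le (φ (α b)) (φ (α s))
    nlinarith
  have := hsub ⟨zero_le_one, le_rfl⟩
  exact ⟨this.1, by simpa using this.2⟩

end Paths

/-! ### Recognizing charts of the maximal atlas -/

section Atlas

variable {d : ℕ} {S : Type*} [TopologicalSpace S] [ChartedSpace (Eu d) S] [IsManifold (𝓡 d) ω S]

/-- An analytic diffeomorphism onto an open subset of the model space is a chart. -/
lemma mem_maximalAtlas_of_contMDiffAt {θ : OpenPartialHomeomorph S (Eu d)}
    (h : ∀ x ∈ θ.source, ContMDiffAt (𝓡 d) (𝓡 d) ω θ x)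
    (h' : ∀ v ∈ θ.target, ContMDiffAt (𝓡 d) (𝓡 d) ω θ.symm v) :
    θ ∈ IsManifold.maximalAtlas (𝓡 d) ω S := by
  have key : ∀ e e' : OpenPartialHomeomorph S (Eu d),
      (∀ x ∈ e.source, ContMDiffAt (𝓡 d) (𝓡 d) ω e x) →
      (∀ v ∈ e'.target, ContMDiffAt (𝓡 d) (𝓡 d) ω e'.symm v) →
      (contDiffPregroupoid ω (𝓡 d)).property (e'.symm.trans e) (e'.symm.trans e).source := by
    intro e e' he he'
    change ContDiffOn ℝ ω _ _
    intro v hv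
    have hv1 : v ∈ (e'.symm.trans e).source := hv.1
    rw [OpenPartialHomeomorph.trans_source] at hv1
    have h1 : ContMDiffAt (𝓡 d) (𝓡 d) ω (e ∘ e'.symm) v :=
      (he _ hv1.2).comp v (he' _ hv1.1)
    exact (contMDiffAt_iff_contDiffAt.1 h1).contDiffWithinAt
  rw [IsManifold.maximalAtlas, mem_maximalAtlas_iff]
  intro e he
  have he1 : e ∈ IsManifold.maximalAtlas (𝓡 d) ω S := IsManifold.subset_maximalAtlas he
  refine ⟨⟨key e θ (fun x hx => contMDiffAt_chart he1 hx) h', ?_⟩,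
    ⟨key θ e h (fun v hv => contMDiffAt_chart_symm he1 hv), ?_⟩⟩
  · exact key θ e h (fun v hv => contMDiffAt_chart_symm he1 hv)
  · exact key e θ (fun x hx => contMDiffAt_chart he1 hx) h'

end Atlas

/-! ### Injectivity of the flow and charts of the hypersurface -/

section Flow

variable {d : ℕ} {M : Type*} [TopologicalSpace M] [T2Space M] [ChartedSpace (Eu (d + 1)) M]
  [IsManifold (𝓡 (d + 1)) ω M]
  {S : Type*} [TopologicalSpace S] [ChartedSpace (Eu d) S] [IsManifold (𝓡 d) ω S]
  {g : Cov2 (d + 1) M} {τ : ∀ p : M, TangentSpace (𝓡 (d + 1)) p} {ι : S → M}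
  {φ : S → OpenPartialHomeomorph M (Eu (d + 1))} {F : S → Eu d → ℝ}
  {ν : S → Eu (d + 1)} {Ψ : S → ℝ × Eu d → Eu (d + 1)} {r c C : ℝ}

/-- A chart of the hypersurface, onto the unit cube, that is induced by a graph chart: the first
`d` coordinates, scaled by `ρ⁻¹`. -/
structure IsHypChart (ι : S → M) (φ : OpenPartialHomeomorph M (Eu (d + 1))) (F : Eu d → ℝ)
    (ρ : ℝ) (y : S) (θ : OpenPartialHomeomorph S (Eu d)) : Prop where
  analytic : θ ∈ IsManifold.maximalAtlas (𝓡 d) ω S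
  target_eq : θ.target = cube d 1
  mem_source : y ∈ θ.source
  center : θ y = 0
  apply : ∀ x, θ x = ρ⁻¹ • initL d (φ (ι x))
  source : ∀ x ∈ θ.source, ι x ∈ φ.source

namespace IsGaussSetup

/-- The normal geodesic flow is injective for short times. -/
lemma flowMap_injOn (h : IsGaussSetup g τ ι φ F ν Ψ r c C) (hg : IsLorentzian g)
    (hτ : IsTimeOrientation g τ) (hι : ContMDiff (𝓡 d) (𝓡 (d + 1)) ω ι)
    (hinj : Function.Injective ι) (hs : IsSpacelike g ι)
    {gref : Cov2 (d + 1) M} {c₀ : ℝ} (hc₀ : 0 < c₀) (hc : 0 < c) (hC : 0 ≤ C)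
    (heq : ∀ y, ∀ v ∈ cube (d + 1) 1, ∀ a, c₀⁻¹ * ‖a‖ ^ 2 ≤ coordCov (φ y) gref v a a ∧
      coordCov (φ y) gref v a a ≤ c₀ * ‖a‖ ^ 2)
    {δ : ℝ} (hδr : δ ≤ r) (hδ1 : C * δ + c₀ * C * δ < 1)
    (hδ2 : ‖initL d‖ * (C * δ + c₀ * C * δ) < r) :
    Set.InjOn (flowMap φ Ψ) (Set.Ioo (-δ) δ ×ˢ Set.univ) := by
  rintro ⟨t, x⟩ ⟨ht, -⟩ ⟨s, y⟩ ⟨hs', -⟩ heqχ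
  have ht' : |t| < δ := abs_lt.2 ht
  have hs'' : |s| < δ := abs_lt.2 hs'
  have hδ : 0 < δ := (abs_nonneg t).trans_lt ht'
  have hr : 0 < r := hδ.trans_le hδr
  have hmem : ∀ u : ℝ, |u| < δ → (u, (0 : Eu d)) ∈ Metric.ball (0 : ℝ × Eu d) r := fun u hu =>
    mem_ball_prod.2 ⟨hu.trans_le hδr, by simpa using hr⟩
  have hzero : Ψ x (0, 0) = 0 := by
    have hz : initL d (φ x (ι x)) = 0 := by rw [h.center, map_zero]
    have := h.eq_initial (h.mem_source x) (by rw [hz, norm_zero]; exact hr)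
    rwa [hz, h.center] at this
  have hΨx : ‖Ψ x (t, 0)‖ ≤ C * δ := by
    have hmv := (convex_Ioo (-δ) δ).norm_image_sub_le_of_norm_hasDerivWithin_le
      (f := fun u => Ψ x (u, 0)) (f' := fun u => fderiv ℝ (Ψ x) (u, 0) (1, 0)) (C := C)
      (fun u hu => (hasDerivAt_slice ((h.flow x).analytic _
        (hmem u (abs_lt.2 hu))).differentiableAt).hasDerivWithinAt)
      (fun u hu => (h.flow x).speed _ (hmem u (abs_lt.2 hu)))
      (show (0 : ℝ) ∈ Set.Ioo (-δ) δ from ⟨by linarith, hδ⟩) ht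
    rw [hzero, sub_zero, sub_zero] at hmv
    refine hmv.trans ?_
    rw [Real.norm_eq_abs]
    gcongr
  -- The normal geodesic through `ι y`, run back from the common point at `σ = 0` to `ι y` at `σ =
  -- 1`. In the chart at `x` its speed is at most `c₀ C δ`, because transitions are `c₀`-Lipschitz.
  let α : ℝ → M := fun σ => (φ y).symm (Ψ y (s * (1 - σ), 0))
  have hball : ∀ σ ∈ Set.Icc (0 : ℝ) 1, |s * (1 - σ)| < δ := by
    intro σ hσ
    rw [abs_mul]
    have : |1 - σ| ≤ 1 := by rw [abs_le]; constructor <;> linarith [hσ.1, hσ.2]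
    calc |s| * |1 - σ| ≤ |s| * 1 := by gcongr
      _ < δ := by rwa [mul_one]
  have hder : ∀ σ ∈ Set.Icc (0 : ℝ) 1, HasDerivAt (fun σ => Ψ y (s * (1 - σ), 0))
      ((-s) • fderiv ℝ (Ψ y) (s * (1 - σ), 0) (1, 0)) σ := by
    intro σ hσ
    have e1 := hasDerivAt_slice ((h.flow y).analytic _ (hmem _ (hball σ hσ))).differentiableAt
    have e2 : HasDerivAt (fun σ : ℝ => s * (1 - σ)) (-s) σ := by
      simpa using ((hasDerivAt_id σ).const_sub 1).const_mul s
    exact HasDerivAt.scomp (g₁ := fun u => Ψ y (u, 0)) σ e1 e2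
  have hα0 : α 0 = (φ x).symm (Ψ x (t, 0)) := by
    simp only [α, sub_zero, mul_one]; exact heqχ.symm
  have htx := h.mem_target x (hmem t ht')
  have hα0s : α 0 ∈ (φ x).source := by rw [hα0]; exact (φ x).map_target htx
  have hfin := stays_in_chart (φ := φ x) (h.chart x).target_eq (α := α) (K := c₀ * C * δ)
    (ρ := C * δ) (by positivity) hδ1
    (fun σ hσ => ((φ y).continuousAt_symm (h.mem_target y (hmem _ (hball σ hσ)))).comp
      (f := fun σ => Ψ y (s * (1 - σ), 0)) (hder σ hσ).continuousAt)
    (fun σ hσ hsrc => by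
      have hty := h.mem_target y (hmem _ (hball σ hσ))
      have e1 := (analyticAt_transition (h.chart y).analytic (h.chart x).analytic hty
        hsrc).differentiableAt.hasFDerivAt.comp_hasDerivAt σ (hder σ hσ)
      refine ⟨_, e1, ?_⟩
      refine (norm_fderiv_transition_le (gref := gref) (h.chart y).analytic (h.chart x).analytic
        hc₀ hty hsrc (fun a => (heq y _ ?_ a).2) (fun a => (heq x _ ?_ a).1) _).trans ?_
      · rw [← (h.chart y).target_eq]; exact hty
      · rw [← (h.chart x).target_eq]; exact (φ x).map_source hsrc
      · rw [norm_smul, norm_neg, Real.norm_eq_abs, mul_assoc]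
        have := (h.flow y).speed _ (hmem _ (hball σ hσ))
        rw [mul_comm C δ]
        gcongr)
    hα0s (by rw [hα0, (φ x).right_inv htx]; exact hΨx)
  have hα1 : α 1 = ι y := by
    have hz : initL d (φ y (ι y)) = 0 := by rw [h.center, map_zero]
    have := h.eq_initial (h.mem_source y) (by rw [hz, norm_zero]; exact hr)
    rw [hz] at this
    simp only [α, sub_self, mul_zero, this]
    exact (φ y).left_inv (h.mem_source y)
  rw [hα1] at hfin
  have hv : ‖initL d (φ x (ι y))‖ < r :=
    ((initL d).le_opNorm _).trans_lt (lt_of_le_of_lt (by gcongr; exact hfin.2) hδ2)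
  have hs1 : |s| < r := hs''.trans_le hδr
  have e1 := h.flowMap_eq hg hτ hι hs hfin.1 hv hs1
  have hmem' : (s, initL d (φ x (ι y))) ∈ Metric.ball (0 : ℝ × Eu d) r := mem_ball_prod.2 ⟨hs1, hv⟩
  -- Since `ι y` lies in the chart at `x`, near its centre, both geodesics are seen by the one local
  -- flow `Ψ x`, which is injective by its expansion estimate.
  have e2 : Ψ x (t, 0) = Ψ x (s, initL d (φ x (ι y))) := by
    refine (φ x).symm.injOn htx (h.mem_target x hmem') ?_
    rw [← e1]; exact heqχ
  have e3 := (h.flow x).expand _ (hmem t ht') _ hmem'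
  rw [e2, sub_self, norm_zero] at e3
  have e4 : ((t, 0) : ℝ × Eu d) = (s, initL d (φ x (ι y))) := by
    rw [← sub_eq_zero, ← norm_le_zero_iff]
    by_contra! hpos
    nlinarith
  obtain ⟨e5, e6⟩ := Prod.mk.inj e4
  have e7 : φ x (ι y) = φ x (ι x) := by
    rw [(h.chart x).eq_graphMap hfin.1, (h.chart x).eq_graphMap (h.mem_source x), ← e6, h.center,
      map_zero]
  rw [e5, hinj ((φ x).injOn (h.mem_source x) hfin.1 e7.symm)]

/-- The charts of the hypersurface that are induced by the graph charts. -/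
lemma exists_hypChart (h : IsGaussSetup g τ ι φ F ν Ψ r c C)
    (hι : Manifold.IsSmoothEmbedding (𝓡 d) (𝓡 (d + 1)) ω ι) {ρ : ℝ} (hρ : 0 < ρ)
    (hρr : ∀ v ∈ cube d 1, ‖ρ • v‖ < r) (y : S) :
    ∃ θ : OpenPartialHomeomorph S (Eu d), IsHypChart ι (φ y) (F y) ρ y θ := by
  have : Nonempty S := ⟨y⟩
  have hιc := hι.contMDiff
  have hinj : Function.Injective ι := hι.isEmbedding.injective
  let f : S → Eu d := fun x => ρ⁻¹ • initL d (φ y (ι x))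
  let q : Eu d → M := fun v => (φ y).symm (graphMap (F y) (ρ • v))
  let f' : Eu d → S := fun v => Function.invFun ι (q v)
  let W : Set S := {x | ι x ∈ (φ y).source ∧ f x ∈ cube d 1}
  have hgt : ∀ v ∈ cube d 1, graphMap (F y) (ρ • v) ∈ (φ y).target := by
    intro v hv
    rw [← (h.flow y).initial _ (mem_ball_zero_iff.2 (hρr v hv))]
    refine h.mem_target y (mem_ball_prod.2 ⟨?_, hρr v hv⟩)
    rw [abs_zero]
    exact (norm_nonneg _).trans_lt (hρr v hv)
  have hf' : ∀ v ∈ cube d 1, ι (f' v) = q v := by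
    intro v hv
    obtain ⟨x, hx1, hx2⟩ := h.exists_point y (hρr v hv)
    refine Function.invFun_eq ⟨x, ?_⟩
    simp only [q]
    rw [← hx2, (φ y).left_inv hx1]
  have hf'2 : ∀ v ∈ cube d 1, ι (f' v) ∈ (φ y).source ∧
      φ y (ι (f' v)) = graphMap (F y) (ρ • v) := by
    intro v hv
    rw [hf' v hv]
    exact ⟨(φ y).map_target (hgt v hv), (φ y).right_inv (hgt v hv)⟩
  have hcf : ∀ x, ι x ∈ (φ y).source → ContMDiffAt (𝓡 d) (𝓡 d) ω f x := by
    intro x hx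
    have h1 := (contMDiffAt_chart (h.chart y).analytic hx).comp x (hιc x)
    have h2 : ContMDiffAt (𝓡 (d + 1)) (𝓡 d) ω (fun w => ρ⁻¹ • initL d w) (φ y (ι x)) :=
      contMDiffAt_iff_contDiffAt.2 ((initL d).contDiff.contDiffAt.const_smul ρ⁻¹)
    exact ContMDiffAt.comp (f := fun x => φ y (ι x)) x h2 h1
  have hcq : ∀ v ∈ cube d 1, ContMDiffAt (𝓡 d) (𝓡 (d + 1)) ω q v := by
    intro v hv
    have h1 : ContMDiffAt (𝓡 d) (𝓡 (d + 1)) ω (fun v => graphMap (F y) (ρ • v)) v := by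
      refine contMDiffAt_iff_contDiffAt.2 ?_
      exact (analyticAt_graphMap ((h.flow y).analytic_graph _
        (mem_ball_zero_iff.2 (hρr v hv)))).contDiffAt.comp v (contDiffAt_id.const_smul ρ)
    exact (contMDiffAt_chart_symm (h.chart y).analytic (hgt v hv)).comp v h1
  have hcf' : ContinuousOn f' (cube d 1) := by
    -- The inverse chart is known only after composition with `ι`. The embedding property gives its
    -- continuity, and below the immersion property gives its analyticity.
    rw [hι.isEmbedding.isInducing.continuousOn_iff]
    exact ContinuousOn.congr (fun v hv => (hcq v hv).continuousAt.continuousWithinAt) hf'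
  have hW : IsOpen W := by
    have h1 : IsOpen (ι ⁻¹' (φ y).source) := (φ y).open_source.preimage hιc.continuous
    exact ContinuousOn.isOpen_inter_preimage
      (fun x hx => (hcf x hx).continuousAt.continuousWithinAt) h1 (isOpen_cube d 1)
  let θ : OpenPartialHomeomorph S (Eu d) :=
    { toFun := f
      invFun := f'
      source := W
      target := cube d 1
      map_source' := fun x hx => hx.2
      map_target' := fun v hv => by
        refine ⟨(hf'2 v hv).1, ?_⟩
        simp only [f]
        rwa [(hf'2 v hv).2, initL_graphMap, inv_smul_smul₀ hρ.ne']
      left_inv' := fun x hx => by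
        refine hinj ?_
        rw [hf' _ hx.2]
        simp only [q, f]
        rw [smul_inv_smul₀ hρ.ne', ← (h.chart y).eq_graphMap hx.1, (φ y).left_inv hx.1]
      right_inv' := fun v hv => by
        simp only [f]
        rw [(hf'2 v hv).2, initL_graphMap, inv_smul_smul₀ hρ.ne']
      open_source := hW
      open_target := isOpen_cube d 1
      continuousOn_toFun := fun x hx => (hcf x hx.1).continuousAt.continuousWithinAt
      continuousOn_invFun := hcf' }
  have hy0 : f y = 0 := by simp only [f, h.center, map_zero, smul_zero]
  refine ⟨θ, mem_maximalAtlas_of_contMDiffAt (fun x hx => hcf x hx.1) (fun v hv => ?_), rfl,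
    ⟨h.mem_source y, by rw [hy0]; exact zero_mem_cube d⟩, hy0, fun x => rfl, fun x hx => hx.1⟩
  have hv' : v ∈ cube d 1 := hv
  rw [ContMDiffAt.iff_comp_isImmersionAt (hι.isImmersion.isImmersionAt _)]
  refine ⟨hcf'.continuousAt ((isOpen_cube d 1).mem_nhds hv'), (hcq v hv').congr_of_eventuallyEq ?_⟩
  filter_upwards [(isOpen_cube d 1).mem_nhds hv'] with w hw using hf' w hw

end IsGaussSetup

end Flow
end BAG

end

noncomputable section
namespace BAG

open Filter
open scoped BoundedContinuousFunction

/-! ### The flow as a diffeomorphism onto its image -/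

section FlowSmooth

variable {d : ℕ} {M : Type*} [TopologicalSpace M] [T2Space M] [ChartedSpace (Eu (d + 1)) M]
  [IsManifold (𝓡 (d + 1)) ω M]
  {S : Type*} [TopologicalSpace S] [ChartedSpace (Eu d) S] [IsManifold (𝓡 d) ω S]
  {g : Cov2 (d + 1) M} {τ : ∀ p : M, TangentSpace (𝓡 (d + 1)) p} {ι : S → M}
  {φ : S → OpenPartialHomeomorph M (Eu (d + 1))} {F : S → Eu d → ℝ}
  {ν : S → Eu (d + 1)} {Ψ : S → ℝ × Eu d → Eu (d + 1)} {r c C : ℝ}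

/-- The limit of the expansion estimate along difference quotients. As both sides have dimension `d
+ 1`, it makes the differential invertible. -/
lemma IsGaussFlow.fderiv_lower {G : Eu (d + 1) → Form (d + 1)} {F : Eu d → ℝ}
    {Ψ : ℝ × Eu d → Eu (d + 1)} (h : IsGaussFlow G F r c C Ψ) {p : ℝ × Eu d}
    (hp : p ∈ Metric.ball (0 : ℝ × Eu d) r) (w : ℝ × Eu d) : c * ‖w‖ ≤ ‖fderiv ℝ Ψ p w‖ := by
  have hd : HasDerivAt (fun s : ℝ => Ψ (p + s • w)) (fderiv ℝ Ψ p w) 0 := by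
    have e1 : HasDerivAt (fun s : ℝ => p + s • w) w 0 := by
      simpa using ((hasDerivAt_id (0 : ℝ)).smul_const w).const_add p
    have e2 : HasFDerivAt Ψ (fderiv ℝ Ψ p) (p + (0 : ℝ) • w) := by
      rw [zero_smul, add_zero]; exact (h.analytic p hp).differentiableAt.hasFDerivAt
    exact e2.comp_hasDerivAt 0 e1
  have ht := (hasDerivAt_iff_tendsto_slope_zero.1 hd).norm
  refine ge_of_tendsto ht ?_
  have hc : ∀ᶠ s in 𝓝 (0 : ℝ), p + s • w ∈ Metric.ball (0 : ℝ × Eu d) r := by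
    have : ContinuousAt (fun s : ℝ => p + s • w) 0 := by fun_prop
    refine this.preimage_mem_nhds (Metric.isOpen_ball.mem_nhds ?_)
    simpa using hp
  filter_upwards [hc.filter_mono nhdsWithin_le_nhds, self_mem_nhdsWithin] with s hs hs0
  have e := h.expand _ hs p hp
  rw [add_sub_cancel_left, norm_smul] at e
  have hpos : 0 < ‖s‖ := norm_pos_iff.2 hs0
  simp only [zero_add, zero_smul, add_zero]
  rw [norm_smul, norm_inv, ← div_eq_inv_mul, le_div_iff₀ hpos]
  linarith

lemma IsGaussFlow.fderiv_isInvertible {G : Eu (d + 1) → Form (d + 1)} {F : Eu d → ℝ}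
    {Ψ : ℝ × Eu d → Eu (d + 1)} (h : IsGaussFlow G F r c C Ψ) (hc : 0 < c) {p : ℝ × Eu d}
    (hp : p ∈ Metric.ball (0 : ℝ × Eu d) r) : (fderiv ℝ Ψ p).IsInvertible := by
  refine isInvertible_of_injective ?_ ((injective_iff_map_eq_zero _).2 fun w hw => ?_)
  · rw [Module.finrank_prod, Module.finrank_self, finrank_euclideanSpace_fin,
      finrank_euclideanSpace_fin, add_comm]
  · have := h.fderiv_lower hp w
    rw [hw, norm_zero] at this
    rw [← norm_le_zero_iff]
    nlinarith [norm_nonneg w]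

/-- The differential of a map on `ℝ × S`. -/
def dflow (χ : ℝ × S → M) (p : ℝ × S) : ℝ × Eu d →L[ℝ] Eu (d + 1) :=
  mfderiv (𝓘(ℝ, ℝ).prod (𝓡 d)) (𝓡 (d + 1)) χ p

variable {ρ : ℝ} {y : S} {θ : OpenPartialHomeomorph S (Eu d)}

namespace IsHypChart

variable {φ : OpenPartialHomeomorph M (Eu (d + 1))} {F : Eu d → ℝ}

lemma smul_apply (hθ : IsHypChart ι φ F ρ y θ) (hρ : 0 < ρ) (x : S) :
    ρ • θ x = initL d (φ (ι x)) := by rw [hθ.apply, smul_inv_smul₀ hρ.ne']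

lemma apply_mem (hθ : IsHypChart ι φ F ρ y θ) {x : S} (hx : x ∈ θ.source) : θ x ∈ cube d 1 := by
  rw [← hθ.target_eq]; exact θ.map_source hx

end IsHypChart

/-- A Gaussian normal setup together with the induced charts of the hypersurface. -/
structure IsGaussAtlas (g : Cov2 (d + 1) M) (τ : ∀ p : M, TangentSpace (𝓡 (d + 1)) p) (ι : S → M)
    (φ : S → OpenPartialHomeomorph M (Eu (d + 1))) (F : S → Eu d → ℝ) (ν : S → Eu (d + 1))
    (Ψ : S → ℝ × Eu d → Eu (d + 1)) (r c C ρ : ℝ) (θ : S → OpenPartialHomeomorph S (Eu d)) :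
    Prop where
  setup : IsGaussSetup g τ ι φ F ν Ψ r c C
  lorentz : IsLorentzian g
  orient : IsTimeOrientation g τ
  smooth : ContMDiff (𝓡 d) (𝓡 (d + 1)) ω ι
  spacelike : IsSpacelike g ι
  c_pos : 0 < c
  ρ_pos : 0 < ρ
  small : ∀ v ∈ cube d 1, ‖ρ • v‖ < r
  hyp : ∀ y, IsHypChart ι (φ y) (F y) ρ y (θ y)

/-- The coordinate expression, in a graph chart, of the induced metrics on the leaves. -/
def leafForm (G : Eu (d + 1) → Form (d + 1)) (Ψ : ℝ × Eu d → Eu (d + 1)) (p : ℝ × Eu d) : Form d :=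
  pullForm (G (Ψ p)) (fderiv ℝ Ψ p ∘L ContinuousLinearMap.inr ℝ ℝ (Eu d))

lemma leafForm_apply (G : Eu (d + 1) → Form (d + 1)) (Ψ : ℝ × Eu d → Eu (d + 1)) (p : ℝ × Eu d)
    (v w : Eu d) : leafForm G Ψ p v w = G (Ψ p) (fderiv ℝ Ψ p (0, v)) (fderiv ℝ Ψ p (0, w)) := rfl

namespace IsGaussAtlas

variable {θ : S → OpenPartialHomeomorph S (Eu d)}

lemma r_pos (h : IsGaussAtlas g τ ι φ F ν Ψ r c C ρ θ) : 0 < r := by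
  simpa using h.small 0 (zero_mem_cube d)

lemma mem_ball (h : IsGaussAtlas g τ ι φ F ν Ψ r c C ρ θ) {t : ℝ} (ht : |t| < r) {v : Eu d}
    (hv : v ∈ cube d 1) : (t, ρ • v) ∈ Metric.ball (0 : ℝ × Eu d) r :=
  mem_ball_prod.2 ⟨ht, h.small v hv⟩

lemma flowMap_eq (h : IsGaussAtlas g τ ι φ F ν Ψ r c C ρ θ) {y x : S} (hx : x ∈ (θ y).source)
    {t : ℝ} (ht : |t| < r) :
    IsGaussSetup.flowMap φ Ψ (t, x) = (φ y).symm (Ψ y (t, ρ • θ y x)) := by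
  have e := (h.hyp y).smul_apply h.ρ_pos x
  rw [e]
  refine h.setup.flowMap_eq h.lorentz h.orient h.smooth h.spacelike ((h.hyp y).source x hx) ?_ ht
  rw [← e]
  exact h.small _ ((h.hyp y).apply_mem hx)

lemma eventually_flowMap_eq (h : IsGaussAtlas g τ ι φ F ν Ψ r c C ρ θ) {y x : S}
    (hx : x ∈ (θ y).source) {t : ℝ} (ht : |t| < r) :
    IsGaussSetup.flowMap φ Ψ =ᶠ[𝓝 (t, x)] fun p => (φ y).symm (Ψ y (p.1, ρ • θ y p.2)) := by
  have h1 : ∀ᶠ s in 𝓝 t, |s| < r := continuous_abs.continuousAt.eventually_lt_const ht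
  have h2 : ∀ᶠ z in 𝓝 x, z ∈ (θ y).source := (θ y).open_source.mem_nhds hx
  filter_upwards [h1.prod_nhds h2] with p hp using h.flowMap_eq hp.2 hp.1

lemma hasMFDerivAt_inner (h : IsGaussAtlas g τ ι φ F ν Ψ r c C ρ θ) {y x : S}
    (hx : x ∈ (θ y).source) {t : ℝ} :
    HasMFDerivAt (𝓘(ℝ, ℝ).prod (𝓡 d)) 𝓘(ℝ, ℝ × Eu d) (fun p : ℝ × S => (p.1, ρ • θ y p.2)) (t, x)
      ((ContinuousLinearMap.fst ℝ ℝ (Eu d)).prod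
        ((ρ • dchart (θ y) x) ∘L ContinuousLinearMap.snd ℝ ℝ (Eu d))) := by
  have h1 : HasMFDerivAt (𝓘(ℝ, ℝ).prod (𝓡 d)) 𝓘(ℝ, ℝ) (fun p : ℝ × S => p.1) (t, x)
      (ContinuousLinearMap.fst ℝ ℝ (Eu d)) := hasMFDerivAt_fst (t, x)
  have h2 : HasMFDerivAt (𝓘(ℝ, ℝ).prod (𝓡 d)) (𝓡 d) (fun p : ℝ × S => p.2) (t, x)
      (ContinuousLinearMap.snd ℝ ℝ (Eu d)) := hasMFDerivAt_snd (t, x)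
  have h3 : HasMFDerivAt (𝓡 d) (𝓡 d) (θ y) x (dchart (θ y) x) :=
    ((contMDiffAt_chart (h.hyp y).analytic hx).mdifferentiableAt (by simp)).hasMFDerivAt
  have h4 : HasFDerivAt (fun w : Eu d => ρ • w) (ρ • ContinuousLinearMap.id ℝ (Eu d)) (θ y x) :=
    (hasFDerivAt_id (θ y x)).const_smul ρ
  have h5 : HasMFDerivAt (𝓘(ℝ, ℝ).prod (𝓡 d)) (𝓡 d) (fun p : ℝ × S => ρ • θ y p.2) (t, x)
      ((ρ • ContinuousLinearMap.id ℝ (Eu d)) ∘L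
        (dchart (θ y) x ∘L ContinuousLinearMap.snd ℝ ℝ (Eu d))) :=
    HasMFDerivAt.comp (t, x) (I' := 𝓡 d) (g := fun w : Eu d => ρ • w)
      (f := fun p : ℝ × S => θ y p.2) (hasMFDerivAt_iff_hasFDerivAt.2 h4)
      (HasMFDerivAt.comp (t, x) (f := fun p : ℝ × S => p.2) h3 h2)
  rw [modelWithCornersSelf_prod, ← chartedSpaceSelf_prod]
  exact HasMFDerivAt.prodMk h1 h5

lemma dflow_eq (h : IsGaussAtlas g τ ι φ F ν Ψ r c C ρ θ) {y x : S} (hx : x ∈ (θ y).source)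
    {t : ℝ} (ht : |t| < r) (a : ℝ) (w : Eu d) :
    dflow (IsGaussSetup.flowMap φ Ψ) (t, x) (a, w) = dsymm (φ y) (Ψ y (t, ρ • θ y x))
      (fderiv ℝ (Ψ y) (t, ρ • θ y x) (a, ρ • dchart (θ y) x w)) := by
  have hm := h.mem_ball ht ((h.hyp y).apply_mem hx)
  have h1 := h.hasMFDerivAt_inner hx (t := t)
  have h2 : HasMFDerivAt 𝓘(ℝ, ℝ × Eu d) (𝓡 (d + 1)) (Ψ y) (t, ρ • θ y x)
      (fderiv ℝ (Ψ y) (t, ρ • θ y x)) :=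
    hasMFDerivAt_iff_hasFDerivAt.2 ((h.setup.flow y).analytic _ hm).differentiableAt.hasFDerivAt
  have h3 : HasMFDerivAt (𝓡 (d + 1)) (𝓡 (d + 1)) (φ y).symm (Ψ y (t, ρ • θ y x))
      (dsymm (φ y) (Ψ y (t, ρ • θ y x))) :=
    ((contMDiffAt_chart_symm (h.setup.chart y).analytic
      (h.setup.mem_target y hm)).mdifferentiableAt (by simp)).hasMFDerivAt
  have h4 := HasMFDerivAt.comp (t, x) (g := (φ y).symm)
    (f := fun p : ℝ × S => Ψ y (p.1, ρ • θ y p.2)) h3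
    (HasMFDerivAt.comp (t, x) (f := fun p : ℝ × S => (p.1, ρ • θ y p.2)) h2 h1)
  have h5 := (h4.congr_of_eventuallyEq (h.eventually_flowMap_eq hx ht)).mfderiv
  exact DFunLike.congr_fun h5 (a, w)

lemma contMDiffAt_flowMap (h : IsGaussAtlas g τ ι φ F ν Ψ r c C ρ θ) {t : ℝ} (ht : |t| < r)
    (x : S) : ContMDiffAt (𝓘(ℝ, ℝ).prod (𝓡 d)) (𝓡 (d + 1)) ω (IsGaussSetup.flowMap φ Ψ) (t, x) := by
  have hx := (h.hyp x).mem_source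
  have hm := h.mem_ball ht ((h.hyp x).apply_mem hx)
  refine ContMDiffAt.congr_of_eventuallyEq ?_ (h.eventually_flowMap_eq hx ht)
  have h1 : ContMDiffAt (𝓘(ℝ, ℝ).prod (𝓡 d)) (𝓡 d) ω (fun p : ℝ × S => ρ • θ x p.2) (t, x) := by
    have e1 : ContMDiffAt (𝓡 d) (𝓡 d) ω (fun w : Eu d => ρ • w) (θ x x) :=
      contMDiffAt_iff_contDiffAt.2 (contDiffAt_id.const_smul ρ)
    exact ContMDiffAt.comp (t, x) (f := fun p : ℝ × S => θ x p.2) e1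
      (ContMDiffAt.comp (t, x) (f := fun p : ℝ × S => p.2)
        (contMDiffAt_chart (h.hyp x).analytic hx) contMDiffAt_snd)
  have h2 : ContMDiffAt (𝓘(ℝ, ℝ).prod (𝓡 d)) 𝓘(ℝ, ℝ × Eu d) ω
      (fun p : ℝ × S => (p.1, ρ • θ x p.2)) (t, x) := contMDiffAt_fst.prodMk_space h1
  have h3 : ContMDiffAt 𝓘(ℝ, ℝ × Eu d) (𝓡 (d + 1)) ω (Ψ x) (t, ρ • θ x x) :=
    contMDiffAt_iff_contDiffAt.2 ((h.setup.flow x).analytic _ hm).contDiffAt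
  exact ContMDiffAt.comp (t, x) (g := (φ x).symm) (f := fun p : ℝ × S => Ψ x (p.1, ρ • θ x p.2))
    (contMDiffAt_chart_symm (h.setup.chart x).analytic (h.setup.mem_target x hm))
    (ContMDiffAt.comp (t, x) (f := fun p : ℝ × S => (p.1, ρ • θ x p.2)) h3 h2)

/-- The normal geodesic flow has local analytic inverses. -/
lemma exists_local_inverse (h : IsGaussAtlas g τ ι φ F ν Ψ r c C ρ θ) {t : ℝ} (ht : |t| < r)
    (x : S) : ∃ j : M → ℝ × S,
      ContMDiffAt (𝓡 (d + 1)) (𝓘(ℝ, ℝ).prod (𝓡 d)) ω j (IsGaussSetup.flowMap φ Ψ (t, x)) ∧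
      j (IsGaussSetup.flowMap φ Ψ (t, x)) = (t, x) ∧
      ∀ᶠ q in 𝓝 (IsGaussSetup.flowMap φ Ψ (t, x)), IsGaussSetup.flowMap φ Ψ (j q) = q := by
  have hx := (h.hyp x).mem_source
  have hm := h.mem_ball ht ((h.hyp x).apply_mem hx)
  have hx0 : ρ • θ x x = 0 := by rw [(h.hyp x).center, smul_zero]
  have hΨa := (h.setup.flow x).analytic _ hm
  have hflow := h.flowMap_eq hx ht
  rw [hx0] at hm hΨa hflow
  obtain ⟨L, hL⟩ := (h.setup.flow x).fderiv_isInvertible h.c_pos hm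
  have hcd : ContDiffAt ℝ ω (Ψ x) (t, 0) := hΨa.contDiffAt
  have hL' : HasFDerivAt (Ψ x) (L : ℝ × Eu d →L[ℝ] Eu (d + 1)) (t, 0) := by
    rw [hL]; exact hΨa.differentiableAt.hasFDerivAt
  set e := hcd.toOpenPartialHomeomorph (Ψ x) hL' (by simp) with he
  have hecoe : (e : ℝ × Eu d → Eu (d + 1)) = Ψ x := rfl
  have hes : (t, (0 : Eu d)) ∈ e.source := hcd.mem_toOpenPartialHomeomorph_source hL' (by simp)
  have het : Ψ x (t, 0) ∈ e.target := hcd.image_mem_toOpenPartialHomeomorph_target hL' (by simp)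
  have hinv0 : e.symm (Ψ x (t, 0)) = (t, 0) := e.left_inv hes
  have hinvC : ContDiffAt ℝ ω e.symm (Ψ x (t, 0)) := hcd.to_localInverse hL' (by simp)
  set q₀ := IsGaussSetup.flowMap φ Ψ (t, x) with hq₀
  have htar := h.setup.mem_target x hm
  have hq₀s : q₀ ∈ (φ x).source := by rw [hflow]; exact (φ x).map_target htar
  have hφq : φ x q₀ = Ψ x (t, 0) := by rw [hflow, (φ x).right_inv htar]
  let k : M → ℝ × Eu d := fun q => e.symm (φ x q)
  have hk0 : k q₀ = (t, 0) := by simp only [k, hφq, hinv0]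
  have hkC : ContMDiffAt (𝓡 (d + 1)) 𝓘(ℝ, ℝ × Eu d) ω k q₀ := by
    refine ContMDiffAt.comp q₀ (I' := 𝓡 (d + 1)) (g := e.symm) ?_
      (contMDiffAt_chart (h.setup.chart x).analytic hq₀s)
    rw [hφq]
    exact contMDiffAt_iff_contDiffAt.2 hinvC
  have h0t : (ρ⁻¹ • (0 : Eu d)) ∈ (θ x).target := by
    rw [smul_zero, (h.hyp x).target_eq]; exact zero_mem_cube d
  have hθ0 : (θ x).symm 0 = x := by
    rw [← (h.hyp x).center]; exact (θ x).left_inv hx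
  -- The inverse function theorem inverts `Ψ x`. The factor `ρ⁻¹` undoes the scaling between the
  -- hypersurface chart and the graph parameter.
  let j : M → ℝ × S := fun q => ((k q).1, (θ x).symm (ρ⁻¹ • (k q).2))
  refine ⟨j, ?_, ?_, ?_⟩
  · have a1 : ContMDiffAt (𝓡 (d + 1)) 𝓘(ℝ, ℝ) ω (fun q => (k q).1) q₀ :=
      ContMDiffAt.comp q₀ (g := fun p : ℝ × Eu d => p.1) (I' := 𝓘(ℝ, ℝ × Eu d))
        (contMDiffAt_iff_contDiffAt.2 contDiffAt_fst) hkC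
    have a2 : ContMDiffAt (𝓡 (d + 1)) (𝓡 d) ω (fun q => ρ⁻¹ • (k q).2) q₀ :=
      ContMDiffAt.comp q₀ (g := fun p : ℝ × Eu d => ρ⁻¹ • p.2) (I' := 𝓘(ℝ, ℝ × Eu d))
        (contMDiffAt_iff_contDiffAt.2 (contDiffAt_snd.const_smul ρ⁻¹)) hkC
    refine a1.prodMk (ContMDiffAt.comp q₀ (g := (θ x).symm) (f := fun q => ρ⁻¹ • (k q).2) ?_ a2)
    rw [hk0]
    exact contMDiffAt_chart_symm (h.hyp x).analytic h0t
  · simp only [j, hk0, smul_zero, hθ0]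
  · have c1 : ∀ᶠ q in 𝓝 q₀, |(k q).1| < r := by
      have : ContinuousAt (fun q => |(k q).1|) q₀ := hkC.continuousAt.fst.abs
      exact this.eventually_lt_const (by simp only [hk0]; exact ht)
    have c2 : ∀ᶠ q in 𝓝 q₀, ρ⁻¹ • (k q).2 ∈ (θ x).target := by
      have : ContinuousAt (fun q => ρ⁻¹ • (k q).2) q₀ := hkC.continuousAt.snd.const_smul ρ⁻¹
      exact this.preimage_mem_nhds ((θ x).open_target.mem_nhds (by simp only [hk0]; exact h0t))
    have c3 : ∀ᶠ q in 𝓝 q₀, q ∈ (φ x).source := (φ x).open_source.mem_nhds hq₀s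
    have c4 : ∀ᶠ q in 𝓝 q₀, φ x q ∈ e.target :=
      ((φ x).continuousAt hq₀s).preimage_mem_nhds (e.open_target.mem_nhds (by rw [hφq]; exact het))
    filter_upwards [c1, c2, c3, c4] with q h1 h2 h3 h4
    simp only [j]
    rw [h.flowMap_eq ((θ x).map_target h2) h1, (θ x).right_inv h2, smul_inv_smul₀ h.ρ_pos.ne']
    have : Ψ x ((k q).1, (k q).2) = φ x q := e.right_inv h4
    rw [this, (φ x).left_inv h3]

end IsGaussAtlas

/-- An injective map with local inverses is a diffeomorphism onto its image. -/
lemma exists_partialDiffeomorph [Nonempty S] {χ : ℝ × S → M} {Ω : Set (ℝ × S)} (hΩ : IsOpen Ω)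
    (hinj : Set.InjOn χ Ω)
    (hχ : ∀ p ∈ Ω, ContMDiffAt (𝓘(ℝ, ℝ).prod (𝓡 d)) (𝓡 (d + 1)) ∞ χ p)
    (hloc : ∀ p ∈ Ω, ∃ j : M → ℝ × S,
      ContMDiffAt (𝓡 (d + 1)) (𝓘(ℝ, ℝ).prod (𝓡 d)) ∞ j (χ p) ∧ j (χ p) = p ∧
      ∀ᶠ q in 𝓝 (χ p), χ (j q) = q) :
    ∃ Φ : PartialDiffeomorph (𝓘(ℝ, ℝ).prod (𝓡 d)) (𝓡 (d + 1)) (ℝ × S) M ∞,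
      Φ.source = Ω ∧ Set.EqOn Φ χ Φ.source := by
  have hev : ∀ p ∈ Ω, ∀ j : M → ℝ × S,
      ContMDiffAt (𝓡 (d + 1)) (𝓘(ℝ, ℝ).prod (𝓡 d)) ∞ j (χ p) → j (χ p) = p →
      ∀ᶠ q in 𝓝 (χ p), j q ∈ Ω := fun p hp j hj hjp =>
    hj.continuousAt.preimage_mem_nhds (hΩ.mem_nhds (by rw [hjp]; exact hp))
  let E : PartialEquiv (ℝ × S) M := hinj.toPartialEquiv χ Ω
  refine ⟨{ toPartialEquiv := E
            open_source := hΩ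
            open_target := ?_
            contMDiffOn_toFun := fun p hp => (hχ p hp).contMDiffWithinAt
            contMDiffOn_invFun := ?_ }, rfl, fun p _ => rfl⟩
  · refine isOpen_iff_mem_nhds.2 ?_
    rintro _ ⟨p, hp, rfl⟩
    obtain ⟨j, hj, hjp, hjq⟩ := hloc p hp
    filter_upwards [hjq, hev p hp j hj hjp] with q h1 h2
    exact ⟨j q, h2, h1⟩
  · rintro _ ⟨p, hp, rfl⟩
    obtain ⟨j, hj, hjp, hjq⟩ := hloc p hp
    refine (hj.congr_of_eventuallyEq ?_).contMDiffWithinAt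
    filter_upwards [hjq, hev p hp j hj hjp] with q h1 h2
    have h3 : q ∈ E.target := ⟨j q, h2, h1⟩
    -- Near a point of the image the local inverse takes values in `Ω`, so injectivity identifies it
    -- with the global inverse, which inherits its smoothness.
    exact hinj (E.map_target h3) h2 ((E.right_inv h3).trans h1.symm)

end FlowSmooth
end BAG

end

noncomputable section
namespace BAG

open Filter
open scoped BoundedContinuousFunction

/-- The minimum on the compact unit sphere serves as the constant; in dimension `0` the sphere is
empty and the claim is trivial. -/
lemma exists_lower_of_pos {n : ℕ} {B : Form n} (hB : ∀ v, v ≠ 0 → 0 < B v v) :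
    ∃ c > 0, ∀ v, c * ‖v‖ ^ 2 ≤ B v v := by
  rcases (Metric.sphere (0 : Eu n) 1).eq_empty_or_nonempty with he | hne
  · refine ⟨1, one_pos, fun v => ?_⟩
    have hv : v = 0 := by
      by_contra hv
      have : (‖v‖⁻¹ • v) ∈ Metric.sphere (0 : Eu n) 1 := by
        rw [mem_sphere_zero_iff_norm, norm_smul, norm_inv, norm_norm,
          inv_mul_cancel₀ (norm_ne_zero_iff.2 hv)]
      rw [he] at this; exact this
    simp [hv]
  · have hc : Continuous (fun v => B v v) := B.continuous.clm_apply continuous_id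
    obtain ⟨w, hw, hmin⟩ := (isCompact_sphere (0 : Eu n) 1).exists_isMinOn hne hc.continuousOn
    rw [mem_sphere_zero_iff_norm] at hw
    refine ⟨B w w, hB w (by rintro rfl; simp at hw), fun v => ?_⟩
    rcases eq_or_ne v 0 with rfl | hv
    · simp
    have hn := norm_pos_iff.2 hv
    have h1 : (‖v‖⁻¹ • v) ∈ Metric.sphere (0 : Eu n) 1 := by
      rw [mem_sphere_zero_iff_norm, norm_smul, norm_inv, norm_norm, inv_mul_cancel₀ hn.ne']
    have h2 : B w w ≤ B (‖v‖⁻¹ • v) (‖v‖⁻¹ • v) := hmin h1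
    simp only [map_smul, smul_apply, smul_eq_mul] at h2
    calc B w w * ‖v‖ ^ 2 ≤ (‖v‖⁻¹ * (‖v‖⁻¹ * B v v)) * ‖v‖ ^ 2 := by gcongr
      _ = B v v := by field_simp

/-! ### The induced metrics on the leaves -/

section Leaf

variable {d : ℕ} {M : Type*} [TopologicalSpace M] [T2Space M] [ChartedSpace (Eu (d + 1)) M]
  [IsManifold (𝓡 (d + 1)) ω M]
  {S : Type*} [TopologicalSpace S] [ChartedSpace (Eu d) S] [IsManifold (𝓡 d) ω S]
  {g : Cov2 (d + 1) M} {τ : ∀ p : M, TangentSpace (𝓡 (d + 1)) p} {ι : S → M}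
  {φ : S → OpenPartialHomeomorph M (Eu (d + 1))} {F : S → Eu d → ℝ}
  {ν : S → Eu (d + 1)} {Ψ : S → ℝ × Eu d → Eu (d + 1)} {r c C ρ δ : ℝ}
  {θ : S → OpenPartialHomeomorph S (Eu d)}

/-- A field of symmetric positive definite forms that is `C^k` is a Riemannian metric. -/
lemma isRiemannian_of {k : WithTop ℕ∞} {h : Cov2 d S} (hsymm : ∀ x v w, formAt h x v w = formAt h x w v)
    (hpos : ∀ x v, v ≠ 0 → 0 < formAt h x v v)
    (hsm : ContMDiff (𝓡 d) ((𝓡 d).prod 𝓘(ℝ, Eu d →L[ℝ] Eu d →L[ℝ] ℝ)) k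
      (fun x : S => Bundle.TotalSpace.mk' (Eu d →L[ℝ] Eu d →L[ℝ] ℝ)
        (E := fun x : S => TangentSpace (𝓡 d) x →L[ℝ] TangentSpace (𝓡 d) x →L[ℝ] ℝ) x (h x))) :
    IsRiemannian k h := by
  refine ⟨⟨h, hsymm, hpos, fun x => ?_, hsm⟩, rfl⟩
  obtain ⟨c, hc, hlow⟩ := exists_lower_of_pos (hpos x)
  have : Bornology.IsVonNBounded ℝ {v : Eu d | formAt h x v v < 1} := by
    rw [NormedSpace.isVonNBounded_iff]
    refine (Metric.isBounded_closedBall (x := (0 : Eu d)) (r := √c⁻¹)).subset fun v hv => ?_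
    rw [mem_closedBall_zero_iff]
    refine Real.le_sqrt_of_sq_le ?_
    rw [← mul_le_mul_iff_right₀ hc, mul_inv_cancel₀ hc.ne']
    exact (hlow v).trans (le_of_lt hv)
  exact this

/-- The metrics induced on the leaves of the normal geodesic flow. -/
def leafMetric (g : Cov2 (d + 1) M) (φ : S → OpenPartialHomeomorph M (Eu (d + 1)))
    (Ψ : S → ℝ × Eu d → Eu (d + 1)) (t : ℝ) : Cov2 d S := fun x =>
  (pullForm (formAt g (IsGaussSetup.flowMap φ Ψ (t, x)))
    (dflow (IsGaussSetup.flowMap φ Ψ) (t, x) ∘L ContinuousLinearMap.inr ℝ ℝ (Eu d)) : Form d)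

section LeafForm

variable {G : Eu (d + 1) → Form (d + 1)} {F : Eu d → ℝ} {Ψ : ℝ × Eu d → Eu (d + 1)}
  {p : ℝ × Eu d}

/-- By the Gauss lemma the leaves are orthogonal to a timelike vector, and transverse vectors are
not killed by the differential. -/
lemma IsGaussFlow.leafForm_pos (h : IsGaussFlow G F r c C Ψ) (hc : 0 < c)
    (hp : p ∈ Metric.ball (0 : ℝ × Eu d) r) (hG : IsLorentzForm (G (Ψ p))) {w : Eu d} (hw : w ≠ 0) :
    0 < leafForm G Ψ p w w := by
  rw [leafForm_apply]
  refine hG.pos_of_orthogonal (u := fderiv ℝ Ψ p (1, 0)) ?_ (h.orth p hp w) fun h0 => hw ?_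
  · rw [h.unit p hp]; norm_num
  · have h1 := h.fderiv_lower hp (0, w)
    rw [h0, norm_zero, Prod.norm_mk, norm_zero, max_eq_right (norm_nonneg w)] at h1
    rw [← norm_le_zero_iff]
    nlinarith [norm_nonneg w]

lemma IsGaussFlow.form_apply (h : IsGaussFlow G F r c C Ψ)
    (hp : p ∈ Metric.ball (0 : ℝ × Eu d) r) (hG : IsLorentzForm (G (Ψ p))) (a b : ℝ) (v w : Eu d) :
    G (Ψ p) (fderiv ℝ Ψ p (a, v)) (fderiv ℝ Ψ p (b, w)) = -(a * b) + leafForm G Ψ p v w := by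
  have e : ∀ (a : ℝ) (v : Eu d),
      fderiv ℝ Ψ p (a, v) = a • fderiv ℝ Ψ p (1, 0) + fderiv ℝ Ψ p (0, v) := by
    intro a v
    rw [← map_smul, ← map_add]; simp
  rw [e a v, e b w, leafForm_apply]
  simp only [map_add, map_smul, add_apply, smul_apply,
    smul_eq_mul, h.unit p hp, h.orth p hp w]
  rw [hG.symm (fderiv ℝ Ψ p (0, v)) (fderiv ℝ Ψ p (1, 0)), h.orth p hp v]
  ring

lemma IsGaussFlow.analyticAt_leafForm (h : IsGaussFlow G F r c C Ψ)
    (hp : p ∈ Metric.ball (0 : ℝ × Eu d) r) (hG : AnalyticAt ℝ G (Ψ p)) :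
    AnalyticAt ℝ (leafForm G Ψ) p := by
  refine AnalyticAt.pullForm (AnalyticAt.comp (g := G) (f := Ψ) hG (h.analytic p hp)) ?_
  exact ((ContinuousLinearMap.compL ℝ (Eu d) (ℝ × Eu d) (Eu (d + 1))).flip
    (ContinuousLinearMap.inr ℝ ℝ (Eu d))).analyticAt _ |>.fun_comp (h.analytic p hp).fderiv

end LeafForm

namespace IsGaussAtlas

lemma mem_target (h : IsGaussAtlas g τ ι φ F ν Ψ r c C ρ θ) (y : S) {t : ℝ} (ht : |t| < r)
    {v : Eu d} (hv : v ∈ cube d 1) : Ψ y (t, ρ • v) ∈ (φ y).target :=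
  h.setup.mem_target y (h.mem_ball ht hv)

lemma lorentzForm (h : IsGaussAtlas g τ ι φ F ν Ψ r c C ρ θ) (y : S) {t : ℝ} (ht : |t| < r)
    {v : Eu d} (hv : v ∈ cube d 1) : IsLorentzForm (coordCov (φ y) g (Ψ y (t, ρ • v))) :=
  h.lorentz.coord (h.setup.chart y).analytic (h.mem_target y ht hv)

lemma formAt_leafMetric (h : IsGaussAtlas g τ ι φ F ν Ψ r c C ρ θ) {y x : S}
    (hx : x ∈ (θ y).source) {t : ℝ} (ht : |t| < r) :
    formAt (leafMetric g φ Ψ t) x = pullForm (leafForm (coordCov (φ y) g) (Ψ y) (t, ρ • θ y x))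
      (ρ • dchart (θ y) x) := by
  ext a b
  have e1 : formAt (leafMetric g φ Ψ t) x a b = formAt g (IsGaussSetup.flowMap φ Ψ (t, x))
    (dflow (IsGaussSetup.flowMap φ Ψ) (t, x) (0, a))
    (dflow (IsGaussSetup.flowMap φ Ψ) (t, x) (0, b)) := rfl
  rw [e1, h.dflow_eq hx ht, h.dflow_eq hx ht, h.flowMap_eq hx ht, pullForm_apply, leafForm_apply,
    coordCov_eq]
  rfl

/-- This identity reduces the analytic claims about `h_t` to the uniformly analytic family
`leafForm`. The chart scales lengths by `ρ⁻¹`, whence the factor `ρ ^ 2`. -/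
lemma coordCov_leafMetric (h : IsGaussAtlas g τ ι φ F ν Ψ r c C ρ θ) (y : S) {t : ℝ}
    (ht : |t| < r) {v : Eu d} (hv : v ∈ cube d 1) :
    coordCov (θ y) (leafMetric g φ Ψ t) v
      = ρ ^ 2 • leafForm (coordCov (φ y) g) (Ψ y) (t, ρ • v) := by
  have hv' : v ∈ (θ y).target := by rw [(h.hyp y).target_eq]; exact hv
  have e := dchart_comp_dsymm (h.hyp y).analytic hv'
  rw [coordCov_eq, h.formAt_leafMetric ((θ y).map_target hv') ht, pullForm_pullForm,
    (θ y).right_inv hv', ContinuousLinearMap.smul_comp, e]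
  ext a b
  simp only [pullForm_apply, smul_apply, ContinuousLinearMap.id_apply, map_smul,
    smul_eq_mul]
  ring

lemma leafMetric_pos (h : IsGaussAtlas g τ ι φ F ν Ψ r c C ρ θ) {t : ℝ} (ht : |t| < r) (x : S)
    {v : Eu d} (hv : v ≠ 0) : 0 < formAt (leafMetric g φ Ψ t) x v v := by
  have hx := (h.hyp x).mem_source
  have hx' := (h.hyp x).apply_mem hx
  rw [h.formAt_leafMetric hx ht, pullForm_apply]
  refine (h.setup.flow x).leafForm_pos h.c_pos (h.mem_ball ht hx') (h.lorentzForm x ht hx') ?_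
  rw [smul_apply]
  refine smul_ne_zero h.ρ_pos.ne' fun h0 => hv ?_
  exact Function.LeftInverse.injective (g := dsymm (θ x) (θ x x)) (fun a =>
    DFunLike.congr_fun (dsymm_comp_dchart (h.hyp x).analytic hx) a) (h0.trans (map_zero _).symm)

lemma leafMetric_symm (h : IsGaussAtlas g τ ι φ F ν Ψ r c C ρ θ) (t : ℝ) (x : S)
    (v w : Eu d) : formAt (leafMetric g φ Ψ t) x v w = formAt (leafMetric g φ Ψ t) x w v :=
  h.lorentz.symm _ _ _

lemma pullbackSplits (h : IsGaussAtlas g τ ι φ F ν Ψ r c C ρ θ) (hδ : δ ≤ r) :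
    PullbackSplits g δ (IsGaussSetup.flowMap φ Ψ) (leafMetric g φ Ψ) := by
  intro t ht x a b v w
  have ht' : |t| < r := (abs_lt.2 ht).trans_le hδ
  have hx := (h.hyp x).mem_source
  have hx' := (h.hyp x).apply_mem hx
  have e1 : ∀ v w : Eu d, formAt g (IsGaussSetup.flowMap φ Ψ (t, x))
      (dflow (IsGaussSetup.flowMap φ Ψ) (t, x) (a, v))
      (dflow (IsGaussSetup.flowMap φ Ψ) (t, x) (b, w))
      = -(a * b) + formAt (leafMetric g φ Ψ t) x v w := by
    intro v w
    rw [h.dflow_eq hx ht', h.dflow_eq hx ht', h.flowMap_eq hx ht', h.formAt_leafMetric hx ht',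
      pullForm_apply]
    exact (h.setup.flow x).form_apply (h.mem_ball ht' hx') (h.lorentzForm x ht' hx') a b _ _
  exact e1 v w

/-- The bundle structure refers to the preferred chart `κ` at `x`, so the coordinate expression `H`
composes the leaf form with the transition from `κ` to the hypersurface chart. -/
lemma contMDiffAt_leafMetric (h : IsGaussAtlas g τ ι φ F ν Ψ r c C ρ θ) {t : ℝ} (ht : |t| < r)
    (x : S) :
    ContMDiffAt (𝓘(ℝ, ℝ).prod (𝓡 d)) ((𝓡 d).prod 𝓘(ℝ, Eu d →L[ℝ] Eu d →L[ℝ] ℝ)) ω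
      (fun p : ℝ × S => Bundle.TotalSpace.mk' (Eu d →L[ℝ] Eu d →L[ℝ] ℝ)
        (E := fun x : S => TangentSpace (𝓡 d) x →L[ℝ] TangentSpace (𝓡 d) x →L[ℝ] ℝ)
        p.2 (leafMetric g φ Ψ p.1 p.2)) (t, x) := by
  set κ := chartAt (Eu d) x with hκdef
  have hκ : κ ∈ IsManifold.maximalAtlas (𝓡 d) ω S := IsManifold.chart_mem_maximalAtlas x
  have hxκ : x ∈ κ.source := mem_chart_source _ _
  have hθ := (h.hyp x).analytic
  have hx := (h.hyp x).mem_source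
  have hx' := (h.hyp x).apply_mem hx
  refine (contMDiffAt_form_iff (f := fun p : ℝ × S => p.2)
    (fun p : ℝ × S => leafMetric g φ Ψ p.1 p.2) contMDiffAt_snd).2 ?_
  let H : ℝ × Eu d → Form d := fun q => pullForm
    (leafForm (coordCov (φ x) g) (Ψ x) (q.1, ρ • θ x (κ.symm q.2)))
    (ρ • fderiv ℝ (fun u => θ x (κ.symm u)) q.2)
  have htr : AnalyticAt ℝ (fun u => θ x (κ.symm u)) (κ x) :=
    analyticAt_transition hκ hθ (κ.map_source hxκ) (by rwa [κ.left_inv hxκ])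
  have hH : AnalyticAt ℝ H (t, κ x) := by
    have a1 : AnalyticAt ℝ (fun q : ℝ × Eu d => θ x (κ.symm q.2)) (t, κ x) :=
      AnalyticAt.comp (g := fun u => θ x (κ.symm u)) (f := fun q : ℝ × Eu d => q.2) htr analyticAt_snd
    have a2 : AnalyticAt ℝ (fun q : ℝ × Eu d => (q.1, ρ • θ x (κ.symm q.2))) (t, κ x) :=
      analyticAt_fst.prod (a1.const_smul (c := ρ))
    have a3 : AnalyticAt ℝ (leafForm (coordCov (φ x) g) (Ψ x)) (t, ρ • θ x (κ.symm (κ x))) := by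
      rw [κ.left_inv hxκ]
      exact (h.setup.flow x).analyticAt_leafForm (h.mem_ball ht hx')
        (analyticAt_coordCov h.lorentz.analytic (h.setup.chart x).analytic (h.mem_target x ht hx'))
    have a4 : AnalyticAt ℝ (fun q : ℝ × Eu d => fderiv ℝ (fun u => θ x (κ.symm u)) q.2) (t, κ x) :=
      AnalyticAt.comp (g := fderiv ℝ (fun u => θ x (κ.symm u))) (f := fun q : ℝ × Eu d => q.2)
        htr.fderiv analyticAt_snd
    exact AnalyticAt.pullForm (AnalyticAt.comp (g := leafForm (coordCov (φ x) g) (Ψ x))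
      (f := fun q : ℝ × Eu d => (q.1, ρ • θ x (κ.symm q.2))) a3 a2) (a4.const_smul (c := ρ))
  have hin : ContMDiffAt (𝓘(ℝ, ℝ).prod (𝓡 d)) 𝓘(ℝ, ℝ × Eu d) ω
      (fun p : ℝ × S => (p.1, κ p.2)) (t, x) :=
    contMDiffAt_fst.prodMk_space (ContMDiffAt.comp (t, x) (f := fun p : ℝ × S => p.2)
      (contMDiffAt_chart hκ hxκ) contMDiffAt_snd)
  have hcomp : ContMDiffAt (𝓘(ℝ, ℝ).prod (𝓡 d)) 𝓘(ℝ, Form d) ω (fun p : ℝ × S => H (p.1, κ p.2))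
      (t, x) :=
    ContMDiffAt.comp (t, x) (g := H) (f := fun p : ℝ × S => (p.1, κ p.2))
      (contMDiffAt_iff_contDiffAt.2 hH.contDiffAt) hin
  refine hcomp.congr_of_eventuallyEq ?_
  have h1 : ∀ᶠ s in 𝓝 t, |s| < r := continuous_abs.continuousAt.eventually_lt_const ht
  have h2 : ∀ᶠ z in 𝓝 x, z ∈ (θ x).source := (θ x).open_source.mem_nhds hx
  have h3 : ∀ᶠ z in 𝓝 x, z ∈ κ.source := κ.open_source.mem_nhds hxκ
  filter_upwards [h1.prod_nhds (h2.and h3)] with p hp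
  obtain ⟨hp1, hp2, hp3⟩ := hp
  have e := h.formAt_leafMetric hp2 hp1
  have e2 := fderiv_transition hκ hθ (κ.map_source hp3) (by rwa [κ.left_inv hp3])
  rw [κ.left_inv hp3] at e2
  simp only [H]
  rw [e2, κ.left_inv hp3, ← ContinuousLinearMap.smul_comp, ← pullForm_pullForm, ← e]
  rfl

lemma isRiemannian_leafMetric (h : IsGaussAtlas g τ ι φ F ν Ψ r c C ρ θ) {t : ℝ} (ht : |t| < r) :
    IsRiemannian ω (leafMetric g φ Ψ t) := by
  refine isRiemannian_of (h.leafMetric_symm t) (fun x v hv => h.leafMetric_pos ht x hv) fun x => ?_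
  exact ContMDiffAt.comp x (f := fun z : S => (t, z)) (h.contMDiffAt_leafMetric ht x)
    (contMDiffAt_const.prodMk contMDiffAt_id)

lemma isSmoothFamily (h : IsGaussAtlas g τ ι φ F ν Ψ r c C ρ θ) (hδ : δ ≤ r) :
    IsSmoothFamily δ (leafMetric g φ Ψ) := by
  refine ⟨fun t ht => ?_, fun p hp => ?_⟩
  · refine isRiemannian_of (h.leafMetric_symm t)
      (fun x v hv => h.leafMetric_pos ((abs_lt.2 ht).trans_le hδ) x hv) fun x => ?_
    exact ContMDiffAt.comp x (f := fun z : S => (t, z))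
      ((h.contMDiffAt_leafMetric ((abs_lt.2 ht).trans_le hδ) x).of_le (by simp))
      (contMDiffAt_const.prodMk contMDiffAt_id)
  · exact ((h.contMDiffAt_leafMetric ((abs_lt.2 hp.1).trans_le hδ) p.2).of_le
      (by simp)).contMDiffWithinAt

lemma isNormalGeodesicFlow (h : IsGaussAtlas g τ ι φ F ν Ψ r c C ρ θ) (hδ : δ ≤ r) :
    IsNormalGeodesicFlow g τ ι δ (IsGaussSetup.flowMap φ Ψ) := by
  intro x
  have hr := h.r_pos
  have h0 : ‖(0 : Eu d)‖ < r := by simpa using hr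
  have hz : initL d (φ x (ι x)) = 0 := by rw [h.setup.center, map_zero]
  have hgeo := (h.setup.isChartGeodesic x h0).isGeodesicOn h.lorentz (h.setup.chart x).analytic
  refine ⟨⟨hgeo.1.mono ?_, fun t ht => hgeo.2 t ?_⟩, ν x, h.setup.future x, ?_⟩
  · exact Set.Ioo_subset_Ioo (neg_le_neg hδ) hδ
  · exact Set.Ioo_subset_Ioo (neg_le_neg hδ) hδ ht
  have e1 := h.setup.eq_initial (h.setup.mem_source x) (by rwa [hz])
  have e2 := h.setup.dsymm_initial h.lorentz h.orient h.smooth h.spacelike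
    (h.setup.mem_source x) (by rwa [hz])
  rw [hz] at e1 e2
  have hbase : IsGaussSetup.flowMap φ Ψ (0, x) = ι x := by
    rw [IsGaussSetup.flowMap, e1, (φ x).left_inv (h.setup.mem_source x)]
  have hm : ((0 : ℝ), (0 : Eu d)) ∈ Metric.ball (0 : ℝ × Eu d) r := Metric.mem_ball_self hr
  have k1 : HasMFDerivAt 𝓘(ℝ, ℝ) (𝓡 (d + 1)) (fun t : ℝ => Ψ x (t, 0)) 0
      (ContinuousLinearMap.toSpanSingleton ℝ (fderiv ℝ (Ψ x) (0, 0) (1, 0))) :=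
    hasMFDerivAt_iff_hasFDerivAt.2
      (hasDerivAt_slice ((h.setup.flow x).analytic _ hm).differentiableAt).hasFDerivAt
  have k2 : HasMFDerivAt (𝓡 (d + 1)) (𝓡 (d + 1)) (φ x).symm (Ψ x (0, 0))
      (dsymm (φ x) (Ψ x (0, 0))) :=
    ((contMDiffAt_chart_symm (h.setup.chart x).analytic
      (h.setup.mem_target x hm)).mdifferentiableAt (by simp)).hasMFDerivAt
  have k3 := (HasMFDerivAt.comp (0 : ℝ) (f := fun t : ℝ => Ψ x (t, 0)) k2 k1).mfderiv
  have k4 : (mfderiv 𝓘(ℝ, ℝ) (𝓡 (d + 1)) (fun t => IsGaussSetup.flowMap φ Ψ (t, x)) (0 : ℝ)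
      : ℝ →L[ℝ] Eu (d + 1)) (1 : ℝ) = ν x := by
    refine (DFunLike.congr_fun k3 (1 : ℝ)).trans ?_
    change dsymm (φ x) (Ψ x (0, 0)) ((1 : ℝ) • fderiv ℝ (Ψ x) (0, 0) (1, 0)) = ν x
    rw [one_smul, e1, e2]
  refine Bundle.TotalSpace.ext hbase ?_
  exact heq_of_eq k4

end IsGaussAtlas

end Leaf
end BAG

end

noncomputable section
namespace BAG

open Filter
open scoped BoundedContinuousFunction

namespace AnalyticBound

variable {n : ℕ} {V : Type*} [NormedAddCommGroup V] [NormedSpace ℝ V] {r C : ℝ} {u w : Eu n → V}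

lemma congr (h : AnalyticBound r C u) (huw : ∀ v ∈ cube n r, u v = w v) : AnalyticBound r C w := by
  obtain ⟨a, ha, hs⟩ := h
  exact ⟨a, ha, fun v hv => huw v hv ▸ hs v hv⟩

lemma mono (h : AnalyticBound r C u) {r' C' : ℝ} (hr0 : 0 ≤ r') (hr : r' ≤ r) (hC : C ≤ C') :
    AnalyticBound r' C' u := by
  obtain ⟨a, ha, hs⟩ := h
  refine ⟨a, fun α => ?_, fun v hv => hs v fun i => (hv i).trans_le hr⟩
  exact (mul_le_mul_of_nonneg_right (pow_le_pow_left₀ hr0 hr _) (norm_nonneg _)).trans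
    ((ha α).trans hC)

/-- Bounded analytic atlases require estimates on the unit cube; rescaling by `ρ ≤ r` provides them.
-/
lemma scale (h : AnalyticBound r C u) {ρ : ℝ} (hρ0 : 0 < ρ) (hρ : ρ ≤ r) (b : ℝ) :
    AnalyticBound 1 (|b| * C) (fun v => b • u (ρ • v)) := by
  obtain ⟨a, ha, hs⟩ := h
  refine ⟨fun α => b • ρ ^ (∑ i, α i) • a α, fun α => ?_, fun v hv => ?_⟩
  · rw [one_pow, one_mul, norm_smul, norm_smul, Real.norm_eq_abs, Real.norm_eq_abs,
      abs_of_nonneg (pow_nonneg hρ0.le _)]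
    refine mul_le_mul_of_nonneg_left ?_ (abs_nonneg b)
    exact (mul_le_mul_of_nonneg_right (pow_le_pow_left₀ hρ0.le hρ _) (norm_nonneg _)).trans (ha α)
  · have h1 : ρ • v ∈ cube n r := fun i => by
      rw [PiLp.smul_apply, smul_eq_mul, abs_mul, abs_of_pos hρ0]
      nlinarith [hv i, abs_nonneg (v i)]
    convert (hs _ h1).const_smul b using 2 with α
    have e : ∏ i, (ρ • v) i ^ α i = (∏ i, v i ^ α i) * ρ ^ (∑ i, α i) := by
      simp only [PiLp.smul_apply, smul_eq_mul, mul_pow, Finset.prod_mul_distrib,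
        Finset.prod_pow_eq_pow_sum]
      ring
    rw [e, mul_smul, smul_comm]

end AnalyticBound

/-! ### Analytic dependence on time with values in bounded analytic tensors -/

section TimeAnalytic

variable {d : ℕ} {S : Type*} [TopologicalSpace S] [ChartedSpace (Eu d) S]
  {θ : S → OpenPartialHomeomorph S (Eu d)} {k : Cov2 d S}

/-- A family of tensors whose coordinate expressions are uniformly analytic in time and space is
analytic in time with values in the bounded analytic tensors. The tensors are recovered from their
values at the centres of the charts by `R`. -/
lemma exists_memAnalyticAT {𝓣 V : Type*} [AddCommGroup 𝓣] [Module ℝ 𝓣] [NormedAddCommGroup V]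
    [NormedSpace ℝ V] [FiniteDimensional ℝ V]
    {coord : OpenPartialHomeomorph S (Eu d) → 𝓣 → Eu d → V} {T : ℝ → 𝓣} {r₀ : ℝ} (hr₀ : 0 < r₀)
    (hθ : IsBoundedAnalyticAtlas k θ) (hlin : ∀ y v, IsLinearMap ℝ fun T => coord (θ y) T v)
    (R : (S → V) → 𝓣) (Λ : S → Eu d → V →ₗ[ℝ] V)
    (hR : ∀ b y, ∀ v ∈ cube d 1, coord (θ y) (R b) v = Λ y v (b ((θ y).symm v)))
    (hRT : ∀ T, R (fun x => coord (θ x) T 0) = T)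
    {u : Pts S → ℝ × Eu d → V} (hu : UA u)
    (huT : ∀ t, |t| < r₀ → ∀ y, ∀ v ∈ cube d 1, coord (θ y) (T t) v = u y (t, v)) :
    ∃ r₁ > 0, ∀ r, 0 < r → r ≤ r₁ → MemAnalyticAT coord k r T := by
  have := FiniteDimensional.complete ℝ V
  obtain ⟨s, hs, C, b, hb, hsum, hrem⟩ := hu.time_expansion
  -- The local expansions must come from global tensors. The value of the `j`-th coefficient at `x`
  -- is read off at the centre of the chart of `x`.
  let a : ℕ → 𝓣 := fun j => R fun x => b x j 0
  have hsub : ∀ {v}, v ∈ cube d (min s 1) → v ∈ cube d s ∧ v ∈ cube d 1 := fun hv =>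
    ⟨fun i => (hv i).trans_le (min_le_left _ _), fun i => (hv i).trans_le (min_le_right _ _)⟩
  have h0s : (0 : Eu d) ∈ cube d s := fun i => by simpa using hs
  have ha : ∀ j (y : S), ∀ v ∈ cube d (min s 1), b y j v = coord (θ y) (a j) v := by
    intro j y v hv
    obtain ⟨hvs, hv1⟩ := hsub hv
    refine Eq.trans ?_ (hR (fun x => b x j 0) y v hv1).symm
    have hev : ∀ᶠ t in 𝓝 (0 : ℝ), |t| < min s r₀ :=
      continuous_abs.continuousAt.eventually_lt_const (by simpa using ⟨hs, hr₀⟩)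
    have e1 : ∀ᶠ t in 𝓝 (0 : ℝ), HasSum (fun j => t ^ j • b y j v) (u y (t, v)) := by
      filter_upwards [hev] with t ht using hsum y t (ht.trans_le (min_le_left _ _)) v hvs
    -- The same function of time, expanded in the chart centred at the point with coordinates `v`
    -- and moved to the chart of `y` by the linear map `Λ y v`. Comparing coefficients with the
    -- expansion in the chart of `y` shows that they define one tensor.
    have e2 : ∀ᶠ t in 𝓝 (0 : ℝ),
        HasSum (fun j => t ^ j • Λ y v (b ((θ y).symm v) j 0)) (u y (t, v)) := by
      filter_upwards [hev] with t ht
      have ht0 := ht.trans_le (min_le_right _ _)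
      have h1 := (hsum ((θ y).symm v) t (ht.trans_le (min_le_left _ _)) 0 h0s).mapL
        (LinearMap.toContinuousLinearMap (Λ y v))
      simp only [map_smul, LinearMap.coe_toContinuousLinearMap'] at h1
      convert h1 using 1
      rw [← huT t ht0 y v hv1, ← huT t ht0 _ 0 (zero_mem_cube d),
        ← hR (fun x => coord (θ x) (T t) 0) y v hv1, hRT]
    have h3 := (iteratedDeriv_of_hasSum e1 j).symm.trans (iteratedDeriv_of_hasSum e2 j)
    exact smul_right_injective V (Nat.cast_ne_zero.2 j.factorial_ne_zero : (j.factorial : ℝ) ≠ 0) h3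
  have hpos : 0 < min s 1 := lt_min hs one_pos
  have hC : ∀ y : S, 0 ≤ C := fun y => by
    obtain ⟨c, hc, -⟩ := hb y 0
    have := hc 0
    simp only [Pi.zero_apply, Finset.sum_const_zero, pow_zero, one_mul, div_one] at this
    exact (norm_nonneg _).trans this
  refine ⟨min s r₀, lt_min hs hr₀, fun r hr hr1 => ⟨θ, hθ, min s 1, hpos, min_le_right _ _, a, C,
    fun j y _ => ?_, fun t ht η hη => ?_⟩⟩
  · refine AnalyticBound.congr ((hb y j).mono hpos.le (min_le_left _ _) ?_) (ha j y)
    exact div_le_div_of_nonneg_left (hC y) (pow_pos hr j)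
      (pow_le_pow_left₀ hr.le (hr1.trans (min_le_left _ _)) j)
  · have ht' := ht.trans_le hr1
    filter_upwards [hrem t (ht'.trans_le (min_le_left _ _)) η hη] with m hm y _
    refine AnalyticBound.congr ((hm y).mono hpos.le (min_le_left _ _) le_rfl) fun v hv => ?_
    have hcoe : ∀ T, coord (θ y) T v = IsLinearMap.mk' _ (hlin y v) T := fun _ => rfl
    rw [hcoe, map_sub, map_sum, ← hcoe, huT t (ht'.trans_le (min_le_right _ _)) y v (hsub hv).2]
    congr 1
    refine Finset.sum_congr rfl fun j _ => ?_
    rw [map_smul, ← hcoe, ha j y v hv]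

variable [IsManifold (𝓡 d) ω S]

lemma IsBoundedAnalyticAtlas.exists_memAnalyticAT_cov {T : ℝ → Cov2 d S} {r₀ : ℝ} (hr₀ : 0 < r₀)
    (hθ : IsBoundedAnalyticAtlas k θ) {u : Pts S → ℝ × Eu d → Form d} (hu : UA u)
    (huT : ∀ t, |t| < r₀ → ∀ y, ∀ v ∈ cube d 1, coordCov (θ y) (T t) v = u y (t, v)) :
    ∃ r₁ > 0, ∀ r, 0 < r → r ≤ r₁ → MemAnalyticAT coordCov k r T := by
  refine exists_memAnalyticAT hr₀ hθ (fun y v => ⟨fun _ _ => rfl, fun _ _ => rfl⟩)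
    (fun b x => pullForm (b x) (dchart (θ x) x))
    (fun y v => ⟨⟨fun B => pullForm B (dchart (θ ((θ y).symm v)) ((θ y).symm v) ∘L dsymm (θ y) v),
      fun _ _ => rfl⟩, fun _ _ => rfl⟩)
    (fun b y v hv => rfl) (fun T => ?_) hu huT
  funext x
  have e := formAt_eq (hθ.analytic x) T (hθ.mem_source x)
  rw [hθ.center] at e
  exact e.symm

/-- The value of a contravariant tensor, as a bilinear form on the dual of the model space. -/
def contraAt (K : Contra2 d S) (x : S) : (Eu d →L[ℝ] ℝ) →L[ℝ] (Eu d →L[ℝ] ℝ) →L[ℝ] ℝ := K x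

lemma IsBoundedAnalyticAtlas.exists_memAnalyticAT_contra {T : ℝ → Contra2 d S} {r₀ : ℝ}
    (hr₀ : 0 < r₀) (hθ : IsBoundedAnalyticAtlas k θ)
    {u : Pts S → ℝ × Eu d → (Eu d →L[ℝ] ℝ) →L[ℝ] (Eu d →L[ℝ] ℝ) →L[ℝ] ℝ} (hu : UA u)
    (huT : ∀ t, |t| < r₀ → ∀ y, ∀ v ∈ cube d 1, coordContra (θ y) (T t) v = u y (t, v)) :
    ∃ r₁ > 0, ∀ r, 0 < r → r ≤ r₁ → MemAnalyticAT coordContra k r T := by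
  refine exists_memAnalyticAT hr₀ hθ (fun y v => ⟨fun _ _ => rfl, fun _ _ => rfl⟩)
    (fun b x => pullForm (b x) ((dsymm (θ x) 0).precomp ℝ))
    (fun y v => ⟨⟨fun B => pullForm B ((dsymm (θ ((θ y).symm v)) 0).precomp ℝ ∘L
      (dchart (θ y) ((θ y).symm v)).precomp ℝ), fun _ _ => rfl⟩, fun _ _ => rfl⟩)
    (fun b y v hv => rfl) (fun T => ?_) hu huT
  funext x
  have e := dsymm_comp_dchart (hθ.analytic x) (hθ.mem_source x)
  rw [hθ.center] at e
  have e2 : pullForm (pullForm (contraAt T ((θ x).symm 0)) ((dchart (θ x) ((θ x).symm 0)).precomp ℝ))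
      ((dsymm (θ x) 0).precomp ℝ) = contraAt T x := by
    rw [hθ.symm_zero]
    ext a b
    have h1 : ∀ a : Eu d →L[ℝ] ℝ, (dchart (θ x) x).precomp ℝ ((dsymm (θ x) 0).precomp ℝ a) = a := by
      intro a
      ext z
      exact congrArg a (DFunLike.congr_fun e z)
    rw [pullForm_apply, pullForm_apply, h1, h1]
  exact e2

end TimeAnalytic

/-! ### The bounded analytic atlas of the hypersurface -/

section LeafBounds

variable {d : ℕ} {M : Type*} [TopologicalSpace M] [T2Space M] [ChartedSpace (Eu (d + 1)) M]
  [IsManifold (𝓡 (d + 1)) ω M]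
  {S : Type*} [TopologicalSpace S] [ChartedSpace (Eu d) S] [IsManifold (𝓡 d) ω S]
  {g : Cov2 (d + 1) M} {τ : ∀ p : M, TangentSpace (𝓡 (d + 1)) p} {ι : S → M}
  {φ : S → OpenPartialHomeomorph M (Eu (d + 1))} {F : S → Eu d → ℝ}
  {ν : S → Eu (d + 1)} {Ψ : S → ℝ × Eu d → Eu (d + 1)} {r c C ρ : ℝ}
  {θ : S → OpenPartialHomeomorph S (Eu d)}

lemma IsGaussSetup.apply_zero (h : IsGaussSetup g τ ι φ F ν Ψ r c C) (hr : 0 < r) (y : S) :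
    Ψ y 0 = 0 := by
  have e := h.eq_initial (h.mem_source y) (by rw [h.center, map_zero, norm_zero]; exact hr)
  rw [h.center, map_zero] at e
  exact e

lemma IsGaussSetup.ua_leafForm (h : IsGaussSetup g τ ι φ F ν Ψ r c C) (hr : 0 < r)
    (hG : UAMetric fun y : Pts S => coordCov (φ y) g) (hΨ : UA fun y : Pts S => Ψ y) :
    UA fun (y : Pts S) p => leafForm (coordCov (φ y) g) (Ψ y) p :=
  UA.pullForm (hG.ua.comp hΨ fun y => h.apply_zero hr y)
    (hΨ.fderiv.clm ((ContinuousLinearMap.compL ℝ (Eu d) (ℝ × Eu d) (Eu (d + 1))).flip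
      (ContinuousLinearMap.inr ℝ ℝ (Eu d))))

/-- The induced metrics on the hypersurface are uniformly analytic and uniformly definite. -/
lemma IsGaussSetup.exists_leafForm_bounds (h : IsGaussSetup g τ ι φ F ν Ψ r c C) (hr : 0 < r)
    (hc : 0 < c) (hg : IsLorentzian g) (hG : UAMetric fun y : Pts S => coordCov (φ y) g)
    (hΨ : UA fun y : Pts S => Ψ y) {N : ℝ} (hN : ∀ y, ‖dchart (φ y) (ι y) (ν y)‖ ≤ N) :
    ∃ R > 0, ∃ B, ∃ m > 0, ∃ K > 0,
      (∀ y, AnalyticBound R B fun v => leafForm (coordCov (φ y) g) (Ψ y) (0, v)) ∧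
      ∀ y v, ‖v‖ < R → ∀ a,
        m * ‖a‖ ^ 2 ≤ leafForm (coordCov (φ y) g) (Ψ y) (0, v) a a ∧
        leafForm (coordCov (φ y) g) (Ψ y) (0, v) a a ≤ K * ‖a‖ ^ 2 := by
  have hm0 : (0 : ℝ × Eu d) ∈ Metric.ball (0 : ℝ × Eu d) r := Metric.mem_ball_self hr
  have hu : UA fun (y : Pts S) (v : Eu d) => leafForm (coordCov (φ y) g) (Ψ y) (0, v) :=
    (h.ua_leafForm hr hG hΨ).comp (w := fun _ v => ((0 : ℝ), v))
      (UA.of_analyticAt (analyticAt_const.prod analyticAt_id)) fun _ => rfl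
  obtain ⟨R₁, hR₁, B, hB⟩ := hu.exists_analyticBound
  obtain ⟨K, hK⟩ := hu.bounded
  obtain ⟨CA, A, hA, -, hGA⟩ := hG.nondeg
  obtain ⟨KG, hKG⟩ := hG.ua.bounded_zero
  -- The constant of `IsLorentzForm.spacelike_lower`, built from uniform bounds on the metric, its
  -- inverse and the normal. Together with the expansion factor `c` it bounds the leaf form below at
  -- each centre.
  set Q := KG * (CA * (1 + KG * N ^ 2)) ^ 2 with hQ
  have hlow : ∀ (y : S) (a : Eu d),
      c ^ 2 * ‖a‖ ^ 2 ≤ (|Q| + 1) * leafForm (coordCov (φ y) g) (Ψ y) (0, 0) a a := by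
    intro y a
    have hL : IsLorentzForm (coordCov (φ y) g (Ψ y (0, 0))) :=
      hg.coord (h.chart y).analytic (h.mem_target y hm0)
    have hpos : 0 ≤ leafForm (coordCov (φ y) g) (Ψ y) (0, 0) a a := by
      rcases eq_or_ne a 0 with rfl | ha
      · simp
      · exact ((h.flow y).leafForm_pos hc hm0 hL ha).le
    have e0 : Ψ y (0, 0) = 0 := h.apply_zero hr y
    have h1 : c * ‖a‖ ≤ ‖fderiv ℝ (Ψ y) (0, 0) (0, a)‖ := by
      have := (h.flow y).fderiv_lower hm0 (0, a)
      rwa [Prod.norm_mk, norm_zero, max_eq_right (norm_nonneg a)] at this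
    have hν : fderiv ℝ (Ψ y) (0, 0) (1, 0) = dchart (φ y) (ι y) (ν y) := h.initial y
    have h2 : ‖fderiv ℝ (Ψ y) (0, 0) (0, a)‖ ^ 2
        ≤ Q * leafForm (coordCov (φ y) g) (Ψ y) (0, 0) a a := by
      rw [leafForm_apply, e0]
      rw [e0] at hL
      have hun := (h.flow y).unit _ hm0
      have hor := (h.flow y).orth _ hm0 a
      change coordCov (φ y) g (Ψ y (0, 0)) (fderiv ℝ (Ψ y) (0, 0) (1, 0)) _ = _ at hun hor
      change coordCov (φ y) g (Ψ y (0, 0)) (fderiv ℝ (Ψ y) (0, 0) (1, 0))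
        (fderiv ℝ (Ψ y) (0, 0) (1, 0)) = _ at hun
      change coordCov (φ y) g (Ψ y (0, 0)) (fderiv ℝ (Ψ y) (0, 0) (1, 0))
        (fderiv ℝ (Ψ y) (0, 0) (0, a)) = _ at hor
      rw [e0] at hun hor
      exact hL.spacelike_lower (hA y) (hGA y) (hKG y) hun (by rw [hν]; exact hN y) hor
    calc c ^ 2 * ‖a‖ ^ 2 = (c * ‖a‖) ^ 2 := by ring
      _ ≤ ‖fderiv ℝ (Ψ y) (0, 0) (0, a)‖ ^ 2 := by gcongr
      _ ≤ Q * leafForm (coordCov (φ y) g) (Ψ y) (0, 0) a a := h2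
      _ ≤ _ := mul_le_mul_of_nonneg_right (by linarith [le_abs_self Q]) hpos
  -- Half the lower bound at the centre; the other half absorbs the variation of the form over a
  -- ball of uniform radius.
  set m := c ^ 2 / (|Q| + 1) / 2 with hmdef
  have hQ1 : 0 < |Q| + 1 := by positivity
  have hm : 0 < m := by positivity
  obtain ⟨R₂, hR₂, hR⟩ := Metric.eventually_nhds_iff_ball.1 ((hu.eventually_dist_lt hm).and hK)
  refine ⟨min R₁ R₂, lt_min hR₁ hR₂, B, m, hm, |K| + 1, by positivity,
    fun y => (hB y).mono (lt_min hR₁ hR₂).le (min_le_left _ _) le_rfl, fun y v hv a => ?_⟩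
  obtain ⟨h1, h2⟩ := hR v (mem_ball_zero_iff.2 (hv.trans_le (min_le_right _ _)))
  have hop : ∀ L : Form d, |L a a| ≤ ‖L‖ * ‖a‖ ^ 2 := fun L => by
    have := L.le_opNorm₂ a a
    rw [Real.norm_eq_abs] at this
    nlinarith
  constructor
  · have e1 := (hop _).trans (mul_le_mul_of_nonneg_right (h1 y).le (sq_nonneg ‖a‖))
    rw [sub_apply, sub_apply] at e1
    have e2 : 2 * m * ‖a‖ ^ 2 ≤ leafForm (coordCov (φ y) g) (Ψ y) (0, 0) a a := by
      have : 2 * m * ‖a‖ ^ 2 = c ^ 2 * ‖a‖ ^ 2 / (|Q| + 1) := by rw [hmdef]; field_simp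
      rw [this, div_le_iff₀ hQ1]
      linarith [hlow y a]
    linarith [(abs_le.1 e1).1]
  · refine ((le_abs_self _).trans (hop _)).trans (mul_le_mul_of_nonneg_right ?_ (sq_nonneg ‖a‖))
    linarith [h2 y, le_abs_self K]

namespace IsGaussAtlas

variable {R B m K : ℝ}

lemma isBoundedAnalyticAtlas (h : IsGaussAtlas g τ ι φ F ν Ψ r c C ρ θ) (hm : 0 < m) (hK : 0 < K)
    (hB : ∀ y, AnalyticBound R B fun v => leafForm (coordCov (φ y) g) (Ψ y) (0, v))
    (heq : ∀ y v, ‖v‖ < R → ∀ a, m * ‖a‖ ^ 2 ≤ leafForm (coordCov (φ y) g) (Ψ y) (0, v) a a ∧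
        leafForm (coordCov (φ y) g) (Ψ y) (0, v) a a ≤ K * ‖a‖ ^ 2)
    (hρR : ρ ≤ R) (hρ : ∀ v ∈ cube d 1, ‖ρ • v‖ < R) :
    IsBoundedAnalyticAtlas (leafMetric g φ Ψ 0) θ := by
  have hρ2 : 0 < ρ ^ 2 := pow_pos h.ρ_pos 2
  have h0 : |(0 : ℝ)| < r := by simpa using h.r_pos
  refine ⟨fun y => (h.hyp y).analytic, fun y => (h.hyp y).mem_source, fun y => (h.hyp y).target_eq,
    fun y => (h.hyp y).center, ⟨|ρ ^ 2| * B, fun y => ?_⟩,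
    -- One constant has to bound the metric above and, through its reciprocal, below; the sum of the
    -- two candidates does both.
    ρ ^ 2 * K + (ρ ^ 2 * m)⁻¹, by positivity, fun y v hv a => ?_⟩
  · exact ((hB y).scale h.ρ_pos hρR (ρ ^ 2)).congr fun v hv =>
      (h.coordCov_leafMetric y h0 hv).symm
  · rw [h.coordCov_leafMetric y h0 hv, smul_apply, smul_apply, smul_eq_mul]
    obtain ⟨h1, h2⟩ := heq y (ρ • v) (hρ v hv) a
    constructor
    · calc (ρ ^ 2 * K + (ρ ^ 2 * m)⁻¹)⁻¹ * ‖a‖ ^ 2 ≤ ((ρ ^ 2 * m)⁻¹)⁻¹ * ‖a‖ ^ 2 := by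
            gcongr
            exact le_add_of_nonneg_left (by positivity)
        _ = ρ ^ 2 * (m * ‖a‖ ^ 2) := by rw [inv_inv]; ring
        _ ≤ _ := by gcongr
    · calc _ ≤ ρ ^ 2 * (K * ‖a‖ ^ 2) := by gcongr
        _ = ρ ^ 2 * K * ‖a‖ ^ 2 := by ring
        _ ≤ _ := by gcongr; exact le_add_of_nonneg_right (by positivity)

lemma exists_memAnalyticAT_leafMetric (h : IsGaussAtlas g τ ι φ F ν Ψ r c C ρ θ)
    (hG : UAMetric fun y : Pts S => coordCov (φ y) g) (hΨ : UA fun y : Pts S => Ψ y)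
    (hθ : IsBoundedAnalyticAtlas (leafMetric g φ Ψ 0) θ) :
    ∃ r₁ > 0, ∀ s, 0 < s → s ≤ r₁ →
      MemAnalyticAT coordCov (leafMetric g φ Ψ 0) s (leafMetric g φ Ψ) ∧
      MemAnalyticAT coordContra (leafMetric g φ Ψ 0) s
        (fun t => inverseMetric (leafMetric g φ Ψ t)) := by
  let L : ℝ × Eu d →L[ℝ] ℝ × Eu d := (ContinuousLinearMap.fst ℝ ℝ (Eu d)).prod
    (ρ • ContinuousLinearMap.snd ℝ ℝ (Eu d))
  have hu : UA fun (y : Pts S) (p : ℝ × Eu d) =>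
      ρ ^ 2 • leafForm (coordCov (φ y) g) (Ψ y) (p.1, ρ • p.2) :=
    (((h.setup.ua_leafForm h.r_pos hG hΨ).comp (w := fun _ => L)
      (UA.of_analyticAt (L.analyticAt _)) fun _ => map_zero L).clm
        (ρ ^ 2 • ContinuousLinearMap.id ℝ (Form d)))
  obtain ⟨r₁, hr₁, h₁⟩ := hθ.exists_memAnalyticAT_cov h.r_pos hu fun t ht y v hv =>
    h.coordCov_leafMetric y ht hv
  obtain ⟨c₀, hc₀, heq⟩ := hθ.equivalent
  have h0 : |(0 : ℝ)| < r := by simpa using h.r_pos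
  have hinv : ∀ y : S, ∃ A : (Eu d →L[ℝ] ℝ) →L[ℝ] Eu d, ‖A‖ ≤ c₀ ∧
      A.comp (ρ ^ 2 • leafForm (coordCov (φ y) g) (Ψ y) (0, ρ • 0)) = ContinuousLinearMap.id ℝ _ ∧
      (ρ ^ 2 • leafForm (coordCov (φ y) g) (Ψ y) (0, ρ • 0)).comp A
        = ContinuousLinearMap.id ℝ _ := by
    intro y
    refine exists_bounded_inverse hc₀.le (norm_le_of_form_lower hc₀ fun a => ?_)
    rw [← h.coordCov_leafMetric y h0 (zero_mem_cube d)]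
    exact (heq y 0 (zero_mem_cube d) a).1
  choose A hA hA1 hA2 using hinv
  -- Uniform definiteness of `h_0` at the centres bounds the inverses there, so the inverse family
  -- is again uniformly analytic in time and space.
  have hi := (hu.inverse (A := fun y : Pts S => A y) hA hA1 hA2).1
  have hi' := hi.clm (ContinuousLinearMap.compL ℝ (Eu d →L[ℝ] ℝ) (Eu d) ℝ).flip
  obtain ⟨r₂, hr₂, h₂⟩ := hθ.exists_memAnalyticAT_contra
    (T := fun t => inverseMetric (leafMetric g φ Ψ t)) h.r_pos hi' fun t ht y v hv => by
      rw [coordContra_inverseMetric (h.hyp y).analytic (by rw [(h.hyp y).target_eq]; exact hv),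
        h.coordCov_leafMetric y ht hv]
      · rfl
      · rw [h.coordCov_leafMetric y ht hv]
        refine isInvertible_form fun a ha => ?_
        by_contra hne
        have h1 := (h.setup.flow y).leafForm_pos h.c_pos (h.mem_ball ht hv)
          (h.lorentzForm y ht hv) hne
        have h2 := DFunLike.congr_fun ha a
        rw [smul_apply, smul_apply, smul_eq_mul] at h2
        exact (mul_pos (pow_pos h.ρ_pos 2) h1).ne' h2
  exact ⟨min r₁ r₂, lt_min hr₁ hr₂, fun s hs hs' =>
    ⟨h₁ s hs (hs'.trans (min_le_left _ _)), h₂ s hs (hs'.trans (min_le_right _ _))⟩⟩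

end IsGaussAtlas

end LeafBounds
end BAG

end

noncomputable section
namespace BAG

open Filter
open scoped BoundedContinuousFunction

/-! ### Future timelike vectors -/

section FutureCone

variable {n : ℕ} {B Q : Form n}

/-- The reversed Cauchy–Schwarz inequality, in qualitative form. -/
lemma IsLorentzForm.neg_of_future (hB : IsLorentzForm B) {τ v w : Eu n} (hτ : B τ τ < 0)
    (hv : B v v < 0) (hw : B w w < 0) (hvτ : B v τ < 0) (hwτ : B w τ < 0) : B v w < 0 := by
  -- This combination is orthogonal to `τ`, hence of nonnegative square, whereas a nonnegative `B v
  -- w` would make every term of that square nonpositive and two of them negative.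
  set c := B w τ • v - B v τ • w with hc
  have h1 : B τ c = 0 := by
    rw [hc, map_sub, map_smul, map_smul, hB.symm τ v, hB.symm τ w, smul_eq_mul, smul_eq_mul]
    ring
  have h2 : 0 ≤ B c c := by
    rcases eq_or_ne c 0 with h0 | h0
    · rw [h0]; simp
    · exact (hB.pos_of_orthogonal hτ h1 h0).le
  have h3 : B c c = B w τ ^ 2 * B v v - 2 * (B v τ * B w τ) * B v w + B v τ ^ 2 * B w w := by
    rw [hc]
    simp only [map_sub, map_smul, sub_apply, smul_apply, smul_eq_mul, hB.symm w v]
    ring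
  have h4 : 0 < B v τ * B w τ := mul_pos_of_neg_of_neg hvτ hwτ
  have h5 := mul_neg_of_pos_of_neg (pow_pos (neg_pos.2 hwτ) 2) hv
  have h6 := mul_neg_of_pos_of_neg (pow_pos (neg_pos.2 hvτ) 2) hw
  by_contra! hge
  have h7 := mul_nonneg h4.le hge
  nlinarith

/-- Convexity allows a partition of unity to glue local smooth choices to a global timelike field
that is bounded for the reference metric. -/
lemma convex_future_unit_ball (hB : IsLorentzForm B) {τ : Eu n} (hτ : B τ τ < 0)
    (hQ : ∀ v w, Q v w = Q w v) (hQ0 : ∀ v, 0 ≤ Q v v) :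
    Convex ℝ {v | B v v < 0 ∧ B v τ < 0 ∧ Q v v < 1} := by
  rintro v ⟨hv1, hv2, hv3⟩ w ⟨hw1, hw2, hw3⟩ a b ha hb hab
  have hvw := hB.neg_of_future hτ hv1 hw1 hv2 hw2
  have hQvw : 2 * Q v w ≤ Q v v + Q w w := by
    have := hQ0 (v - w)
    simp only [map_sub, sub_apply, hQ w v] at this
    linarith
  have hab' : 0 < a ∨ 0 < b := by
    rcases ha.eq_or_lt with rfl | h
    · right; linarith
    · left; exact h
  refine ⟨?_, ?_, ?_⟩
  · simp only [map_add, map_smul, add_apply, smul_apply, smul_eq_mul, hB.symm w v]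
    have e1 : a * (b * B v w) ≤ 0 :=
      mul_nonpos_of_nonneg_of_nonpos ha (mul_nonpos_of_nonneg_of_nonpos hb hvw.le)
    have e2 : a * (a * B v v) ≤ 0 :=
      mul_nonpos_of_nonneg_of_nonpos ha (mul_nonpos_of_nonneg_of_nonpos ha hv1.le)
    have e3 : b * (b * B w w) ≤ 0 :=
      mul_nonpos_of_nonneg_of_nonpos hb (mul_nonpos_of_nonneg_of_nonpos hb hw1.le)
    rcases hab' with h | h
    · have := mul_neg_of_pos_of_neg h (mul_neg_of_pos_of_neg h hv1)
      nlinarith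
    · have := mul_neg_of_pos_of_neg h (mul_neg_of_pos_of_neg h hw1)
      nlinarith
  · simp only [map_add, map_smul, add_apply, smul_apply, smul_eq_mul]
    rcases hab' with h | h
    · linarith [mul_neg_of_pos_of_neg h hv2, mul_nonpos_of_nonneg_of_nonpos hb hw2.le]
    · linarith [mul_neg_of_pos_of_neg h hw2, mul_nonpos_of_nonneg_of_nonpos ha hv2.le]
  · simp only [map_add, map_smul, add_apply, smul_apply, smul_eq_mul, hQ w v]
    have e1 := mul_le_mul_of_nonneg_left hQvw (mul_nonneg ha hb)
    have e2 : a * Q v v + b * Q w w < 1 := by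
      rcases hab' with h | h
      · nlinarith [mul_lt_mul_of_pos_left hv3 h]
      · nlinarith [mul_lt_mul_of_pos_left hw3 h]
    have e3 : a * (a * Q v v + b * Q v w) + b * (a * Q v w + b * Q w w)
        = (a + b) * (a * Q v v + b * Q w w) - (a * b) * (Q v v + Q w w)
          + (a * b) * (2 * Q v w) := by ring
    rw [hab, one_mul] at e3
    nlinarith

end FutureCone

/-- By the mean value theorem on `[t, t + 1]` the derivative takes the value `f (t + 1) - f t`,
which tends to zero, at points going to infinity. -/
lemma eq_zero_of_tendsto_deriv {f f' : ℝ → ℝ} {a b : ℝ} (hf : Tendsto f atTop (𝓝 a))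
    (hd : ∀ᶠ t in atTop, HasDerivAt f (f' t) t) (hf' : Tendsto f' atTop (𝓝 b)) : b = 0 := by
  obtain ⟨T, hT⟩ := eventually_atTop.1 hd
  have hex : ∀ t : ℝ, ∃ s, t ≤ s ∧ (T ≤ t → f' s = f (t + 1) - f t) := by
    intro t
    by_cases h : T ≤ t
    · obtain ⟨s, hs, he⟩ := exists_hasDerivAt_eq_slope f f' (lt_add_one t)
        (fun s hs => (hT s (h.trans hs.1)).continuousAt.continuousWithinAt)
        (fun s hs => hT s (h.trans hs.1.le))
      exact ⟨s, hs.1.le, fun _ => by rw [he]; ring⟩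
    · exact ⟨t, le_rfl, fun h' => absurd h' h⟩
  choose s hs he using hex
  have h1 : Tendsto (fun t => f' (s t)) atTop (𝓝 b) := hf'.comp (tendsto_atTop_mono hs tendsto_id)
  have h2 : Tendsto (fun t => f (t + 1) - f t) atTop (𝓝 (a - a)) :=
    (hf.comp (tendsto_atTop_add_const_right _ 1 tendsto_id)).sub hf
  rw [sub_self] at h2
  refine tendsto_nhds_unique (h1.congr' ?_) h2
  filter_upwards [eventually_ge_atTop T] with t ht using he t ht

open ODE in
/-- A solution of an autonomous equation that stays in the ball where the field is controlled. -/
lemma exists_solution_mem_closedBall {E : Type*} [NormedAddCommGroup E] [NormedSpace ℝ E]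
    [CompleteSpace E] {f : E → E} {x₀ : E} {a L K : NNReal} {ε : ℝ} (hε : 0 < ε)
    (hb : ∀ x ∈ Metric.closedBall x₀ a, ‖f x‖ ≤ L)
    (hl : LipschitzOnWith K f (Metric.closedBall x₀ a)) (hLε : L * ε ≤ a) :
    ∃ α : ℝ → E, α 0 = x₀ ∧ ∀ t ∈ Set.Ioo (-ε) ε,
      α t ∈ Metric.closedBall x₀ a ∧ HasDerivAt α (f (α t)) t := by
  have h0 : (0 : ℝ) ∈ Set.Icc (-ε) ε := ⟨by linarith, hε.le⟩
  have hf : IsPicardLindelof (fun _ => f) ⟨0, h0⟩ x₀ a 0 L K :=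
    IsPicardLindelof.of_time_independent hb hl (by simpa using hLε)
  have hx : x₀ ∈ Metric.closedBall x₀ ((0 : NNReal) : ℝ) := Metric.mem_closedBall_self le_rfl
  obtain ⟨α, hα⟩ := FunSpace.exists_isFixedPt_next hf hx
  refine ⟨α.compProj, ?_, fun t ht => ⟨α.compProj_mem_closedBall hf.mul_max_le, ?_⟩⟩
  · have h1 : α.compProj 0 = α ⟨0, h0⟩ := FunSpace.compProj_of_mem h0
    rw [h1]
    exact α.apply_of_zero
  · have ht' := Set.Ioo_subset_Icc_self ht
    have h1 : HasDerivWithinAt α.compProj (f (α.compProj t)) (Set.Icc (-ε) ε) t := by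
      refine (hasDerivWithinAt_picard_Icc (f := fun _ => f) h0 hf.continuousOn_uncurry
        α.continuous_compProj.continuousOn
        (fun _ _ => α.compProj_mem_closedBall hf.mul_max_le) x₀ ht').congr_of_mem ?_ ht'
      intro s hs
      nth_rw 1 [← hα]
      rw [FunSpace.compProj_of_mem hs, FunSpace.next_apply]
    exact h1.hasDerivAt (Icc_mem_nhds ht.1 ht.2)

/-! ### Integral curves in charts -/

section IntegralCurve

variable {d : ℕ} {M : Type*} [TopologicalSpace M] [ChartedSpace (Eu (d + 1)) M]
  [IsManifold (𝓡 (d + 1)) ω M] {φ : OpenPartialHomeomorph M (Eu (d + 1))}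
  {X : M → Eu (d + 1)} {γ : ℝ → M}

/-- The vector field `X`, as a section of the tangent bundle. -/
def toSection (X : M → Eu (d + 1)) (x : M) : TangentBundle (𝓡 (d + 1)) M := ⟨x, X x⟩

/-- The coordinate expression of the vector field `X` in the chart `φ`. -/
def coordField (φ : OpenPartialHomeomorph M (Eu (d + 1))) (X : M → Eu (d + 1)) (v : Eu (d + 1)) :
    Eu (d + 1) := dchart φ (φ.symm v) (X (φ.symm v))

/-- A smooth vector field is smooth in coordinates. -/
lemma contMDiffAt_coord_vectorField (hφ : φ ∈ IsManifold.maximalAtlas (𝓡 (d + 1)) ω M) {x : M}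
    (hX : ContMDiffAt (𝓡 (d + 1)) (𝓡 (d + 1)).tangent ∞ (toSection X) x) (hx : x ∈ φ.source) :
    ContMDiffAt (𝓡 (d + 1)) (𝓡 (d + 1)) ∞ (fun y => dchart φ y (X y)) x := by
  have h1 : ContMDiffOn (𝓡 (d + 1)) (𝓡 (d + 1)) ω φ φ.source := fun y hy =>
    (contMDiffAt_chart hφ hy).contMDiffWithinAt
  have h2 := h1.contMDiffOn_tangentMapWithin (m := ∞) le_top φ.open_source.uniqueMDiffOn
  have h3 : ContMDiffAt (𝓡 (d + 1)) (𝓡 (d + 1)).tangent ∞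
      (fun y : M => tangentMapWithin (𝓡 (d + 1)) (𝓡 (d + 1)) φ φ.source (toSection X y)) x := by
    refine ContMDiffAt.comp x (f := toSection X)
      (g := tangentMapWithin (𝓡 (d + 1)) (𝓡 (d + 1)) φ φ.source) (h2.contMDiffAt ?_) hX
    exact (φ.open_source.preimage (FiberBundle.continuous_proj _ _)).mem_nhds hx
  have h5 := ContMDiffAt.comp x (f := fun y : M =>
    tangentMapWithin (𝓡 (d + 1)) (𝓡 (d + 1)) φ φ.source (toSection X y))
    (contMDiff_snd_tangentBundle_modelSpace (Eu (d + 1)) (𝓡 (d + 1))).contMDiffAt h3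
  refine h5.congr_of_eventuallyEq ?_
  filter_upwards [φ.open_source.mem_nhds hx] with y hy
  have h6 := mfderivWithin_of_isOpen (I := 𝓡 (d + 1)) (I' := 𝓡 (d + 1)) (f := φ) φ.open_source hy
  exact (DFunLike.congr_fun h6 (X y)).symm

lemma contDiffAt_coordField (hφ : φ ∈ IsManifold.maximalAtlas (𝓡 (d + 1)) ω M)
    (hX : ContMDiff (𝓡 (d + 1)) (𝓡 (d + 1)).tangent ∞ (toSection X)) {v : Eu (d + 1)}
    (hv : v ∈ φ.target) : ContDiffAt ℝ ∞ (coordField φ X) v := by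
  refine contMDiffAt_iff_contDiffAt.1 ?_
  exact ContMDiffAt.comp v (g := fun y => dchart φ y (X y)) (f := φ.symm)
    (contMDiffAt_coord_vectorField hφ (hX _) (φ.map_target hv))
    ((contMDiffAt_chart_symm hφ hv).of_le (by simp))

lemma coordField_apply {x : M} (hx : x ∈ φ.source) :
    coordField φ X (φ x) = dchart φ x (X x) := by rw [coordField, φ.left_inv hx]

/-- The derivative of a curve with prescribed velocity, in coordinates. -/
lemma hasDerivAt_coord_curve (hφ : φ ∈ IsManifold.maximalAtlas (𝓡 (d + 1)) ω M)
    (hγ : IsMIntegralCurve (I := 𝓡 (d + 1)) γ X) {t : ℝ} (ht : γ t ∈ φ.source) :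
    HasDerivAt (fun s => φ (γ s)) (coordField φ X (φ (γ t))) t := by
  rw [coordField_apply ht]
  have h1 : HasMFDerivAt (𝓡 (d + 1)) (𝓡 (d + 1)) φ (γ t) (dchart φ (γ t)) :=
    ((contMDiffAt_chart hφ ht).mdifferentiableAt (by simp)).hasMFDerivAt
  have h2 : HasFDerivAt (fun s => φ (γ s))
      (dchart φ (γ t) ∘L (1 : ℝ →L[ℝ] ℝ).smulRight (X (γ t))) t :=
    hasMFDerivAt_iff_hasFDerivAt.1 (HasMFDerivAt.comp t h1 (hγ t))
  simpa using h2.hasDerivAt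

/-- Integral curves of smooth vector fields are smooth. -/
lemma contMDiff_integralCurve (hX : ContMDiff (𝓡 (d + 1)) (𝓡 (d + 1)).tangent ∞ (toSection X))
    (hγ : IsMIntegralCurve (I := 𝓡 (d + 1)) γ X) : ContMDiff 𝓘(ℝ, ℝ) (𝓡 (d + 1)) ∞ γ := by
  intro t₀
  set κ := chartAt (Eu (d + 1)) (γ t₀) with hκdef
  have hκ : κ ∈ IsManifold.maximalAtlas (𝓡 (d + 1)) ω M := IsManifold.chart_mem_maximalAtlas _
  have hs : ∀ᶠ t in 𝓝 t₀, γ t ∈ κ.source :=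
    hγ.continuous.continuousAt.preimage_mem_nhds (κ.open_source.mem_nhds (mem_chart_source _ _))
  obtain ⟨ε, hε, hball⟩ := Metric.eventually_nhds_iff_ball.1 hs
  have hmem : ∀ t ∈ Set.Icc (t₀ - ε / 2) (t₀ + ε / 2), γ t ∈ κ.source := fun t ht => by
    refine hball t ?_
    rw [Metric.mem_ball, Real.dist_eq, abs_lt]
    constructor <;> linarith [ht.1, ht.2]
  have hu : ContDiffOn ℝ ∞ (fun s => κ (γ s)) (Set.Icc (t₀ - ε / 2) (t₀ + ε / 2)) := by
    refine ODE.contDiffOn_enat_Icc_of_hasDerivWithinAt (n := ⊤) (f := fun _ => coordField κ X)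
      (u := κ.target) ?_ (fun t ht => (hasDerivAt_coord_curve hκ hγ (hmem t ht)).hasDerivWithinAt)
      fun t ht => κ.map_source (hmem t ht)
    rintro ⟨t, v⟩ ⟨-, hv⟩
    exact (ContDiffAt.comp (t, v) (g := coordField κ X) (f := Prod.snd)
      (contDiffAt_coordField hκ hX hv) contDiffAt_snd).contDiffWithinAt
  have hu' : ContDiffAt ℝ ∞ (fun s => κ (γ s)) t₀ :=
    hu.contDiffAt (Icc_mem_nhds (by linarith) (by linarith))
  have hc : ContMDiffAt 𝓘(ℝ, ℝ) (𝓡 (d + 1)) ∞ (fun s => κ.symm (κ (γ s))) t₀ :=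
    ContMDiffAt.comp t₀ (g := κ.symm) (f := fun s => κ (γ s))
      ((contMDiffAt_chart_symm hκ (κ.map_source (mem_chart_source _ _))).of_le (by simp))
      (contMDiffAt_iff_contDiffAt.2 hu')
  refine hc.congr_of_eventuallyEq ?_
  filter_upwards [hs] with t ht using (κ.left_inv ht).symm

/-- Integral curves of nowhere vanishing vector fields have no limit points at infinity. -/
lemma not_tendsto_integralCurve (hX : ContMDiff (𝓡 (d + 1)) (𝓡 (d + 1)).tangent ∞ (toSection X))
    (hX0 : ∀ x, X x ≠ 0) (hγ : IsMIntegralCurve (I := 𝓡 (d + 1)) γ X) {σ : ℝ} (hσ : σ ≠ 0) (p : M) :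
    ¬ Tendsto (fun t => γ (σ * t)) atTop (𝓝 p) := by
  intro hp
  set κ := chartAt (Eu (d + 1)) p with hκdef
  have hκ : κ ∈ IsManifold.maximalAtlas (𝓡 (d + 1)) ω M := IsManifold.chart_mem_maximalAtlas _
  have hps : p ∈ κ.source := mem_chart_source _ _
  set e := coordField κ X (κ p) with he
  have he0 : e ≠ 0 := by
    rw [he, coordField_apply hps]
    exact fun h0 => hX0 p (dchart_injective hκ hps (h0.trans (map_zero _).symm))
  have hlim : Tendsto (fun t => κ (γ (σ * t))) atTop (𝓝 (κ p)) :=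
    (κ.continuousAt hps).tendsto.comp hp
  have hlim' : Tendsto (fun t => coordField κ X (κ (γ (σ * t)))) atTop (𝓝 e) :=
    (contDiffAt_coordField hκ hX (κ.map_source hps)).continuousAt.tendsto.comp hlim
  -- If the curve converged, the component of its coordinates along the limiting field `e` would
  -- converge too, with derivative tending to `σ ‖e‖²`, which is not zero.
  have hd : ∀ᶠ t in atTop, HasDerivAt (fun t => inner ℝ e (κ (γ (σ * t))))
      (inner ℝ e (σ • coordField κ X (κ (γ (σ * t))))) t := by
    filter_upwards [hp.eventually (κ.open_source.mem_nhds hps)] with t ht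
    have h1 : HasDerivAt (fun t : ℝ => σ * t) σ t := by
      simpa using (hasDerivAt_id t).const_mul σ
    have h2 := (hasDerivAt_coord_curve hκ hγ ht).scomp t h1
    exact (innerSL ℝ e).hasFDerivAt.comp_hasDerivAt t h2
  have h0 := eq_zero_of_tendsto_deriv (tendsto_const_nhds.inner hlim) hd
    (tendsto_const_nhds.inner (hlim'.const_smul σ))
  rw [inner_smul_right, mul_eq_zero] at h0
  exact h0.elim hσ fun h => he0 (inner_self_eq_zero.1 h)

/-- The existence time of integral curves depends only on a bound in coordinates. -/
lemma exists_isMIntegralCurveOn_of_bound (hφ : φ ∈ IsManifold.maximalAtlas (𝓡 (d + 1)) ω M)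
    (htarget : φ.target = cube (d + 1) 1) {x : M} (hx : x ∈ φ.source) (hx0 : φ x = 0)
    (hX : ContMDiff (𝓡 (d + 1)) (𝓡 (d + 1)).tangent ∞ (toSection X)) {L : ℝ} (hL0 : 0 ≤ L)
    (hL : ∀ v ∈ cube (d + 1) 1, ‖coordField φ X v‖ ≤ L) :
    ∃ γ : ℝ → M, γ 0 = x ∧ IsMIntegralCurveOn (I := 𝓡 (d + 1)) γ X
      (Set.Ioo (-(2 * (L + 1))⁻¹) (2 * (L + 1))⁻¹) := by
  -- At speed at most `L` the solution stays in the closed ball of radius `1 / 2` during this time.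
  -- The Lipschitz constant may depend on the chart, but `ε` does not.
  set ε := (2 * (L + 1))⁻¹ with hε
  have hε0 : 0 < ε := by positivity
  have hsub : Metric.closedBall (0 : Eu (d + 1)) (1 / 2) ⊆ cube (d + 1) 1 :=
    (Metric.closedBall_subset_ball (by norm_num)).trans (ball_subset_cube _ _)
  have hC : ∀ v ∈ Metric.closedBall (0 : Eu (d + 1)) (1 / 2), ContDiffAt ℝ ∞ (coordField φ X) v :=
    fun v hv => contDiffAt_coordField hφ hX (htarget ▸ hsub hv)
  obtain ⟨K, hK⟩ := (isCompact_closedBall (0 : Eu (d + 1)) (1 / 2)).exists_bound_of_continuousOn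
    (f := fderiv ℝ (coordField φ X)) fun v hv =>
      ((hC v hv).fderiv_right (m := 0) (by simp)).continuousAt.continuousWithinAt
  have hlip : LipschitzOnWith K.toNNReal (coordField φ X)
      (Metric.closedBall (0 : Eu (d + 1)) (1 / 2)) := by
    refine (convex_closedBall _ _).lipschitzOnWith_of_nnnorm_fderiv_le (𝕜 := ℝ)
      (fun v hv => (hC v hv).differentiableAt (by simp)) fun v hv => ?_
    rw [← norm_toNNReal]
    exact Real.toNNReal_le_toNNReal (hK v hv)
  obtain ⟨α, hα0, hα⟩ := exists_solution_mem_closedBall (f := coordField φ X) (x₀ := 0)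
    (a := ⟨1 / 2, by norm_num⟩) (L := ⟨L, hL0⟩) hε0 (fun v hv => hL v (hsub hv)) hlip (by
      change L * ε ≤ 1 / 2
      rw [hε, ← div_eq_mul_inv, div_le_iff₀ (by positivity)]
      linarith)
  have hαmem : ∀ t ∈ Set.Ioo (-ε) ε, α t ∈ φ.target := fun t ht => by
    rw [htarget]; exact hsub (hα t ht).1
  refine ⟨fun t => φ.symm (α t), ?_, fun t ht => ?_⟩
  · change φ.symm (α 0) = x
    rw [hα0, ← hx0, φ.left_inv hx]
  · have h1 : HasMFDerivAt 𝓘(ℝ, ℝ) (𝓡 (d + 1)) α t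
        (ContinuousLinearMap.toSpanSingleton ℝ (coordField φ X (α t))) :=
      hasMFDerivAt_iff_hasFDerivAt.2 (hα t ht).2.hasFDerivAt
    have h2 : HasMFDerivAt (𝓡 (d + 1)) (𝓡 (d + 1)) φ.symm (α t)
        (dsymm φ (α t)) :=
      ((contMDiffAt_chart_symm hφ (hαmem t ht)).mdifferentiableAt (by simp)).hasMFDerivAt
    have h3 := HasMFDerivAt.comp t h2 h1
    have h4 : dsymm φ (α t) ∘L
        ContinuousLinearMap.toSpanSingleton ℝ (coordField φ X (α t))
        = (1 : ℝ →L[ℝ] ℝ).smulRight (X (φ.symm (α t))) := by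
      refine ContinuousLinearMap.ext_ring ?_
      have h5 := DFunLike.congr_fun (dsymm_comp_dchart hφ (φ.map_target (hαmem t ht)))
        (X (φ.symm (α t)))
      rw [φ.right_inv (hαmem t ht)] at h5
      simpa [coordField] using h5
    exact (HasMFDerivAt.hasMFDerivWithinAt (h4 ▸ h3))

end IntegralCurve
end BAG

end

noncomputable section
namespace BAG

open Filter
open scoped BoundedContinuousFunction

/-! ### Nonemptiness of the Cauchy surface -/

section Nonempty

variable {d : ℕ} {M : Type*} [TopologicalSpace M] [T2Space M] [SecondCountableTopology M]
  [ChartedSpace (Eu (d + 1)) M] [IsManifold (𝓡 (d + 1)) ω M]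
  {g : Cov2 (d + 1) M} {τ : ∀ p : M, TangentSpace (𝓡 (d + 1)) p}

/-- A time oriented Lorentzian manifold has a smooth timelike vector field that is bounded for a
given Riemannian metric. -/
lemma exists_timelike_field (hg : IsLorentzian g) (hτ : IsTimeOrientation g τ)
    (m : Bundle.ContMDiffRiemannianMetric (𝓡 (d + 1)) ω (Eu (d + 1))
      (fun x : M => TangentSpace (𝓡 (d + 1)) x)) :
    ∃ X : M → Eu (d + 1), ContMDiff (𝓡 (d + 1)) (𝓡 (d + 1)).tangent ∞ (toSection X) ∧
      ∀ x, formAt g x (X x) (X x) < 0 ∧ formAt m.inner x (X x) (X x) < 1 := by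
  have : LocallyCompactSpace M := ChartedSpace.locallyCompactSpace (Eu (d + 1)) M
  let τ' : M → Eu (d + 1) := fun x => τ x
  have hm0 : ∀ x (v : Eu (d + 1)), 0 ≤ formAt m.inner x v v := fun x v => by
    rcases eq_or_ne v 0 with rfl | hv
    · simp
    · exact (m.pos x v hv).le
  let T : M → Set (Eu (d + 1)) := fun x => {v | formAt g x v v < 0 ∧ formAt g x v (τ' x) < 0 ∧
    formAt m.inner x v v < 1}
  have hconv : ∀ x, Convex ℝ (T x) := fun x =>
    convex_future_unit_ball (hg.form x) (hτ.2 x) (m.symm x) (hm0 x)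
  obtain ⟨X, hX⟩ := exists_contMDiffSection_forall_mem_convex_of_local (𝓡 (d + 1)) (n := ⊤)
    (F_fiber := Eu (d + 1)) (fun x : M => TangentSpace (𝓡 (d + 1)) x) T hconv (fun x₀ => by
      set κ := chartAt (Eu (d + 1)) x₀ with hκdef
      have hκ : κ ∈ IsManifold.maximalAtlas (𝓡 (d + 1)) ω M :=
        IsManifold.chart_mem_maximalAtlas x₀
      have hx₀ : x₀ ∈ κ.source := mem_chart_source _ _
      have hQ := hm0 x₀ (τ' x₀)
      set Q := formAt m.inner x₀ (τ' x₀) (τ' x₀) with hQdef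
      -- Scales `τ` at `x₀` so that its reference square `c² Q` is less than `1`.
      set c := (1 + Q)⁻¹ with hc
      have hc0 : 0 < c := by positivity
      have hτ0 : formAt g x₀ (τ' x₀) (τ' x₀) < 0 := hτ.2 x₀
      obtain ⟨U, hU, hsU⟩ := FiberBundle.exists_contMDiffOn_extend (k := ∞) (𝓡 (d + 1))
        (Eu (d + 1)) (V := fun x : M => TangentSpace (𝓡 (d + 1)) x) (x₀ := x₀) (c • τ' x₀)
      let s : M → Eu (d + 1) := fun y => FiberBundle.extend (Eu (d + 1))
        (E := fun x : M => TangentSpace (𝓡 (d + 1)) x) (x := x₀) (c • τ' x₀) y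
      have hs0 : s x₀ = c • τ' x₀ := FiberBundle.extend_apply_self (Eu (d + 1))
        (E := fun x : M => TangentSpace (𝓡 (d + 1)) x) (x := x₀) (c • τ' x₀)
      have hs : ContMDiffAt (𝓡 (d + 1)) (𝓡 (d + 1)).tangent ∞ (toSection s) x₀ :=
        hsU.contMDiffAt hU
      have k1 : ContinuousAt (fun y => dchart κ y (s y)) x₀ :=
        (contMDiffAt_coord_vectorField hκ hs hx₀).continuousAt
      have k2 : ContinuousAt (fun y => dchart κ y (τ' y)) x₀ :=
        continuousAt_coord_vectorField hκ hτ.1 hx₀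
      have k3 : ∀ {h : Cov2 (d + 1) M}, ContMDiff (𝓡 (d + 1))
          ((𝓡 (d + 1)).prod 𝓘(ℝ, Eu (d + 1) →L[ℝ] Eu (d + 1) →L[ℝ] ℝ)) ω
          (fun x : M => Bundle.TotalSpace.mk' (Eu (d + 1) →L[ℝ] Eu (d + 1) →L[ℝ] ℝ)
            (E := fun x : M => TangentSpace (𝓡 (d + 1)) x →L[ℝ] TangentSpace (𝓡 (d + 1)) x →L[ℝ] ℝ)
            x (h x)) → ∀ {a b : M → Eu (d + 1)}, ContinuousAt (fun y => dchart κ y (a y)) x₀ →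
          ContinuousAt (fun y => dchart κ y (b y)) x₀ →
          ContinuousAt (fun y => formAt h y (a y) (b y)) x₀ := by
        intro h hh a b ha hb
        have h1 : ContinuousAt (fun y => coordCov κ h (κ y)) x₀ :=
          ContinuousAt.comp (g := coordCov κ h) (f := κ)
            (analyticAt_coordCov hh hκ (κ.map_source hx₀)).continuousAt (κ.continuousAt hx₀)
        refine ((h1.clm_apply ha).clm_apply hb).congr ?_
        filter_upwards [κ.open_source.mem_nhds hx₀] with y hy
        exact (formAt_coord hκ h hy (a y) (b y)).symm
      have e1 : ∀ᶠ y in 𝓝 x₀, formAt g y (s y) (s y) < 0 :=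
        (k3 hg.analytic k1 k1).eventually_lt_const (by
          simp only [hs0, map_smul, smul_apply, smul_eq_mul]
          exact mul_neg_of_pos_of_neg hc0 (mul_neg_of_pos_of_neg hc0 hτ0))
      have e2 : ∀ᶠ y in 𝓝 x₀, formAt g y (s y) (τ' y) < 0 :=
        (k3 hg.analytic k1 k2).eventually_lt_const (by
          simp only [hs0, map_smul, smul_apply, smul_eq_mul]
          exact mul_neg_of_pos_of_neg hc0 hτ0)
      have e3 : ∀ᶠ y in 𝓝 x₀, formAt m.inner y (s y) (s y) < 1 :=
        (k3 m.contMDiff k1 k1).eventually_lt_const (by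
          simp only [hs0, map_smul, smul_apply, smul_eq_mul]
          rw [← hQdef, hc]
          have : (1 + Q)⁻¹ * Q < 1 := by rw [inv_mul_lt_iff₀ (by positivity)]; linarith
          have h1 : (1 + Q)⁻¹ ≤ 1 := inv_le_one_of_one_le₀ (by linarith)
          nlinarith)
      refine ⟨_, inter_mem hU (e1.and (e2.and e3)), s, fun y hy => (hsU y hy.1).mono Set.inter_subset_left,
        fun y hy => hy.2⟩)
  exact ⟨fun x => X x, X.contMDiff, fun x => ⟨(hX x).1, (hX x).2.2⟩⟩

/-- A Cauchy surface of a spacetime with a background of bounded geometry is not empty. -/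
lemma nonempty_of_isCauchySurface (hg : IsLorentzian g) (hτ : IsTimeOrientation g τ)
    {gref : Cov2 (d + 1) M} (href : BoundedAnalyticGeometry gref) [Nonempty M] {Sig : Set M}
    (hS : IsCauchySurface g Sig) : Sig.Nonempty := by
  obtain ⟨⟨m, rfl⟩, ψ, hψ⟩ := href
  obtain ⟨X, hX, hXb⟩ := exists_timelike_field hg hτ m
  obtain ⟨c, hc, heq⟩ := hψ.equivalent
  have hbound : ∀ x, ∀ v ∈ cube (d + 1) 1, ‖coordField (ψ x) X v‖ ≤ √c := by
    intro x v hv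
    have hv' : v ∈ (ψ x).target := by rw [hψ.target_eq]; exact hv
    refine Real.le_sqrt_of_sq_le ?_
    have h1 := (heq x v hv (coordField (ψ x) X v)).1
    have h2 := formAt_coord (hψ.analytic x) m.inner ((ψ x).map_target hv')
      (X ((ψ x).symm v)) (X ((ψ x).symm v))
    rw [(ψ x).right_inv hv'] at h2
    rw [coordField] at h1 ⊢
    rw [← h2, inv_mul_le_iff₀ hc] at h1
    nlinarith [(hXb ((ψ x).symm v)).2]
  have hX1 : ContMDiff (𝓡 (d + 1)) (𝓡 (d + 1)).tangent 1 (toSection X) := hX.of_le (by simp)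
  have : BoundarylessManifold (𝓡 (d + 1)) M := inferInstance
  -- The field is bounded by `√c` in all charts of the reference atlas, so integral curves exist for
  -- a common time around every point and extend to the whole line.
  obtain ⟨γ, -, hγ⟩ := exists_isMIntegralCurve_of_isMIntegralCurveOn (I := 𝓡 (d + 1)) (v := X) hX1
    (ε := (2 * (√c + 1))⁻¹) (by positivity) (fun x => exists_isMIntegralCurveOn_of_bound
      (hψ.analytic x) (hψ.target_eq x) (hψ.mem_source x) (hψ.center x) hX (Real.sqrt_nonneg c)
      (hbound x)) (Classical.arbitrary M)
  have hX0 : ∀ x, X x ≠ 0 := fun x h0 => by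
    have := (hXb x).1
    rw [h0] at this
    simp at this
  have hvel : ∀ t, mfderiv 𝓘(ℝ, ℝ) (𝓡 (d + 1)) γ t (1 : ℝ) = X (γ t) := fun t => by
    have h1 := DFunLike.congr_fun (hγ t).mfderiv (1 : ℝ)
    refine h1.trans ?_
    exact one_smul ℝ (X (γ t))
  obtain ⟨t, ht, -⟩ := hS.2 γ (contMDiff_integralCurve hX hγ)
    (fun t => by
      have h1 := (hXb (γ t)).1
      have h2 : formAt g (γ t) (mfderiv 𝓘(ℝ, ℝ) (𝓡 (d + 1)) γ t (1 : ℝ))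
        (mfderiv 𝓘(ℝ, ℝ) (𝓡 (d + 1)) γ t (1 : ℝ)) < 0 := by rw [hvel]; exact h1
      exact h2)
    (fun ⟨p, hp⟩ => not_tendsto_integralCurve hX hX0 hγ one_ne_zero p (by simpa using hp))
    (fun ⟨p, hp⟩ => not_tendsto_integralCurve hX hX0 hγ (σ := -1) (by norm_num) p 
      ((hp.comp tendsto_neg_atTop_atBot).congr fun t => by simp))
  exact ⟨_, ht⟩

end Nonempty
end BAG

end

noncomputable section
namespace BAG

open Filter
open scoped BoundedContinuousFunction

lemma norm_lt_of_mem_cube {n : ℕ} {v : Eu n} (hv : v ∈ cube n 1) : ‖v‖ < n + 1 := by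
  have h1 : ‖v‖ ^ 2 ≤ n := by
    rw [EuclideanSpace.norm_sq_eq]
    calc ∑ i, ‖v i‖ ^ 2 ≤ ∑ _i : Fin n, (1 : ℝ) :=
          Finset.sum_le_sum fun i _ => pow_le_one₀ (norm_nonneg _) (hv i).le
      _ = n := by simp
  have hn : (0 : ℝ) ≤ n := n.cast_nonneg
  nlinarith [norm_nonneg v]

/-! ### Choice of the constants and conclusion -/

section Final

variable {d : ℕ} {M : Type*} [TopologicalSpace M] [T2Space M] [ChartedSpace (Eu (d + 1)) M]
  [IsManifold (𝓡 (d + 1)) ω M]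
  {S : Type*} [TopologicalSpace S] [ChartedSpace (Eu d) S] [IsManifold (𝓡 d) ω S]
  {g : Cov2 (d + 1) M} {τ : ∀ p : M, TangentSpace (𝓡 (d + 1)) p} {ι : S → M}
  {φ : S → OpenPartialHomeomorph M (Eu (d + 1))} {F : S → Eu d → ℝ}
  {ν : S → Eu (d + 1)} {Ψ : S → ℝ × Eu d → Eu (d + 1)} {r c C ρ δ : ℝ}
  {θ : S → OpenPartialHomeomorph S (Eu d)}

/-- A partial diffeomorphism carries a total inverse function `M → ℝ × S`. For empty `S` there is
one only if `M` is empty as well, which is why nonemptiness of the Cauchy surface has to be proved.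
-/
lemma exists_partialDiffeomorph_of_isEmpty [IsEmpty S] [IsEmpty M] (χ : ℝ × S → M)
    (Ω : Set (ℝ × S)) :
    ∃ Φ : PartialDiffeomorph (𝓘(ℝ, ℝ).prod (𝓡 d)) (𝓡 (d + 1)) (ℝ × S) M ∞,
      Φ.source = Ω ∧ Set.EqOn Φ χ Φ.source :=
  ⟨{ toFun := χ
     invFun := isEmptyElim
     source := Ω
     target := Set.univ
     map_source' := fun p => isEmptyElim p
     map_target' := fun q => isEmptyElim q
     left_inv' := fun p => isEmptyElim p
     right_inv' := fun q => isEmptyElim q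
     open_source := by rw [Set.eq_empty_of_isEmpty Ω]; exact isOpen_empty
     open_target := isOpen_univ
     contMDiffOn_toFun := fun p => isEmptyElim p
     contMDiffOn_invFun := fun q => isEmptyElim q }, rfl, fun p => isEmptyElim p⟩

/-- The injectivity of the normal geodesic flow up to some positive time. -/
lemma IsGaussSetup.exists_flowMap_injOn (h : IsGaussSetup g τ ι φ F ν Ψ r c C)
    (hg : IsLorentzian g) (hτ : IsTimeOrientation g τ) (hι : ContMDiff (𝓡 d) (𝓡 (d + 1)) ω ι)
    (hinj : Function.Injective ι) (hs : IsSpacelike g ι) (hr : 0 < r)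
    {gref : Cov2 (d + 1) M} {c₀ : ℝ} (hc₀ : 0 < c₀) (hc : 0 < c)
    (heq : ∀ y, ∀ v ∈ cube (d + 1) 1, ∀ a, c₀⁻¹ * ‖a‖ ^ 2 ≤ coordCov (φ y) gref v a a ∧
      coordCov (φ y) gref v a a ≤ c₀ * ‖a‖ ^ 2) :
    ∃ δ > 0, δ ≤ r ∧ Set.InjOn (flowMap φ Ψ) (Set.Ioo (-δ) δ ×ˢ Set.univ) := by
  set A := |C| * (1 + c₀) with hA
  have hA0 : 0 ≤ A := by positivity
  set l := ‖initL d‖ with hl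
  have hl0 : 0 ≤ l := norm_nonneg _
  set μ := min 1 r with hμ
  have hμ0 : 0 < μ := lt_min one_pos hr
  -- With `A = |C| (1 + c₀)` and `l` the norm of the projection, this makes both `A δ < 1` and `l A
  -- δ < r`, the two smallness conditions for injectivity.
  set δ := min r (μ / ((A + 1) * (l + 1))) with hδ
  have hδ0 : 0 < δ := lt_min hr (by positivity)
  have hAδ : (A + 1) * (l + 1) * δ ≤ μ := by
    have h1 : δ ≤ μ / ((A + 1) * (l + 1)) := min_le_right _ _
    rw [le_div_iff₀ (by positivity)] at h1
    linarith
  refine ⟨δ, hδ0, min_le_left _ _, fun p hp q hq hpq => ?_⟩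
  have hC : 0 ≤ C := (norm_nonneg _).trans ((h.flow p.2).speed 0 (Metric.mem_ball_self hr))
  have e : C * δ + c₀ * C * δ = A * δ := by rw [hA, abs_of_nonneg hC]; ring
  have k1 : 0 ≤ A * δ := by positivity
  have k2 : 0 ≤ l * δ := by positivity
  have k3 : 0 ≤ A * l * δ := by positivity
  refine h.flowMap_injOn hg hτ hι hinj hs hc₀ hc hC heq (min_le_left _ _) ?_ ?_ hp hq hpq
  · rw [e]
    nlinarith [min_le_left 1 r]
  · rw [e]
    nlinarith [min_le_right 1 r]

end Final
end BAG

end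

open BAG in
theorem theorem3 {d : ℕ}
    {M : Type*} [TopologicalSpace M] [T2Space M] [SecondCountableTopology M]
    [ChartedSpace (Eu (d + 1)) M] [IsManifold (𝓡 (d + 1)) ω M]
    {S : Type*} [TopologicalSpace S] [ChartedSpace (Eu d) S]
    [IsManifold (𝓡 d) ω S]
    (g : Cov2 (d + 1) M) (hg : IsLorentzian g)
    (τ : ∀ p : M, TangentSpace (𝓡 (d + 1)) p) (hτ : IsTimeOrientation g τ)
    (ι : S → M) (hι : Manifold.IsSmoothEmbedding (𝓡 d) (𝓡 (d + 1)) ω ι)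
    (hspace : IsSpacelike g ι) (hcauchy : IsCauchySurface g (Set.range ι))
    (hbag : BoundedAnalyticGeometryNear g τ ι) :
    ∃ δ > 0, ∃ χ : ℝ × S → M,
      IsNormalGeodesicFlow g τ ι δ χ ∧
      (∃ Φ : PartialDiffeomorph (𝓘(ℝ, ℝ).prod (𝓡 d)) (𝓡 (d + 1)) (ℝ × S) M ∞,
        Φ.source = Set.Ioo (-δ) δ ×ˢ Set.univ ∧ Set.EqOn Φ χ Φ.source) ∧
      ∃ h : ℝ → Cov2 d S,
        IsSmoothFamily δ h ∧ PullbackSplits g δ χ h ∧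
        BoundedAnalyticGeometry (h 0) ∧
        ∃ ε₁ > 0, ε₁ ≤ δ ∧
          MemAnalyticAT coordCov (h 0) ε₁ h ∧
          MemAnalyticAT coordContra (h 0) ε₁ (fun t => inverseMetric (h t)) := by
  have hιc := hι.contMDiff
  have hne : Nonempty S ∨ IsEmpty M := by
    rcases isEmpty_or_nonempty M with hM | hM
    · exact Or.inr hM
    · obtain ⟨gref, href, -⟩ := hbag
      obtain ⟨-, x, -⟩ := nonempty_of_isCauchySurface hg hτ href hcauchy
      exact Or.inl ⟨x⟩
  obtain ⟨gref, ψ, hψ, hG, F, ν, Ψ, hΨ, ⟨N, hN⟩, r, hr, c, hc, C, hset⟩ :=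
    exists_gaussSetup hg hτ hιc hspace hbag
  obtain ⟨c₀, hc₀, heq⟩ := hψ.equivalent
  obtain ⟨δ, hδ, hδr, hinj⟩ := hset.exists_flowMap_injOn hg hτ hιc hι.isEmbedding.injective
    hspace hr hc₀ hc fun y => heq (ι y)
  obtain ⟨R, hR, B, m, hm, K, hK, hB, hbd⟩ := hset.exists_leafForm_bounds hr hc hg hG hΨ hN
  -- The Euclidean norm on the unit cube is below `d + 1`, so the scaled cube lies in the ball where
  -- the flow exists and the leaf form is controlled.
  set ρ := min r R / (d + 1) with hρdef
  have hd : (0 : ℝ) < d + 1 := by positivity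
  have hρ : 0 < ρ := div_pos (lt_min hr hR) hd
  have hρv : ∀ v ∈ cube d 1, ‖ρ • v‖ < min r R := by
    intro v hv
    rw [norm_smul, Real.norm_of_nonneg hρ.le, ← div_mul_cancel₀ (min r R) hd.ne']
    exact mul_lt_mul_of_pos_left (norm_lt_of_mem_cube hv) hρ
  have hρr : ∀ v ∈ cube d 1, ‖ρ • v‖ < r := fun v hv => (hρv v hv).trans_le (min_le_left _ _)
  have hρR : ρ ≤ R := (div_le_self (lt_min hr hR).le (by simp)).trans (min_le_right _ _)
  choose θ hθ using fun y => hset.exists_hypChart hι hρ hρr y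
  have hat : IsGaussAtlas g τ ι (fun y => ψ (ι y)) F ν Ψ r c C ρ θ :=
    ⟨hset, hg, hτ, hιc, hspace, hc, hρ, hρr, hθ⟩
  have hatlas := hat.isBoundedAnalyticAtlas hm hK hB hbd hρR
    fun v hv => (hρv v hv).trans_le (min_le_right _ _)
  obtain ⟨r₁, hr₁, hmem⟩ := hat.exists_memAnalyticAT_leafMetric hG hΨ hatlas
  refine ⟨δ, hδ, IsGaussSetup.flowMap (fun y => ψ (ι y)) Ψ, hat.isNormalGeodesicFlow hδr, ?_,
    leafMetric g (fun y => ψ (ι y)) Ψ, hat.isSmoothFamily hδr, hat.pullbackSplits hδr,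
    ⟨hat.isRiemannian_leafMetric (by simpa using hr), θ, hatlas⟩, min δ r₁, lt_min hδ hr₁,
    min_le_left _ _, hmem _ (lt_min hδ hr₁) (min_le_right _ _)⟩
  rcases hne with hS | hM
  · refine exists_partialDiffeomorph (isOpen_Ioo.prod isOpen_univ) hinj (fun p hp => ?_)
      fun p hp => ?_
    · exact (hat.contMDiffAt_flowMap ((abs_lt.2 hp.1).trans_le hδr) p.2).of_le (by simp)
    · obtain ⟨j, hj, hj1, hj2⟩ := hat.exists_local_inverse ((abs_lt.2 hp.1).trans_le hδr) p.2
      exact ⟨j, hj.of_le (by simp), hj1, hj2⟩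
  · have : IsEmpty S := ⟨fun x => hM.false (ι x)⟩
    exact exists_partialDiffeomorph_of_isEmpty _ _
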